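/- **Proposition 3.5 ($N$-soliton formula).** Let $k_0>0$, $m\ge 1$, let $T\subset\mathbb R$ be a nonempty open interval, and let $Q:\mathbb R\times T\to\mathbb C^{m\times m}$ be a classical solution with symmetric values, $Q^T=Q$, of the focusing matrix modified KdV equation $$Q_t+Q_{xxx}+3\,(Q_xQ^\dagger Q+QQ^\dagger Q_x)=0$$ ($Q$ is $C^3$ in $x$ and differentiable in $t$, and $Q,Q_x,Q_{xx},Q_{xxx}$ are jointly continuous). Assume $Q\to Q_\pm$ and $Q_x,Q_{xx}\to0$ as $x\to\pm\infty$, locally uniformly in $t$, with constant matrices $Q_\pm$ such that $Q_\pm Q_\pm^\dagger=Q_\pm^\dagger Q_\pm=k_0^2I$, and that for every $t\in T$ and $c\in\mathbb R$ the function $(1+|x|)(Q-Q_+)$ is integrable on $(c,\infty)$ and $(1+|x|)(Q-Q_-)$ on $(-\infty,c)$. For $z\in\mathbb C\setminus\{0\}$ put $k(z)=\frac12(z-k_0^2/z)$, $\lambda(z)=\frac12(z+k_0^2/z)$, $\gamma(z)=1+k_0^2/z^2$, $\theta(x,t;z)=\lambda(z)\bigl(x+(4k(z)^2-2k_0^2)t\bigr)$,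 and $$D^\pm=\{z:\pm(|z|^2-k_0^2)\,\mathrm{Im}\,z>0\},\qquad \Sigma_0=\{z:\ z\in\mathbb R\ \text{or}\ |z|=k_0\}\setminus\{0,\pm ik_0\}.$$ With $\sigma_3=\mathrm{diag}(I,-I)$ and $\underline Q=\begin{pmatrix}0&Q\\-Q^\dagger&0\end{pmatrix}$, the Lax pair is $\varphi_x=M\varphi$, $\varphi_t=\mathcal L\varphi$, where $M=-ik\sigma_3+\underline Q$ and $$\mathcal L=-4ik^3\sigma_3+4k^2\underline Q-2ik(\underline Q^2+\underline Q_x)\sigma_3-\underline Q_{xx}+2\underline Q^3+\underline Q_x\underline Q-\underline Q\,\underline Q_x .$$ Let $E_\pm(z)=\begin{pmatrix}I&-\frac izQ_\pm\\-\frac izQ_\pm^\dagger&I\end{pmatrix}$. The Jost eigenfunctions are the simultaneous $2m\times m$ matrix solutions $\phi,\psi$ (for $z\in D^+\cup\Sigma_0$) and $\bar\phi,\bar\psi$ (for $z\in D^-\cup\Sigma_0$) of the Lax pair for which $(\phi e^{i\theta},\bar\phi e^{-i\theta})\to E_-$ as $x\to-\infty$ and $(\bar\psi e^{i\theta},\psi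 e^{-i\theta})\to E_+$ as $x\to+\infty$. Put $\hat W=\phi e^{i\theta}$, $\hat V=\psi e^{-i\theta}$, $\bar V=\bar\psi e^{i\theta}$. The scattering matrix $S=\begin{pmatrix}a&\bar b\\ b&\bar a\end{pmatrix}$ is the matrix, independent of $x,t$, with $(\phi,\bar\phi)=(\bar\psi,\psi)S$ on $\Sigma_0$; the block $a$ is continued to $D^+$ by $\gamma(z)a(z)=\bar\psi(x,t;z^*)^\dagger\phi(x,t;z)$. Assume that the potential is reflectionless: on $\Sigma_0$ the matrices $a,\bar a$ are invertible and $\rho=ba^{-1}=0$, $\bar\rho=\bar b\bar a^{-1}=0$. Assume that $\det a$ has exactly $N\ge0$ distinct zeros $z_1,\dots,z_N$ in $D^+\cap\{\mathrm{Im}\,z>0\}$, and that $a^{-1}$ has at most a simple pole at each $z_n$ (as is automatic if the zeros of $\det a$ are simple). Then for each $n$ there is a unique matrix $C_n\in\mathbb C^{m\times m}$ (the norming constant) with $$\mathop{\mathrm{Res}}_{z=z_n}\bigl[\hat W(x,t;z)a^{-1}(z)\bigr]=e^{2i\theta(x,t;z_n)}\hat V(x,t;z_n)C_n\qquad\text{for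 all }x\in\mathbb R,\ t\in T .$$ Put $\zeta_n=z_n$, $\zeta_{N+n}=-k_0^2/z_n^*$, $C_{N+n}=-(z_n^*)^{-2}Q_+^\dagger C_n^\dagger Q_+^\dagger$ for $1\le n\le N$, and, for $1\le n,l\le 2N$, $$\bar C_n=-C_n^\dagger,\qquad c_n(x,t;z)=\frac{C_n}{z-\zeta_n}e^{2i\theta(x,t;\zeta_n)},$$ $$Y_n=I-iQ_+\sum_{j=1}^{2N}\frac{c_j(\zeta_n^*)}{\zeta_j},\qquad \Omega_{n,l}=\sum_{j=1}^{2N}c_l(\zeta_j^*)^\dagger c_j(\zeta_n^*).$$ Then for all $x\in\mathbb R$, $t\in T$, $$Q(x,t)=Q_++i\sum_{n=1}^{2N}e^{-2i\theta(x,t;\zeta_n^*)}X_n\bar C_n ,$$ where $X_n=\bar V^{up}(x,t;\zeta_n^*)$ (the upper $m\times m$ block) and $X_1,\dots,X_{2N}$ are determined by the linear system $$X_n+\sum_{l=1}^{2N}X_l\,\Omega_{n,l}=Y_n,\qquad n=1,\dots,2N,$$ that is, $K\mathbf X=\mathbf Y$ with $\mathbf X=(X_1,\dots,X_{2N})^T$,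 $\mathbf Y=(Y_1,\dots,Y_{2N})^T$ (the transposes of the block rows) and $K=I_{2mN}+\Omega$, where the $(n,l)$ block of $\Omega$ is $\Omega_{n,l}^T$; the matrix $K$ is invertible. -/

import Mathlib

open Filter Topology
open scoped Matrix ComplexConjugate

noncomputable section

namespace MMKdV

/-- Square `m × m` complex matrices. -/
abbrev Mat (m : ℕ) := Matrix (Fin m) (Fin m) ℂ

/-- Square `2m × 2m` complex matrices, in `m × m` blocks. -/
abbrev Mat2 (m : ℕ) := Matrix (Fin m ⊕ Fin m) (Fin m ⊕ Fin m) ℂ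

/-- Half of a `2m × 2m` matrix: `2m × m` matrices. -/
abbrev MatH (m : ℕ) := Matrix (Fin m ⊕ Fin m) (Fin m) ℂ

/-- Entrywise partial derivative in `x` of a matrix function of `(x, t)`. -/
def dx {m : ℕ} (F : ℝ → ℝ → Mat m) : ℝ → ℝ → Mat m :=
  fun x t => Matrix.of fun i j => deriv (fun y => F y t i j) x

/-- Entrywise partial derivative in `t` of a matrix function of `(x, t)`. -/
def dt {m : ℕ} (F : ℝ → ℝ → Mat m) : ℝ → ℝ → Mat m :=
  fun x t => Matrix.of fun i j => deriv (fun s => F x s i j) t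

/-- The bare data: amplitude `k₀`, time interval `T`, matrix function `Q (x, t)` and
its boundary values `Qm` (at `x → -∞`) and `Qp` (at `x → +∞`). -/
structure Potential (m : ℕ) where
  k₀ : ℝ
  T : Set ℝ
  Q : ℝ → ℝ → Mat m
  Qm : Mat m
  Qp : Mat m

namespace Potential

variable {m : ℕ} (P : Potential m)

/-- `P.Q` is a symmetric-matrix-valued classical solution, for times in the open interval `P.T`,
of the focusing matrix modified KdV equation
`Q_t + Q_xxx + 3 (Q_x Q† Q + Q Q† Q_x) = 0`
with nonzero boundary values `Q → Q_±`, `Q_± Q_±† = Q_±† Q_± = k₀² I`. -/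
structure IsSolution : Prop where
  k₀_pos : 0 < P.k₀
  isOpen_T : IsOpen P.T
  isConnected_T : IsConnected P.T
  Qm_mul : P.Qm * P.Qmᴴ = ((P.k₀ : ℂ) ^ 2) • (1 : Mat m)
  Qm_mul' : P.Qmᴴ * P.Qm = ((P.k₀ : ℂ) ^ 2) • (1 : Mat m)
  Qp_mul : P.Qp * P.Qpᴴ = ((P.k₀ : ℂ) ^ 2) • (1 : Mat m)
  Qp_mul' : P.Qpᴴ * P.Qp = ((P.k₀ : ℂ) ^ 2) • (1 : Mat m)
  symm : ∀ x, ∀ t ∈ P.T, (P.Q x t)ᵀ = P.Q x t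
  contDiff_x : ∀ t ∈ P.T, ∀ i j, ContDiff ℝ 3 (fun x => P.Q x t i j)
  differentiable_t : ∀ x, ∀ t ∈ P.T, ∀ i j, DifferentiableAt ℝ (fun s => P.Q x s i j) t
  /-- `Q, Q_x, Q_xx, Q_xxx` are jointly continuous. -/
  continuous_dx : ∀ n ≤ 3,
    ContinuousOn (fun p : ℝ × ℝ => (dx^[n] P.Q) p.1 p.2) (Set.univ ×ˢ P.T)
  equation : ∀ x, ∀ t ∈ P.T,
    dt P.Q x t + dx (dx (dx P.Q)) x t
      + (3 : ℂ) • (dx P.Q x t * (P.Q x t)ᴴ * P.Q x t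
        + P.Q x t * (P.Q x t)ᴴ * dx P.Q x t) = 0
  /-- Boundary values, attained locally uniformly in time, with `Q_x, Q_xx → 0`. -/
  tendsto_right : TendstoLocallyUniformlyOn (fun x t => P.Q x t) (fun _ => P.Qp) atTop P.T
  tendsto_left : TendstoLocallyUniformlyOn (fun x t => P.Q x t) (fun _ => P.Qm) atBot P.T
  tendsto_dx_right : TendstoLocallyUniformlyOn (fun x t => dx P.Q x t) (fun _ => 0) atTop P.T
  tendsto_dx_left : TendstoLocallyUniformlyOn (fun x t => dx P.Q x t) (fun _ => 0) atBot P.T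
  tendsto_dxx_right :
    TendstoLocallyUniformlyOn (fun x t => dx (dx P.Q) x t) (fun _ => 0) atTop P.T
  tendsto_dxx_left :
    TendstoLocallyUniformlyOn (fun x t => dx (dx P.Q) x t) (fun _ => 0) atBot P.T
  /-- `(1 + |x|) (Q - Q_±)` is integrable near `±∞`. -/
  integrable_right : ∀ t ∈ P.T, ∀ c : ℝ, ∀ i j,
    MeasureTheory.IntegrableOn (fun x : ℝ => (1 + |x|) * ‖P.Q x t i j - P.Qp i j‖) (Set.Ioi c)
  integrable_left : ∀ t ∈ P.T, ∀ c : ℝ, ∀ i j,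
    MeasureTheory.IntegrableOn (fun x : ℝ => (1 + |x|) * ‖P.Q x t i j - P.Qm i j‖) (Set.Iio c)

/-! ### Uniformization variable (focusing case) -/

/-- `k(z) = (z - k₀² / z) / 2`. -/
def k (z : ℂ) : ℂ := (z - (P.k₀ : ℂ) ^ 2 / z) / 2

/-- `λ(z) = (z + k₀² / z) / 2`. -/
def lam (z : ℂ) : ℂ := (z + (P.k₀ : ℂ) ^ 2 / z) / 2

/-- `θ(x,t;z) = λ(z) (x + (4 k(z)² - 2 k₀²) t)`. -/
def theta (x t : ℝ) (z : ℂ) : ℂ :=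
  P.lam z * ((x : ℂ) + (4 * P.k z ^ 2 - 2 * (P.k₀ : ℂ) ^ 2) * (t : ℂ))

/-- `γ(z) = 1 + k₀² / z²`. -/
def gam (z : ℂ) : ℂ := 1 + (P.k₀ : ℂ) ^ 2 / z ^ 2

/-- The region `Im λ(z) > 0`. -/
def Dplus : Set ℂ := {z | 0 < (‖z‖ ^ 2 - P.k₀ ^ 2) * z.im}

/-- The continuous spectrum (real axis and circle of radius `k₀`) without the branch points
`± i k₀` and without the puncture `z = 0` of the uniformization variable. -/
def Sigma₀ : Set ℂ :=
  {z | (z.im = 0 ∨ ‖z‖ = P.k₀) ∧ z ≠ 0 ∧ z ≠ Complex.I * P.k₀ ∧ z ≠ -(Complex.I * P.k₀)}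

/-! ### Lax pair -/

/-- `σ₃ = diag (I, -I)`. -/
def sigma3 : Mat2 m := Matrix.fromBlocks 1 0 0 (-1)

/-- The off-diagonal matrix `[[0, A], [-A†, 0]]`. -/
def und (A : Mat m) : Mat2 m := Matrix.fromBlocks 0 A (-Aᴴ) 0

/-- The matrix of the scattering problem `φ_x = M φ`. -/
def laxM (x t : ℝ) (z : ℂ) : Mat2 m := (-(Complex.I * P.k z)) • sigma3 + und (P.Q x t)

/-- The matrix of the time-dependent problem `φ_t = N φ`. -/
def laxN (x t : ℝ) (z : ℂ) : Mat2 m :=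
  let U : Mat2 m := und (P.Q x t)
  let Ux : Mat2 m := und (dx P.Q x t)
  let Uxx : Mat2 m := und (dx (dx P.Q) x t)
  (-(4 * Complex.I * P.k z ^ 3)) • sigma3 + (4 * P.k z ^ 2) • U
    - (2 * Complex.I * P.k z) • ((U ^ 2 + Ux) * sigma3)
    - Uxx + (2 : ℂ) • U ^ 3 + Ux * U - U * Ux

/-! ### Jost eigenfunctions -/

/-- First `m` columns of the asymptotic eigenvector matrix `E(z)` for the boundary value `A`. -/
def E₁ (A : Mat m) (z : ℂ) : MatH m := Matrix.fromRows 1 ((-(Complex.I / z)) • Aᴴ)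

/-- Last `m` columns of the asymptotic eigenvector matrix `E(z)` for the boundary value `A`. -/
def E₂ (A : Mat m) (z : ℂ) : MatH m := Matrix.fromRows ((-(Complex.I / z)) • A) 1

/-- `f` solves both parts of the Lax pair and `e^{s i θ} f → E` as `x → ±∞` (along `l`). -/
def IsJost (l : Filter ℝ) (s : ℂ) (E : MatH m) (z : ℂ) (f : ℝ → ℝ → MatH m) : Prop :=
  ∀ t ∈ P.T,
    (∀ x i j, HasDerivAt (fun y => f y t i j) ((P.laxM x t z * f x t) i j) x) ∧
    (∀ x i j, HasDerivAt (fun τ => f x τ i j) ((P.laxN x t z * f x t) i j) t) ∧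
    Tendsto (fun x => Complex.exp (s * Complex.I * P.theta x t z) • f x t) l (𝓝 E)

/-- `φ ~ E₋,₁ e^{-iθ}` as `x → -∞`. -/
def phi (z : ℂ) : ℝ → ℝ → MatH m := Classical.epsilon (P.IsJost atBot 1 (E₁ P.Qm z) z)

/-- `φ̄ ~ E₋,₂ e^{iθ}` as `x → -∞`. -/
def phiBar (z : ℂ) : ℝ → ℝ → MatH m := Classical.epsilon (P.IsJost atBot (-1) (E₂ P.Qm z) z)

/-- `ψ̄ ~ E₊,₁ e^{-iθ}` as `x → +∞`. -/
def psiBar (z : ℂ) : ℝ → ℝ → MatH m := Classical.epsilon (P.IsJost atTop 1 (E₁ P.Qp z) z)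

/-- `ψ ~ E₊,₂ e^{iθ}` as `x → +∞`. -/
def psi (z : ℂ) : ℝ → ℝ → MatH m := Classical.epsilon (P.IsJost atTop (-1) (E₂ P.Qp z) z)

/-- Modified eigenfunction `Ŵ = φ e^{iθ}`. -/
def WHat (x t : ℝ) (z : ℂ) : MatH m :=
  Complex.exp (Complex.I * P.theta x t z) • P.phi z x t

/-- Modified eigenfunction `V̂ = ψ e^{-iθ}`. -/
def VHat (x t : ℝ) (z : ℂ) : MatH m :=
  Complex.exp (-(Complex.I * P.theta x t z)) • P.psi z x t

/-- Modified eigenfunction `V̄ = ψ̄ e^{iθ}`. -/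
def VBar (x t : ℝ) (z : ℂ) : MatH m :=
  Complex.exp (Complex.I * P.theta x t z) • P.psiBar z x t

/-! ### Scattering data -/

/-- The scattering matrix on the continuous spectrum: the constant matrix `S(z)` with
`(φ, φ̄) = (ψ̄, ψ) S(z)` for all `x`, `t`. -/
def scatS (z : ℂ) : Mat2 m :=
  Classical.epsilon fun S : Mat2 m => ∀ x, ∀ t ∈ P.T,
    Matrix.fromCols (P.phi z x t) (P.phiBar z x t)
      = Matrix.fromCols (P.psiBar z x t) (P.psi z x t) * S

/-- The block `b(z)`. -/
def b (z : ℂ) : Mat m := (P.scatS z).toBlocks₂₁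

/-- The block `b̄(z)`. -/
def bBar (z : ℂ) : Mat m := (P.scatS z).toBlocks₁₂

/-- The block `ā(z)`. -/
def aBar (z : ℂ) : Mat m := (P.scatS z).toBlocks₂₂

open Classical in
/-- The block `a(z)`: the upper left block of `S(z)` on the continuous spectrum, and its analytic
continuation to `D⁺`, i.e. the constant matrix with `γ(z) a(z) = ψ̄(x,t;z*)† φ(x,t;z)` for all
`x`, `t`. -/
def a (z : ℂ) : Mat m :=
  if z ∈ P.Sigma₀ then (P.scatS z).toBlocks₁₁
  else Classical.epsilon fun A : Mat m => ∀ x, ∀ t ∈ P.T,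
    P.gam z • A = (P.psiBar (conj z) x t)ᴴ * P.phi z x t

/-- Reflection coefficient `ρ = b a⁻¹`. -/
def rho (z : ℂ) : Mat m := P.b z * (P.a z)⁻¹

/-- Reflection coefficient `ρ̄ = b̄ ā⁻¹`. -/
def rhoBar (z : ℂ) : Mat m := P.bBar z * (P.aBar z)⁻¹

/-- The reflection coefficients are defined and vanish on the continuous spectrum. -/
def Reflectionless : Prop :=
  ∀ z ∈ P.Sigma₀, IsUnit (P.a z).det ∧ IsUnit (P.aBar z).det ∧ P.rho z = 0 ∧ P.rhoBar z = 0

/-- `z 1, …, z N` are the distinct zeros of `det a` in `D⁺ ∩ {Im z > 0}`. -/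
structure IsDiscreteSpectrum {N : ℕ} (z : Fin N → ℂ) : Prop where
  injective : Function.Injective z
  mem_range_iff : ∀ w : ℂ,
    w ∈ Set.range z ↔ w ∈ P.Dplus ∧ 0 < w.im ∧ (P.a w).det = 0

/-- `a(w)⁻¹` has at most a simple pole at `w = ζ`. -/
def InvHasSimplePole (ζ : ℂ) : Prop :=
  ∃ R : Mat m, Tendsto (fun w => (w - ζ) • (P.a w)⁻¹) (𝓝[≠] ζ) (𝓝 R)

/-- `C` is the norming constant at `ζ`:
`Res_{w = ζ} [Ŵ(x,t;w) a(w)⁻¹] = e^{2iθ(x,t;ζ)} V̂(x,t;ζ) C` for all `x`, `t`. -/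
def IsNormingConstant (ζ : ℂ) (C : Mat m) : Prop :=
  ∀ x, ∀ t ∈ P.T,
    Tendsto (fun w => (w - ζ) • (P.WHat x t w * (P.a w)⁻¹)) (𝓝[≠] ζ)
      (𝓝 (Complex.exp (2 * Complex.I * P.theta x t ζ) • (P.VHat x t ζ * C)))

/-! ### The algebraic system -/

variable {N : ℕ} (z : Fin N → ℂ) (C : Fin N → Mat m)

/-- `ζ_j = z_j` and `ζ_{N+j} = -k₀² / z_j*` (`Sum.inl j` stands for `j`, `Sum.inr j` for `N+j`). -/
def zeta : Fin N ⊕ Fin N → ℂ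
  | .inl j => z j
  | .inr j => -((P.k₀ : ℂ) ^ 2) / conj (z j)

/-- All norming constants: `C_j`, and `C_{N+j} = Q₊† C̄_j Q₊† / (z_j*)²` with `C̄_j = -C_j†`. -/
def norm2 : Fin N ⊕ Fin N → Mat m
  | .inl j => C j
  | .inr j => (1 / (conj (z j)) ^ 2) • (P.Qpᴴ * (-(C j)ᴴ) * P.Qpᴴ)

/-- `c_j(x,t;w) = C_j e^{2iθ(x,t;ζ_j)} / (w - ζ_j)`. -/
def cFun (x t : ℝ) (j : Fin N ⊕ Fin N) (w : ℂ) : Mat m :=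
  (Complex.exp (2 * Complex.I * P.theta x t (P.zeta z j)) / (w - P.zeta z j)) • P.norm2 z C j

/-- `Y_n = I - i Q₊ ∑_j c_j(ζ_n*) / ζ_j`. -/
def Yblock (x t : ℝ) (n : Fin N ⊕ Fin N) : Mat m :=
  1 - Complex.I • (P.Qp * ∑ j, (1 / P.zeta z j) • P.cFun z C x t j (conj (P.zeta z n)))

/-- `Ω_{n,l} = ∑_j c_l(ζ_j*)† c_j(ζ_n*)`. -/
def Omega (x t : ℝ) (n l : Fin N ⊕ Fin N) : Mat m :=
  ∑ j, (P.cFun z C x t l (conj (P.zeta z j)))ᴴ * P.cFun z C x t j (conj (P.zeta z n))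

/-- The column `(A_1, …, A_{2N})ᵀ` of a family of `m × m` matrices, a `2mN × m` matrix. -/
def col (A : Fin N ⊕ Fin N → Mat m) : Matrix ((Fin N ⊕ Fin N) × Fin m) (Fin m) ℂ :=
  Matrix.of fun p c => A p.1 c p.2

/-- `K = I + Ω`, of size `2mN`. Its `(n, l)` block acts on `X_lᵀ` as right multiplication of `X_l`
by `Ω_{n,l}`, so that `K * col X = col Y` says `X_n + ∑_l X_l Ω_{n,l} = Y_n` for all `n`. -/
def Kmat (x t : ℝ) : Matrix ((Fin N ⊕ Fin N) × Fin m) ((Fin N ⊕ Fin N) × Fin m) ℂ :=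
  1 + Matrix.of fun p q => P.Omega z C x t p.1 q.1 q.2 p.2

theorem Kmat_mul_col_iff (x t : ℝ) (X Y : Fin N ⊕ Fin N → Mat m) :
    P.Kmat z C x t * col X = col Y ↔
      ∀ n, X n + ∑ l, X l * P.Omega z C x t n l = Y n := by
  have key : ∀ n c i, (P.Kmat z C x t * col X) (n, i) c
      = (X n + ∑ l, X l * P.Omega z C x t n l) c i := by
    intro n c i
    rw [Kmat, Matrix.add_mul, Matrix.one_mul, Matrix.add_apply, Matrix.add_apply]
    congr 1
    rw [Matrix.mul_apply, Fintype.sum_prod_type, Matrix.sum_apply]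
    refine Finset.sum_congr rfl fun l _ => ?_
    rw [Matrix.mul_apply]
    exact Finset.sum_congr rfl fun b _ => mul_comm _ _
  constructor
  · intro h n
    ext c i
    rw [← key, h]
    rfl
  · intro h
    ext ⟨n, i⟩ c
    rw [key, h]
    rfl

end Potential

end MMKdV

end

/-! At fixed `(x, t)` everything is read as a function of the spectral parameter. Without
reflection, `Ŵ a⁻¹` on `Im λ > 0` and `V̄` on `Im λ ≤ 0` have the same boundary values on the
continuous spectrum. They therefore form one meromorphic function, `merom`, with at most simple
poles, at the `2N` points `ζ_j` and at `0`, and with limit `(I, 0)` at infinity. Liouville's theorem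
recovers it from its principal parts (`vbar_eq_sum`). The residue at `ζ_j` is a multiple of
`V̂(ζ_j)`, and an antilinear symmetry of the Lax pair expresses `V̂(ζ_j)` through `V̄(ζ_j*)`.
Evaluation at the points `ζ_n*` and elimination of the lower blocks give the linear system
(`linear_system`). The `1/z` term of the lower block of `V̄` carries `Q†`, which gives the formula
for the potential (`Q_eq_sum`).

The analytic input concerns the normalized Jost solutions. They satisfy `w' = (A + R) w` with `A² =
2iλ A`, so `exp(sA) = 1 + growth(s) A`, and `|growth(s)| ≤ s` whenever `Im λ ≥ 0`. The Volterra
series (`vol`) then converges up to and including the branch points `± i k₀`, at the price of the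
weight `1 + |x|`. Only the left half-line is treated; the right one follows by reversing the signs
of `x`, `z` and `Q`. The limits for large `z` (`tendsto_jost_cobounded`, `tendsto_mul_lower`) come
from an integration by parts in the lower block. That the solutions found at each time also satisfy
the time equation is deduced from zero curvature and uniqueness (`isJost_of_isXJost`).

Adjoint products of solutions at `z*` and `z` are constant. This produces the scattering matrix and
the Wronskian formula for `a` (`gam_smul_a`). Reflection `z ↦ -k₀²/z*` acts on all the data
(`merom_reflK`): it doubles the discrete spectrum, transfers residues to the reflected points, and
converts the limit at infinity into the simple pole at `0`.

Gluing across the continuous spectrum uses `λ` as a chart that straightens the curve `Im λ = 0`. The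
chart fails at `± k₀`, where continuity makes the singularity removable. The delicate points are `±
i k₀`, where `γ` vanishes and `a` is a quotient `0/0`: a limit along the spectrum is carried to the
inside by a Lindelöf type theorem (`exists_boundary_limit_branch`).

Existence of norming constants is linear algebra: `a R = 0` for the residue `R` of `a⁻¹` makes the
columns of `Ŵ R` orthogonal to `V̄(ζ*)`, and the orthogonal complement of this isotropic space is
spanned by `V̂(ζ)` (`existsUnique_normingConstant`). The elimination also needs the norming
constants to be symmetric, which follows from isotropy again (`norming_transpose`). Invertibility of
`K` is independent of the scattering problem: a solution of the homogeneous system defines two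
rational matrix functions `F`, `G` with `F F† + G G† = 0` on the real line
(`cauchy_system_eq_zero`). -/

noncomputable section

set_option linter.unusedSectionVars false

namespace MMKdV

open MeasureTheory Set

/-! ### Linear ordinary differential equations -/

section LinearODE

variable {E : Type*} [NormedAddCommGroup E] [NormedSpace ℝ E]

/-- Terms of the Neumann series of `∂ₓ G = M G`, `G (0, t) = v t`. -/
def odeTerm (M : ℝ → ℝ → E →L[ℝ] E) (v : ℝ → E) : ℕ → ℝ → ℝ → E
  | 0, _, t => v t
  | n + 1, x, t => ∫ s in (0 : ℝ)..x, M s t (odeTerm M v n s t)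

theorem continuous_odeTerm {M : ℝ → ℝ → E →L[ℝ] E}
    (hM : Continuous (Function.uncurry M)) {v : ℝ → E} (hv : Continuous v) (n : ℕ) :
    Continuous (Function.uncurry (odeTerm M v n)) := by
  induction n with
  | zero => exact hv.comp continuous_snd
  | succ n ih =>
    have h : Continuous (Function.uncurry
        fun (p : ℝ × ℝ) (s : ℝ) => M s p.2 (odeTerm M v n s p.2)) := by
      have h1 : Continuous fun q : (ℝ × ℝ) × ℝ => M q.2 q.1.2 :=
        hM.comp (continuous_snd.prodMk (continuous_snd.comp continuous_fst))
      have h2 : Continuous fun q : (ℝ × ℝ) × ℝ => odeTerm M v n q.2 q.1.2 :=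
        ih.comp (continuous_snd.prodMk (continuous_snd.comp continuous_fst))
      exact h1.clm_apply h2
    exact intervalIntegral.continuous_parametric_intervalIntegral_of_continuous
      (a₀ := 0) h continuous_fst

/-- The `n`-fold iterated integral runs over a simplex of volume `|x|ⁿ / n!`; the factorial makes
the Neumann series converge on every bounded interval, whatever the size of `M`. -/
theorem norm_odeTerm_le {M : ℝ → ℝ → E →L[ℝ] E}
    (hM : Continuous (Function.uncurry M)) {v : ℝ → E} (hv : Continuous v) {t a C V : ℝ}
    (hC : ∀ s, |s| ≤ a → ‖M s t‖ ≤ C) (hV : ‖v t‖ ≤ V) (n : ℕ) :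
    ∀ x, |x| ≤ a → ‖odeTerm M v n x t‖ ≤ V * C ^ n * |x| ^ n / n.factorial := by
  induction n with
  | zero => intro x _; simpa [odeTerm] using hV
  | succ n ih =>
    intro x hx
    have hC0 : 0 ≤ C := (norm_nonneg _).trans (hC x hx)
    have hcont : Continuous fun s => V * C ^ (n + 1) * |s - 0| ^ n / n.factorial := by fun_prop
    calc ‖odeTerm M v (n + 1) x t‖
        = ‖∫ s in (0 : ℝ)..x, M s t (odeTerm M v n s t)‖ := rfl
      _ ≤ ∫ s in uIoc (0 : ℝ) x, ‖M s t (odeTerm M v n s t)‖ :=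
          intervalIntegral.norm_integral_le_integral_norm_uIoc
      _ ≤ ∫ s in uIoc (0 : ℝ) x, V * C ^ (n + 1) * |s - 0| ^ n / n.factorial := by
          have hc2 : Continuous fun s => ‖M s t (odeTerm M v n s t)‖ := by
            have h1 : Continuous fun s => M s t :=
              hM.comp (continuous_id.prodMk continuous_const)
            have h2 : Continuous fun s => odeTerm M v n s t :=
              (continuous_odeTerm hM hv n).comp (continuous_id.prodMk continuous_const)
            exact (h1.clm_apply h2).norm
          refine setIntegral_mono_on (hc2.integrableOn_uIoc) (hcont.integrableOn_uIoc)
            measurableSet_uIoc fun s hs => ?_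
          have hsa : |s| ≤ a := by
            refine le_trans ?_ hx
            rcases le_total 0 x with h | h
            · rw [uIoc_of_le h] at hs
              rw [abs_of_pos hs.1, abs_of_nonneg h]; exact hs.2
            · rw [uIoc_of_ge h] at hs
              rw [abs_of_nonpos hs.2, abs_of_nonpos h]; linarith [hs.1]
          calc ‖M s t (odeTerm M v n s t)‖ ≤ C * (V * C ^ n * |s| ^ n / n.factorial) :=
                ((M s t).le_opNorm _).trans
                  (mul_le_mul (hC s hsa) (ih s hsa) (norm_nonneg _) hC0)
            _ = V * C ^ (n + 1) * |s - 0| ^ n / n.factorial := by rw [sub_zero]; ring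
      _ = V * C ^ (n + 1) * |x| ^ (n + 1) / (n + 1).factorial := by
          have : ∀ s : ℝ, V * C ^ (n + 1) * |s - 0| ^ n / n.factorial
              = (V * C ^ (n + 1) / n.factorial) * |s - 0| ^ n := fun s => by ring
          simp_rw [this]
          rw [integral_const_mul, integral_pow_abs_sub_uIoc, sub_zero, Nat.factorial_succ]
          push_cast
          field_simp

/-- A linear ODE depending continuously on a parameter has a jointly continuous solution. -/
theorem exists_linear_ode [CompleteSpace E] {M : ℝ → ℝ → E →L[ℝ] E}
    (hM : Continuous (Function.uncurry M)) {v : ℝ → E} (hv : Continuous v) :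
    ∃ G : ℝ → ℝ → E, Continuous (Function.uncurry G) ∧ (∀ t, G 0 t = v t) ∧
      ∀ x t, HasDerivAt (fun y => G y t) (M x t (G x t)) x := by
  have hsum : ∀ V C a : ℝ, Summable fun n : ℕ => V * C ^ n * a ^ n / n.factorial := by
    intro V C a
    have := (Real.summable_pow_div_factorial (C * a)).mul_left V
    refine this.congr fun n => ?_
    rw [mul_pow]; ring
  have hbd : ∀ a : ℝ, ∃ C V : ℝ, 0 ≤ C ∧ 0 ≤ V ∧ ∀ t, |t| ≤ a → ‖v t‖ ≤ V ∧
      ∀ s, |s| ≤ a → ‖M s t‖ ≤ C := by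
    intro a
    obtain ⟨C, hC⟩ := ((isCompact_Icc (a := -a) (b := a)).prod
      (isCompact_Icc (a := -a) (b := a))).exists_bound_of_continuousOn hM.continuousOn
    obtain ⟨V, hV⟩ := (isCompact_Icc (a := -a) (b := a)).exists_bound_of_continuousOn
      hv.continuousOn
    refine ⟨max C 0, max V 0, le_max_right _ _, le_max_right _ _, fun t ht => ⟨?_, fun s hs => ?_⟩⟩
    · exact (hV t (abs_le.1 ht)).trans (le_max_left _ _)
    · exact (hC (s, t) ⟨abs_le.1 hs, abs_le.1 ht⟩).trans (le_max_left _ _)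
  have hterm : ∀ a : ℝ, ∃ C V : ℝ, 0 ≤ C ∧ 0 ≤ V ∧
      (∀ s t, |s| ≤ a → |t| ≤ a → ‖M s t‖ ≤ C) ∧
      ∀ n x t, |x| ≤ a → |t| ≤ a →
        ‖odeTerm M v n x t‖ ≤ V * C ^ n * a ^ n / n.factorial := by
    intro a
    obtain ⟨C, V, hC0, hV0, h⟩ := hbd a
    refine ⟨C, V, hC0, hV0, fun s t hs ht => (h t ht).2 s hs, fun n x t hx ht => ?_⟩
    refine (norm_odeTerm_le hM hv (h t ht).2 (h t ht).1 n x hx).trans ?_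
    gcongr
  refine ⟨fun x t => ∑' n, odeTerm M v n x t, ?_, ?_, ?_⟩
  · refine continuous_iff_continuousAt.2 fun p => ?_
    set a := max |p.1| |p.2| + 1
    obtain ⟨C, V, hC0, hV0, -, h⟩ := hterm a
    have hopen : IsOpen {q : ℝ × ℝ | |q.1| < a ∧ |q.2| < a} :=
      (isOpen_lt (continuous_abs.comp continuous_fst) continuous_const).inter
        (isOpen_lt (continuous_abs.comp continuous_snd) continuous_const)
    have hp : p ∈ {q : ℝ × ℝ | |q.1| < a ∧ |q.2| < a} :=
      ⟨lt_of_le_of_lt (le_max_left _ _) (lt_add_one _),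
        lt_of_le_of_lt (le_max_right _ _) (lt_add_one _)⟩
    have : ContinuousOn (fun q : ℝ × ℝ => ∑' n, odeTerm M v n q.1 q.2)
        {q : ℝ × ℝ | |q.1| < a ∧ |q.2| < a} :=
      continuousOn_tsum (fun n => (continuous_odeTerm hM hv n).continuousOn) (hsum V C a)
        fun n q hq => h n q.1 q.2 hq.1.le hq.2.le
    exact this.continuousAt (hopen.mem_nhds hp)
  · intro t
    change ∑' n, odeTerm M v n 0 t = v t
    rw [tsum_eq_single 0]
    · rfl
    · intro n hn
      obtain ⟨k, rfl⟩ := Nat.exists_eq_succ_of_ne_zero hn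
      simp [odeTerm]
  · intro x t
    set a := max |x| |t| + 1
    obtain ⟨C, V, hC0, hV0, hMC, h⟩ := hterm a
    have ha0 : 0 ≤ a := by positivity
    have ht : |t| ≤ a := (le_max_right _ _).trans (lt_add_one _).le
    have hx : x ∈ Ioo (-a) a := by
      exact abs_lt.1 (lt_of_le_of_lt (le_max_left _ _) (lt_add_one _))
    -- The zeroth term does not depend on `x`, so the termwise derivatives begin with `0` and are
    -- shifted by one against the series; dropping this `0` leaves `M` applied to the whole series.
    let g' : ℕ → ℝ → E := fun n y => match n with
      | 0 => 0
      | k + 1 => M y t (odeTerm M v k y t)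
    let u : ℕ → ℝ := fun n => match n with
      | 0 => 0
      | k + 1 => C * (V * C ^ k * a ^ k / k.factorial)
    have hu : Summable u := (summable_nat_add_iff 1).1 ((hsum V C a).mul_left C)
    have hmain := hasDerivAt_tsum_of_isPreconnected (g := fun n y => odeTerm M v n y t)
      (g' := g') hu (isOpen_Ioo (a := -a) (b := a)) isPreconnected_Ioo
      (fun n y _ => ?_) (fun n y hy => ?_) hx
      (Summable.of_norm_bounded (hsum V C a)
        fun n => h n x t (abs_lt.2 hx).le ht) hx
    · refine hmain.congr_deriv ?_
      have hs : Summable fun n => odeTerm M v n x t :=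
        Summable.of_norm_bounded (hsum V C a) fun n => h n x t (abs_lt.2 hx).le ht
      have hs' : HasSum (fun n => g' (n + 1) x) (M x t (∑' n, odeTerm M v n x t)) :=
        (M x t).hasSum hs.hasSum
      have := (hasSum_nat_add_iff (f := fun n => g' n x) 1).1 hs'
      simp only [Finset.range_one, Finset.sum_singleton] at this
      rw [this.tsum_eq]
      exact add_zero _
    · cases n with
      | zero => exact hasDerivAt_const _ _
      | succ k =>
        have hc : Continuous fun s => M s t (odeTerm M v k s t) := by
          have h1 : Continuous fun s => M s t :=
            hM.comp (continuous_id.prodMk continuous_const)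
          have h2 : Continuous fun s => odeTerm M v k s t :=
            (continuous_odeTerm hM hv k).comp (continuous_id.prodMk continuous_const)
          exact h1.clm_apply h2
        exact intervalIntegral.integral_hasDerivAt_right (hc.intervalIntegrable _ _)
          (hc.stronglyMeasurableAtFilter _ _) hc.continuousAt
    · have hy' := (abs_lt.2 hy).le
      cases n with
      | zero => simp [g', u]
      | succ k =>
        exact ((M y t).le_opNorm _).trans
          (mul_le_mul (hMC y t hy' ht) (h k y t hy' ht) (norm_nonneg _) hC0)

/-- Two-sided Grönwall bound for `d' = f'` with `‖f'‖ ≤ K ‖d‖ + ε`. -/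
theorem norm_le_gronwallBound_of_abs {d d' : ℝ → E} {T : Set ℝ} (hc : T.OrdConnected)
    (hd : ∀ x ∈ T, HasDerivAt d (d' x) x) {δ K ε : ℝ} {x₀ x : ℝ} (hx₀ : x₀ ∈ T) (hx : x ∈ T)
    (h0 : ‖d x₀‖ ≤ δ) (hb : ∀ y ∈ uIcc x₀ x, ‖d' y‖ ≤ K * ‖d y‖ + ε) :
    ‖d x‖ ≤ gronwallBound δ K ε |x - x₀| := by
  have hsub : uIcc x₀ x ⊆ T := hc.uIcc_subset hx₀ hx
  rcases le_total x₀ x with h | h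
  · rw [abs_of_nonneg (sub_nonneg.2 h)]
    rw [uIcc_of_le h] at hsub hb
    exact norm_le_gronwallBound_of_norm_deriv_right_le (f := d) (f' := d')
      (fun y hy => (hd y (hsub hy)).continuousAt.continuousWithinAt)
      (fun y hy => (hd y (hsub (Ico_subset_Icc_self hy))).hasDerivWithinAt) h0
      (fun y hy => hb y (Ico_subset_Icc_self hy)) x (right_mem_Icc.2 h)
  · rw [abs_of_nonpos (sub_nonpos.2 h)]
    rw [uIcc_of_ge h] at hsub hb
    have key : ∀ y ∈ Icc (-x₀) (-x), HasDerivAt (fun s => d (-s)) (-d' (-y)) y := by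
      intro y hy
      have := (hd (-y) (hsub ⟨by linarith [hy.2], by linarith [hy.1]⟩)).scomp y (hasDerivAt_neg y)
      simpa [Function.comp_def] using this
    have := norm_le_gronwallBound_of_norm_deriv_right_le (f := fun s => d (-s))
      (f' := fun y => -d' (-y)) (δ := δ) (K := K) (ε := ε) (a := -x₀) (b := -x)
      (fun y hy => (key y hy).continuousAt.continuousWithinAt)
      (fun y hy => (key y (Ico_subset_Icc_self hy)).hasDerivWithinAt) (by simpa using h0)
      (fun y hy => by
        rw [norm_neg]
        exact hb (-y) ⟨by linarith [hy.2], by linarith [hy.1]⟩) (-x)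
      (right_mem_Icc.2 (by linarith))
    simpa [sub_eq_add_neg, add_comm] using this

/-- Uniqueness for linear ODEs on an interval. -/
theorem linear_ode_eq_zero {T : Set ℝ} (hc : T.OrdConnected) {M : ℝ → E →L[ℝ] E}
    (hM : ContinuousOn M T) {d : ℝ → E} (hd : ∀ x ∈ T, HasDerivAt d (M x (d x)) x) {x₀ : ℝ}
    (hx₀ : x₀ ∈ T) (h0 : d x₀ = 0) : ∀ x ∈ T, d x = 0 := by
  intro x hx
  obtain ⟨K, hK⟩ := isCompact_uIcc.exists_bound_of_continuousOn
    (hM.mono (hc.uIcc_subset hx₀ hx))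
  have := norm_le_gronwallBound_of_abs hc hd (δ := 0) (K := K) (ε := 0) hx₀ hx (by simp [h0])
    (fun y hy => by
      rw [add_zero]
      exact ((M y).le_opNorm _).trans (mul_le_mul_of_nonneg_right (hK y hy) (norm_nonneg _)))
  rw [gronwallBound_ε0_δ0] at this
  exact norm_le_zero_iff.1 this

end LinearODE

/-! ### Holomorphic dependence of integrals on a parameter -/

/-- Cauchy's estimate on a disc of radius `r / 2` turns the bound on `f` into one on its derivative,
so no domination of derivatives has to be assumed. The derivative is measurable as a limit of
difference quotients along a sequence. -/
theorem differentiableOn_integral {α E : Type*} [MeasurableSpace α] {ν : Measure α}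
    [NormedAddCommGroup E] [NormedSpace ℂ E] [NormedSpace ℝ E] [CompleteSpace E] {U : Set ℂ} (hU : IsOpen U)
    {f : ℂ → α → E} {b : α → ℝ} (hb : Integrable b ν)
    (hm : ∀ z ∈ U, AEStronglyMeasurable (f z) ν)
    (hd : ∀ᵐ a ∂ν, DifferentiableOn ℂ (fun z => f z a) U)
    (hf : ∀ᵐ a ∂ν, ∀ z ∈ U, ‖f z a‖ ≤ b a) :
    DifferentiableOn ℂ (fun z => ∫ a, f z a ∂ν) U := by
  intro z₀ hz₀
  obtain ⟨r, hr, hball⟩ := Metric.isOpen_iff.1 hU z₀ hz₀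
  have hr2 : 0 < r / 2 := half_pos hr
  have hsub : Metric.ball z₀ (r / 2) ⊆ U := (Metric.ball_subset_ball (by linarith)).trans hball
  have hmeas : AEStronglyMeasurable (fun a => deriv (fun z => f z a) z₀) ν := by
    have hseq : Tendsto (fun n : ℕ => z₀ + ((r / 2 / (n + 1) : ℝ) : ℂ)) atTop (𝓝[≠] z₀) := by
      refine tendsto_nhdsWithin_iff.2 ⟨?_, Eventually.of_forall fun n => ?_⟩
      · have h1 : Tendsto (fun n : ℕ => r / 2 / ((n : ℝ) + 1)) atTop (𝓝 0) := by
          have := (tendsto_one_div_add_atTop_nhds_zero_nat (𝕜 := ℝ)).const_mul (r / 2)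
          simpa [div_eq_mul_inv] using this
        have h2 := (Complex.continuous_ofReal.tendsto 0).comp h1
        simpa using h2.const_add z₀
      · have : (0 : ℝ) < r / 2 / (n + 1) := by positivity
        simp only [mem_compl_iff, mem_singleton_iff, add_eq_left, Complex.ofReal_eq_zero]
        exact this.ne'
    refine aestronglyMeasurable_of_tendsto_ae (u := atTop)
      (f := fun (n : ℕ) a => slope (fun z => f z a) z₀ (z₀ + ((r / 2 / (n + 1) : ℝ) : ℂ))) ?_ ?_
    · intro n
      have hn : z₀ + ((r / 2 / (n + 1) : ℝ) : ℂ) ∈ U := by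
        refine hball ?_
        rw [Metric.mem_ball, dist_eq_norm, add_sub_cancel_left, Complex.norm_real,
          Real.norm_of_nonneg (by positivity)]
        calc r / 2 / ((n : ℝ) + 1) ≤ r / 2 := div_le_self hr2.le (by simp)
          _ < r := by linarith
      simp only [slope, vsub_eq_sub]
      exact ((hm _ hn).sub (hm _ hz₀)).const_smul _
    · filter_upwards [hd] with a ha
      have : HasDerivAt (fun z => f z a) (deriv (fun z => f z a) z₀) z₀ :=
        (ha.differentiableAt (hU.mem_nhds hz₀)).hasDerivAt
      exact (hasDerivAt_iff_tendsto_slope.1 this).comp hseq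
  have := hasDerivAt_integral_of_dominated_loc_of_deriv_le (𝕜 := ℂ) (μ := ν) (F := f)
    (F' := fun z a => deriv (fun z => f z a) z) (x₀ := z₀) (s := Metric.ball z₀ (r / 2))
    (bound := fun a => b a / (r / 2))
    (Metric.ball_mem_nhds _ hr2)
    (by filter_upwards [hU.mem_nhds hz₀] with z hz using hm z hz)
    (hb.mono' (hm z₀ hz₀) (by filter_upwards [hf] with a ha using ha z₀ hz₀))
    hmeas ?_ (hb.div_const _) ?_
  · exact this.2.differentiableAt.differentiableWithinAt
  · filter_upwards [hd, hf] with a ha ha' z hz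
    have hcb : Metric.ball z (r / 2) ⊆ U := by
      refine Subset.trans ?_ hball
      intro w hw
      rw [Metric.mem_ball] at hw hz ⊢
      linarith [dist_triangle w z z₀]
    -- Only the open disc of radius `r / 2` is known to lie in `U`, so Cauchy's estimate is applied
    -- with radii `s < r / 2` close to it.
    refine le_of_forall_pos_le_add fun ε hε => ?_
    have hlim : Tendsto (fun s : ℝ => b a / s) (𝓝[<] (r / 2)) (𝓝 (b a / (r / 2))) :=
      (tendsto_const_nhds.div tendsto_id hr2.ne').mono_left nhdsWithin_le_nhds
    obtain ⟨s, hs1, hs2⟩ := ((hlim.eventually (gt_mem_nhds (lt_add_of_pos_right _ hε))).and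
      (Ioo_mem_nhdsLT hr2)).exists
    refine (Complex.norm_deriv_le_of_forall_mem_sphere_norm_le hs2.1 ?_ ?_).trans hs1.le
    · refine DifferentiableOn.diffContOnCl ?_
      rw [closure_ball _ hs2.1.ne']
      exact ha.mono ((Metric.closedBall_subset_ball hs2.2).trans hcb)
    · intro w hw
      exact ha' w (hcb (Metric.sphere_subset_closedBall.trans
        (Metric.closedBall_subset_ball hs2.2) hw))
  · filter_upwards [hd] with a ha z hz
    exact (ha.differentiableAt (hU.mem_nhds (hsub hz))).hasDerivAt

/-! ### Volterra equations on a left half-line -/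

section Volterra

/-- `∫₀^{s⁺} exp (2 i μ u) du`; for `A² = 2 i μ A` and `s ≥ 0` one has
`exp (s A) = 1 + growth μ s • A`. -/
def growth (μ : ℂ) (s : ℝ) : ℂ :=
  ∫ u in (0 : ℝ)..(max s 0), Complex.exp (2 * Complex.I * μ * u)

theorem growth_of_nonpos (μ : ℂ) {s : ℝ} (hs : s ≤ 0) : growth μ s = 0 := by
  simp [growth, max_eq_right hs]

theorem norm_exp_two_I_mul_le {μ : ℂ} (hμ : 0 ≤ μ.im) {u : ℝ} (hu : 0 ≤ u) :
    ‖Complex.exp (2 * Complex.I * μ * u)‖ ≤ 1 := by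
  rw [Complex.norm_exp, Real.exp_le_one_iff]
  have : (2 * Complex.I * μ * u).re = -(2 * μ.im * u) := by simp
  rw [this]
  nlinarith [mul_nonneg hμ hu]

/-- The integrand has modulus at most one and `s ↦ s⁺` is 1-Lipschitz. The bound is uniform in `μ`
and covers `μ = 0`, which is how branch points are reached. -/
theorem norm_growth_sub_le {μ : ℂ} (hμ : 0 ≤ μ.im) (s s' : ℝ) :
    ‖growth μ s - growth μ s'‖ ≤ |s - s'| := by
  have hc : Continuous fun u : ℝ => Complex.exp (2 * Complex.I * μ * u) := by fun_prop
  rw [growth, growth, intervalIntegral.integral_interval_sub_left (hc.intervalIntegrable _ _)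
    (hc.intervalIntegrable _ _)]
  refine (intervalIntegral.norm_integral_le_of_norm_le_const (C := 1) fun u hu => ?_).trans ?_
  · refine norm_exp_two_I_mul_le hμ ?_
    exact (le_min (le_max_right _ _) (le_max_right _ _)).trans hu.1.le
  · rw [one_mul]
    exact abs_max_sub_max_le_abs _ _ _

theorem norm_growth_le {μ : ℂ} (hμ : 0 ≤ μ.im) {s : ℝ} (hs : 0 ≤ s) : ‖growth μ s‖ ≤ s := by
  have := norm_growth_sub_le hμ s 0
  rwa [growth_of_nonpos μ le_rfl, sub_zero, sub_zero, abs_of_nonneg hs] at this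

theorem continuous_growth {μ : ℂ} (hμ : 0 ≤ μ.im) : Continuous (growth μ) := by
  have : LipschitzWith 1 (growth μ) := LipschitzWith.of_dist_le_mul fun s s' => by
    rw [dist_eq_norm, Real.dist_eq, NNReal.coe_one, one_mul]
    exact norm_growth_sub_le hμ s s'
  exact this.continuous

theorem continuous_growth_left (s : ℝ) : Continuous fun μ => growth μ s :=
  intervalIntegral.continuous_parametric_intervalIntegral_of_continuous' (by fun_prop) _ _

/-- Stated without a division by `μ`, so that the calculus of `exp (s A)` is available at `μ = 0` as
well. -/
theorem two_mul_growth (μ : ℂ) {s : ℝ} (hs : 0 ≤ s) :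
    2 * Complex.I * μ * growth μ s = Complex.exp (2 * Complex.I * μ * s) - 1 := by
  rw [growth, max_eq_left hs, ← intervalIntegral.integral_const_mul]
  have hd : ∀ u ∈ uIcc 0 s, HasDerivAt (fun u : ℝ => Complex.exp (2 * Complex.I * μ * u))
      (2 * Complex.I * μ * Complex.exp (2 * Complex.I * μ * u)) u := by
    intro u _
    have h1 : HasDerivAt (fun u : ℝ => (2 * Complex.I * μ * u : ℂ)) (2 * Complex.I * μ * 1) u :=
      (Complex.ofRealCLM.hasDerivAt (x := u)).const_mul _
    exact h1.cexp.congr_deriv (by ring)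
  rw [intervalIntegral.integral_eq_sub_of_hasDerivAt hd
    (Continuous.intervalIntegrable (by fun_prop) _ _)]
  simp

theorem growth_eq_of_ne_zero {μ : ℂ} (hμ : μ ≠ 0) {s : ℝ} (hs : 0 ≤ s) :
    growth μ s = (Complex.exp (2 * Complex.I * μ * s) - 1) / (2 * Complex.I * μ) := by
  rw [← two_mul_growth μ hs, mul_div_cancel_left₀]
  simp [hμ]

/-- Complements the linear bound in `s`: the decay in `μ` compensates the growth of the coefficient
matrix for large `z`, and it bounds the flow uniformly in `s` when `μ ≠ 0`. -/
theorem norm_growth_le_div {μ : ℂ} (hμ : 0 ≤ μ.im) {s : ℝ} (hs : 0 ≤ s) :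
    ‖growth μ s‖ * ‖μ‖ ≤ 1 := by
  have h := congrArg norm (two_mul_growth μ hs)
  have h2 : ‖Complex.exp (2 * Complex.I * μ * s) - 1‖ ≤ 2 :=
    (norm_sub_le _ _).trans (by
      rw [norm_one]; linarith [norm_exp_two_I_mul_le hμ hs])
  rw [← h] at h2
  simp only [norm_mul, Complex.norm_I, Complex.norm_ofNat, mul_one] at h2
  linarith

theorem hasDerivAt_growth_pos (μ : ℂ) {s : ℝ} (hs : 0 < s) :
    HasDerivAt (growth μ) (Complex.exp (2 * Complex.I * μ * s)) s := by
  have hc : Continuous fun u : ℝ => Complex.exp (2 * Complex.I * μ * u) := by fun_prop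
  have h := intervalIntegral.integral_hasDerivAt_right (hc.intervalIntegrable 0 s)
    (hc.stronglyMeasurableAtFilter _ _) hc.continuousAt
  refine h.congr_of_eventuallyEq ?_
  filter_upwards [lt_mem_nhds hs] with y hy
  rw [growth, max_eq_left hy.le]

theorem hasDerivAt_growth_neg (μ : ℂ) {s : ℝ} (hs : s < 0) : HasDerivAt (growth μ) 0 s := by
  refine (hasDerivAt_const s (0 : ℂ)).congr_of_eventuallyEq ?_
  filter_upwards [gt_mem_nhds hs] with y hy
  exact growth_of_nonpos μ hy.le

variable {E : Type*} [NormedAddCommGroup E] [NormedSpace ℂ E] [NormedSpace ℝ E]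
  [IsScalarTower ℝ ℂ E]

/-- `f` is continuous and `(1 + |x|) f` is integrable near `-∞`. -/
def WInt {F : Type*} [NormedAddCommGroup F] (f : ℝ → F) : Prop :=
  Continuous f ∧ ∀ c, IntegrableOn (fun y => (1 + |y|) * ‖f y‖) (Iic c)

theorem WInt.integrableOn {F : Type*} [NormedAddCommGroup F] {f : ℝ → F} (hf : WInt f) (c : ℝ) :
    IntegrableOn f (Iic c) := by
  refine (hf.2 c).mono' hf.1.aestronglyMeasurable (Eventually.of_forall fun y => ?_)
  nlinarith [norm_nonneg (f y), mul_nonneg (abs_nonneg y) (norm_nonneg (f y))]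

theorem hasDerivAt_integral_Iic {F : Type*} [NormedAddCommGroup F] [NormedSpace ℝ F]
    [CompleteSpace F] {f : ℝ → F} (hf : Continuous f)
    (hi : ∀ c, IntegrableOn f (Iic c)) (x : ℝ) :
    HasDerivAt (fun x => ∫ y in Iic x, f y) (f x) x := by
  have h := (intervalIntegral.integral_hasDerivAt_right (hf.intervalIntegrable x x)
    (hf.stronglyMeasurableAtFilter _ _) hf.continuousAt).const_add (∫ y in Iic x, f y)
  refine h.congr_of_eventuallyEq (Eventually.of_forall fun z => ?_)
  simp only
  rw [← intervalIntegral.integral_Iic_sub_Iic (hi x) (hi z)]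
  abel

theorem tendsto_integral_Iic_atBot {F : Type*} [NormedAddCommGroup F] [NormedSpace ℝ F]
    [CompleteSpace F] {f : ℝ → F} (hi : ∀ c, IntegrableOn f (Iic c)) :
    Tendsto (fun x => ∫ y in Iic x, f y) atBot (𝓝 0) := by
  have h := (intervalIntegral_tendsto_integral_Iic 0 (hi 0) tendsto_id).const_sub
    (∫ y in Iic (0 : ℝ), f y)
  rw [sub_self] at h
  refine h.congr fun x => ?_
  simp only [id]
  rw [← intervalIntegral.integral_Iic_sub_Iic (hi x) (hi 0)]
  abel

/-- `∫_{-∞}^x exp ((x - y) A) f y dy` for `A² = 2 i μ A`. -/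
def duhamel (μ : ℂ) (A : E →L[ℂ] E) (f : ℝ → E) (x : ℝ) : E :=
  ∫ y in Iic x, (f y + growth μ (x - y) • A (f y))

/-- The factor `1 + (x - y)` is at most `(1 + |X|)(1 + |y|)`; this is the origin of the weight `1 +
|y|` imposed on the potential. The constant `C` is left free so that the estimate serves both
locally in `z` and uniformly for large `z`. -/
theorem norm_duhamel_integrand_le {μ : ℂ} {A : E →L[ℂ] E} {C : ℝ}
    (hC : ∀ s, 0 ≤ s → 1 + ‖growth μ s‖ * ‖A‖ ≤ C * (1 + s)) {X x y : ℝ} (hx : x ≤ X)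
    (hy : y ≤ x) (v : E) :
    ‖v + growth μ (x - y) • A v‖ ≤ C * (1 + |X|) * ((1 + |y|) * ‖v‖) := by
  have hs : 0 ≤ x - y := sub_nonneg.2 hy
  have hC0 : 0 ≤ C := by
    have h1 := hC 0 le_rfl
    have h2 : (0 : ℝ) ≤ 1 + ‖growth μ 0‖ * ‖A‖ := by positivity
    linarith
  have h1 : ‖v + growth μ (x - y) • A v‖ ≤ (1 + ‖growth μ (x - y)‖ * ‖A‖) * ‖v‖ := by
    refine (norm_add_le _ _).trans ?_
    rw [norm_smul, add_mul, one_mul, mul_assoc]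
    gcongr
    exact A.le_opNorm v
  have h2 : 1 + (x - y) ≤ (1 + |X|) * (1 + |y|) := by
    nlinarith [le_abs_self X, neg_abs_le y, mul_nonneg (abs_nonneg X) (abs_nonneg y)]
  calc ‖v + growth μ (x - y) • A v‖ ≤ (1 + ‖growth μ (x - y)‖ * ‖A‖) * ‖v‖ := h1
    _ ≤ (C * (1 + (x - y))) * ‖v‖ := by gcongr; exact hC _ hs
    _ ≤ (C * ((1 + |X|) * (1 + |y|))) * ‖v‖ := by gcongr
    _ = _ := by ring

theorem duhamel_bound {μ : ℂ} (hμ : 0 ≤ μ.im) (A : E →L[ℂ] E) (s : ℝ) (hs : 0 ≤ s) :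
    1 + ‖growth μ s‖ * ‖A‖ ≤ (1 + ‖A‖) * (1 + s) := by
  have := norm_growth_le hμ hs
  nlinarith [norm_nonneg A, norm_nonneg (growth μ s)]

theorem continuous_duhamel_integrand {μ : ℂ} (hμ : 0 ≤ μ.im) (A : E →L[ℂ] E) {f : ℝ → E}
    (hf : Continuous f) (x : ℝ) : Continuous fun y => f y + growth μ (x - y) • A (f y) :=
  hf.add (((continuous_growth hμ).comp (continuous_const.sub continuous_id)).smul
    (A.continuous.comp hf))

theorem integrableOn_duhamel_integrand {μ : ℂ} (hμ : 0 ≤ μ.im) (A : E →L[ℂ] E) {f : ℝ → E}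
    (hf : WInt f) (x : ℝ) :
    IntegrableOn (fun y => f y + growth μ (x - y) • A (f y)) (Iic x) := by
  refine ((hf.2 x).const_mul ((1 + ‖A‖) * (1 + |x|))).mono'
    (continuous_duhamel_integrand hμ A hf.1 x).aestronglyMeasurable ?_
  filter_upwards [ae_restrict_mem measurableSet_Iic] with y hy
  exact norm_duhamel_integrand_le (duhamel_bound hμ A) le_rfl hy (f y)

theorem integrableOn_growth_smul {μ : ℂ} (hμ : 0 ≤ μ.im) {f : ℝ → E}
    (hf : WInt f) (x : ℝ) : IntegrableOn (fun y => growth μ (x - y) • f y) (Iic x) := by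
  have := (integrableOn_duhamel_integrand hμ (ContinuousLinearMap.id ℂ E) hf x).sub
    (hf.integrableOn x)
  refine this.congr (Eventually.of_forall fun y => ?_)
  simp

theorem WInt.clm {F : Type*} [NormedAddCommGroup F] [NormedSpace ℂ F] {f : ℝ → E} (hf : WInt f)
    (A : E →L[ℂ] F) : WInt fun y => A (f y) := by
  refine ⟨A.continuous.comp hf.1, fun c => ?_⟩
  have hc : Continuous fun y => (1 + |y|) * ‖A (f y)‖ :=
    (continuous_const.add continuous_abs).mul (A.continuous.comp hf.1).norm
  refine ((hf.2 c).const_mul ‖A‖).mono' hc.aestronglyMeasurable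
    (Eventually.of_forall fun y => ?_)
  rw [Real.norm_of_nonneg (by positivity)]
  calc (1 + |y|) * ‖A (f y)‖ ≤ (1 + |y|) * (‖A‖ * ‖f y‖) := by gcongr; exact A.le_opNorm _
    _ = _ := by ring

/-- The Duhamel integral solves `u' = A u + f`. -/
theorem hasDerivAt_duhamel [CompleteSpace E] {μ : ℂ} (hμ : 0 ≤ μ.im) {A : E →L[ℂ] E}
    (hA : ∀ v, A (A v) = (2 * Complex.I * μ) • A v) {f : ℝ → E} (hf : WInt f) (x₀ : ℝ) :
    HasDerivAt (duhamel μ A f) (f x₀ + A (duhamel μ A f x₀)) x₀ := by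
  have hAf := hf.clm A
  have hsplit : ∀ x, duhamel μ A f x
      = (∫ y in Iic x, f y) + ∫ y in Iic x, growth μ (x - y) • A (f y) := fun x =>
    integral_add (hf.integrableOn x) (integrableOn_growth_smul hμ hAf x)
  -- Since `growth` vanishes for negative arguments, the moving endpoint can be replaced by a fixed
  -- one, and only the integrand remains to be differentiated.
  have hext : ∀ᶠ x in 𝓝 x₀, ∫ y in Iic x, growth μ (x - y) • A (f y)
      = ∫ y in Iic (x₀ + 1), growth μ (x - y) • A (f y) := by
    filter_upwards [gt_mem_nhds (lt_add_one x₀)] with x hx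
    refine (setIntegral_eq_of_subset_of_forall_sdiff_eq_zero measurableSet_Iic
      (Iic_subset_Iic.2 hx.le) fun y hy => ?_).symm
    have : x < y := by simpa using hy.2
    rw [growth_of_nonpos μ (by linarith), zero_smul]
  have hcont : ∀ x, Continuous fun y => growth μ (x - y) • A (f y) := fun x =>
    ((continuous_growth hμ).comp (continuous_const.sub continuous_id)).smul hAf.1
  -- The kernel is Lipschitz in `x` and has its only kink at `y = x₀`, a null set, so dominated
  -- differentiation of a Lipschitz integrand applies.
  have hint : HasDerivAt (fun x => ∫ y in Iic (x₀ + 1), growth μ (x - y) • A (f y))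
      (∫ y in Iic (x₀ + 1), (if y ≤ x₀ then Complex.exp (2 * Complex.I * μ * ((x₀ - y : ℝ) : ℂ))
        else 0) • A (f y)) x₀ := by
    refine (hasDerivAt_integral_of_dominated_loc_of_lip (s := univ) (bound := fun y => ‖A (f y)‖)
      univ_mem
      (Eventually.of_forall fun x => (hcont x).aestronglyMeasurable) ?_ ?_ ?_
      (hAf.integrableOn _).norm ?_).2
    · have h1 := integrableOn_growth_smul hμ hAf x₀
      have h2 : IntegrableOn (fun y => growth μ (x₀ - y) • A (f y)) (Icc x₀ (x₀ + 1)) :=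
        (hcont x₀).continuousOn.integrableOn_compact isCompact_Icc
      refine (h1.union h2).mono_set fun y hy => ?_
      rcases le_total y x₀ with h | h
      · exact Or.inl h
      · exact Or.inr ⟨h, hy⟩
    · refine AEStronglyMeasurable.smul ?_ hAf.1.aestronglyMeasurable
      refine Measurable.aestronglyMeasurable ?_
      exact Measurable.ite measurableSet_Iic (by fun_prop) measurable_const
    · refine Eventually.of_forall fun y => LipschitzOnWith.of_dist_le_mul fun s _ s' _ => ?_
      rw [dist_eq_norm, ← sub_smul, norm_smul, Real.dist_eq, mul_comm]
      simp only [Real.coe_nnabs, abs_norm]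
      refine mul_le_mul_of_nonneg_left ((norm_growth_sub_le hμ _ _).trans_eq ?_) (norm_nonneg _)
      congr 1; ring
    · have hne : ∀ᵐ y ∂(volume.restrict (Iic (x₀ + 1))), y ≠ x₀ :=
        ae_restrict_of_ae (by simp [ae_iff])
      filter_upwards [hne] with y hy
      refine HasDerivAt.smul_const ?_ _
      rcases lt_or_gt_of_ne hy with h | h
      · rw [if_pos h.le]
        exact (hasDerivAt_growth_pos μ (sub_pos.2 h)).comp_sub_const x₀ y
      · rw [if_neg (not_le.2 h)]
        exact (hasDerivAt_growth_neg μ (sub_neg.2 h)).comp_sub_const x₀ y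
  have hval : (∫ y in Iic (x₀ + 1), (if y ≤ x₀ then
      Complex.exp (2 * Complex.I * μ * ((x₀ - y : ℝ) : ℂ)) else 0) • A (f y))
      = A (duhamel μ A f x₀) := by
    rw [duhamel, ← A.integral_comp_comm (integrableOn_duhamel_integrand hμ A hf x₀),
      setIntegral_eq_of_subset_of_forall_sdiff_eq_zero (s := Iic x₀) measurableSet_Iic
        (Iic_subset_Iic.2 (lt_add_one x₀).le) (fun y hy => ?_)]
    · refine setIntegral_congr_fun measurableSet_Iic fun y hy => ?_
      have hy' : y ≤ x₀ := hy
      -- By `A² = 2iμ A`, the operator `A (1 + growth A)` equals `exp (2iμ s) A`, which is the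
      -- differentiated kernel.
      simp only [if_pos hy', map_add, map_smul, hA, smul_smul]
      rw [mul_comm (growth _ _), two_mul_growth μ (sub_nonneg.2 hy'), sub_smul, one_smul]
      abel
    · have : ¬ y ≤ x₀ := by simpa using hy.2
      rw [if_neg this, zero_smul]
  rw [← hval]
  refine ((hasDerivAt_integral_Iic hf.1 hf.integrableOn x₀).add hint).congr_of_eventuallyEq ?_
  filter_upwards [hext] with x hx
  rw [hsplit, hx]
  rfl

/-- The weight dominating the Volterra kernel on `(-∞, X]`. -/
def volWeight (R : ℝ → E →L[ℂ] E) (C X : ℝ) (y : ℝ) : ℝ := C * (1 + |X|) * ((1 + |y|) * ‖R y‖)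

/-- `∫_{-∞}^x` of the weight. -/
def volMass (R : ℝ → E →L[ℂ] E) (C X : ℝ) (x : ℝ) : ℝ := ∫ y in Iic x, volWeight R C X y

/-! ### The weight of the Volterra kernel and its primitive. -/

section Mass

variable {R : ℝ → E →L[ℂ] E} (hR : WInt R) {C X : ℝ} (hC : 0 ≤ C)
include hR

theorem continuous_volWeight : Continuous (volWeight R C X) :=
  continuous_const.mul ((continuous_const.add continuous_abs).mul hR.1.norm)

theorem integrableOn_volWeight (c : ℝ) : IntegrableOn (volWeight R C X) (Iic c) :=
  (hR.2 c).const_mul _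

theorem hasDerivAt_volMass (x : ℝ) :
    HasDerivAt (volMass R C X) (volWeight R C X x) x :=
  hasDerivAt_integral_Iic (continuous_volWeight hR) (integrableOn_volWeight hR) x

theorem tendsto_volMass : Tendsto (volMass R C X) atBot (𝓝 0) :=
  tendsto_integral_Iic_atBot (integrableOn_volWeight hR)

omit hR in
include hC in
theorem volWeight_nonneg (y : ℝ) : 0 ≤ volWeight R C X y := by
  rw [volWeight]; positivity

include hC in
theorem volMass_mono : Monotone (volMass R C X) := fun _ y hxy =>
  setIntegral_mono_set (integrableOn_volWeight hR y)
    (Eventually.of_forall (volWeight_nonneg hC)) (Eventually.of_forall (Iic_subset_Iic.2 hxy))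

omit hR in
include hC in
theorem volMass_nonneg (x : ℝ) : 0 ≤ volMass R C X x :=
  setIntegral_nonneg measurableSet_Iic fun y _ => volWeight_nonneg hC y

include hC in
theorem integrableOn_volWeight_mul_exp (x : ℝ) :
    IntegrableOn (fun y => volWeight R C X y * Real.exp (2 * volMass R C X y)) (Iic x) := by
  have hcm : Continuous (volMass R C X) :=
    continuous_iff_continuousAt.2 fun y => (hasDerivAt_volMass hR y).continuousAt
  refine ((integrableOn_volWeight hR (C := C) (X := X) x).mul_const
    (Real.exp (2 * volMass R C X x))).mono'
    ((continuous_volWeight hR).mul (by fun_prop)).aestronglyMeasurable ?_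
  filter_upwards [ae_restrict_mem measurableSet_Iic] with y hy
  rw [Real.norm_of_nonneg (mul_nonneg (volWeight_nonneg hC y) (Real.exp_pos _).le)]
  refine mul_le_mul_of_nonneg_left ?_ (volWeight_nonneg hC y)
  exact Real.exp_le_exp.2 (by linarith [volMass_mono hR hC (X := X) hy])

include hC in
-- The integrand is the derivative of `exp (2 volMass) / 2`. The factor `2` in the exponent is what
-- produces the contraction constant `1/2` of the Neumann series.
theorem integral_volWeight_mul_exp (x : ℝ) :
    ∫ y in Iic x, volWeight R C X y * Real.exp (2 * volMass R C X y)
      = (Real.exp (2 * volMass R C X x) - 1) / 2 := by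
  have hd : ∀ y, HasDerivAt (fun y => Real.exp (2 * volMass R C X y) / 2)
      (volWeight R C X y * Real.exp (2 * volMass R C X y)) y := fun y => by
    have := (((hasDerivAt_volMass hR (C := C) (X := X) y).const_mul 2).exp).div_const 2
    refine this.congr_deriv ?_
    ring
  have hlim : Tendsto (fun y => Real.exp (2 * volMass R C X y) / 2) atBot (𝓝 (1 / 2)) := by
    have := ((Real.continuous_exp.tendsto _).comp
      ((tendsto_volMass hR (C := C) (X := X)).const_mul 2)).div_const 2
    simpa using this
  rw [integral_Iic_of_hasDerivAt_of_tendsto (hd x).continuousAt.continuousWithinAt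
    (fun y _ => hd y) (integrableOn_volWeight_mul_exp hR hC x) hlim]
  ring

end Mass

/-- Terms of the Neumann series of `w = e + duhamel (R w)`. -/
def volTerm (μ : ℂ) (A : E →L[ℂ] E) (R : ℝ → E →L[ℂ] E) (e : E) : ℕ → ℝ → E
  | 0 => fun _ => e
  | n + 1 => duhamel μ A fun y => R y (volTerm μ A R e n y)

/-- The solution of `w' = (A + R) w` with `w → e` at `-∞`, for `A² = 2 i μ A` and `A e = 0`. -/
def vol (μ : ℂ) (A : E →L[ℂ] E) (R : ℝ → E →L[ℂ] E) (e : E) (x : ℝ) : E :=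
  ∑' n, volTerm μ A R e n x

theorem WInt.apply {R : ℝ → E →L[ℂ] E} (hR : WInt R) {w : ℝ → E} (hw : Continuous w)
    (hb : ∀ X, ∃ B, ∀ x ≤ X, ‖w x‖ ≤ B) : WInt fun y => R y (w y) := by
  have hc : Continuous fun y => R y (w y) := hR.1.clm_apply hw
  refine ⟨hc, fun c => ?_⟩
  obtain ⟨B, hB⟩ := hb c
  refine ((hR.2 c).mul_const B).mono'
    ((continuous_const.add continuous_abs).mul hc.norm).aestronglyMeasurable ?_
  filter_upwards [ae_restrict_mem measurableSet_Iic] with y hy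
  rw [Real.norm_of_nonneg (by positivity), mul_assoc]
  refine mul_le_mul_of_nonneg_left ?_ (by positivity)
  exact ((R y).le_opNorm _).trans (mul_le_mul_of_nonneg_left (hB y hy) (norm_nonneg _))

/-! ### The Volterra solution at a fixed spectral parameter. -/

section Single

variable {μ : ℂ} {A : E →L[ℂ] E} {R : ℝ → E →L[ℂ] E} {e : E}

/-- In the norm weighted by `exp (2 volMass)` the Volterra operator is a contraction by `1/2`,
however large the potential. Keeping the `-1` makes the estimate vanish at `-∞`, which later gives
the boundary value. -/
theorem volTerm_bound_aux (hR : WInt R) {C X B : ℝ}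
    (hC : ∀ s, 0 ≤ s → 1 + ‖growth μ s‖ * ‖A‖ ≤ C * (1 + s)) {w : ℝ → E}
    (hw : ∀ y ≤ X, ‖w y‖ ≤ B * Real.exp (2 * volMass R C X y)) {x : ℝ} (hx : x ≤ X) :
    ‖duhamel μ A (fun y => R y (w y)) x‖ ≤ B / 2 * (Real.exp (2 * volMass R C X x) - 1) := by
  have hC0 : 0 ≤ C := by
    have h1 := hC 0 le_rfl
    have h2 : (0 : ℝ) ≤ 1 + ‖growth μ 0‖ * ‖A‖ := by positivity
    linarith
  have hi := (integrableOn_volWeight_mul_exp hR hC0 (X := X) x).const_mul B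
  refine (norm_integral_le_of_norm_le hi ?_).trans_eq ?_
  · filter_upwards [ae_restrict_mem measurableSet_Iic] with y hy
    refine (norm_duhamel_integrand_le hC hx hy _).trans ?_
    have h1 : ‖R y (w y)‖ ≤ ‖R y‖ * (B * Real.exp (2 * volMass R C X y)) :=
      ((R y).le_opNorm _).trans
        (mul_le_mul_of_nonneg_left (hw y (le_trans hy hx)) (norm_nonneg _))
    calc C * (1 + |X|) * ((1 + |y|) * ‖R y (w y)‖)
        ≤ C * (1 + |X|) * ((1 + |y|) * (‖R y‖ * (B * Real.exp (2 * volMass R C X y)))) := by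
          gcongr
      _ = _ := by rw [volWeight]; ring
  · rw [integral_const_mul, integral_volWeight_mul_exp hR hC0]
    ring

theorem norm_volTerm_succ_le (hR : WInt R) {C X B : ℝ}
    (hC : ∀ s, 0 ≤ s → 1 + ‖growth μ s‖ * ‖A‖ ≤ C * (1 + s)) (he : ‖e‖ ≤ B) (n : ℕ) :
    ∀ x ≤ X, ‖volTerm μ A R e (n + 1) x‖
      ≤ B * (1 / 2) ^ (n + 1) * (Real.exp (2 * volMass R C X x) - 1) := by
  have hC0 : 0 ≤ C := by
    have h1 := hC 0 le_rfl
    have h2 : (0 : ℝ) ≤ 1 + ‖growth μ 0‖ * ‖A‖ := by positivity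
    linarith
  have hB : 0 ≤ B := (norm_nonneg _).trans he
  induction n with
  | zero =>
    intro x hx
    refine (volTerm_bound_aux hR hC (B := B) (fun y _ => ?_) hx).trans_eq (by ring)
    refine he.trans (le_mul_of_one_le_right hB ?_)
    exact Real.one_le_exp (by linarith [volMass_nonneg (R := R) hC0 (X := X) y])
  | succ n ih =>
    intro x hx
    refine (volTerm_bound_aux hR hC (B := B * (1 / 2) ^ (n + 1)) (fun y hy => ?_) hx).trans_eq
      (by ring)
    refine (ih y hy).trans ?_
    gcongr
    linarith

theorem norm_volTerm_le (hR : WInt R) {C X B : ℝ}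
    (hC : ∀ s, 0 ≤ s → 1 + ‖growth μ s‖ * ‖A‖ ≤ C * (1 + s)) (he : ‖e‖ ≤ B) (n : ℕ)
    {x : ℝ} (hx : x ≤ X) :
    ‖volTerm μ A R e n x‖ ≤ B * Real.exp (2 * volMass R C X X) * (1 / 2) ^ n := by
  have hC0 : 0 ≤ C := by
    have h1 := hC 0 le_rfl
    have h2 : (0 : ℝ) ≤ 1 + ‖growth μ 0‖ * ‖A‖ := by positivity
    linarith
  have hB : 0 ≤ B := (norm_nonneg _).trans he
  have h1 : Real.exp (2 * volMass R C X x) ≤ Real.exp (2 * volMass R C X X) :=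
    Real.exp_le_exp.2 (by linarith [volMass_mono hR hC0 (X := X) hx])
  cases n with
  | zero =>
    rw [pow_zero, mul_one]
    refine he.trans (le_mul_of_one_le_right hB ?_)
    exact Real.one_le_exp (by linarith [volMass_nonneg (R := R) hC0 (X := X) X])
  | succ n =>
    refine (norm_volTerm_succ_le hR hC he n x hx).trans ?_
    rw [mul_right_comm]
    gcongr
    linarith

variable (hμ : 0 ≤ μ.im)
include hμ

theorem exists_bound_volTerm (hR : WInt R) (n : ℕ) (X : ℝ) :
    ∃ B, ∀ x ≤ X, ‖volTerm μ A R e n x‖ ≤ B :=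
  ⟨_, fun _ hx => norm_volTerm_le hR (duhamel_bound hμ A) le_rfl n hx⟩

variable [CompleteSpace E] (hA : ∀ v, A (A v) = (2 * Complex.I * μ) • A v) (hR : WInt R)
include hA hR

theorem continuous_volTerm (n : ℕ) : Continuous (volTerm μ A R e n) := by
  induction n with
  | zero => exact continuous_const
  | succ n ih =>
    exact continuous_iff_continuousAt.2 fun x => (hasDerivAt_duhamel hμ hA
      (hR.apply ih (exists_bound_volTerm hμ hR n)) x).continuousAt

theorem hasDerivAt_volTerm_succ (n : ℕ) (x : ℝ) :
    HasDerivAt (volTerm μ A R e (n + 1))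
      (R x (volTerm μ A R e n x) + A (volTerm μ A R e (n + 1) x)) x :=
  hasDerivAt_duhamel hμ hA (hR.apply (continuous_volTerm hμ hA hR n)
    (exists_bound_volTerm hμ hR n)) x

omit hA in
theorem hasSum_vol (x : ℝ) : HasSum (fun n => volTerm μ A R e n x) (vol μ A R e x) :=
  (Summable.of_norm_bounded ((summable_geometric_of_lt_one (by norm_num)
    (by norm_num : (1 / 2 : ℝ) < 1)).mul_left _)
    fun n => norm_volTerm_le hR (duhamel_bound hμ A) le_rfl n le_rfl).hasSum

omit hA in
theorem norm_vol_le {C X B : ℝ} (hC : ∀ s, 0 ≤ s → 1 + ‖growth μ s‖ * ‖A‖ ≤ C * (1 + s))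
    (he : ‖e‖ ≤ B) {x : ℝ} (hx : x ≤ X) :
    ‖vol μ A R e x‖ ≤ B * Real.exp (2 * volMass R C X X) * 2 := by
  rw [← (hasSum_vol hμ hR x).tsum_eq]
  refine tsum_of_norm_bounded ?_ fun n => norm_volTerm_le hR hC he n hx
  exact hasSum_geometric_two.mul_left _

/-- Termwise differentiation: each later term solves the equation for `A` with source `R` applied to
its predecessor, and the constant zeroth term fits in because `A e = 0`. -/
theorem hasDerivAt_vol (he : A e = 0) (x : ℝ) :
    HasDerivAt (vol μ A R e) (A (vol μ A R e x) + R x (vol μ A R e x)) x := by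
  set X := x + 1
  obtain ⟨D, hD⟩ := (isCompact_Icc (a := x - 1) (b := X)).exists_bound_of_continuousOn
    hR.1.continuousOn
  set B := ‖e‖ * Real.exp (2 * volMass R (1 + ‖A‖) X X)
  have hB : 0 ≤ B := by positivity
  have hbd : ∀ n, ∀ y ≤ X, ‖volTerm μ A R e n y‖ ≤ B * (1 / 2) ^ n := fun n y hy =>
    norm_volTerm_le hR (duhamel_bound hμ A) le_rfl n hy
  let g' : ℕ → ℝ → E := fun n y => match n with
    | 0 => 0
    | k + 1 => R y (volTerm μ A R e k y) + A (volTerm μ A R e (k + 1) y)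
  let u : ℕ → ℝ := fun n => match n with
    | 0 => 0
    | k + 1 => max D 0 * (B * (1 / 2) ^ k) + ‖A‖ * (B * (1 / 2) ^ (k + 1))
  have hgeo : Summable fun k : ℕ => (1 / 2 : ℝ) ^ k :=
    summable_geometric_of_lt_one (by norm_num) (by norm_num)
  have hu : Summable u := by
    refine (summable_nat_add_iff 1).1 (Summable.add ((hgeo.mul_left B).mul_left _) ?_)
    exact (((summable_nat_add_iff 1).2 hgeo).mul_left B).mul_left _
  have hxm : x ∈ Ioo (x - 1) X := ⟨by linarith, lt_add_one x⟩
  have hmain := hasDerivAt_tsum_of_isPreconnected (g := fun n y => volTerm μ A R e n y)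
    (g' := g') hu (isOpen_Ioo (a := x - 1) (b := X)) isPreconnected_Ioo
    (fun n y _ => ?_) (fun n y hy => ?_) hxm (hasSum_vol hμ hR x).summable hxm
  · refine hmain.congr_deriv ?_
    have h0 := hasSum_vol hμ hR (A := A) (e := e) x
    have h1 := (hasSum_nat_add_iff' (f := fun n => volTerm μ A R e n x) 1).2 h0
    have h2 := ((R x).hasSum h0).add (A.hasSum h1)
    have h3 := (hasSum_nat_add_iff (f := fun n => g' n x) 1).1 h2
    simp only [Finset.range_one, Finset.sum_singleton] at h3
    rw [h3.tsum_eq]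
    change R x (vol μ A R e x) + A (vol μ A R e x - e) + 0 = _
    rw [map_sub, he, sub_zero, add_zero, add_comm]
  · cases n with
    | zero => exact hasDerivAt_const _ _
    | succ k => exact hasDerivAt_volTerm_succ hμ hA hR k y
  · cases n with
    | zero => simp [g', u]
    | succ k =>
      refine (norm_add_le _ _).trans (add_le_add ?_ ?_)
      · exact ((R y).le_opNorm _).trans (mul_le_mul ((hD y ⟨hy.1.le, hy.2.le⟩).trans
          (le_max_left _ _)) (hbd k y hy.2.le) (norm_nonneg _) (le_max_right _ _))
      · exact (A.le_opNorm _).trans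
          (mul_le_mul_of_nonneg_left (hbd (k + 1) y hy.2.le) (norm_nonneg _))

omit hA in
theorem norm_vol_sub_le {C X B : ℝ} (hC : ∀ s, 0 ≤ s → 1 + ‖growth μ s‖ * ‖A‖ ≤ C * (1 + s))
    (he : ‖e‖ ≤ B) {x : ℝ} (hx : x ≤ X) :
    ‖vol μ A R e x - e‖ ≤ B * (Real.exp (2 * volMass R C X x) - 1) := by
  have h0 := hasSum_vol hμ hR (A := A) (e := e) x
  have h1 := (hasSum_nat_add_iff' (f := fun n => volTerm μ A R e n x) 1).2 h0
  simp only [Finset.range_one, Finset.sum_singleton] at h1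
  change HasSum _ (vol μ A R e x - e) at h1
  rw [← h1.tsum_eq]
  refine tsum_of_norm_bounded (g := fun n => B * (Real.exp (2 * volMass R C X x) - 1) *
    ((1 / 2) * (1 / 2) ^ n)) ?_ fun n => ?_
  · have := (hasSum_geometric_two.mul_left (1 / 2 : ℝ)).mul_left
      (B * (Real.exp (2 * volMass R C X x) - 1))
    simpa using this
  · exact (norm_volTerm_succ_le hR hC he n x hx).trans_eq (by ring)

omit hA in
theorem tendsto_vol : Tendsto (vol μ A R e) atBot (𝓝 e) := by
  rw [tendsto_iff_norm_sub_tendsto_zero]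
  have h1 : Tendsto (fun x => ‖e‖ * (Real.exp (2 * volMass R (1 + ‖A‖) 0 x) - 1)) atBot (𝓝 0) := by
    have := (((Real.continuous_exp.tendsto _).comp
      ((tendsto_volMass hR (C := 1 + ‖A‖) (X := 0)).const_mul 2)).sub_const 1).const_mul ‖e‖
    simpa using this
  refine squeeze_zero' (Eventually.of_forall fun x => norm_nonneg _) ?_ h1
  filter_upwards [Iic_mem_atBot 0] with x hx
  exact norm_vol_sub_le hμ hR (duhamel_bound hμ A) le_rfl hx

/-- A solution of `d' = (A + R) d` vanishing at `-∞` is zero, for `A² = 2 i μ A`, `μ ≠ 0`. -/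
theorem eq_zero_of_tendsto_atBot (hμ0 : μ ≠ 0) {d : ℝ → E}
    (hd : ∀ x, HasDerivAt d (A (d x) + R x (d x)) x) (hlim : Tendsto d atBot (𝓝 0)) :
    ∀ x, d x = 0 := by
  have hdc : Continuous d := continuous_iff_continuousAt.2 fun x => (hd x).continuousAt
  have hdb : ∀ X, ∃ B, ∀ x ≤ X, ‖d x‖ ≤ B := by
    intro X
    obtain ⟨a, ha⟩ := (eventually_atBot.1 (hlim.norm.eventually
      (gt_mem_nhds (by simp : ‖(0 : E)‖ < 1))))
    obtain ⟨B, hB⟩ := (isCompact_Icc (a := a) (b := X)).exists_bound_of_continuousOn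
      hdc.continuousOn
    refine ⟨max B 1, fun x hx => ?_⟩
    rcases le_total x a with h | h
    · exact (ha x h).le.trans (le_max_right _ _)
    · exact (hB x ⟨h, hx⟩).trans (le_max_left _ _)
  have hRd := hR.apply hdc hdb
  have hexp : Tendsto (fun x => Real.exp (2 * volMass R (1 + ‖A‖) 0 x) - 1) atBot (𝓝 0) := by
    have := ((Real.continuous_exp.tendsto _).comp
      ((tendsto_volMass hR (C := 1 + ‖A‖) (X := 0)).const_mul 2)).sub_const 1
    simpa using this
  have hC0 : 0 ≤ 1 + ‖A‖ := by positivity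
  have hone : ∀ y, 1 ≤ Real.exp (2 * volMass R (1 + ‖A‖) 0 y) := fun y =>
    Real.one_le_exp (by linarith [volMass_nonneg (R := R) hC0 (X := 0) y])
  obtain ⟨D, hD⟩ := hdb 0
  have hD0 : 0 ≤ D := (norm_nonneg _).trans (hD 0 le_rfl)
  -- the difference with the Duhamel integral solves the constant coefficient equation
  have heq : ∀ x, d x = duhamel μ A (fun y => R y (d y)) x := by
    set h : ℝ → E := fun x => d x - duhamel μ A (fun y => R y (d y)) x with hh
    have hder : ∀ x, HasDerivAt h (A (h x)) x := fun x => by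
      refine ((hd x).sub (hasDerivAt_duhamel hμ hA hRd x)).congr_deriv ?_
      rw [hh]; simp only [map_sub]; abel
    have hT : Tendsto (duhamel μ A fun y => R y (d y)) atBot (𝓝 0) := by
      have h1 := hexp.const_mul (D / 2)
      rw [mul_zero] at h1
      refine squeeze_zero_norm' ?_ h1
      filter_upwards [Iic_mem_atBot 0] with x hx
      refine volTerm_bound_aux hR (duhamel_bound hμ A) (fun y hy => ?_) hx
      exact (hD y hy).trans (le_mul_of_one_le_right hD0 (hone y))
    have hh0 : Tendsto h atBot (𝓝 0) := by simpa using hlim.sub hT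
    intro x
    have hprop : ∀ y < x, h x = h y + growth μ (x - y) • A (h y) := by
      intro y hy
      -- This is `exp ((x - s) A) h(s)`, which is constant in `s` because `h' = A h`; it is compared
      -- at `s = y` and `s = x`.
      set G : ℝ → E := fun s => h s + growth μ (x - s) • A (h s)
      have hG : ∀ s ∈ Ico y x, HasDerivWithinAt G 0 (Ici s) s := by
        intro s hs
        have h1 : HasDerivAt (fun s => growth μ (x - s))
            (-Complex.exp (2 * Complex.I * μ * ((x - s : ℝ) : ℂ))) s :=
          (hasDerivAt_growth_pos μ (sub_pos.2 hs.2)).comp_const_sub x s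
        have h2 : HasDerivAt (fun s => A (h s)) (A (A (h s))) s :=
          ((A.restrictScalars ℝ).hasFDerivAt.comp_hasDerivAt s (hder s))
        have h3 := (hder s).add (h1.smul h2)
        refine (h3.congr_deriv ?_).hasDerivWithinAt
        rw [hA, smul_smul, mul_comm, two_mul_growth μ (sub_nonneg.2 hs.2.le), sub_smul, neg_smul,
          one_smul]
        abel
      have hGc : ContinuousOn G (Icc y x) := by
        have hhc : Continuous h := continuous_iff_continuousAt.2 fun x => (hder x).continuousAt
        exact (continuous_duhamel_integrand hμ A hhc x).continuousOn
      have := constant_of_has_deriv_right_zero hGc hG x (right_mem_Icc.2 hy.le)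
      simp only [G, sub_self, growth_of_nonpos μ le_rfl, zero_smul, add_zero] at this
      exact this
    -- Here `μ ≠ 0` enters: the flow is bounded uniformly in `y`, so `y` can be sent to `-∞`, where
    -- `h` vanishes.
    have hle : ∀ y < x, ‖h x‖ ≤ (1 + ‖μ‖⁻¹ * ‖A‖) * ‖h y‖ := by
      intro y hy
      rw [hprop y hy]
      refine (norm_add_le _ _).trans ?_
      rw [norm_smul, add_mul, one_mul, mul_assoc]
      gcongr
      · have := norm_growth_le_div hμ (sub_nonneg.2 hy.le)
        rwa [← le_div_iff₀ (norm_pos_iff.2 hμ0), one_div] at this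
      · exact A.le_opNorm _
    have : ‖h x‖ ≤ 0 := by
      have h1 := hh0.norm.const_mul (1 + ‖μ‖⁻¹ * ‖A‖)
      rw [norm_zero, mul_zero] at h1
      refine ge_of_tendsto h1 ?_
      filter_upwards [Iio_mem_atBot x] with y hy using hle y hy
    exact sub_eq_zero.1 (norm_le_zero_iff.1 this)
  -- Iterating the contraction on `d = duhamel (R d)` forces `d` to vanish on the half-line;
  -- uniqueness for the differential equation extends this to all `x`.
  have hzero : ∀ n : ℕ, ∀ x ≤ 0, ‖d x‖ ≤ D * (1 / 2) ^ n *
      Real.exp (2 * volMass R (1 + ‖A‖) 0 x) := by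
    intro n
    induction n with
    | zero =>
      intro x hx
      rw [pow_zero, mul_one]
      exact (hD x hx).trans (le_mul_of_one_le_right hD0 (hone x))
    | succ n ih =>
      intro x hx
      rw [heq x]
      refine (volTerm_bound_aux hR (duhamel_bound hμ A) ih hx).trans ?_
      rw [pow_succ, ← mul_assoc, mul_one_div]
      refine mul_le_mul_of_nonneg_left (by linarith) (by positivity)
  have h0 : d 0 = 0 := by
    have h1 : Tendsto (fun n : ℕ => D * (1 / 2 : ℝ) ^ n *
        Real.exp (2 * volMass R (1 + ‖A‖) 0 0)) atTop (𝓝 0) := by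
      have := ((tendsto_pow_atTop_nhds_zero_of_lt_one (r := (1 / 2 : ℝ)) (by norm_num)
        (by norm_num)).const_mul D).mul_const (Real.exp (2 * volMass R (1 + ‖A‖) 0 0))
      simpa using this
    exact norm_le_zero_iff.1 (ge_of_tendsto' h1 fun n => hzero n 0 le_rfl)
  have hode : ∀ x ∈ (univ : Set ℝ), HasDerivAt d
      (((A + R x).restrictScalars ℝ : E →L[ℝ] E) (d x)) x := fun x _ => by
    simpa using hd x
  intro x
  refine linear_ode_eq_zero ordConnected_univ (Continuous.continuousOn ?_) hode (mem_univ 0) h0 x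
    (mem_univ x)
  exact (ContinuousLinearMap.continuous_restrictScalars (𝕜' := ℝ)).comp
    (continuous_const.add hR.1)

end Single

end Volterra

/-! ### Dependence of Volterra solutions on the spectral parameter -/

section VolterraParameter

variable {E : Type*} [NormedAddCommGroup E] [NormedSpace ℂ E] [NormedSpace ℝ E]
  [IsScalarTower ℝ ℂ E]
variable {μ : ℂ → ℂ} {A : ℂ → E →L[ℂ] E} {R : ℝ → E →L[ℂ] E} {e : ℂ → E} {Z : Set ℂ}

theorem exists_local_bound {F : Type*} [NormedAddCommGroup F] {f : ℂ → F}
    (hf : ContinuousOn f Z) {z₀ : ℂ} (hz₀ : z₀ ∈ Z) :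
    ∃ V, IsOpen V ∧ z₀ ∈ V ∧ ∀ z ∈ V ∩ Z, ‖f z‖ ≤ ‖f z₀‖ + 1 := by
  have h := (hf z₀ hz₀).norm.eventually (gt_mem_nhds (lt_add_one ‖f z₀‖))
  obtain ⟨V, hV, hzV, hsub⟩ := mem_nhdsWithin.1 h
  exact ⟨V, hV, hzV, fun z hz => (hsub hz).le⟩

theorem duhamel_bound_of_le {ν : ℂ} (hν : 0 ≤ ν.im) {B : E →L[ℂ] E} {a : ℝ} (hB : ‖B‖ ≤ a)
    (s : ℝ) (hs : 0 ≤ s) : 1 + ‖growth ν s‖ * ‖B‖ ≤ (1 + a) * (1 + s) :=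
  (duhamel_bound hν B s hs).trans (by gcongr)

/-- The constants depend on `z` only through local bounds for `A` and `e`, so the Neumann series
converges locally uniformly in `z` and passes on continuity and holomorphy. -/
theorem exists_local_bound_volTerm (hμ : ∀ z ∈ Z, 0 ≤ (μ z).im) (hAc : ContinuousOn A Z)
    (hec : ContinuousOn e Z) (hR : WInt R) {z₀ : ℂ} (hz₀ : z₀ ∈ Z) (X : ℝ) :
    ∃ V C B, IsOpen V ∧ z₀ ∈ V ∧ 0 ≤ C ∧ 0 ≤ B ∧ ∀ z ∈ V ∩ Z,
      (∀ s, 0 ≤ s → 1 + ‖growth (μ z) s‖ * ‖A z‖ ≤ C * (1 + s)) ∧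
      ∀ n, ∀ x ≤ X, ‖volTerm (μ z) (A z) R (e z) n x‖ ≤ B * (1 / 2) ^ n := by
  obtain ⟨V₁, hV₁, hz₁, h₁⟩ := exists_local_bound hAc hz₀
  obtain ⟨V₂, hV₂, hz₂, h₂⟩ := exists_local_bound hec hz₀
  refine ⟨V₁ ∩ V₂, 1 + (‖A z₀‖ + 1), (‖e z₀‖ + 1) *
    Real.exp (2 * volMass R (1 + (‖A z₀‖ + 1)) X X), hV₁.inter hV₂, ⟨hz₁, hz₂⟩, by positivity,
    by positivity, fun z hz => ?_⟩
  have hC := duhamel_bound_of_le (hμ z hz.2) (h₁ z ⟨hz.1.1, hz.2⟩)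
  exact ⟨hC, fun n x hx => norm_volTerm_le hR hC (h₂ z ⟨hz.1.2, hz.2⟩) n hx⟩

theorem norm_duhamel_integrand_comp_le {ν : ℂ} {B : E →L[ℂ] E} {C D : ℝ}
    (hC : ∀ s, 0 ≤ s → 1 + ‖growth ν s‖ * ‖B‖ ≤ C * (1 + s)) (hC0 : 0 ≤ C) {x y : ℝ} (hy : y ≤ x)
    {v : E} (hv : ‖v‖ ≤ D) :
    ‖R y v + growth ν (x - y) • B (R y v)‖ ≤ volWeight R C x y * D := by
  refine (norm_duhamel_integrand_le hC le_rfl hy _).trans ?_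
  have h1 : ‖R y v‖ ≤ ‖R y‖ * D :=
    ((R y).le_opNorm _).trans (mul_le_mul_of_nonneg_left hv (norm_nonneg _))
  calc C * (1 + |x|) * ((1 + |y|) * ‖R y v‖)
      ≤ C * (1 + |x|) * ((1 + |y|) * (‖R y‖ * D)) := by gcongr
    _ = _ := by rw [volWeight]; ring

variable [CompleteSpace E] (hμ : ∀ z ∈ Z, 0 ≤ (μ z).im)
  (hA : ∀ z ∈ Z, ∀ v, A z (A z v) = (2 * Complex.I * μ z) • A z v) (hR : WInt R)
  (hAc : ContinuousOn A Z) (hec : ContinuousOn e Z)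
include hμ hA hR hAc hec

theorem continuousOn_volTerm (hμc : ContinuousOn μ Z) (n : ℕ) (x : ℝ) :
    ContinuousOn (fun z => volTerm (μ z) (A z) R (e z) n x) Z := by
  induction n generalizing x with
  | zero => exact hec
  | succ n ih =>
    intro z₀ hz₀
    obtain ⟨V, C, B, hV, hzV, hC0, hB0, hVb⟩ := exists_local_bound_volTerm hμ hAc hec hR hz₀ x
    have hmem : V ∩ Z ∈ 𝓝[Z] z₀ :=
      inter_mem (mem_nhdsWithin_of_mem_nhds (hV.mem_nhds hzV)) self_mem_nhdsWithin
    refine continuousWithinAt_of_dominated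
      (bound := fun y => volWeight R C x y * (B * (1 / 2) ^ n)) ?_ ?_ ?_ ?_
    · filter_upwards [hmem] with z hz
      exact (continuous_duhamel_integrand (hμ z hz.2) (A z) (hR.1.clm_apply
        (continuous_volTerm (hμ z hz.2) (hA z hz.2) hR n)) x).aestronglyMeasurable
    · filter_upwards [hmem] with z hz
      filter_upwards [ae_restrict_mem measurableSet_Iic] with y hy
      exact norm_duhamel_integrand_comp_le (hVb z hz).1 hC0 hy ((hVb z hz).2 n y hy)
    · exact (integrableOn_volWeight hR x).mul_const _
    · refine Eventually.of_forall fun y => ?_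
      have h1 : ContinuousWithinAt (fun z => R y (volTerm (μ z) (A z) R (e z) n y)) Z z₀ :=
        (R y).continuous.continuousAt.comp_continuousWithinAt (ih y z₀ hz₀)
      exact h1.add (((continuous_growth_left (x - y)).continuousAt.comp_continuousWithinAt
        (hμc z₀ hz₀)).smul ((hAc z₀ hz₀).clm_apply h1))

theorem continuousOn_vol (hμc : ContinuousOn μ Z) (x : ℝ) :
    ContinuousOn (fun z => vol (μ z) (A z) R (e z) x) Z := by
  intro z₀ hz₀
  obtain ⟨V, C, B, hV, hzV, hC0, hB0, hVb⟩ := exists_local_bound_volTerm hμ hAc hec hR hz₀ x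
  have h : ContinuousOn (fun z => vol (μ z) (A z) R (e z) x) (V ∩ Z) :=
    continuousOn_tsum (fun n => (continuousOn_volTerm hμ hA hR hAc hec hμc n x).mono
      inter_subset_right) (summable_geometric_two.mul_left B)
      fun n z hz => (hVb z hz).2 n x le_rfl
  refine (h z₀ ⟨hzV, hz₀⟩).mono_of_mem_nhdsWithin ?_
  exact inter_mem (mem_nhdsWithin_of_mem_nhds (hV.mem_nhds hzV)) self_mem_nhdsWithin

variable {U : Set ℂ} (hU : IsOpen U) (hUZ : U ⊆ Z) (hμ0 : ∀ z ∈ U, μ z ≠ 0)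
  (hμd : DifferentiableOn ℂ μ U) (hAd : DifferentiableOn ℂ A U) (hed : DifferentiableOn ℂ e U)
include hU hUZ hμ0 hμd hAd hed

theorem differentiableOn_volTerm (n : ℕ) (x : ℝ) :
    DifferentiableOn ℂ (fun z => volTerm (μ z) (A z) R (e z) n x) U := by
  induction n generalizing x with
  | zero => exact hed
  | succ n ih =>
    intro z₀ hz₀
    obtain ⟨V, C, B, hV, hzV, hC0, hB0, hVb⟩ :=
      exists_local_bound_volTerm hμ hAc hec hR (hUZ hz₀) x
    have hsub : V ∩ U ⊆ V ∩ Z := inter_subset_inter_right _ hUZ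
    have h := differentiableOn_integral (ν := volume.restrict (Iic x)) (hV.inter hU)
      (f := fun z y => R y (volTerm (μ z) (A z) R (e z) n y) +
        growth (μ z) (x - y) • A z (R y (volTerm (μ z) (A z) R (e z) n y)))
      (b := fun y => volWeight R C x y * (B * (1 / 2) ^ n))
      ((integrableOn_volWeight hR x).mul_const _) (fun z hz => ?_) ?_ ?_
    · exact ((h z₀ ⟨hzV, hz₀⟩).differentiableAt
        ((hV.inter hU).mem_nhds ⟨hzV, hz₀⟩)).differentiableWithinAt
    · have hz' := (hsub hz).2
      exact (continuous_duhamel_integrand (hμ z hz') (A z) (hR.1.clm_apply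
        (continuous_volTerm (hμ z hz') (hA z hz') hR n)) x).aestronglyMeasurable
    · filter_upwards [ae_restrict_mem measurableSet_Iic] with y hy
      have h1 : DifferentiableOn ℂ (fun z => R y (volTerm (μ z) (A z) R (e z) n y)) (V ∩ U) :=
        (R y).differentiable.comp_differentiableOn ((ih y).mono inter_subset_right)
      -- Holomorphy is read off the closed form of `growth`, valid because `μ ≠ 0` on `U` and `x - y
      -- ≥ 0`.
      have hg : DifferentiableOn ℂ (fun z => growth (μ z) (x - y)) (V ∩ U) := by
        have hm : DifferentiableOn ℂ μ (V ∩ U) := hμd.mono inter_subset_right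
        have : DifferentiableOn ℂ (fun z => (Complex.exp (2 * Complex.I * μ z *
            ((x - y : ℝ) : ℂ)) - 1) / (2 * Complex.I * μ z)) (V ∩ U) := by
          refine DifferentiableOn.div (by fun_prop) (by fun_prop) fun z hz => ?_
          simp [hμ0 z hz.2]
        exact this.congr fun z hz => growth_eq_of_ne_zero (hμ0 z hz.2) (sub_nonneg.2 hy)
      exact h1.add (hg.smul ((hAd.mono inter_subset_right).clm_apply h1))
    · filter_upwards [ae_restrict_mem measurableSet_Iic] with y hy z hz
      exact norm_duhamel_integrand_comp_le (hVb z (hsub hz)).1 hC0 hy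
        ((hVb z (hsub hz)).2 n y hy)

theorem differentiableOn_vol (x : ℝ) :
    DifferentiableOn ℂ (fun z => vol (μ z) (A z) R (e z) x) U := by
  intro z₀ hz₀
  obtain ⟨V, C, B, hV, hzV, hC0, hB0, hVb⟩ :=
    exists_local_bound_volTerm hμ hAc hec hR (hUZ hz₀) x
  have h : DifferentiableOn ℂ (fun z => vol (μ z) (A z) R (e z) x) (V ∩ U) :=
    Complex.differentiableOn_tsum_of_summable_norm (summable_geometric_two.mul_left B)
      (fun n => (differentiableOn_volTerm hμ hA hR hAc hec hU hUZ hμ0 hμd hAd hed n x).mono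
        inter_subset_right) (hV.inter hU)
      fun n z hz => (hVb z ⟨hz.1, hUZ hz.2⟩).2 n x le_rfl
  exact ((h z₀ ⟨hzV, hz₀⟩).differentiableAt
    ((hV.inter hU).mem_nhds ⟨hzV, hz₀⟩)).differentiableWithinAt

end VolterraParameter

/-! ### Gluing, Liouville and Lindelöf theorems -/

section ComplexAnalysis

variable {E : Type*} [NormedAddCommGroup E] [NormedSpace ℂ E]

/-- A continuous function on a disc, holomorphic off a horizontal line, is holomorphic. -/
theorem differentiableOn_ball_of_off_line [CompleteSpace E] {f : ℂ → E} {c : ℂ} {r a : ℝ}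
    (hf : ContinuousOn f (Metric.ball c r))
    (hd : ∀ z ∈ Metric.ball c r, z.im ≠ a → DifferentiableAt ℂ f z) :
    DifferentiableOn ℂ f (Metric.ball c r) := by
  refine (Complex.isConservativeOn_and_continuousOn_iff_isDifferentiableOn
    Metric.isOpen_ball).1 ⟨fun z w hzw => ?_, hf⟩
  rw [← add_eq_zero_iff_eq_neg, Complex.wedgeIntegral_add_wedgeIntegral_eq]
  have hrect : ∀ z w : ℂ, (uIcc z.re w.re) ×ℂ (uIcc z.im w.im) ⊆ Metric.ball c r →
      a ∉ Ioo (min z.im w.im) (max z.im w.im) →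
      (∫ x : ℝ in z.re..w.re, f (x + z.im * Complex.I)) -
        (∫ x : ℝ in z.re..w.re, f (x + w.im * Complex.I)) +
        Complex.I • (∫ y : ℝ in z.im..w.im, f (w.re + y * Complex.I)) -
        Complex.I • (∫ y : ℝ in z.im..w.im, f (z.re + y * Complex.I)) = 0 := by
    intro z w hzw ha
    refine Complex.integral_boundary_rect_eq_zero_of_continuousOn_of_differentiableOn f z w
      (hf.mono hzw) fun x hx => (hd x (hzw ?_) ?_).differentiableWithinAt
    · exact ⟨Ioo_subset_Icc_self hx.1, Ioo_subset_Icc_self hx.2⟩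
    · rintro rfl
      exact ha hx.2
  -- For Morera's theorem, a rectangle met by the line is cut along it; each half then meets the
  -- line only in its boundary, where continuity is enough for Cauchy's theorem.
  by_cases ha : a ∈ (uIcc z.im w.im)
  · have h1 := hrect z ⟨w.re, a⟩ (Subset.trans
      (inter_subset_inter_right _ (preimage_mono (uIcc_subset_uIcc_left ha))) hzw)
      (by rcases le_total z.im a with h | h <;> simp [h])
    have h2 := hrect ⟨z.re, a⟩ w (Subset.trans
      (inter_subset_inter_right _ (preimage_mono (uIcc_subset_uIcc_right ha))) hzw)
      (by rcases le_total a w.im with h | h <;> simp [h])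
    have hvert : ∀ u ∈ (uIcc z.re w.re), ∀ s t, s ∈ (uIcc z.im w.im) → t ∈ (uIcc z.im w.im) →
        IntervalIntegrable (fun y : ℝ => f (u + y * Complex.I)) MeasureTheory.volume s t := by
      intro u hu s t hs ht
      refine ContinuousOn.intervalIntegrable (hf.comp (by fun_prop) fun y hy => hzw ?_)
      refine ⟨by simpa using hu, ?_⟩
      simpa using uIcc_subset_uIcc hs ht hy
    have e1 := intervalIntegral.integral_add_adjacent_intervals
      (hvert w.re right_mem_uIcc z.im a left_mem_uIcc ha)
      (hvert w.re right_mem_uIcc a w.im ha right_mem_uIcc)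
    have e2 := intervalIntegral.integral_add_adjacent_intervals
      (hvert z.re left_mem_uIcc z.im a left_mem_uIcc ha)
      (hvert z.re left_mem_uIcc a w.im ha right_mem_uIcc)
    simp only at h1 h2
    rw [← e1, ← e2, smul_add, smul_add]
    have := congrArg₂ (· + ·) h1 h2
    simp only [add_zero] at this
    rw [← this]
    abel
  · exact hrect z w hzw fun h => ha (Ioo_subset_Icc_self h)

/-- A continuous function which is holomorphic off the curve `Im L = 0`, where `L` is a local
chart, is holomorphic. -/
theorem differentiableAt_of_chart [CompleteSpace E] {f : ℂ → E} {L : ℂ → ℂ} {z₀ L' : ℂ}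
    (hL : ContDiffAt ℂ 1 L z₀) (hL' : HasDerivAt L L' z₀) (hne : L' ≠ 0)
    (hc : ∀ᶠ z in 𝓝 z₀, ContinuousAt f z)
    (hd : ∀ᶠ z in 𝓝 z₀, (L z).im ≠ 0 → DifferentiableAt ℂ f z) : DifferentiableAt ℂ f z₀ := by
  have hL'' : HasFDerivAt L
      ((ContinuousLinearEquiv.unitsEquivAut ℂ (Units.mk0 L' hne) : ℂ ≃L[ℂ] ℂ) : ℂ →L[ℂ] ℂ) z₀ := by
    refine hL'.hasFDerivAt.congr_fderiv ?_
    ext; simp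
  have hst := hL.hasStrictFDerivAt' hL'' one_ne_zero
  set g := hL.localInverse hL'' one_ne_zero with hg
  have hgc : ContDiffAt ℂ 1 g (L z₀) := hL.to_localInverse hL'' one_ne_zero
  have hgz : g (L z₀) = z₀ := hL.localInverse_apply_image hL'' one_ne_zero
  have hright : ∀ᶠ w in 𝓝 (L z₀), L (g w) = w := hst.eventually_right_inverse
  have hleft : ∀ᶠ z in 𝓝 z₀, g (L z) = z := hst.eventually_left_inverse
  have hgt : Tendsto g (𝓝 (L z₀)) (𝓝 z₀) := by
    have := hgc.continuousAt.tendsto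
    rwa [hgz] at this
  have hgd : ∀ᶠ w in 𝓝 (L z₀), DifferentiableAt ℂ g w := by
    filter_upwards [hgc.eventually (by simp)] with w hw
    exact hw.differentiableAt one_ne_zero
  have hall := (hgt.eventually hc).and ((hgt.eventually hd).and (hright.and hgd))
  obtain ⟨r, hr, hball⟩ := Metric.eventually_nhds_iff_ball.1 hall
  -- In the coordinate `L` the exceptional curve becomes a piece of the real axis.
  have hfg : DifferentiableOn ℂ (f ∘ g) (Metric.ball (L z₀) r) := by
    refine differentiableOn_ball_of_off_line (a := 0) (fun w hw => ?_) fun w hw him => ?_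
    · obtain ⟨h1, -, -, h4⟩ := hball w hw
      exact (ContinuousAt.comp h1 h4.continuousAt).continuousWithinAt
    · obtain ⟨-, h2, h3, h4⟩ := hball w hw
      exact (h2 (by rwa [h3])).comp w h4
  have h1 : DifferentiableAt ℂ (f ∘ g) (L z₀) :=
    hfg.differentiableAt (Metric.ball_mem_nhds _ hr)
  have h2 : DifferentiableAt ℂ ((f ∘ g) ∘ L) z₀ := h1.comp z₀ hL'.differentiableAt
  refine h2.congr_of_eventuallyEq ?_
  filter_upwards [hleft] with z hz
  simp [hz]

/-- Puts a vanishing residue into the form required by the removable singularity theorem. -/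
theorem isLittleO_sub_inv {f : ℂ → E} {c : ℂ}
    (h : Tendsto (fun z => (z - c) • f z) (𝓝[≠] c) (𝓝 0)) :
    (fun z => f z - f c) =o[𝓝[≠] c] fun z => (z - c)⁻¹ := by
  have h0 : Tendsto (fun z : ℂ => (z - c) • f c) (𝓝[≠] c) (𝓝 0) := by
    have : ContinuousAt (fun z : ℂ => (z - c) • f c) c := by fun_prop
    have h2 := this.tendsto
    rw [sub_self, zero_smul] at h2
    exact h2.mono_left nhdsWithin_le_nhds
  have h1 := h.sub h0
  rw [sub_zero] at h1
  have h2 := (Asymptotics.isBigO_refl (fun z : ℂ => (z - c)⁻¹) (𝓝[≠] c)).smul_isLittleO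
    ((Asymptotics.isLittleO_one_iff ℂ).2 h1)
  refine (h2.congr' ?_ (Eventually.of_forall fun z => by simp))
  filter_upwards [self_mem_nhdsWithin] with z hz
  rw [← smul_sub, smul_smul, inv_mul_cancel₀ (sub_ne_zero.2 hz), one_smul]

/-- A holomorphic function with finitely many simple poles and a limit at infinity is the sum of
its principal parts and of this limit. -/
theorem eq_add_sum_of_simple_poles [CompleteSpace E] (S : Finset ℂ) {r : ℂ → E} {c : E} :
    ∀ {f : ℂ → E}, (∀ z ∉ S, DifferentiableAt ℂ f z) →
    (∀ p ∈ S, Tendsto (fun z => (z - p) • f z) (𝓝[≠] p) (𝓝 (r p))) →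
    Tendsto f (cocompact ℂ) (𝓝 c) → ∀ z ∉ S, f z = c + ∑ p ∈ S, (z - p)⁻¹ • r p := by
  classical
  induction S using Finset.induction_on with
  | empty =>
    intro f hd _ hinf z _
    have hdiff : Differentiable ℂ f := fun z => hd z (by simp)
    rw [hdiff.eq_const_of_tendsto_cocompact hinf]
    simp
  | insert p S hpS ih =>
    intro f hd hres hinf z hz
    set h : ℂ → E := fun z => f z - (z - p)⁻¹ • r p with hh
    -- Subtracting the principal part leaves a removable singularity at `p`; after filling in the
    -- limit there, one pole fewer remains for the induction.
    set g := Function.update h p (limUnder (𝓝[≠] p) h) with hgdef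
    have hSo : IsOpen ((S : Set ℂ)ᶜ) := S.finite_toSet.isClosed.isOpen_compl
    have hpmem : (S : Set ℂ)ᶜ ∈ 𝓝 p := hSo.mem_nhds (by simpa using hpS)
    have hhd : ∀ w ∉ insert p S, DifferentiableAt ℂ h w := by
      intro w hw
      have hwp : w - p ≠ 0 := sub_ne_zero.2 fun h => hw (h ▸ Finset.mem_insert_self _ _)
      have hinv : DifferentiableAt ℂ (fun z : ℂ => (z - p)⁻¹) w :=
        DifferentiableAt.inv (by fun_prop) hwp
      exact (hd w hw).sub (hinv.smul_const _)
    have hgd : DifferentiableOn ℂ g (S : Set ℂ)ᶜ := by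
      refine Complex.differentiableOn_update_limUnder_of_isLittleO hpmem (fun w hw => ?_) ?_
      · refine (hhd w fun hmem => ?_).differentiableWithinAt
        rcases Finset.mem_insert.1 hmem with h | h
        · exact hw.2 h
        · exact hw.1 h
      · refine isLittleO_sub_inv ?_
        have h1 := (hres p (Finset.mem_insert_self _ _)).sub_const (r p)
        rw [sub_self] at h1
        refine h1.congr' ?_
        filter_upwards [self_mem_nhdsWithin] with w hw
        rw [hh]
        simp only [smul_sub, smul_smul]
        rw [mul_inv_cancel₀ (sub_ne_zero.2 hw), one_smul]
    have hgS : ∀ w ∉ S, DifferentiableAt ℂ g w := fun w hw =>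
      (hgd w (by simpa using hw)).differentiableAt (hSo.mem_nhds (by simpa using hw))
    have hgh : ∀ w, w ≠ p → g w = h w := fun w hw => Function.update_of_ne hw _ _
    have hzp : z ≠ p := fun h => hz (h ▸ Finset.mem_insert_self _ _)
    have key := ih hgS (fun q hq => ?_) ?_ z fun h => hz (Finset.mem_insert_of_mem h)
    · rw [hgh z hzp, hh] at key
      rw [sub_eq_iff_eq_add] at key
      rw [key, Finset.sum_insert hpS]
      abel
    · have hqp : q ≠ p := fun h => hpS (h ▸ hq)
      have h1 : Tendsto (fun w => (w - q) • ((w - p)⁻¹ • r p)) (𝓝[≠] q) (𝓝 0) := by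
        have : ContinuousAt (fun w => (w - q) • ((w - p)⁻¹ • r p)) q := by
          refine ContinuousAt.smul (by fun_prop) (ContinuousAt.smul ?_ continuousAt_const)
          exact ContinuousAt.inv₀ (by fun_prop) (sub_ne_zero.2 hqp)
        have h2 := this.tendsto
        rw [sub_self, zero_smul] at h2
        exact h2.mono_left nhdsWithin_le_nhds
      have h2 := (hres q (Finset.mem_insert_of_mem hq)).sub h1
      rw [sub_zero] at h2
      refine h2.congr' ?_
      filter_upwards [mem_nhdsWithin_of_mem_nhds (isOpen_ne.mem_nhds hqp)] with w hw
      rw [hgh w hw, hh, smul_sub]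
    · have h1 : Tendsto (fun w : ℂ => (w - p)⁻¹ • r p) (cocompact ℂ) (𝓝 0) := by
        have h2 : Tendsto (fun w : ℂ => w - p) (cocompact ℂ) (cocompact ℂ) :=
          (Homeomorph.subRight p).isClosedEmbedding.tendsto_cocompact
        have h3 := (tendsto_inv₀_cobounded (α := ℂ)).comp
          (by rwa [← Metric.cobounded_eq_cocompact] at h2)
        simpa [Metric.cobounded_eq_cocompact] using h3.smul_const (r p)
      have h2 := hinf.sub h1
      rw [sub_zero] at h2
      refine h2.congr' ?_
      have : {p}ᶜ ∈ cocompact ℂ := isCompact_singleton.compl_mem_cocompact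
      filter_upwards [this] with w hw
      rw [hgh w hw]

/-- Lindelöf's theorem for a quotient `P / L` on the domain `0 < Im L` near a zero `p` of the
chart `L`: a boundary limit along `Im L = 0` is attained from the inside. -/
theorem tendsto_inv_smul_of_boundary {P : ℂ → E} {L : ℂ → ℂ} {p : ℂ} {δ : ℝ} (hδ : 0 < δ)
    (hLc : ContinuousOn L (Metric.closedBall p δ))
    (hLd : DifferentiableOn ℂ L (Metric.ball p δ))
    (hL0 : ∀ z ∈ Metric.closedBall p δ, L z = 0 ↔ z = p)
    (hPc : ContinuousOn P (Metric.closedBall p δ ∩ {z | 0 ≤ (L z).im}))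
    (hPd : DifferentiableOn ℂ P (Metric.ball p δ ∩ {z | 0 < (L z).im})) (hPp : P p = 0)
    (hlim : Tendsto (fun z => (L z)⁻¹ • P z) (𝓝[{z | (L z).im = 0} \ {p}] p) (𝓝 0)) :
    Tendsto (fun z => (L z)⁻¹ • P z) (𝓝[{z | 0 ≤ (L z).im} \ {p}] p) (𝓝 0) := by
  rw [Metric.tendsto_nhds]
  intro η' hη'
  -- One factor `2` is spent in the maximum principle, the other in removing the damping factor near
  -- `p`.
  obtain ⟨η, hη, hη4⟩ : ∃ η, 0 < η ∧ 4 * η < η' := ⟨η' / 5, by positivity, by linarith⟩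
  -- a smaller disc on whose boundary curve the quotient is small
  obtain ⟨δ', hδ'0, hδ'δ, hbd⟩ : ∃ δ', 0 < δ' ∧ δ' ≤ δ ∧ ∀ z ∈ Metric.closedBall p δ',
      (L z).im = 0 → z ≠ p → ‖(L z)⁻¹ • P z‖ ≤ η := by
    have h := Metric.tendsto_nhds.1 hlim η hη
    rw [eventually_nhdsWithin_iff] at h
    obtain ⟨ε, hε, hball⟩ := Metric.eventually_nhds_iff_ball.1 h
    refine ⟨min δ (ε / 2), by positivity, min_le_left _ _, fun z hz him hne => ?_⟩
    have := hball z (Metric.closedBall_subset_ball (by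
      exact lt_of_le_of_lt (min_le_right _ _) (by linarith)) hz) ⟨him, hne⟩
    rw [dist_zero_right] at this
    exact this.le
  have hcb : Metric.closedBall p δ' ⊆ Metric.closedBall p δ := Metric.closedBall_subset_closedBall hδ'δ
  have hLc' := hLc.mono hcb
  have hHc : IsClosed (Metric.closedBall p δ' ∩ {z | 0 ≤ (L z).im}) :=
    (Complex.continuous_im.comp_continuousOn hLc').preimage_isClosed_of_isClosed
      Metric.isClosed_closedBall isClosed_Ici
  set K := Metric.sphere p δ' ∩ {z | 0 ≤ (L z).im} with hK
  have hKsub : K ⊆ Metric.closedBall p δ' ∩ {z | 0 ≤ (L z).im} :=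
    inter_subset_inter_left _ Metric.sphere_subset_closedBall
  have hKcl : K = Metric.sphere p δ' ∩ (Metric.closedBall p δ' ∩ {z | 0 ≤ (L z).im}) := by
    rw [← inter_assoc, inter_eq_left.2 Metric.sphere_subset_closedBall]
  have hKcpt : IsCompact K := by
    rw [hKcl]; exact (isCompact_sphere p δ').inter_right hHc
  have hKne : ∀ z ∈ K, L z ≠ 0 := by
    intro z hz h0
    have hzp := (hL0 z (hcb (hKsub hz).1)).1 h0
    have : dist z p = δ' := hz.1
    rw [hzp, dist_self] at this
    exact hδ'0.ne this
  have hFc : ContinuousOn (fun z => ‖(L z)⁻¹ • P z‖) K :=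
    (((hLc'.mono fun z hz => (hKsub hz).1).inv₀ hKne).smul
      (hPc.mono fun z hz => ⟨hcb (hKsub hz).1, hz.2⟩)).norm
  obtain ⟨M, hM⟩ := hKcpt.exists_bound_of_continuousOn hFc
  -- On the arc `K` the quotient reaches `2η` only on a compact set where `Im L > 0`. The factor
  -- `exp (i N L)`, of modulus one on the boundary curve, therefore brings it below `2η` for large
  -- `N`.
  obtain ⟨N, hN⟩ : ∃ N : ℕ, ∀ z ∈ K, ‖(L z)⁻¹ • P z‖ * Real.exp (-(N * (L z).im)) ≤ 2 * η := by
    have hK'c : IsCompact (K ∩ (fun z => ‖(L z)⁻¹ • P z‖) ⁻¹' Ici (2 * η)) :=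
      hKcpt.of_isClosed_subset (hFc.preimage_isClosed_of_isClosed hKcpt.isClosed isClosed_Ici)
        inter_subset_left
    have hpos : ∀ z ∈ K ∩ (fun z => ‖(L z)⁻¹ • P z‖) ⁻¹' Ici (2 * η), 0 < (L z).im := by
      intro z hz
      refine lt_of_le_of_ne hz.1.2 fun h0 => ?_
      have hzp : z ≠ p := fun h => hKne z hz.1 ((hL0 z (hcb (hKsub hz.1).1)).2 h)
      have h1 := hbd z (hKsub hz.1).1 h0.symm hzp
      have h2 : 2 * η ≤ ‖(L z)⁻¹ • P z‖ := hz.2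
      linarith
    obtain ⟨c, hc, hcle⟩ := hK'c.exists_forall_le' (f := fun z => (L z).im)
      ((Complex.continuous_im.comp_continuousOn hLc').mono fun z hz => (hKsub hz.1).1) hpos
    have h0 : Tendsto (fun N : ℕ => |M| * Real.exp (-c) ^ N) atTop (𝓝 0) := by
      have := (tendsto_pow_atTop_nhds_zero_of_lt_one (Real.exp_pos (-c)).le
        (by rw [Real.exp_lt_one_iff]; linarith)).const_mul |M|
      rwa [mul_zero] at this
    obtain ⟨N, hN⟩ := (h0.eventually (gt_mem_nhds (by positivity : 0 < 2 * η))).exists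
    refine ⟨N, fun z hz => ?_⟩
    by_cases hz' : 2 * η ≤ ‖(L z)⁻¹ • P z‖
    · refine le_trans ?_ hN.le
      rw [← Real.exp_nat_mul]
      refine mul_le_mul ?_ ?_ (Real.exp_pos _).le (abs_nonneg _)
      · have := hM z hz
        rw [norm_norm] at this
        exact this.trans (le_abs_self M)
      · refine Real.exp_le_exp.2 ?_
        have := hcle z ⟨hz, hz'⟩
        have hNn : (0 : ℝ) ≤ N := Nat.cast_nonneg N
        nlinarith
    · push Not at hz'
      refine le_trans (mul_le_of_le_one_right (norm_nonneg _) ?_) hz'.le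
      rw [Real.exp_le_one_iff]
      have h1 : 0 ≤ (L z).im := hz.2
      have hNn : (0 : ℝ) ≤ N := Nat.cast_nonneg N
      nlinarith
  -- the maximum principle, for a regularised quotient
  set U := Metric.ball p δ' ∩ {z | 0 < (L z).im} with hU
  have hLdU : DifferentiableOn ℂ L (Metric.ball p δ') := hLd.mono (Metric.ball_subset_ball hδ'δ)
  have hclU : closure U ⊆ Metric.closedBall p δ' ∩ {z | 0 ≤ (L z).im} := by
    refine closure_minimal (fun z hz => ?_) hHc
    have : 0 < (L z).im := hz.2
    exact ⟨Metric.ball_subset_closedBall hz.1, this.le⟩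
  have hUo : IsOpen U :=
    (Complex.continuous_im.comp_continuousOn hLdU.continuousOn).isOpen_inter_preimage
      Metric.isOpen_ball isOpen_Ioi
  have hnormexp : ∀ z, ‖Complex.exp (Complex.I * N * L z)‖ = Real.exp (-(N * (L z).im)) := by
    intro z
    rw [Complex.norm_exp]
    congr 1
    simp
  -- Replacing `L` by `L + iε` moves its zero out of the closed domain without enlarging the
  -- quotient. Since `P` vanishes at `p`, the regularised quotient is continuous up to `p`, and the
  -- maximum principle applies before `ε → 0`.
  have hineq : ∀ z, 0 ≤ (L z).im → ∀ ε : ℝ, 0 < ε → ‖L z‖ ≤ ‖L z + Complex.I * ε‖ := by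
    intro z hz ε hε
    rw [← abs_norm, ← abs_norm (L z + _), ← sq_le_sq, Complex.sq_norm, Complex.sq_norm,
      Complex.normSq_apply, Complex.normSq_apply]
    simp only [Complex.add_re, Complex.mul_re, Complex.I_re, Complex.ofReal_re, zero_mul,
      Complex.I_im, Complex.ofReal_im, mul_zero, sub_zero, add_zero, Complex.add_im,
      Complex.mul_im, one_mul, zero_add]
    nlinarith
  have hmax : ∀ ε : ℝ, 0 < ε → ∀ z ∈ U,
      ‖(L z + Complex.I * ε)⁻¹ • Complex.exp (Complex.I * N * L z) • P z‖ ≤ 2 * η := by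
    intro ε hε z hz
    have hne : ∀ z, 0 ≤ (L z).im → L z + Complex.I * ε ≠ 0 := by
      intro z hz h0
      have := congrArg Complex.im h0
      simp at this
      linarith
    refine Complex.norm_le_of_forall_mem_frontier_norm_le
      (f := fun z => (L z + Complex.I * ε)⁻¹ • Complex.exp (Complex.I * N * L z) • P z) (U := U)
      (Metric.isBounded_ball.subset inter_subset_left) ⟨?_, ?_⟩ ?_ (subset_closure hz)
    · have hl : DifferentiableOn ℂ L U := hLdU.mono inter_subset_left
      have hp : DifferentiableOn ℂ P U :=
        hPd.mono (inter_subset_inter_left _ (Metric.ball_subset_ball hδ'δ))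
      refine DifferentiableOn.smul (DifferentiableOn.inv (by fun_prop) fun z hz => ?_)
        (DifferentiableOn.smul (by fun_prop) hp)
      have : 0 < (L z).im := hz.2
      exact hne z this.le
    · have hl : ContinuousOn L (closure U) := hLc'.mono fun z hz => (hclU hz).1
      have hp : ContinuousOn P (closure U) := hPc.mono fun z hz => ⟨hcb (hclU hz).1, (hclU hz).2⟩
      exact ContinuousOn.smul (ContinuousOn.inv₀ (by fun_prop) fun z hz => hne z (hclU hz).2)
        (ContinuousOn.smul (by fun_prop) hp)
    · intro z hz
      have hz' := hclU hz.1
      have him : 0 ≤ (L z).im := hz'.2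
      have hzU : z ∉ U := by
        have := hz.2
        rwa [hUo.interior_eq] at this
      by_cases hzp : z = p
      · rw [hzp, hPp, smul_zero, smul_zero, norm_zero]; positivity
      have hLz : L z ≠ 0 := fun h => hzp ((hL0 z (hcb hz'.1)).1 h)
      have hcmp : ‖(L z + Complex.I * ε)⁻¹ • Complex.exp (Complex.I * N * L z) • P z‖
          ≤ ‖(L z)⁻¹ • P z‖ * Real.exp (-(N * (L z).im)) := by
        rw [norm_smul, norm_smul, norm_smul, hnormexp, norm_inv, norm_inv, mul_assoc, mul_comm ‖P z‖]
        have h1 := hineq z him ε hε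
        have h2 : 0 < ‖L z‖ := norm_pos_iff.2 hLz
        gcongr
      refine hcmp.trans ?_
      by_cases hsph : z ∈ Metric.sphere p δ'
      · exact hN z ⟨hsph, him⟩
      · have hzb : z ∈ Metric.ball p δ' := lt_of_le_of_ne hz'.1 hsph
        have him0 : (L z).im = 0 := by
          by_contra h
          exact hzU ⟨hzb, lt_of_le_of_ne him (Ne.symm h)⟩
        rw [him0, mul_zero, neg_zero, Real.exp_zero, mul_one]
        linarith [hbd z hz'.1 him0 hzp]
  have hbound : ∀ z ∈ U, ‖(L z)⁻¹ • P z‖ ≤ 2 * η * Real.exp (N * (L z).im) := by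
    intro z hz
    have him : 0 < (L z).im := hz.2
    have hLz : L z ≠ 0 := fun h => by rw [h] at him; simp at him
    have hlimε : Tendsto (fun ε : ℝ =>
        ‖(L z + Complex.I * ε)⁻¹ • Complex.exp (Complex.I * N * L z) • P z‖) (𝓝[>] 0)
        (𝓝 ‖(L z)⁻¹ • Complex.exp (Complex.I * N * L z) • P z‖) := by
      have hc : ContinuousAt (fun ε : ℝ =>
          ‖(L z + Complex.I * ε)⁻¹ • Complex.exp (Complex.I * N * L z) • P z‖) 0 := by
        refine ContinuousAt.norm (ContinuousAt.smul (ContinuousAt.inv₀ (by fun_prop) (by simpa))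
          continuousAt_const)
      have := hc.tendsto
      simp only [Complex.ofReal_zero, mul_zero, add_zero] at this
      exact this.mono_left nhdsWithin_le_nhds
    have := le_of_tendsto hlimε (by
      filter_upwards [self_mem_nhdsWithin] with ε hε using hmax ε hε z hz)
    rw [smul_comm, norm_smul, hnormexp, Real.exp_neg, inv_mul_le_iff₀ (Real.exp_pos _)] at this
    linarith
  have hexp : ∀ᶠ z in 𝓝 p, Real.exp (N * (L z).im) < 2 := by
    have hLat : ContinuousAt L p := hLc.continuousAt (Metric.closedBall_mem_nhds p hδ)
    have hc : ContinuousAt (fun z => Real.exp (N * (L z).im)) p := by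
      have : ContinuousAt (fun z => (L z).im) p := Complex.continuous_im.continuousAt.comp hLat
      fun_prop
    refine hc.tendsto.eventually (gt_mem_nhds ?_)
    rw [(hL0 p (Metric.mem_closedBall_self hδ.le)).2 rfl]
    simp
  rw [eventually_nhdsWithin_iff]
  filter_upwards [hexp, Metric.ball_mem_nhds p hδ'0] with z h1 h2 h3
  rw [dist_zero_right]
  rcases eq_or_lt_of_le (show 0 ≤ (L z).im from h3.1) with h | h
  · linarith [hbd z (Metric.ball_subset_closedBall h2) h.symm h3.2]
  · have := hbound z ⟨h2, h⟩
    nlinarith [Real.exp_pos (N * (L z).im)]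

end ComplexAnalysis

open Potential (und sigma3 E₁ E₂)

/-! ### Calculus of matrix functions -/

section MatrixCalculus

variable {ι κ τ : Type*} [Fintype ι] [Fintype κ] [Fintype τ]

/-- The entrywise supremum metric, with the standard topology of matrices. -/
instance matrixMetric : MetricSpace (Matrix ι κ ℂ) :=
  MetricSpace.replaceTopology (inferInstanceAs (MetricSpace (ι → κ → ℂ))) rfl

instance matrixNorm : NormedAddCommGroup (Matrix ι κ ℂ) where
  norm A := ‖(fun i j => A i j : ι → κ → ℂ)‖
  dist_eq A B := by
    rw [neg_add_eq_sub]
    exact (dist_comm (α := ι → κ → ℂ) A B).trans (dist_eq_norm (E := ι → κ → ℂ) B A)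

instance matrixNormedSpace : NormedSpace ℂ (Matrix ι κ ℂ) where
  norm_smul_le c A := norm_smul_le (β := ι → κ → ℂ) c A

instance matrixNormedSpaceReal : NormedSpace ℝ (Matrix ι κ ℂ) where
  norm_smul_le c A := norm_smul_le (β := ι → κ → ℂ) c A

instance matrixComplete : CompleteSpace (Matrix ι κ ℂ) := FiniteDimensional.complete ℂ _

theorem matrix_norm_le_iff {A : Matrix ι κ ℂ} {r : ℝ} (hr : 0 ≤ r) :
    ‖A‖ ≤ r ↔ ∀ i j, ‖A i j‖ ≤ r := by
  refine (pi_norm_le_iff_of_nonneg (x := (fun i j => A i j : ι → κ → ℂ)) hr).trans ?_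
  exact forall_congr' fun i => pi_norm_le_iff_of_nonneg (x := fun j => A i j) hr

theorem norm_entry_le (A : Matrix ι κ ℂ) (i : ι) (j : κ) : ‖A i j‖ ≤ ‖A‖ :=
  (matrix_norm_le_iff (norm_nonneg _)).1 le_rfl i j

theorem hasDerivAt_matrix {F : ℝ → Matrix ι κ ℂ} {F' : Matrix ι κ ℂ} {x : ℝ} :
    HasDerivAt F F' x ↔ ∀ i j, HasDerivAt (fun y => F y i j) (F' i j) x := by
  refine (hasDerivAt_pi (φ := fun y i => F y i) (φ' := fun i => F' i)).trans ?_
  exact forall_congr' fun i => hasDerivAt_pi (φ := fun y j => F y i j) (φ' := fun j => F' i j)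

theorem hasDerivAt_matrix_mul {F : ℝ → Matrix ι κ ℂ} {G : ℝ → Matrix κ τ ℂ}
    {F' : Matrix ι κ ℂ} {G' : Matrix κ τ ℂ} {x : ℝ} (hF : HasDerivAt F F' x)
    (hG : HasDerivAt G G' x) : HasDerivAt (fun y => F y * G y) (F' * G x + F x * G') x := by
  rw [hasDerivAt_matrix] at hF hG ⊢
  intro i j
  simp only [Matrix.add_apply, Matrix.mul_apply, ← Finset.sum_add_distrib]
  exact HasDerivAt.fun_sum fun l _ => (hF i l).mul (hG l j)

theorem hasDerivAt_conjTranspose {F : ℝ → Matrix ι κ ℂ} {F' : Matrix ι κ ℂ} {x : ℝ}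
    (hF : HasDerivAt F F' x) : HasDerivAt (fun y => (F y)ᴴ) F'ᴴ x := by
  rw [hasDerivAt_matrix] at hF ⊢
  intro i j
  exact (hF j i).star

theorem hasDerivAt_transpose {F : ℝ → Matrix ι κ ℂ} {F' : Matrix ι κ ℂ} {x : ℝ}
    (hF : HasDerivAt F F' x) : HasDerivAt (fun y => (F y)ᵀ) F'ᵀ x := by
  rw [hasDerivAt_matrix] at hF ⊢
  exact fun i j => hF j i

theorem norm_matrix_mul_le (A : Matrix ι κ ℂ) (B : Matrix κ τ ℂ) :
    ‖A * B‖ ≤ Fintype.card κ * ‖A‖ * ‖B‖ := by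
  rw [matrix_norm_le_iff (by positivity)]
  intro i j
  rw [Matrix.mul_apply]
  refine (norm_sum_le _ _).trans ?_
  calc ∑ l, ‖A i l * B l j‖ ≤ ∑ _l : κ, ‖A‖ * ‖B‖ := Finset.sum_le_sum fun l _ => by
        rw [norm_mul]
        exact mul_le_mul (norm_entry_le A i l) (norm_entry_le B l j)
          (norm_nonneg _) (norm_nonneg _)
    _ = _ := by rw [Finset.sum_const, Finset.card_univ, nsmul_eq_mul, mul_assoc]

end MatrixCalculus

/-! ### The system with constant coefficients at infinity. -/

section Symbol

variable {m : ℕ}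

/-- Left multiplication, as a continuous bilinear map. -/
def mulL : Mat2 m →L[ℂ] MatH m →L[ℂ] MatH m :=
  LinearMap.mkContinuous₂ (LinearMap.mk₂ ℂ (fun (A : Mat2 m) (w : MatH m) => A * w)
    Matrix.add_mul (fun c A w => Matrix.smul_mul c A w) Matrix.mul_add
    (fun c A w => Matrix.mul_smul A c w)) (Fintype.card (Fin m ⊕ Fin m)) norm_matrix_mul_le

@[simp] theorem mulL_apply (A : Mat2 m) (w : MatH m) : mulL A w = A * w := rfl

/-- `λ(z)` as a function of the amplitude. -/
def lamK (k₀ : ℝ) (z : ℂ) : ℂ := (z + (k₀ : ℂ) ^ 2 / z) / 2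

/-- `M + i λ`, where `M` is the matrix of the scattering problem. -/
def symb (k₀ : ℝ) (q : Mat m) (z : ℂ) : Mat2 m :=
  Matrix.fromBlocks ((Complex.I * (k₀ : ℂ) ^ 2 / z) • 1) q (-qᴴ) ((Complex.I * z) • 1)

theorem symb_eq (k₀ : ℝ) (q : Mat m) (z : ℂ) :
    symb k₀ q z = (Complex.I * (k₀ : ℂ) ^ 2 / z) • Matrix.fromBlocks 1 0 0 0 + und q
      + (Complex.I * z) • Matrix.fromBlocks 0 0 0 1 := by
  simp [symb, und, Matrix.fromBlocks_smul, Matrix.fromBlocks_add]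

theorem und_sub (A B : Mat m) : und (A - B) = und A - und B := by
  simp [und, sub_eq_add_neg, Matrix.fromBlocks_add, Matrix.fromBlocks_neg, add_comm]

theorem symb_add_und (k₀ : ℝ) (q A : Mat m) (z : ℂ) :
    symb k₀ A z + und (q - A) = symb k₀ q z := by
  rw [symb_eq, symb_eq, und_sub]; abel

/-- The columns of `E₁` are eigenvectors of the limiting scattering matrix for `-iλ`; after
normalization by `e^{iθ}` they become the constant leading term of the Volterra series. -/
theorem symb_mul_E₁ {k₀ : ℝ} {A : Mat m} (hA : A * Aᴴ = ((k₀ : ℂ) ^ 2) • (1 : Mat m)) {z : ℂ}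
    (hz : z ≠ 0) : symb k₀ A z * E₁ A z = 0 := by
  rw [symb, E₁, Matrix.fromBlocks_mul_fromRows, ← Matrix.fromRows_zero]
  congr 1
  · rw [Matrix.mul_one, Matrix.mul_smul, hA, smul_smul, ← add_smul]
    convert zero_smul ℂ (1 : Mat m) using 2
    field_simp; ring
  · rw [Matrix.mul_one, Matrix.smul_mul, Matrix.one_mul, smul_smul]
    have : Complex.I * z * -(Complex.I / z) = 1 := by
      field_simp; simp
    rw [this, one_smul, neg_add_cancel]

/-- The limiting scattering matrix has square `-λ²`, because `λ² = k² + k₀²`; adding `iλ` gives a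
matrix of spectrum `{0, 2iλ}` satisfying this quadratic relation, including `λ = 0`, where it is
nilpotent. -/
theorem symb_mul_symb {k₀ : ℝ} {A : Mat m} (hA : A * Aᴴ = ((k₀ : ℂ) ^ 2) • (1 : Mat m))
    (hA' : Aᴴ * A = ((k₀ : ℂ) ^ 2) • (1 : Mat m)) {z : ℂ} (hz : z ≠ 0) :
    symb k₀ A z * symb k₀ A z = (2 * Complex.I * lamK k₀ z) • symb k₀ A z := by
  have hI : Complex.I ^ 2 = -1 := Complex.I_sq
  rw [symb, Matrix.fromBlocks_multiply, Matrix.fromBlocks_smul]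
  simp only [Matrix.mul_neg, Matrix.neg_mul, Matrix.smul_mul, Matrix.mul_smul, Matrix.one_mul,
    Matrix.mul_one, smul_smul, hA, hA', lamK]
  congr 1
  · rw [← neg_smul, ← add_smul]
    congr 1; field_simp; rw [hI]; ring
  · rw [← add_smul]
    congr 1; field_simp; ring
  · rw [smul_neg, smul_neg, ← neg_add, ← add_smul]
    congr 2; field_simp; ring
  · rw [← neg_smul, ← add_smul]
    congr 1; field_simp; rw [hI]; ring

end Symbol

/-! ### Jost solutions on a left half-line -/

/-- A matrix potential on the line with its limit `A` at `-∞`. -/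
structure Wing (m : ℕ) where
  k₀ : ℝ
  q : ℝ → Mat m
  A : Mat m

namespace Wing

variable {m : ℕ} (W : Wing m)

/-- Regularity and decay of a potential towards `-∞`. -/
structure Good : Prop where
  k₀_pos : 0 < W.k₀
  mul : W.A * W.Aᴴ = ((W.k₀ : ℂ) ^ 2) • (1 : Mat m)
  mul' : W.Aᴴ * W.A = ((W.k₀ : ℂ) ^ 2) • (1 : Mat m)
  wint : WInt fun x => W.q x - W.A
  diff : ∃ q' : ℝ → Mat m, Continuous q' ∧ ∀ x, HasDerivAt W.q (q' x) x

/-- The perturbation of the constant coefficient system. -/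
def pert (x : ℝ) : MatH m →L[ℂ] MatH m := mulL (und (W.q x - W.A))

/-- The normalized Jost solution, `e^{iθ} φ` at fixed time. -/
def jost (z : ℂ) (x : ℝ) : MatH m :=
  vol (lamK W.k₀ z) (mulL (symb W.k₀ W.A z)) W.pert (E₁ W.A z) x

end Wing

/-- `Im λ ≥ 0`, `z ≠ 0`. -/
def Hclosed (k₀ : ℝ) : Set ℂ := {z | z ≠ 0 ∧ 0 ≤ (lamK k₀ z).im}

/-- `Im λ > 0`, `z ≠ 0`. -/
def Hopen (k₀ : ℝ) : Set ℂ := {z | z ≠ 0 ∧ 0 < (lamK k₀ z).im}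

theorem Hopen_subset (k₀ : ℝ) : Hopen k₀ ⊆ Hclosed k₀ := fun _ h => ⟨h.1, h.2.le⟩

theorem differentiableOn_lamK (k₀ : ℝ) : DifferentiableOn ℂ (lamK k₀) {z | z ≠ 0} := by
  intro z hz
  have : z ≠ 0 := hz
  refine DifferentiableAt.differentiableWithinAt ?_
  unfold lamK
  fun_prop (disch := assumption)

theorem isOpen_Hopen (k₀ : ℝ) : IsOpen (Hopen k₀) :=
  (Complex.continuous_im.comp_continuousOn
    (differentiableOn_lamK k₀).continuousOn).isOpen_inter_preimage isOpen_ne isOpen_Ioi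

section Aux

variable {m : ℕ}

theorem norm_und_le (B : Mat m) : ‖(und B : Mat2 m)‖ ≤ ‖B‖ := by
  rw [matrix_norm_le_iff (norm_nonneg _)]
  rintro (i | i) (j | j)
  · simp [und]
  · simpa [und] using norm_entry_le B _ _
  · simpa [und] using norm_entry_le B _ _
  · simp [und]

theorem continuous_und : Continuous (und : Mat m → Mat2 m) := by
  unfold und
  exact Continuous.matrix_fromBlocks continuous_const continuous_id
    (continuous_id.matrix_conjTranspose.neg) continuous_const

theorem E₁_eq (A : Mat m) (z : ℂ) :
    E₁ A z = (Matrix.fromRows 1 0 : MatH m)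
      + (-(Complex.I / z)) • (Matrix.fromRows 0 Aᴴ : MatH m) := by
  ext (i | i) j <;> simp [E₁]

theorem differentiableOn_E₁ (A : Mat m) : DifferentiableOn ℂ (E₁ A) {z | z ≠ 0} := by
  intro z hz
  have : z ≠ 0 := hz
  refine DifferentiableAt.differentiableWithinAt ?_
  have h : E₁ A = fun z => (Matrix.fromRows 1 0 : MatH m)
      + (-(Complex.I / z)) • (Matrix.fromRows 0 Aᴴ : MatH m) := funext (E₁_eq A)
  rw [h]
  fun_prop (disch := assumption)

theorem differentiableOn_mulL_symb (k₀ : ℝ) (A : Mat m) :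
    DifferentiableOn ℂ (fun z => mulL (symb k₀ A z)) {z | z ≠ 0} := by
  intro z hz
  have : z ≠ 0 := hz
  refine DifferentiableAt.differentiableWithinAt ?_
  refine mulL.differentiableAt.comp z ?_
  have h : symb k₀ A = fun z => (Complex.I * (k₀ : ℂ) ^ 2 / z) • Matrix.fromBlocks 1 0 0 0 + und A
      + (Complex.I * z) • Matrix.fromBlocks 0 0 0 1 := funext (symb_eq k₀ A)
  rw [h]
  fun_prop (disch := assumption)

theorem WInt.of_norm_le {F G : Type*} [NormedAddCommGroup F] [NormedAddCommGroup G] {f : ℝ → F}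
    {g : ℝ → G} (hf : WInt f) (hg : Continuous g) (h : ∀ x, ‖g x‖ ≤ ‖f x‖) : WInt g := by
  refine ⟨hg, fun c => (hf.2 c).mono'
    ((continuous_const.add continuous_abs).mul hg.norm).aestronglyMeasurable
    (Eventually.of_forall fun y => ?_)⟩
  rw [Real.norm_of_nonneg (by positivity)]
  exact mul_le_mul_of_nonneg_left (h y) (by positivity)

theorem mulL_symb_sq {k₀ : ℝ} {A : Mat m} (hA : A * Aᴴ = ((k₀ : ℂ) ^ 2) • (1 : Mat m))
    (hA' : Aᴴ * A = ((k₀ : ℂ) ^ 2) • (1 : Mat m)) {z : ℂ} (hz : z ≠ 0) (w : MatH m) :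
    mulL (symb k₀ A z) (mulL (symb k₀ A z) w)
      = (2 * Complex.I * lamK k₀ z) • mulL (symb k₀ A z) w := by
  simp only [mulL_apply]
  rw [← Matrix.mul_assoc, symb_mul_symb hA hA' hz, Matrix.smul_mul]

theorem mul_fromRows_one (B : MatH m) : B = Matrix.fromRows B.toRows₁ B.toRows₂ :=
  (Matrix.fromRows_toRows B).symm

theorem E₁_injective (A : Mat m) (z : ℂ) {n : ℕ} {v : Matrix (Fin m) (Fin n) ℂ}
    (h : E₁ A z * v = 0) : v = 0 := by
  have := congrArg Matrix.toRows₁ h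
  rw [E₁, Matrix.fromRows_mul, Matrix.toRows₁_fromRows, Matrix.one_mul] at this
  rw [this]; rfl

end Aux

namespace Wing

variable {m : ℕ} {W : Wing m} (hW : W.Good)
include hW

theorem wint_pert : WInt W.pert := by
  have h : WInt fun x => (und (W.q x - W.A) : Mat2 m) :=
    hW.wint.of_norm_le (continuous_und.comp hW.wint.1) fun x => norm_und_le _
  exact h.clm mulL

theorem continuous_q : Continuous W.q := by
  have := hW.wint.1.add_const W.A
  simpa using this

theorem hasDerivAt_jost {z : ℂ} (hz : z ∈ Hclosed W.k₀) (x : ℝ) :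
    HasDerivAt (W.jost z) (symb W.k₀ (W.q x) z * W.jost z x) x := by
  have h := hasDerivAt_vol hz.2 (mulL_symb_sq hW.mul hW.mul' hz.1) (wint_pert hW)
    (e := E₁ W.A z) (by rw [mulL_apply, symb_mul_E₁ hW.mul hz.1]) x
  refine h.congr_deriv ?_
  simp only [pert, mulL_apply]
  rw [← Matrix.add_mul, symb_add_und]
  rfl

theorem tendsto_jost {z : ℂ} (hz : z ∈ Hclosed W.k₀) :
    Tendsto (W.jost z) atBot (𝓝 (E₁ W.A z)) :=
  tendsto_vol hz.2 (wint_pert hW)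

theorem continuousOn_jost (x : ℝ) : ContinuousOn (fun z => W.jost z x) (Hclosed W.k₀) := by
  have hsub : Hclosed W.k₀ ⊆ {z | z ≠ 0} := fun z hz => hz.1
  exact continuousOn_vol (fun z hz => hz.2) (fun z hz => mulL_symb_sq hW.mul hW.mul' hz.1)
    (wint_pert hW) ((differentiableOn_mulL_symb W.k₀ W.A).continuousOn.mono hsub)
    ((differentiableOn_E₁ W.A).continuousOn.mono hsub)
    ((differentiableOn_lamK W.k₀).continuousOn.mono hsub) x

theorem differentiableOn_jost (x : ℝ) :
    DifferentiableOn ℂ (fun z => W.jost z x) (Hopen W.k₀) := by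
  have hsub : Hclosed W.k₀ ⊆ {z | z ≠ 0} := fun z hz => hz.1
  have hsub' := (Hopen_subset W.k₀).trans hsub
  exact differentiableOn_vol (Z := Hclosed W.k₀) (fun z hz => hz.2)
    (fun z hz => mulL_symb_sq hW.mul hW.mul' hz.1)
    (wint_pert hW) ((differentiableOn_mulL_symb W.k₀ W.A).continuousOn.mono hsub)
    ((differentiableOn_E₁ W.A).continuousOn.mono hsub) (isOpen_Hopen _) (Hopen_subset _)
    (fun z hz h => by have := hz.2; rw [h] at this; simp at this)
    ((differentiableOn_lamK W.k₀).mono hsub') ((differentiableOn_mulL_symb W.k₀ W.A).mono hsub')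
    ((differentiableOn_E₁ W.A).mono hsub') x

/-- Uniqueness of Jost solutions. -/
theorem jost_unique {z : ℂ} (hz : z ∈ Hclosed W.k₀) (hl : lamK W.k₀ z ≠ 0) {w : ℝ → MatH m}
    (hw : ∀ x, HasDerivAt w (symb W.k₀ (W.q x) z * w x) x)
    (hlim : Tendsto w atBot (𝓝 (E₁ W.A z))) : w = W.jost z := by
  funext x
  refine sub_eq_zero.1 (eq_zero_of_tendsto_atBot hz.2 (mulL_symb_sq hW.mul hW.mul' hz.1)
    (wint_pert hW) hl (d := fun x => w x - W.jost z x) (fun x => ?_) ?_ x)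
  · refine ((hw x).sub (hasDerivAt_jost hW hz x)).congr_deriv ?_
    simp only [pert, mulL_apply]
    rw [← Matrix.add_mul, symb_add_und, Matrix.mul_sub]
  · have := hlim.sub (tendsto_jost hW hz)
    rwa [sub_self] at this

omit hW in
theorem eq_zero_of_ode {M : ℝ → Mat2 m} (hM : Continuous M) {d : ℝ → MatH m}
    (hd : ∀ x, HasDerivAt d (M x * d x) x) {x₀ : ℝ} (h0 : d x₀ = 0) (x : ℝ) : d x = 0 := by
  refine linear_ode_eq_zero ordConnected_univ
    (M := fun x => ((mulL (M x)).restrictScalars ℝ : MatH m →L[ℝ] MatH m))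
    (Continuous.continuousOn ?_) (fun x _ => by simpa using hd x) (mem_univ x₀) h0 x (mem_univ x)
  exact (ContinuousLinearMap.continuous_restrictScalars (𝕜' := ℝ)).comp (mulL.continuous.comp hM)

omit hW in
theorem continuous_symb {q : ℝ → Mat m} (hq : Continuous q) (k₀ : ℝ) (z : ℂ) :
    Continuous fun x => symb k₀ (q x) z := by
  simp_rw [symb_eq]
  exact (continuous_const.add (continuous_und.comp hq)).add continuous_const

/-- A combination of columns vanishing at one point vanishes identically, hence so does its limit
`E₁ v` at `-∞`, whose upper block is `v`. Branch points are included. -/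
theorem jost_injective {z : ℂ} (hz : z ∈ Hclosed W.k₀) (x : ℝ) {v : Mat m}
    (h : W.jost z x * v = 0) : v = 0 := by
  have hzero : ∀ y, W.jost z y * v = 0 := by
    intro y
    refine eq_zero_of_ode (continuous_symb (continuous_q hW) W.k₀ z)
      (d := fun y => W.jost z y * v) (fun y => ?_) h y
    have := hasDerivAt_matrix_mul (hasDerivAt_jost hW hz y) (hasDerivAt_const y v)
    refine this.congr_deriv ?_
    rw [Matrix.mul_zero, add_zero, Matrix.mul_assoc]
  have hlim : Tendsto (fun y => W.jost z y * v) atBot (𝓝 (E₁ W.A z * v)) := by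
    have hc : Continuous fun w : MatH m => w * v := by fun_prop
    exact (hc.tendsto _).comp (tendsto_jost hW hz)
  refine E₁_injective W.A z (tendsto_nhds_unique hlim ?_)
  simp_rw [hzero]
  exact tendsto_const_nhds

end Wing

/-! ### Jost solutions for large spectral parameter -/

/-- Since `k₀² / z = (k₀² / |z|²) z*`, the sign of `Im λ` is that of `(|z|² - k₀²) Im z`; this
identifies `D⁺` and the continuous spectrum. -/
theorem lamK_im (k₀ : ℝ) {z : ℂ} (hz : z ≠ 0) :
    (lamK k₀ z).im = (‖z‖ ^ 2 - k₀ ^ 2) * z.im / (2 * ‖z‖ ^ 2) := by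
  have hn : ‖z‖ ^ 2 ≠ 0 := by positivity
  have h1 : (k₀ : ℂ) ^ 2 / z = ((k₀ ^ 2 / ‖z‖ ^ 2 : ℝ) : ℂ) * conj z := by
    rw [div_eq_iff hz, mul_assoc, ← Complex.normSq_eq_conj_mul_self, ← Complex.sq_norm]
    push_cast
    have : ((‖z‖ : ℝ) : ℂ) ≠ 0 := by exact_mod_cast norm_ne_zero_iff.2 hz
    field_simp
  rw [lamK, h1]
  have h2 : ∀ w : ℂ, (w / 2).im = w.im / 2 := fun w => by
    rw [← Complex.ofReal_ofNat, Complex.div_ofReal_im]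
  rw [h2, Complex.add_im, Complex.im_ofReal_mul, Complex.conj_im]
  field_simp
  ring

theorem im_nonneg_of_mem_Hclosed {k₀ : ℝ} (hk : 0 < k₀) {z : ℂ} (hz : z ∈ Hclosed k₀)
    (hl : 2 * k₀ ≤ ‖z‖) : 0 ≤ z.im := by
  have h := hz.2
  rw [lamK_im k₀ hz.1] at h
  have hn : 0 < ‖z‖ := by linarith
  have h1 : 0 < 2 * ‖z‖ ^ 2 := by positivity
  have h2 : 0 < ‖z‖ ^ 2 - k₀ ^ 2 := by nlinarith
  by_contra hneg
  push Not at hneg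
  have := div_neg_of_neg_of_pos (mul_neg_of_pos_of_neg h2 hneg) h1
  linarith

theorem norm_lamK_ge {k₀ : ℝ} (hk : 0 < k₀) {z : ℂ} (hl : 2 * k₀ ≤ ‖z‖) :
    ‖z‖ / 4 ≤ ‖lamK k₀ z‖ := by
  have hn : 0 < ‖z‖ := by linarith
  have h1 : ‖(k₀ : ℂ) ^ 2 / z‖ ≤ ‖z‖ / 2 := by
    rw [norm_div, norm_pow, Complex.norm_real, Real.norm_of_nonneg hk.le, div_le_iff₀ hn]
    nlinarith
  have h2 : ‖lamK k₀ z‖ = ‖z + (k₀ : ℂ) ^ 2 / z‖ / 2 := by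
    rw [lamK, norm_div, Complex.norm_ofNat]
  have h3 := norm_sub_le (z + (k₀ : ℂ) ^ 2 / z) ((k₀ : ℂ) ^ 2 / z)
  rw [add_sub_cancel_right] at h3
  rw [h2]
  linarith

section Rows

variable {m : ℕ}

theorem norm_toRows₁_le (B : MatH m) : ‖B.toRows₁‖ ≤ ‖B‖ :=
  (matrix_norm_le_iff (norm_nonneg _)).2 fun i j => norm_entry_le B (Sum.inl i) j

theorem norm_toRows₂_le (B : MatH m) : ‖B.toRows₂‖ ≤ ‖B‖ :=
  (matrix_norm_le_iff (norm_nonneg _)).2 fun i j => norm_entry_le B (Sum.inr i) j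

theorem norm_le_of_rows {B : MatH m} {r : ℝ} (h₁ : ‖B.toRows₁‖ ≤ r) (h₂ : ‖B.toRows₂‖ ≤ r) :
    ‖B‖ ≤ r := by
  refine (matrix_norm_le_iff ((norm_nonneg _).trans h₁)).2 ?_
  rintro (i | i) j
  · exact (norm_entry_le B.toRows₁ i j).trans h₁
  · exact (norm_entry_le B.toRows₂ i j).trans h₂

theorem symb_mul (k₀ : ℝ) (q : Mat m) (z : ℂ) (w : MatH m) :
    symb k₀ q z * w = Matrix.fromRows
      ((Complex.I * (k₀ : ℂ) ^ 2 / z) • w.toRows₁ + q * w.toRows₂)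
      (-(qᴴ * w.toRows₁) + (Complex.I * z) • w.toRows₂) := by
  conv_lhs => rw [mul_fromRows_one w]
  rw [symb, Matrix.fromBlocks_mul_fromRows]
  simp

theorem hasDerivAt_toRows {w : ℝ → MatH m} {w' : MatH m} {x : ℝ} (h : HasDerivAt w w' x) :
    HasDerivAt (fun y => (w y).toRows₁) w'.toRows₁ x ∧
      HasDerivAt (fun y => (w y).toRows₂) w'.toRows₂ x := by
  simp only [hasDerivAt_matrix] at h ⊢
  exact ⟨fun i j => h (Sum.inl i) j, fun i j => h (Sum.inr i) j⟩

end Rows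

namespace Wing

variable {m : ℕ} {W : Wing m} (hW : W.Good)
include hW

/-- The matrix `symb` grows like `|z|` while `growth` is at most `1/|λ| ≤ 4/|z|`, so the Volterra
kernel stays bounded as `z → ∞`. -/
theorem exists_kernel_bound : ∃ C, ∀ z ∈ Hclosed W.k₀, 2 * W.k₀ ≤ ‖z‖ →
    (∀ s, 0 ≤ s → 1 + ‖growth (lamK W.k₀ z) s‖ * ‖mulL (symb W.k₀ W.A z)‖ ≤ C * (1 + s)) ∧
      ‖E₁ W.A z‖ ≤ C := by
  have hk := hW.k₀_pos
  set p₁ : Mat2 m := Matrix.fromBlocks 1 0 0 0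
  set p₂ : Mat2 m := Matrix.fromBlocks 0 0 0 1
  set c := ‖p₁‖ + ‖(und W.A : Mat2 m)‖ / W.k₀ + ‖p₂‖ with hc
  have hc0 : 0 ≤ c := by positivity
  refine ⟨max (1 + 4 * (‖(mulL : Mat2 m →L[ℂ] _)‖ * c))
    (‖(Matrix.fromRows 1 0 : MatH m)‖ + 1 / W.k₀ * ‖(Matrix.fromRows 0 W.Aᴴ : MatH m)‖),
    fun z hz hl => ⟨fun s hs => ?_, ?_⟩⟩
  · have hn : 0 < ‖z‖ := by linarith
    have h1 : ‖symb W.k₀ W.A z‖ ≤ c * ‖z‖ := by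
      rw [symb_eq]
      refine (norm_add₃_le).trans ?_
      rw [norm_smul, norm_smul, norm_div, norm_mul, norm_mul, Complex.norm_I, one_mul, one_mul,
        norm_pow, Complex.norm_real, Real.norm_of_nonneg hk.le, hc, add_mul, add_mul]
      have e1 : W.k₀ ^ 2 / ‖z‖ ≤ ‖z‖ := by
        rw [div_le_iff₀ hn]; nlinarith
      have e2 : ‖(und W.A : Mat2 m)‖ ≤ ‖(und W.A : Mat2 m)‖ / W.k₀ * ‖z‖ := by
        rw [div_mul_eq_mul_div, le_div_iff₀ hk]
        exact mul_le_mul_of_nonneg_left (by linarith) (norm_nonneg _)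
      have e3 : W.k₀ ^ 2 / ‖z‖ * ‖p₁‖ ≤ ‖p₁‖ * ‖z‖ := by
        rw [mul_comm]; exact mul_le_mul_of_nonneg_left e1 (norm_nonneg _)
      linarith [mul_comm ‖z‖ ‖p₂‖]
    have h2 : ‖growth (lamK W.k₀ z) s‖ * ‖z‖ ≤ 4 := by
      have h3 := norm_growth_le_div hz.2 hs
      have h4 := norm_lamK_ge hk hl
      have h5 := norm_nonneg (growth (lamK W.k₀ z) s)
      nlinarith
    have h3 : ‖mulL (symb W.k₀ W.A z)‖ ≤ ‖(mulL : Mat2 m →L[ℂ] _)‖ * c * ‖z‖ := by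
      refine (mulL.le_opNorm _).trans ?_
      rw [mul_assoc]
      exact mul_le_mul_of_nonneg_left h1 (norm_nonneg _)
    have h4 : 1 + ‖growth (lamK W.k₀ z) s‖ * ‖mulL (symb W.k₀ W.A z)‖
        ≤ 1 + 4 * (‖(mulL : Mat2 m →L[ℂ] _)‖ * c) := by
      have h5 : 0 ≤ ‖(mulL : Mat2 m →L[ℂ] _)‖ * c := by positivity
      have h6 := mul_le_mul_of_nonneg_left h3 (norm_nonneg (growth (lamK W.k₀ z) s))
      nlinarith
    have h5 := le_max_left (1 + 4 * (‖(mulL : Mat2 m →L[ℂ] _)‖ * c))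
      (‖(Matrix.fromRows 1 0 : MatH m)‖ + 1 / W.k₀ * ‖(Matrix.fromRows 0 W.Aᴴ : MatH m)‖)
    refine h4.trans (h5.trans (le_mul_of_one_le_right (le_trans (by positivity) h5) ?_))
    linarith
  · refine le_trans ?_ (le_max_right _ _)
    rw [E₁_eq]
    refine (norm_add_le _ _).trans ?_
    rw [norm_smul, norm_neg, norm_div, Complex.norm_I]
    have : 1 / ‖z‖ ≤ 1 / W.k₀ := one_div_le_one_div_of_le hk (by linarith)
    gcongr

theorem exists_jost_bound (X : ℝ) : ∃ B, 0 ≤ B ∧ ∀ z ∈ Hclosed W.k₀, 2 * W.k₀ ≤ ‖z‖ →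
    ∀ x ≤ X, ‖W.jost z x‖ ≤ B := by
  obtain ⟨C, hC⟩ := exists_kernel_bound hW
  refine ⟨max (C * Real.exp (2 * volMass W.pert C X X) * 2) 0, le_max_right _ _,
    fun z hz hl x hx => le_trans ?_ (le_max_left _ _)⟩
  exact norm_vol_le hz.2 (wint_pert hW) (hC z hz hl).1 (hC z hz hl).2 hx

theorem exists_jost_tail (X : ℝ) {ε : ℝ} (hε : 0 < ε) : ∃ a ≤ X, ∀ z ∈ Hclosed W.k₀,
    2 * W.k₀ ≤ ‖z‖ → ∀ x ≤ a, ‖W.jost z x - E₁ W.A z‖ ≤ ε := by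
  obtain ⟨C, hC⟩ := exists_kernel_bound hW
  have hlim : Tendsto (fun x => C * (Real.exp (2 * volMass W.pert C X x) - 1)) atBot (𝓝 0) := by
    have := (((Real.continuous_exp.tendsto _).comp
      ((tendsto_volMass (wint_pert hW) (C := C) (X := X)).const_mul 2)).sub_const 1).const_mul C
    simpa using this
  obtain ⟨a, ha⟩ := eventually_atBot.1 (hlim.eventually (gt_mem_nhds hε))
  refine ⟨min a X, min_le_right _ _, fun z hz hl x hx => ?_⟩
  refine le_trans ?_ (ha x (hx.trans (min_le_left _ _))).le
  exact norm_vol_sub_le hz.2 (wint_pert hW) (hC z hz hl).1 (hC z hz hl).2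
    (hx.trans (min_le_right _ _))

/-- The lower block of a Jost solution, corrected to first order in `1 / z`, is propagated by
`exp (i z x)` up to `O (1 / z)`. -/
theorem exists_corrected_bound (a X : ℝ) : ∃ D, 0 ≤ D ∧ ∀ z ∈ Hclosed W.k₀, 2 * W.k₀ ≤ ‖z‖ →
    (∀ s ∈ Icc a X, ‖(Complex.I * z)⁻¹ • ((W.q s)ᴴ * (W.jost z s).toRows₁)‖ ≤ D / ‖z‖) ∧
    ∀ s ∈ Icc a X, ∀ b ∈ Icc a s,
      ‖((W.jost z s).toRows₂ - (Complex.I * z)⁻¹ • ((W.q s)ᴴ * (W.jost z s).toRows₁))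
        - Complex.exp (Complex.I * z * ((s - b : ℝ) : ℂ)) •
          ((W.jost z b).toRows₂ - (Complex.I * z)⁻¹ • ((W.q b)ᴴ * (W.jost z b).toRows₁))‖
        ≤ D / ‖z‖ * (s - b) := by
  have hk := hW.k₀_pos
  obtain ⟨q', hq'c, hq'⟩ := hW.diff
  obtain ⟨B, hB0, hB⟩ := exists_jost_bound hW X
  obtain ⟨K, hK⟩ := (isCompact_Icc (a := a) (b := X)).exists_bound_of_continuousOn
    (f := fun s => (W.q s)ᴴ) (continuous_q hW).matrix_conjTranspose.continuousOn
  obtain ⟨K', hK'⟩ := (isCompact_Icc (a := a) (b := X)).exists_bound_of_continuousOn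
    (f := fun s => (q' s)ᴴ) hq'c.matrix_conjTranspose.continuousOn
  obtain ⟨K₂, hK₂⟩ := (isCompact_Icc (a := a) (b := X)).exists_bound_of_continuousOn
    (f := W.q) (continuous_q hW).continuousOn
  set c : ℝ := (Fintype.card (Fin m) : ℝ)
  have hc0 : 0 ≤ c := Nat.cast_nonneg _
  -- The first summand controls the correction `q† u`, the remaining ones its derivative along the
  -- flow.
  set D := c * |K| * B + (c * |K'| * B + c * |K| * (W.k₀ * B + c * |K₂| * B)) with hD
  refine ⟨D, by positivity, fun z hz hl => ?_⟩
  have hzn : 0 < ‖z‖ := by linarith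
  have hI : ‖(Complex.I * z)⁻¹‖ = 1 / ‖z‖ := by simp
  have hu : ∀ s ≤ X, ‖(W.jost z s).toRows₁‖ ≤ B := fun s hs =>
    (norm_toRows₁_le _).trans (hB z hz hl s hs)
  have hd : ∀ s ≤ X, ‖(W.jost z s).toRows₂‖ ≤ B := fun s hs =>
    (norm_toRows₂_le _).trans (hB z hz hl s hs)
  have hmul : ∀ (F G : Mat m) (f g : ℝ), ‖F‖ ≤ f → ‖G‖ ≤ g → ‖F * G‖ ≤ c * |f| * g := by
    intro F G f g hF hG
    refine (norm_matrix_mul_le F G).trans ?_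
    have := hF.trans (le_abs_self f)
    gcongr
  constructor
  · intro s hs
    rw [norm_smul, hI, div_mul_eq_mul_div, one_mul]
    have h1 := hmul _ _ _ _ (hK s hs) (hu s hs.2)
    gcongr
    refine h1.trans ?_
    rw [hD]
    have : 0 ≤ c * |K'| * B + c * |K| * (W.k₀ * B + c * |K₂| * B) := by positivity
    linarith
  · intro s hs b hb
    have hrows := fun y => hasDerivAt_toRows (hasDerivAt_jost hW hz y)
    simp only [symb_mul, Matrix.toRows₁_fromRows, Matrix.toRows₂_fromRows] at hrows
    set P' : ℝ → Mat m := fun y => (q' y)ᴴ * (W.jost z y).toRows₁ + (W.q y)ᴴ *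
      ((Complex.I * (W.k₀ : ℂ) ^ 2 / z) • (W.jost z y).toRows₁ + W.q y * (W.jost z y).toRows₂)
      with hP'
    have hP : ∀ y, HasDerivAt (fun y => (W.q y)ᴴ * (W.jost z y).toRows₁) (P' y) y := fun y =>
      hasDerivAt_matrix_mul (hasDerivAt_conjTranspose (hq' y)) (hrows y).1
    have hP'b : ∀ y ∈ Icc a X, ‖P' y‖ ≤ D := by
      intro y hy
      have h1 := hmul _ _ _ _ (hK' y hy) (hu y hy.2)
      have h2 := hmul _ _ _ _ (hK₂ y hy) (hd y hy.2)
      have h3 : ‖(Complex.I * (W.k₀ : ℂ) ^ 2 / z) • (W.jost z y).toRows₁‖ ≤ W.k₀ * B := by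
        rw [norm_smul, norm_div, norm_mul, Complex.norm_I, one_mul, norm_pow, Complex.norm_real,
          Real.norm_of_nonneg hk.le]
        refine mul_le_mul ?_ (hu y hy.2) (norm_nonneg _) hk.le
        rw [div_le_iff₀ hzn]
        nlinarith
      have h4 := hmul _ _ _ _ (hK y hy) ((norm_add_le _ _).trans (add_le_add h3 h2))
      refine (norm_add_le _ _).trans ((add_le_add h1 h4).trans ?_)
      rw [hD]
      have : 0 ≤ c * |K| * B := by positivity
      linarith
    set Y : ℝ → Mat m := fun y =>
      (W.jost z y).toRows₂ - (Complex.I * z)⁻¹ • ((W.q y)ᴴ * (W.jost z y).toRows₁) with hY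
    have hIz : Complex.I * z ≠ 0 := mul_ne_zero Complex.I_ne_zero hz.1
    -- The lower block satisfies `d' = iz d - q† u`. Subtracting `(iz)⁻¹ q† u` trades the forcing of
    -- order one for one of order `1/z`: an integration by parts, for which `q` must be
    -- differentiable.
    have hYd : ∀ y, HasDerivAt Y ((Complex.I * z) • Y y - (Complex.I * z)⁻¹ • P' y) y := by
      intro y
      refine ((hrows y).2.sub ((hP y).const_smul ((Complex.I * z)⁻¹ : ℂ))).congr_deriv ?_
      simp only [hY]
      rw [smul_sub, smul_smul, mul_inv_cancel₀ hIz, one_smul]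
      abel
    have hG : ∀ y, HasDerivAt (fun y : ℝ => Complex.exp (Complex.I * z * ((s - y : ℝ) : ℂ)) • Y y)
        (-(Complex.exp (Complex.I * z * ((s - y : ℝ) : ℂ)) • ((Complex.I * z)⁻¹ • P' y))) y := by
      intro y
      have h1 : HasDerivAt (fun y : ℝ => Complex.I * z * ((s - y : ℝ) : ℂ))
          (Complex.I * z * ((-1 : ℝ) : ℂ)) y :=
        (((hasDerivAt_id y).const_sub s).ofReal_comp).const_mul _
      refine (h1.cexp.smul (hYd y)).congr_deriv ?_
      rw [smul_sub, smul_smul]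
      push_cast
      rw [mul_neg_one, mul_neg, neg_smul]
      abel
    have him := im_nonneg_of_mem_Hclosed hk hz hl
    have := norm_image_sub_le_of_norm_deriv_le_segment' (C := D / ‖z‖)
      (f := fun y : ℝ => Complex.exp (Complex.I * z * ((s - y : ℝ) : ℂ)) • Y y)
      (fun y (_ : y ∈ Icc b s) => (hG y).hasDerivWithinAt) (fun y hy => ?_) s
      (right_mem_Icc.2 hb.2)
    · simpa [hY] using this
    · have hya : y ∈ Icc a X := ⟨hb.1.trans hy.1, hy.2.le.trans hs.2⟩
      rw [norm_neg, norm_smul, norm_smul, hI]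
      have he : ‖Complex.exp (Complex.I * z * ((s - y : ℝ) : ℂ))‖ ≤ 1 := by
        rw [Complex.norm_exp, Real.exp_le_one_iff]
        have : (Complex.I * z * ((s - y : ℝ) : ℂ)).re = -(z.im * (s - y)) := by
          simp
        rw [this]
        nlinarith [mul_nonneg him (sub_nonneg.2 hy.2.le)]
      calc _ ≤ 1 * (1 / ‖z‖ * D) := by
            have := hP'b y hya
            gcongr
        _ = D / ‖z‖ := by ring

omit hW in
theorem norm_toRows₂_E₁_le (z : ℂ) : ‖(E₁ W.A z).toRows₂‖ ≤ ‖W.Aᴴ‖ / ‖z‖ := by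
  rw [E₁, Matrix.toRows₂_fromRows, norm_smul, norm_neg, norm_div, Complex.norm_I]
  exact le_of_eq (by ring)

/-- Far to the left the solution is close to `E₁`, uniformly in large `z`, and the lower block of
`E₁` is `O(1/z)`. The propagator `exp (iz(s - a))` has modulus at most one and carries this
smallness to a compact interval with error `O(1/z)`. -/
theorem exists_lower_small (a₀ X : ℝ) (ha₀ : a₀ ≤ X) {ε : ℝ} (hε : 0 < ε) :
    ∃ r, 2 * W.k₀ ≤ r ∧
    ∀ z ∈ Hclosed W.k₀, r ≤ ‖z‖ → ∀ s ∈ Icc a₀ X, ‖(W.jost z s).toRows₂‖ ≤ ε := by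
  have hk := hW.k₀_pos
  obtain ⟨a, haX, ha⟩ := exists_jost_tail hW a₀ (half_pos hε)
  obtain ⟨D, hD0, hD⟩ := exists_corrected_bound hW a X
  set C := ‖W.Aᴴ‖ + D + D + D * (X - a) with hC
  have hC0 : 0 ≤ C := by
    have : 0 ≤ X - a := by linarith
    positivity
  refine ⟨max (2 * W.k₀) (2 * C / ε), le_max_left _ _, fun z hz hr s hs => ?_⟩
  have hl := (le_max_left _ _).trans hr
  have hzn : 0 < ‖z‖ := by linarith
  have hCz : C / ‖z‖ ≤ ε / 2 := by
    have := (le_max_right _ _).trans hr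
    rw [div_le_iff₀ hε] at this
    rw [div_le_iff₀ hzn]
    linarith
  have hsa : s ∈ Icc a X := ⟨haX.trans hs.1, hs.2⟩
  have haa : a ∈ Icc a X := ⟨le_rfl, hsa.1.trans hsa.2⟩
  have h1 := (hD z hz hl).2 s hsa a ⟨le_rfl, hsa.1⟩
  have h2 := (hD z hz hl).1 s hsa
  have h3 := (hD z hz hl).1 a haa
  have h4 : ‖(W.jost z a).toRows₂‖ ≤ ε / 2 + ‖W.Aᴴ‖ / ‖z‖ := by
    have e1 : ‖(W.jost z a - E₁ W.A z).toRows₂‖ ≤ ε / 2 :=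
      (norm_toRows₂_le _).trans (ha z hz hl a le_rfl)
    have e2 := norm_toRows₂_E₁_le (W := W) z
    have e3 : (W.jost z a).toRows₂ = (W.jost z a - E₁ W.A z).toRows₂ + (E₁ W.A z).toRows₂ := by
      ext i j; simp [Matrix.toRows₂]
    rw [e3]
    exact (norm_add_le _ _).trans (add_le_add e1 e2)
  have him := im_nonneg_of_mem_Hclosed hk hz hl
  have he : ‖Complex.exp (Complex.I * z * ((s - a : ℝ) : ℂ))‖ ≤ 1 := by
    rw [Complex.norm_exp, Real.exp_le_one_iff]
    have : (Complex.I * z * ((s - a : ℝ) : ℂ)).re = -(z.im * (s - a)) := by simp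
    rw [this]
    nlinarith [mul_nonneg him (sub_nonneg.2 hsa.1)]
  set Ya := (W.jost z a).toRows₂ - (Complex.I * z)⁻¹ • ((W.q a)ᴴ * (W.jost z a).toRows₁)
  have hYa : ‖Ya‖ ≤ ε / 2 + ‖W.Aᴴ‖ / ‖z‖ + D / ‖z‖ :=
    (norm_sub_le _ _).trans (add_le_add h4 h3)
  set e := Complex.exp (Complex.I * z * ((s - a : ℝ) : ℂ))
  set g := (Complex.I * z)⁻¹ • ((W.q s)ᴴ * (W.jost z s).toRows₁)
  have hdec : (W.jost z s).toRows₂ = ((W.jost z s).toRows₂ - g - e • Ya) + g + e • Ya := by abel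
  have h5 : ‖e • Ya‖ ≤ ‖Ya‖ := by
    rw [norm_smul]
    exact mul_le_of_le_one_left (norm_nonneg _) he
  have h6 : D / ‖z‖ * (s - a) ≤ D / ‖z‖ * (X - a) :=
    mul_le_mul_of_nonneg_left (by linarith [hs.2]) (by positivity)
  rw [hdec]
  refine (norm_add₃_le).trans ?_
  have h7 : C / ‖z‖ = ‖W.Aᴴ‖ / ‖z‖ + D / ‖z‖ + D / ‖z‖ + D / ‖z‖ * (X - a) := by
    rw [hC]; field_simp
  linarith

/-- The upper block has derivative `(i k₀²/z) u + q d`, which is small on compact intervals once the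
lower block `d` is, so `u` keeps the value near `1` it has far to the left. -/
theorem exists_upper_close (X : ℝ) {ε : ℝ} (hε : 0 < ε) : ∃ r, 2 * W.k₀ ≤ r ∧
    ∀ z ∈ Hclosed W.k₀, r ≤ ‖z‖ → ‖(W.jost z X).toRows₁ - 1‖ ≤ ε := by
  have hk := hW.k₀_pos
  obtain ⟨a, haX, ha⟩ := exists_jost_tail hW X (half_pos hε)
  obtain ⟨B, hB0, hB⟩ := exists_jost_bound hW X
  obtain ⟨K, hK⟩ := (isCompact_Icc (a := a) (b := X)).exists_bound_of_continuousOn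
    (f := W.q) (continuous_q hW).continuousOn
  set c : ℝ := (Fintype.card (Fin m) : ℝ)
  have hc0 : 0 ≤ c := Nat.cast_nonneg _
  have hXa : 0 ≤ X - a := sub_nonneg.2 haX
  set η := ε / 4 / (c * |K| * (X - a) + 1)
  have hη : 0 < η := by positivity
  obtain ⟨r, hr, hlow⟩ := exists_lower_small hW a X haX hη
  refine ⟨max r (4 * (W.k₀ ^ 2 * B * (X - a)) / ε), hr.trans (le_max_left _ _),
    fun z hz hrz => ?_⟩
  have hrz1 := (le_max_left _ _).trans hrz
  have hl := hr.trans hrz1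
  have hzn : 0 < ‖z‖ := by linarith
  have hrows := fun y => (hasDerivAt_toRows (hasDerivAt_jost hW hz y)).1
  simp only [symb_mul, Matrix.toRows₁_fromRows] at hrows
  have hest := norm_image_sub_le_of_norm_deriv_le_segment' (C := W.k₀ ^ 2 * B / ‖z‖ + c * |K| * η)
    (f := fun y => (W.jost z y).toRows₁)
    (fun y (_ : y ∈ Icc a X) => (hrows y).hasDerivWithinAt) (fun y hy => ?_) X
    (right_mem_Icc.2 haX)
  · have h1 : W.k₀ ^ 2 * B / ‖z‖ * (X - a) ≤ ε / 4 := by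
      have := (le_max_right _ _).trans hrz
      rw [div_le_iff₀ hε] at this
      rw [div_mul_eq_mul_div, div_le_iff₀ hzn]
      linarith
    have h2 : c * |K| * η * (X - a) ≤ ε / 4 := by
      have : c * |K| * η * (X - a) = ε / 4 * ((c * |K| * (X - a)) / (c * |K| * (X - a) + 1)) := by
        simp only [η]; field_simp
      rw [this]
      refine mul_le_of_le_one_right (by positivity) ?_
      rw [div_le_one (by positivity)]
      linarith
    have h3 : ‖(W.jost z a).toRows₁ - 1‖ ≤ ε / 2 := by
      have e1 : ‖(W.jost z a - E₁ W.A z).toRows₁‖ ≤ ε / 2 :=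
        (norm_toRows₁_le _).trans (ha z hz hl a le_rfl)
      have e3 : (W.jost z a - E₁ W.A z).toRows₁ = (W.jost z a).toRows₁ - 1 := by
        ext i j; simp [Matrix.toRows₁, E₁]
      rwa [e3] at e1
    have h4 : (W.jost z X).toRows₁ - 1
        = ((W.jost z X).toRows₁ - (W.jost z a).toRows₁) + ((W.jost z a).toRows₁ - 1) := by abel
    rw [h4]
    refine (norm_add_le _ _).trans ?_
    rw [add_mul] at hest
    linarith
  · have hyI : y ∈ Icc a X := Ico_subset_Icc_self hy
    refine (norm_add_le _ _).trans (add_le_add ?_ ?_)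
    · rw [norm_smul, norm_div, norm_mul, Complex.norm_I, one_mul, norm_pow, Complex.norm_real,
        Real.norm_of_nonneg hk.le, div_mul_eq_mul_div]
      have := (norm_toRows₁_le _).trans (hB z hz hl y hyI.2)
      gcongr
    · refine (norm_matrix_mul_le _ _).trans ?_
      have h1 := (hK y hyI).trans (le_abs_self K)
      have h2 := hlow z hz hrz1 y hyI
      gcongr

theorem tendsto_jost_cobounded (x : ℝ) :
    Tendsto (fun z => W.jost z x) (Bornology.cobounded ℂ ⊓ 𝓟 (Hclosed W.k₀))
      (𝓝 (Matrix.fromRows 1 0)) := by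
  rw [Metric.tendsto_nhds]
  intro ε hε
  obtain ⟨r₁, h₁, hr₁⟩ := exists_lower_small hW x x le_rfl (half_pos hε)
  obtain ⟨r₂, h₂, hr₂⟩ := exists_upper_close hW x (half_pos hε)
  rw [eventually_inf_principal]
  have h1 := tendsto_norm_cobounded_atTop (E := ℂ)
  filter_upwards [h1.eventually_ge_atTop r₁, h1.eventually_ge_atTop r₂] with z hz1 hz2 hz
  rw [dist_eq_norm]
  refine lt_of_le_of_lt (norm_le_of_rows (r := ε / 2) ?_ ?_) (half_lt_self hε)
  · have : (W.jost z x - Matrix.fromRows 1 0).toRows₁ = (W.jost z x).toRows₁ - 1 := by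
      ext i j; simp [Matrix.toRows₁]
    rw [this]
    exact hr₂ z hz hz2
  · have : (W.jost z x - Matrix.fromRows 1 0).toRows₂ = (W.jost z x).toRows₂ := by
      ext i j; simp [Matrix.toRows₂]
    rw [this]
    exact hr₁ z hz hz1 x ⟨le_rfl, le_rfl⟩

omit hW in
theorem I_mul_mem_Hclosed {k₀ : ℝ} (hk : 0 < k₀) {y : ℝ} (hy : 2 * k₀ ≤ y) :
    Complex.I * y ∈ Hclosed k₀ := by
  have hy0 : 0 < y := by linarith
  have hne : Complex.I * (y : ℂ) ≠ 0 := mul_ne_zero Complex.I_ne_zero (by exact_mod_cast hy0.ne')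
  refine ⟨hne, ?_⟩
  rw [lamK_im k₀ hne]
  have h1 : ‖Complex.I * (y : ℂ)‖ = y := by simp [hy0.le]
  have h2 : (Complex.I * (y : ℂ)).im = y := by simp
  rw [h1, h2]
  have : 0 ≤ y ^ 2 - k₀ ^ 2 := by nlinarith
  positivity

/-- The potential is recovered from the `1 / z` term of a Jost solution. -/
theorem tendsto_mul_lower (x : ℝ) :
    Tendsto (fun y : ℝ => (y : ℂ) • (W.jost (Complex.I * y) x).toRows₂) atTop
      (𝓝 (-(W.q x)ᴴ)) := by
  have hk := hW.k₀_pos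
  obtain ⟨D, hD0, hD⟩ := exists_corrected_bound hW (x - 1) x
  obtain ⟨B, hB0, hB⟩ := exists_jost_bound hW x
  have hIy : Tendsto (fun y : ℝ => Complex.I * (y : ℂ)) atTop
      (Bornology.cobounded ℂ ⊓ 𝓟 (Hclosed W.k₀)) := by
    refine tendsto_inf.2 ⟨?_, tendsto_principal.2 ?_⟩
    · rw [← tendsto_norm_atTop_iff_cobounded]
      refine tendsto_id.congr' ?_
      filter_upwards [eventually_ge_atTop 0] with y hy
      simp [abs_of_nonneg hy]
    · filter_upwards [eventually_ge_atTop (2 * W.k₀)] with y hy using I_mul_mem_Hclosed hk hy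
  have hjost := (tendsto_jost_cobounded hW x).comp hIy
  have hup : Tendsto (fun y : ℝ => (W.jost (Complex.I * y) x).toRows₁) atTop (𝓝 1) := by
    have hc : Continuous fun B : MatH m => B.toRows₁ :=
      continuous_matrix fun i j => (continuous_id.matrix_elem (Sum.inl i) j)
    have := (hc.tendsto _).comp hjost
    simpa [Function.comp_def] using this
  have hqu : Tendsto (fun y : ℝ => -((W.q x)ᴴ * (W.jost (Complex.I * y) x).toRows₁)) atTop
      (𝓝 (-(W.q x)ᴴ)) := by
    have hc : Continuous fun B : Mat m => -((W.q x)ᴴ * B) := by fun_prop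
    have := (hc.tendsto _).comp hup
    simpa [Function.comp_def] using this
  set Y : ℝ → ℝ → Mat m := fun y s => (W.jost (Complex.I * y) s).toRows₂ -
    (Complex.I * (Complex.I * y))⁻¹ • ((W.q s)ᴴ * (W.jost (Complex.I * y) s).toRows₁) with hY
  have hYlim : Tendsto (fun y : ℝ => (y : ℂ) • Y y x) atTop (𝓝 0) := by
    -- The propagation estimate is started at `x - y^{-1/2}`: far enough for `exp (-√y)` to beat the
    -- factor `y`, near enough for the accumulated error `(D / y) y^{-1/2}` to be `o(1/y)`.
    have hb : Tendsto (fun y : ℝ => y * Real.exp (-Real.sqrt y) * (B + D) + D / Real.sqrt y) atTop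
        (𝓝 0) := by
      have h1 : Tendsto (fun y : ℝ => y * Real.exp (-Real.sqrt y)) atTop (𝓝 0) := by
        have := (Real.tendsto_pow_mul_exp_neg_atTop_nhds_zero 2).comp Real.tendsto_sqrt_atTop
        refine this.congr' ?_
        filter_upwards [eventually_ge_atTop 0] with y hy
        simp [Real.sq_sqrt hy]
      have h2 : Tendsto (fun y : ℝ => D / Real.sqrt y) atTop (𝓝 0) :=
        Real.tendsto_sqrt_atTop.const_div_atTop D
      simpa using (h1.mul_const (B + D)).add h2
    refine squeeze_zero_norm' ?_ hb
    filter_upwards [eventually_ge_atTop (2 * W.k₀), eventually_ge_atTop 1] with y hy hy1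
    have hy0 : 0 < y := by linarith
    have hn : ‖Complex.I * (y : ℂ)‖ = y := by simp [hy0.le]
    have hmem := I_mul_mem_Hclosed hk hy
    have hsq : 0 < Real.sqrt y := Real.sqrt_pos.2 hy0
    have hsq1 : 1 / Real.sqrt y ≤ 1 := by
      rw [div_le_one hsq, Real.one_le_sqrt]; exact hy1
    have hpos : 0 < 1 / Real.sqrt y := by positivity
    have hbm : x - 1 / Real.sqrt y ∈ Icc (x - 1) x := ⟨by linarith, by linarith⟩
    obtain ⟨hD1, hD2⟩ := hD _ hmem (by rw [hn]; exact hy)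
    have h1 := hD2 x ⟨by linarith, le_rfl⟩ (x - 1 / Real.sqrt y) hbm
    have h2 := hD1 (x - 1 / Real.sqrt y) hbm
    rw [hn] at h1 h2
    have hYb : ‖Y y (x - 1 / Real.sqrt y)‖ ≤ B + D := by
      refine (norm_sub_le _ _).trans (add_le_add ?_ (h2.trans (div_le_self hD0 hy1)))
      exact (norm_toRows₂_le _).trans (hB _ hmem (by rw [hn]; exact hy) _ hbm.2)
    change ‖Y y x - Complex.exp _ • Y y (x - 1 / Real.sqrt y)‖ ≤ _ at h1
    have hsx : x - (x - 1 / Real.sqrt y) = 1 / Real.sqrt y := by ring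
    rw [hsx] at h1
    have hexp : ‖Complex.exp (Complex.I * (Complex.I * y) * ((1 / Real.sqrt y : ℝ) : ℂ))‖
        = Real.exp (-Real.sqrt y) := by
      rw [Complex.norm_exp]
      congr 1
      rw [← mul_assoc, Complex.I_mul_I, neg_one_mul, ← Complex.ofReal_neg, ← Complex.ofReal_mul,
        Complex.ofReal_re]
      rw [mul_one_div, neg_div, Real.div_sqrt]
    have h3 : ‖Y y x‖ ≤ D / y * (1 / Real.sqrt y) + Real.exp (-Real.sqrt y) * (B + D) := by
      have := norm_sub_norm_le (Y y x)
        (Complex.exp (Complex.I * (Complex.I * y) * ((1 / Real.sqrt y : ℝ) : ℂ)) •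
          Y y (x - 1 / Real.sqrt y))
      rw [norm_smul, hexp] at this
      have h4 := mul_le_mul_of_nonneg_left hYb (Real.exp_pos (-Real.sqrt y)).le
      linarith
    rw [norm_smul, Complex.norm_real, Real.norm_of_nonneg hy0.le]
    calc y * ‖Y y x‖ ≤ y * (D / y * (1 / Real.sqrt y) + Real.exp (-Real.sqrt y) * (B + D)) := by
          gcongr
      _ = _ := by field_simp; ring
  have hsum := hYlim.add hqu
  rw [zero_add] at hsum
  refine hsum.congr' ?_
  filter_upwards [eventually_gt_atTop 0] with y hy
  have hy' : (y : ℂ) ≠ 0 := by exact_mod_cast hy.ne'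
  simp only [hY]
  rw [smul_sub, smul_smul, ← mul_assoc, Complex.I_mul_I, neg_one_mul, inv_neg, mul_neg,
    mul_inv_cancel₀ hy', neg_one_smul]
  abel

end Wing

/-! ### Transport of solutions in time -/

section Transport

variable {m : ℕ}

theorem gronwallBound_le_of_one_le {δ K ε x : ℝ} (hK : 1 ≤ K) (hε : 0 ≤ ε) (hx : 0 ≤ x) :
    gronwallBound δ K ε x ≤ (δ + ε) * Real.exp (K * x) := by
  rw [gronwallBound_of_K_ne_0 (by linarith), add_mul]
  have h1 : 1 ≤ Real.exp (K * x) := Real.one_le_exp (by positivity)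
  have h2 : ε / K ≤ ε := div_le_self hε hK
  have h3 : ε / K * (Real.exp (K * x) - 1) ≤ ε * (Real.exp (K * x) - 1) :=
    mul_le_mul_of_nonneg_right h2 (by linarith)
  linarith

theorem continuous_mulL_real :
    Continuous fun A : Mat2 m => ((mulL A).restrictScalars ℝ : MatH m →L[ℝ] MatH m) :=
  (ContinuousLinearMap.continuous_restrictScalars (𝕜' := ℝ)).comp mulL.continuous

/-- The flow of the time-dependent problem transports solutions of the scattering problem, by the
zero curvature condition. -/
theorem exists_transport {M N Nx Mt : ℝ → ℝ → Mat2 m} {a b t₁ : ℝ} (h₁ : t₁ ∈ Icc a b)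
    (hN : ContinuousOn (Function.uncurry N) (univ ×ˢ Icc a b))
    (hNx : ContinuousOn (Function.uncurry Nx) (univ ×ˢ Icc a b))
    (hNd : ∀ x, ∀ t ∈ Icc a b, HasDerivAt (fun y => N y t) (Nx x t) x)
    (hMd : ∀ x, ∀ t ∈ Icc a b, HasDerivAt (fun s => M x s) (Mt x t) t)
    (hz : ∀ x, ∀ t ∈ Icc a b, Nx x t + N x t * M x t = Mt x t + M x t * N x t)
    {f : ℝ → MatH m} (hf : ∀ x, HasDerivAt f (M x t₁ * f x) x) :
    ∃ H : ℝ → ℝ → MatH m, (∀ x, H x t₁ = f x) ∧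
      (∀ x, ∀ t ∈ Icc a b, HasDerivAt (H x) (N x t * H x t) t) ∧
      ∀ x, ∀ t ∈ Icc a b, HasDerivAt (fun y => H y t) (M x t * H x t) x := by
  have hab : a ≤ b := h₁.1.trans h₁.2
  -- The roles of the variables are exchanged: time is integrated and `x` is the parameter.
  -- Projecting time to `[a, b]` extends the coefficients to the whole line.
  obtain ⟨G, hGc, hG0, hG⟩ := exists_linear_ode
    (M := fun s x => ((mulL (N x (projIcc a b hab (s + t₁)))).restrictScalars ℝ :
      MatH m →L[ℝ] MatH m))
    (v := f) (by
      refine continuous_mulL_real.comp ?_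
      refine hN.comp_continuous (f := fun p : ℝ × ℝ => (p.2, (projIcc a b hab (p.1 + t₁) : ℝ)))
        ?_ fun p => ⟨mem_univ _, Subtype.coe_prop _⟩
      exact continuous_snd.prodMk (continuous_subtype_val.comp
        (continuous_projIcc.comp (continuous_fst.add_const t₁))))
    (continuous_iff_continuousAt.2 fun x => (hf x).continuousAt)
  set H : ℝ → ℝ → MatH m := fun x t => G (t - t₁) x with hH
  have hHc : Continuous (Function.uncurry H) :=
    hGc.comp (g := Function.uncurry G) (f := fun p : ℝ × ℝ => (p.2 - t₁, p.1)) (by fun_prop)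
  have hH1 : ∀ x, H x t₁ = f x := fun x => by simp [hH, hG0]
  have hHt : ∀ x, ∀ t ∈ Icc a b, HasDerivAt (H x) (N x t * H x t) t := by
    intro x t ht
    have h := (hG (t - t₁) x).comp_sub_const t t₁
    simp only [sub_add_cancel, ContinuousLinearMap.coe_restrictScalars', mulL_apply] at h
    rwa [projIcc_of_mem hab ht] at h
  refine ⟨H, hH1, hHt, fun x₀ t ht => ?_⟩
  have hsec : ∀ {F : ℝ → ℝ → Mat2 m}, ContinuousOn (Function.uncurry F) (univ ×ˢ Icc a b) →
      ContinuousOn (F x₀) (Icc a b) := fun {F} hF =>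
    hF.comp (f := fun s => (x₀, s)) (by fun_prop) fun s hs => ⟨mem_univ _, hs⟩
  obtain ⟨K₀, hK₀⟩ := isCompact_Icc.exists_bound_of_continuousOn (hsec hN)
  obtain ⟨B₁, hB₁⟩ := isCompact_Icc.exists_bound_of_continuousOn (hsec hNx)
  obtain ⟨B₀, hB₀⟩ := isCompact_Icc.exists_bound_of_continuousOn
    (s := Icc a b) (f := H x₀) (hHc.comp (f := fun s => (x₀, s)) (by fun_prop)).continuousOn
  have hB₁0 : 0 ≤ B₁ := (norm_nonneg _).trans (hB₁ t ht)
  have hB₀0 : 0 ≤ B₀ := (norm_nonneg _).trans (hB₀ t ht)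
  set c : ℝ := (Fintype.card (Fin m ⊕ Fin m) : ℝ)
  have hc0 : 0 ≤ c := Nat.cast_nonneg _
  set K := max 1 (c * K₀)
  set C := (1 + c * (B₀ + 1 + B₁)) * Real.exp (K * |t - t₁|) with hC
  have hC0 : 0 < C := by positivity
  refine HasDerivAt.of_isLittleO (Asymptotics.isLittleO_iff.2 fun ε hε => ?_)
  set η := min 1 (ε / C)
  have hη : 0 < η := by positivity
  have hη1 : η ≤ 1 := min_le_left _ _
  have hηC : η * C ≤ ε := by
    have := min_le_right 1 (ε / C)
    rwa [le_div_iff₀ hC0] at this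
  obtain ⟨v, hv, hvs⟩ := isCompact_Icc.mem_uniformity_of_prod (f := Nx) hNx (mem_univ x₀)
    (Metric.dist_mem_uniformity hη)
  obtain ⟨v', hv', hvs'⟩ := (isCompact_Icc (a := a) (b := b)).mem_uniformity_of_prod (f := H)
    (hHc.continuousOn (s := univ ×ˢ Icc a b)) (mem_univ x₀) (Metric.dist_mem_uniformity hη)
  rw [nhdsWithin_univ] at hv hv'
  obtain ⟨r, hr, hball⟩ := Metric.mem_nhds_iff.1 hv
  have hfl := Asymptotics.isLittleO_iff.1 (hf x₀).isLittleO hη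
  filter_upwards [Metric.ball_mem_nhds x₀ hr, hv', hfl] with x' hx' hx'v hx'f
  set h := x' - x₀ with hh
  -- The defect in the expected first-order expansion in `x`. It is `o(h)` at time `t₁` and
  -- satisfies the time equation up to a forcing `o(h)`, so Grönwall's inequality gives
  -- differentiability in `x` and the derivative at once.
  set d : ℝ → MatH m := fun s => H x' s - H x₀ s - h • (M x₀ s * H x₀ s) with hd
  set d' : ℝ → MatH m := fun s => N x' s * H x' s - N x₀ s * H x₀ s
    - h • (Mt x₀ s * H x₀ s + M x₀ s * (N x₀ s * H x₀ s)) with hd'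
  have hdd : ∀ s ∈ Icc a b, HasDerivAt d (d' s) s := fun s hs =>
    ((hHt x' s hs).sub (hHt x₀ s hs)).sub
      ((hasDerivAt_matrix_mul (hMd x₀ s hs) (hHt x₀ s hs)).const_smul h)
  have hd'eq : ∀ s ∈ Icc a b, d' s = N x₀ s * d s
      + (N x' s - N x₀ s - h • Nx x₀ s) * H x' s + h • (Nx x₀ s * (H x' s - H x₀ s)) := by
    intro s hs
    -- Zero curvature is used here and only here: it cancels the terms of first order in `h`.
    have e1 : Mt x₀ s * H x₀ s + M x₀ s * (N x₀ s * H x₀ s)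
        = Nx x₀ s * H x₀ s + N x₀ s * (M x₀ s * H x₀ s) := by
      rw [← Matrix.mul_assoc, ← Matrix.mul_assoc, ← Matrix.add_mul, ← Matrix.add_mul, hz x₀ s hs]
    simp only [hd', e1]
    simp only [hd, Matrix.mul_sub, Matrix.sub_mul, Matrix.smul_mul, Matrix.mul_smul,
      smul_add, smul_sub]
    abel
  have hmv : ∀ s ∈ Icc a b, ‖N x' s - N x₀ s - h • Nx x₀ s‖ ≤ η * |h| := by
    intro s hs
    have hcv : Convex ℝ (Metric.ball x₀ r) := convex_ball x₀ r
    have := hcv.norm_image_sub_le_of_norm_hasDerivWithin_le (C := η)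
      (f := fun y => N y s - (y - x₀) • Nx x₀ s) (f' := fun y => Nx y s - Nx x₀ s)
      (fun y _ => ?_) (fun y hy => ?_) (Metric.mem_ball_self hr) hx'
    · simp only [sub_self, zero_smul, sub_zero, Real.norm_eq_abs] at this
      rwa [sub_right_comm] at this
    · have h1 := (((hasDerivAt_id y).sub_const x₀).smul_const (Nx x₀ s))
      rw [one_smul] at h1
      exact ((hNd y s hs).sub h1).hasDerivWithinAt
    · have h2 := hvs y (hball hy) s hs
      rw [mem_ofPred_eq, dist_eq_norm] at h2
      exact h2.le
  have hHd : ∀ s ∈ Icc a b, ‖H x' s - H x₀ s‖ ≤ η := by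
    intro s hs
    have h2 := hvs' x' hx'v s hs
    rw [mem_ofPred_eq, dist_eq_norm] at h2
    exact h2.le
  have hHb : ∀ s ∈ Icc a b, ‖H x' s‖ ≤ B₀ + 1 := by
    intro s hs
    have := norm_sub_norm_le (H x' s) (H x₀ s)
    linarith [hHd s hs, hB₀ s hs]
  have hmain := norm_le_gronwallBound_of_abs ordConnected_Icc hdd (δ := η * |h|) (K := K)
    (ε := η * |h| * (c * (B₀ + 1 + B₁))) h₁ ht (by
      simp only [hd, hH1]
      simpa using hx'f) (fun s hs => ?_)
  · refine (hmain.trans (gronwallBound_le_of_one_le (le_max_left _ _) (by positivity)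
      (abs_nonneg _))).trans ?_
    calc _ = η * C * |h| := by rw [hC]; ring
      _ ≤ ε * ‖h‖ := mul_le_mul_of_nonneg_right hηC (abs_nonneg _)
  · have hs' : s ∈ Icc a b := ordConnected_Icc.uIcc_subset h₁ ht hs
    rw [hd'eq s hs', add_assoc]
    refine (norm_add_le _ _).trans (add_le_add ?_ ((norm_add_le _ _).trans ?_))
    · refine (norm_matrix_mul_le _ _).trans ?_
      have h1 : c * ‖N x₀ s‖ ≤ K :=
        (mul_le_mul_of_nonneg_left (hK₀ s hs') hc0).trans (le_max_right _ _)
      exact mul_le_mul_of_nonneg_right h1 (norm_nonneg _)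
    · have h1 : ‖(N x' s - N x₀ s - h • Nx x₀ s) * H x' s‖ ≤ c * (η * |h|) * (B₀ + 1) := by
        refine (norm_matrix_mul_le _ _).trans ?_
        have := hmv s hs'
        have := hHb s hs'
        gcongr
      have h2 : ‖h • (Nx x₀ s * (H x' s - H x₀ s))‖ ≤ |h| * (c * B₁ * η) := by
        rw [norm_smul, Real.norm_eq_abs]
        refine mul_le_mul_of_nonneg_left ((norm_matrix_mul_le _ _).trans ?_) (abs_nonneg _)
        have := hB₁ s hs'
        have := hHd s hs'
        gcongr
      linarith

end Transport

/-! ### Zero curvature -/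

section ZeroCurvature

variable {m : ℕ}

theorem sigma3_mul_self : (sigma3 : Mat2 m) * sigma3 = 1 := by
  simp [sigma3, Matrix.fromBlocks_multiply]

theorem sigma3_mul_und (A : Mat m) : sigma3 * und A = -(und A * sigma3) := by
  simp [sigma3, und, Matrix.fromBlocks_multiply, Matrix.fromBlocks_neg]

/-- With `κ = ik`, the compatibility condition is an identity in any algebra: once `σ` is moved to
the right by anticommutation, the coefficients of all words in `U, V, X, Y` cancel. `D` is the time
derivative prescribed by the equation, written for `und Q`. -/
theorem zero_curvature_algebra {R : Type*} [Ring R] [Algebra ℂ R] (κ : ℂ) {σ U V X Y D : R}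
    (hσ : σ * σ = 1) (hU : σ * U = -(U * σ)) (hV : σ * V = -(V * σ)) (hX : σ * X = -(X * σ))
    (hD : D = -Y + (3 : ℂ) • (V * U * U + U * U * V)) :
    (-4 * κ ^ 2) • V - (2 * κ) • ((V * U + U * V + X) * σ) - Y
        + (2 : ℂ) • (V * U * U + U * V * U + U * U * V) + (X * U - U * X)
      + ((4 * κ ^ 3) • σ + (-4 * κ ^ 2) • U - (2 * κ) • ((U * U + V) * σ) - X
        + (2 : ℂ) • (U * U * U) + V * U - U * V) * ((-κ) • σ + U)
      = D + ((-κ) • σ + U) * ((4 * κ ^ 3) • σ + (-4 * κ ^ 2) • U - (2 * κ) • ((U * U + V) * σ) - X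
        + (2 : ℂ) • (U * U * U) + V * U - U * V) := by
  have hU' : ∀ A, σ * (U * A) = -(U * (σ * A)) := fun A => by
    rw [← mul_assoc, hU, neg_mul, mul_assoc]
  have hV' : ∀ A, σ * (V * A) = -(V * (σ * A)) := fun A => by
    rw [← mul_assoc, hV, neg_mul, mul_assoc]
  subst hD
  simp only [mul_add, add_mul, mul_sub, sub_mul, smul_mul_assoc, mul_smul_comm, mul_assoc, hU, hV,
    hX, hU', hV', hσ, mul_neg, neg_mul, mul_one, neg_neg, smul_neg]
  module

theorem hasDerivAt_und {F : ℝ → Mat m} {F' : Mat m} {x : ℝ} (h : HasDerivAt F F' x) :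
    HasDerivAt (fun y => und (F y)) (und F') x := by
  rw [hasDerivAt_matrix] at h ⊢
  rintro (i | i) (j | j)
  · simpa [und] using hasDerivAt_const x (0 : ℂ)
  · simpa [und] using h i j
  · simpa [und] using ((h j i).star).fun_neg
  · simpa [und] using hasDerivAt_const x (0 : ℂ)

end ZeroCurvature

/-! ### The Lax pair of a solution -/

theorem hasDerivAt_dx {m n : ℕ} {F : ℝ → ℝ → Mat m} {t : ℝ}
    (h : ∀ i j, ContDiff ℝ ((n + 1 : ℕ) : WithTop ℕ∞) fun x => F x t i j) :
    (∀ x, HasDerivAt (fun y => F y t) (dx F x t) x) ∧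
      ∀ i j, ContDiff ℝ (n : WithTop ℕ∞) fun x => dx F x t i j := by
  have h' : ∀ i j, Differentiable ℝ (fun x => F x t i j) ∧
      ContDiff ℝ (n : WithTop ℕ∞) (deriv fun x => F x t i j) := fun i j => by
    have := h i j
    push_cast at this
    rw [contDiff_succ_iff_deriv] at this
    exact ⟨this.1, this.2.2⟩
  exact ⟨fun x => hasDerivAt_matrix.2 fun i j => ((h' i j).1 x).hasDerivAt, fun i j => (h' i j).2⟩

/-- The matrix of the time-dependent problem, as a function of `i k`, `U`, `U_x` and `U_xx`. -/
def timeMat {m : ℕ} (κ : ℂ) (U V X : Mat2 m) : Mat2 m :=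
  (4 * κ ^ 3) • sigma3 + (-4 * κ ^ 2) • U - (2 * κ) • ((U * U + V) * sigma3) - X
    + (2 : ℂ) • (U * U * U) + V * U - U * V

/-- The derivative of `timeMat`. -/
def timeMatDeriv {m : ℕ} (κ : ℂ) (U V X Y : Mat2 m) : Mat2 m :=
  (-4 * κ ^ 2) • V - (2 * κ) • ((V * U + U * V + X) * sigma3) - Y
    + (2 : ℂ) • (V * U * U + U * V * U + U * U * V) + (X * U - U * X)

theorem continuous_timeMat {m : ℕ} (κ : ℂ) :
    Continuous fun p : Mat2 m × Mat2 m × Mat2 m => timeMat κ p.1 p.2.1 p.2.2 := by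
  unfold timeMat
  fun_prop

theorem continuous_timeMatDeriv {m : ℕ} (κ : ℂ) : Continuous
    fun p : Mat2 m × Mat2 m × Mat2 m × Mat2 m => timeMatDeriv κ p.1 p.2.1 p.2.2.1 p.2.2.2 := by
  unfold timeMatDeriv
  fun_prop

theorem hasDerivAt_timeMat {m : ℕ} (κ : ℂ) {U V X : ℝ → Mat2 m} {Y : Mat2 m} {x : ℝ}
    (hU : HasDerivAt U (V x) x) (hV : HasDerivAt V (X x) x) (hX : HasDerivAt X Y x) :
    HasDerivAt (fun y => timeMat κ (U y) (V y) (X y)) (timeMatDeriv κ (U x) (V x) (X x) Y) x := by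
  have hUU := hasDerivAt_matrix_mul hU hU
  have h1 := (hU.const_smul (-4 * κ ^ 2)).const_add ((4 * κ ^ 3) • (sigma3 : Mat2 m))
  have h2 := (hasDerivAt_matrix_mul (hUU.fun_add hV)
    (hasDerivAt_const x (sigma3 : Mat2 m))).const_smul (2 * κ)
  have h3 := (hasDerivAt_matrix_mul hUU hU).const_smul (2 : ℂ)
  have h4 := hasDerivAt_matrix_mul hV hU
  have h5 := hasDerivAt_matrix_mul hU hV
  refine (((((h1.fun_sub h2).fun_sub hX).fun_add h3).fun_add h4).fun_sub h5).congr_deriv ?_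
  simp only [timeMatDeriv, Matrix.mul_zero, add_zero, Matrix.add_mul]
  abel

/-- A solution of the mKdV equation satisfies the zero curvature condition. -/
theorem timeMat_zero_curvature {m : ℕ} (κ : ℂ) {q q₁ q₂ q₃ q' : Mat m}
    (h : q' + q₃ + (3 : ℂ) • (q₁ * qᴴ * q + q * qᴴ * q₁) = 0) :
    timeMatDeriv κ (und q) (und q₁) (und q₂) (und q₃)
        + timeMat κ (und q) (und q₁) (und q₂) * ((-κ) • sigma3 + und q)
      = und q' + ((-κ) • sigma3 + und q) * timeMat κ (und q) (und q₁) (und q₂) := by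
  refine zero_curvature_algebra κ sigma3_mul_self (sigma3_mul_und _) (sigma3_mul_und _)
    (sigma3_mul_und _) ?_
  have e : q' = -q₃ - (3 : ℂ) • (q₁ * qᴴ * q + q * qᴴ * q₁) := by
    rw [eq_sub_iff_add_eq, eq_neg_iff_add_eq_zero, ← h]; abel
  rw [e]
  simp only [und, Matrix.fromBlocks_multiply, Matrix.fromBlocks_neg, Matrix.fromBlocks_add,
    Matrix.fromBlocks_smul]
  congr 1 <;>
  simp only [Matrix.zero_mul, Matrix.mul_zero, add_zero, zero_add, Matrix.mul_neg, Matrix.neg_mul,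
    Matrix.conjTranspose_sub, Matrix.conjTranspose_neg, Matrix.conjTranspose_smul,
    Matrix.conjTranspose_add, Matrix.conjTranspose_mul, Matrix.conjTranspose_conjTranspose,
    Matrix.mul_assoc, smul_zero, neg_zero, star_ofNat, smul_add, smul_neg] <;> abel

theorem und_mul_und {m : ℕ} {A : Mat m} {c : ℂ} (h : A * Aᴴ = c • (1 : Mat m))
    (h' : Aᴴ * A = c • (1 : Mat m)) : und A * und A = (-c) • (1 : Mat2 m) := by
  rw [und, Matrix.fromBlocks_multiply, ← Matrix.fromBlocks_one, Matrix.fromBlocks_smul]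
  simp [h, h']

/-- The time-dependent problem at infinity is a multiple of the scattering problem. -/
theorem timeMat_const {m : ℕ} (κ : ℂ) {A : Mat m} {c : ℂ} (h : A * Aᴴ = c • (1 : Mat m))
    (h' : Aᴴ * A = c • (1 : Mat m)) :
    timeMat κ (und A) 0 0 = (-4 * κ ^ 2 - 2 * c) • ((-κ) • sigma3 + und A) := by
  simp only [timeMat, und_mul_und h h', Matrix.zero_mul, Matrix.mul_zero, add_zero, sub_zero,
    Matrix.smul_mul, Matrix.one_mul]
  module

namespace Potential

variable {m : ℕ} {P : Potential m}

theorem laxM_eq (P : Potential m) (x t : ℝ) (z : ℂ) :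
    P.laxM x t z = (-(Complex.I * P.k z)) • sigma3 + und (P.Q x t) := rfl

theorem laxN_eq (P : Potential m) (x t : ℝ) (z : ℂ) : P.laxN x t z
    = timeMat (Complex.I * P.k z) (und (P.Q x t)) (und (dx P.Q x t)) (und (dx (dx P.Q) x t)) := by
  have h2 : Complex.I ^ 2 = -1 := Complex.I_sq
  have h3 : Complex.I ^ 3 = -Complex.I := Complex.I_pow_three
  simp only [laxN, timeMat, pow_succ (_ : Mat2 m), pow_zero, one_mul]
  simp only [mul_pow, h2, h3]
  congr 6
  · ring_nf
  · ring_nf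
  · ring

theorem sigma3_und_add_lam (P : Potential m) {z : ℂ} (hz : z ≠ 0) (A : Mat m) :
    (-(Complex.I * P.k z)) • sigma3 + und A + (Complex.I * P.lam z) • (1 : Mat2 m)
      = symb P.k₀ A z := by
  rw [symb, sigma3, und, ← Matrix.fromBlocks_one, Matrix.fromBlocks_smul,
    Matrix.fromBlocks_smul, Matrix.fromBlocks_add, Matrix.fromBlocks_add]
  simp only [smul_zero, zero_add, add_zero, smul_neg, neg_smul, neg_neg]
  rw [← neg_smul, ← add_smul, ← add_smul]
  congr 2
  · rw [k, lam]; field_simp; ring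
  · rw [k, lam]; ring

/-- The scattering problem at fixed time, with the boundary condition of a Jost solution. -/
def IsXJost (P : Potential m) (l : Filter ℝ) (s : ℂ) (E : MatH m) (z : ℂ) (t : ℝ)
    (v : ℝ → MatH m) : Prop :=
  (∀ x, HasDerivAt v (P.laxM x t z * v x) x) ∧
    Tendsto (fun x => Complex.exp (s * Complex.I * P.theta x t z) • v x) l (𝓝 E)

theorem IsJost.isXJost {l : Filter ℝ} {s : ℂ} {E : MatH m} {z : ℂ} {f : ℝ → ℝ → MatH m}
    (h : P.IsJost l s E z f) {t : ℝ} (ht : t ∈ P.T) : P.IsXJost l s E z t fun x => f x t :=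
  ⟨fun x => hasDerivAt_matrix.2 ((h t ht).1 x), (h t ht).2.2⟩

/-- Decay of the potential at one end of the line, locally uniformly in time. -/
structure Settles (P : Potential m) (l : Filter ℝ) (A : Mat m) : Prop where
  mul : A * Aᴴ = ((P.k₀ : ℂ) ^ 2) • (1 : Mat m)
  mul' : Aᴴ * A = ((P.k₀ : ℂ) ^ 2) • (1 : Mat m)
  lim : TendstoLocallyUniformlyOn (fun x t => P.Q x t) (fun _ => A) l P.T
  lim_dx : TendstoLocallyUniformlyOn (fun x t => dx P.Q x t) (fun _ => 0) l P.T
  lim_dxx : TendstoLocallyUniformlyOn (fun x t => dx (dx P.Q) x t) (fun _ => 0) l P.T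

section

variable (hP : P.IsSolution)
include hP

theorem IsSolution.settles_right : P.Settles atTop P.Qp :=
  ⟨hP.Qp_mul, hP.Qp_mul', hP.tendsto_right, hP.tendsto_dx_right, hP.tendsto_dxx_right⟩

theorem IsSolution.settles_left : P.Settles atBot P.Qm :=
  ⟨hP.Qm_mul, hP.Qm_mul', hP.tendsto_left, hP.tendsto_dx_left, hP.tendsto_dxx_left⟩

theorem hasDerivAt_Q {t : ℝ} (ht : t ∈ P.T) :
    (∀ x, HasDerivAt (fun y => P.Q y t) (dx P.Q x t) x) ∧
    (∀ x, HasDerivAt (fun y => dx P.Q y t) (dx (dx P.Q) x t) x) ∧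
    ∀ x, HasDerivAt (fun y => dx (dx P.Q) y t) (dx (dx (dx P.Q)) x t) x := by
  have h1 := hasDerivAt_dx (n := 2) (F := P.Q) (t := t) (hP.contDiff_x t ht)
  have h2 := hasDerivAt_dx (n := 1) h1.2
  exact ⟨h1.1, h2.1, (hasDerivAt_dx (n := 0) h2.2).1⟩

theorem hasDerivAt_laxN {t : ℝ} (ht : t ∈ P.T) (x : ℝ) (z : ℂ) :
    HasDerivAt (fun y => P.laxN y t z) (timeMatDeriv (Complex.I * P.k z) (und (P.Q x t))
      (und (dx P.Q x t)) (und (dx (dx P.Q) x t)) (und (dx (dx (dx P.Q)) x t))) x := by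
  obtain ⟨h1, h2, h3⟩ := hasDerivAt_Q hP ht
  simp_rw [laxN_eq]
  exact hasDerivAt_timeMat _ (hasDerivAt_und (h1 x)) (hasDerivAt_und (h2 x)) (hasDerivAt_und (h3 x))

theorem hasDerivAt_laxM {t : ℝ} (ht : t ∈ P.T) (x : ℝ) (z : ℂ) :
    HasDerivAt (fun s => P.laxM x s z) (und (dt P.Q x t)) t := by
  simp_rw [laxM_eq]
  refine (hasDerivAt_und (hasDerivAt_matrix.2 fun i j => ?_)).const_add _
  exact (hP.differentiable_t x t ht i j).hasDerivAt

theorem continuousOn_und_dx {n : ℕ} (hn : n ≤ 3) : ContinuousOn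
    (fun p : ℝ × ℝ => (und ((dx^[n] P.Q) p.1 p.2) : Mat2 m)) (univ ×ˢ P.T) :=
  continuous_und.comp_continuousOn (hP.continuous_dx n hn)

theorem exists_lax_transport {t₁ : ℝ} {a b : ℝ} (hab : t₁ ∈ Icc a b)
    (hT : Icc a b ⊆ P.T) (z : ℂ) {f : ℝ → MatH m}
    (hf : ∀ x, HasDerivAt f (P.laxM x t₁ z * f x) x) :
    ∃ H : ℝ → ℝ → MatH m, (∀ x, H x t₁ = f x) ∧
      (∀ x, ∀ t ∈ Icc a b, HasDerivAt (H x) (P.laxN x t z * H x t) t) ∧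
      ∀ x, ∀ t ∈ Icc a b, HasDerivAt (fun y => H y t) (P.laxM x t z * H x t) x := by
  have hsub : (univ : Set ℝ) ×ˢ Icc a b ⊆ univ ×ˢ P.T := prod_mono_right hT
  have h0 : ContinuousOn (fun p : ℝ × ℝ => (und ((P.Q) p.1 p.2) : Mat2 m)) (univ ×ˢ Icc a b) :=
    (continuousOn_und_dx hP (n := 0) (by norm_num)).mono hsub
  have h1 : ContinuousOn (fun p : ℝ × ℝ => (und ((dx P.Q) p.1 p.2) : Mat2 m)) (univ ×ˢ Icc a b) :=
    (continuousOn_und_dx hP (n := 1) (by norm_num)).mono hsub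
  have h2 : ContinuousOn (fun p : ℝ × ℝ => (und ((dx (dx P.Q)) p.1 p.2) : Mat2 m)) (univ ×ˢ Icc a b) :=
    (continuousOn_und_dx hP (n := 2) (by norm_num)).mono hsub
  have h3 : ContinuousOn (fun p : ℝ × ℝ => (und ((dx (dx (dx P.Q))) p.1 p.2) : Mat2 m)) (univ ×ˢ Icc a b) :=
    (continuousOn_und_dx hP (n := 3) (by norm_num)).mono hsub
  refine exists_transport (M := fun x t => P.laxM x t z) (N := fun x t => P.laxN x t z)
    (Nx := fun x t => timeMatDeriv (Complex.I * P.k z) (und (P.Q x t))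
      (und (dx P.Q x t)) (und (dx (dx P.Q) x t)) (und (dx (dx (dx P.Q)) x t)))
    (Mt := fun x t => und (dt P.Q x t)) hab ?_ ?_ (fun x t ht => hasDerivAt_laxN hP (hT ht) x z)
    (fun x t ht => hasDerivAt_laxM hP (hT ht) x z) (fun x t ht => ?_) hf
  · have : (Function.uncurry fun x t => P.laxN x t z) = fun p : ℝ × ℝ =>
        timeMat (Complex.I * P.k z) (und (P.Q p.1 p.2)) (und (dx P.Q p.1 p.2))
          (und (dx (dx P.Q) p.1 p.2)) := by
      funext p; exact laxN_eq P p.1 p.2 z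
    rw [this]
    exact (continuous_timeMat (m := m) (Complex.I * P.k z)).comp_continuousOn
      (f := fun p : ℝ × ℝ => (und (P.Q p.1 p.2), und (dx P.Q p.1 p.2), und (dx (dx P.Q) p.1 p.2)))
      (h0.prodMk (h1.prodMk h2))
  · exact (continuous_timeMatDeriv (m := m) (Complex.I * P.k z)).comp_continuousOn
      (f := fun p : ℝ × ℝ => (und (P.Q p.1 p.2), und (dx P.Q p.1 p.2), und (dx (dx P.Q) p.1 p.2),
        und (dx (dx (dx P.Q)) p.1 p.2))) (h0.prodMk (h1.prodMk (h2.prodMk h3)))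
  · rw [laxN_eq, laxM_eq]
    exact timeMat_zero_curvature _ (hP.equation x t (hT ht))

end

theorem tendsto_prod_of_locallyUniformly {l : Filter ℝ} {F : ℝ → ℝ → Mat m} {A : Mat m}
    {T K : Set ℝ} (h : TendstoLocallyUniformlyOn F (fun _ => A) l T) (hK : IsCompact K)
    (hKT : K ⊆ T) : Tendsto (fun p : ℝ × ℝ => F p.1 p.2) (l ×ˢ 𝓟 K) (𝓝 A) := by
  have h1 := (tendstoLocallyUniformlyOn_iff_tendstoUniformlyOn_of_compact hK).1 (h.mono hKT)
  rw [tendstoUniformlyOn_iff_tendsto] at h1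
  exact Uniform.tendsto_nhds_right.2 h1

theorem Settles.tendsto_laxN {l : Filter ℝ} {A : Mat m} (h : P.Settles l A) {K : Set ℝ}
    (hK : IsCompact K) (hKT : K ⊆ P.T) (z : ℂ) :
    Tendsto (fun p : ℝ × ℝ => P.laxN p.1 p.2 z) (l ×ˢ 𝓟 K)
      (𝓝 ((4 * P.k z ^ 2 - 2 * (P.k₀ : ℂ) ^ 2) •
        ((-(Complex.I * P.k z)) • sigma3 + und A))) := by
  have h0 := (continuous_und.tendsto _).comp (tendsto_prod_of_locallyUniformly h.lim hK hKT)
  have h1 := (continuous_und.tendsto _).comp (tendsto_prod_of_locallyUniformly h.lim_dx hK hKT)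
  have h2 := (continuous_und.tendsto _).comp (tendsto_prod_of_locallyUniformly h.lim_dxx hK hKT)
  have h3 := ((continuous_timeMat (Complex.I * P.k z)).tendsto _).comp
    (h0.prodMk_nhds (h1.prodMk_nhds h2))
  have hz : (und 0 : Mat2 m) = 0 := by simp [und]
  simp only [hz] at h3
  rw [timeMat_const _ h.mul h.mul'] at h3
  have e : -4 * (Complex.I * P.k z) ^ 2 - 2 * (P.k₀ : ℂ) ^ 2
      = 4 * P.k z ^ 2 - 2 * (P.k₀ : ℂ) ^ 2 := by
    rw [mul_pow, Complex.I_sq]; ring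
  rw [e] at h3
  refine h3.congr fun p => ?_
  rw [laxN_eq]
  rfl

/-- Jost solutions of the scattering problem that are unique at each time satisfy the
time-dependent problem. -/
theorem isJost_of_isXJost (hP : P.IsSolution) {l : Filter ℝ} {A : Mat m} (hl : P.Settles l A)
    {s : ℂ} {E : MatH m} {z : ℂ}
    (hE : (s * Complex.I * P.lam z) • E + ((-(Complex.I * P.k z)) • sigma3 + und A) * E = 0)
    (huniq : ∀ t ∈ P.T, ∀ v v', P.IsXJost l s E z t v → P.IsXJost l s E z t v' → v = v')
    {f : ℝ → ℝ → MatH m} (hf : ∀ t ∈ P.T, P.IsXJost l s E z t fun x => f x t) :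
    P.IsJost l s E z f := by
  intro t₁ ht₁
  refine ⟨fun x => hasDerivAt_matrix.1 ((hf t₁ ht₁).1 x), fun x => ?_, (hf t₁ ht₁).2⟩
  obtain ⟨r, hr, hball⟩ := Metric.isOpen_iff.1 hP.isOpen_T t₁ ht₁
  set a := t₁ - r / 2 with ha
  set b := t₁ + r / 2 with hb
  have hab : t₁ ∈ Icc a b := ⟨by linarith, by linarith⟩
  have hT : Icc a b ⊆ P.T := fun y hy => hball (by
    rw [Metric.mem_ball, Real.dist_eq, abs_lt]
    exact ⟨by linarith [hy.1], by linarith [hy.2]⟩)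
  obtain ⟨H, hH1, hHt, hHx⟩ := exists_lax_transport hP hab hT z (hf t₁ ht₁).1
  set ω := 4 * P.k z ^ 2 - 2 * (P.k₀ : ℂ) ^ 2 with hω
  set N₀ := ω • ((-(Complex.I * P.k z)) • sigma3 + und A : Mat2 m) with hN₀
  set c : ℝ := (Fintype.card (Fin m ⊕ Fin m) : ℝ)
  have hc0 : 0 ≤ c := Nat.cast_nonneg _
  set K := max 1 (‖s * Complex.I * P.lam z * ω‖ + c * (‖N₀‖ + 1))
  -- At infinity the time matrix is `ω` times the scattering matrix, and `E` consists of
  -- eigenvectors; the drift of `e^{siθ}` in time cancels exactly, so `E` stays the boundary value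
  -- at neighbouring times.
  have hNE : (s * Complex.I * P.lam z * ω) • E + N₀ * E = 0 := by
    rw [hN₀, Matrix.smul_mul, mul_comm _ ω, mul_smul, ← smul_add, hE, smul_zero]
  have hlim : ∀ t ∈ Icc a b,
      Tendsto (fun x => Complex.exp (s * Complex.I * P.theta x t z) • H x t) l (𝓝 E) := by
    intro t ht
    rw [Metric.tendsto_nhds]
    intro ε hε
    set C := (1 + c * ‖E‖) * Real.exp (K * |t - t₁|)
    have hC : 0 < C := by positivity
    set η := min 1 (ε / (2 * C))
    have hη : 0 < η := by positivity
    have hηC : η * C < ε := by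
      have := min_le_right 1 (ε / (2 * C))
      rw [le_div_iff₀ (by positivity)] at this
      linarith
    have hN := Metric.tendsto_nhds.1 (hl.tendsto_laxN isCompact_Icc hT z) η hη
    rw [eventually_prod_principal_iff] at hN
    have h0 := Metric.tendsto_nhds.1 (hf t₁ ht₁).2 η hη
    filter_upwards [hN, h0] with x hNx h0x
    set e : ℝ → ℂ := fun τ => Complex.exp (s * Complex.I * P.theta x τ z) with he
    have hed : ∀ τ, HasDerivAt e (s * Complex.I * P.lam z * ω * e τ) τ := by
      intro τ
      have h1 : HasDerivAt (fun τ : ℝ => s * Complex.I * P.theta x τ z)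
          (s * Complex.I * (P.lam z * (ω * 1))) τ := by
        unfold theta
        exact ((((Complex.ofRealCLM.hasDerivAt (x := τ)).const_mul ω).const_add _).const_mul
          _).const_mul _
      exact h1.cexp.congr_deriv (by simp only [he]; ring)
    set d : ℝ → MatH m := fun τ => e τ • H x τ - E
    have hdd : ∀ τ ∈ Icc a b, HasDerivAt d ((s * Complex.I * P.lam z * ω) • d τ
        + P.laxN x τ z * d τ + (P.laxN x τ z - N₀) * E) τ := by
      intro τ hτ
      refine (((hed τ).smul (hHt x τ hτ)).sub_const E).congr_deriv ?_
      have h1 : N₀ * E = -((s * Complex.I * P.lam z * ω) • E) :=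
        eq_neg_of_add_eq_zero_right hNE
      simp only [d, Matrix.mul_sub, Matrix.sub_mul, h1, Matrix.mul_smul, smul_sub, smul_smul]
      abel
    have hmain := norm_le_gronwallBound_of_abs ordConnected_Icc hdd (δ := η) (K := K)
      (ε := c * η * ‖E‖) hab ht (by
        simp only [d, hH1, he]
        rw [← dist_eq_norm]
        exact h0x.le) (fun τ hτ => ?_)
    · rw [dist_eq_norm]
      refine lt_of_le_of_lt (hmain.trans (gronwallBound_le_of_one_le (le_max_left _ _)
        (by positivity) (abs_nonneg _))) ?_
      refine lt_of_eq_of_lt ?_ hηC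
      simp only [C]; ring
    · have hτ' : τ ∈ Icc a b := ordConnected_Icc.uIcc_subset hab ht hτ
      have h2 := hNx τ hτ'
      rw [dist_eq_norm] at h2
      have h3 : ‖P.laxN x τ z‖ ≤ ‖N₀‖ + 1 := by
        have := norm_sub_norm_le (P.laxN x τ z) N₀
        have := min_le_left 1 (ε / (2 * C))
        linarith
      refine (norm_add_le _ _).trans (add_le_add ((norm_add_le _ _).trans ?_) ?_)
      · rw [norm_smul]
        have h4 := norm_matrix_mul_le (P.laxN x τ z) (d τ)
        have h5 : c * ‖P.laxN x τ z‖ * ‖d τ‖ ≤ c * (‖N₀‖ + 1) * ‖d τ‖ := by gcongr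
        have h6 := mul_le_mul_of_nonneg_right
          (le_max_right 1 (‖s * Complex.I * P.lam z * ω‖ + c * (‖N₀‖ + 1))) (norm_nonneg (d τ))
        rw [add_mul] at h6
        exact (add_le_add le_rfl (h4.trans h5)).trans h6
      · refine (norm_matrix_mul_le _ _).trans ?_
        gcongr
  -- The transported solution satisfies the same boundary value problem at each time as `f`; by
  -- uniqueness they agree, so `f` inherits the time equation.
  have heq : ∀ t ∈ Icc a b, H x t = f x t := fun t ht =>
    congrFun (huniq t (hT ht) (fun y => H y t) (fun y => f y t)
      ⟨fun y => hHx y t ht, hlim t ht⟩ (hf t (hT ht))) x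
  have hnhds : Icc a b ∈ 𝓝 t₁ :=
    Icc_mem_nhds (by linarith) (by linarith)
  have h1 := hHt x t₁ hab
  rw [heq t₁ hab] at h1
  refine hasDerivAt_matrix.1 (h1.congr_of_eventuallyEq ?_)
  filter_upwards [hnhds] with t ht using (heq t ht).symm

end Potential

/-! ### The conjugation symmetry -/

section Conjugation

variable {m : ℕ}

/-- The antilinear symmetry `(u, d) ↦ (-d*, u*)` of the Lax pair of a symmetric potential. -/
def jconj (B : MatH m) : MatH m :=
  Matrix.fromRows (-(B.toRows₂).map star) ((B.toRows₁).map star)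

@[simp] theorem jconj_toRows₁ (B : MatH m) : (jconj B).toRows₁ = -(B.toRows₂).map star := rfl

@[simp] theorem jconj_toRows₂ (B : MatH m) : (jconj B).toRows₂ = (B.toRows₁).map star := rfl

theorem ext_rows {B C : MatH m} (h₁ : B.toRows₁ = C.toRows₁) (h₂ : B.toRows₂ = C.toRows₂) :
    B = C := by
  rw [mul_fromRows_one B, mul_fromRows_one C, h₁, h₂]

theorem toRows_mul (B : MatH m) (C : Mat m) :
    (B * C).toRows₁ = B.toRows₁ * C ∧ (B * C).toRows₂ = B.toRows₂ * C := ⟨rfl, rfl⟩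

theorem map_star_mul (B C : Mat m) : (B * C).map star = B.map star * C.map star := by
  ext i j; simp [Matrix.mul_apply]

theorem jconj_mul (B : MatH m) (C : Mat m) : jconj (B * C) = jconj B * C.map star := by
  refine ext_rows ?_ ?_
  · rw [jconj_toRows₁, (toRows_mul _ _).2, (toRows_mul _ _).1, map_star_mul, jconj_toRows₁,
      Matrix.neg_mul]
  · rw [jconj_toRows₂, (toRows_mul _ _).1, (toRows_mul _ _).2, map_star_mul, jconj_toRows₂]

theorem jconj_smul (c : ℂ) (B : MatH m) : jconj (c • B) = conj c • jconj B := by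
  refine ext_rows ?_ ?_ <;> ext i j <;> simp [jconj, Matrix.toRows₁, Matrix.toRows₂]

theorem jconj_neg (B : MatH m) : jconj (-B) = -jconj B := by
  refine ext_rows ?_ ?_ <;> ext i j <;> simp [jconj, Matrix.toRows₁, Matrix.toRows₂]

theorem jconj_jconj (B : MatH m) : jconj (jconj B) = -B := by
  refine ext_rows ?_ ?_ <;> ext i j <;> simp [jconj, Matrix.toRows₁, Matrix.toRows₂]

theorem continuous_jconj : Continuous (jconj : MatH m → MatH m) := by
  refine continuous_matrix fun i j => ?_
  rcases i with i | i
  · exact ((continuous_id.matrix_elem (Sum.inr i) j).star).neg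
  · exact (continuous_id.matrix_elem (Sum.inl i) j).star

theorem hasDerivAt_jconj {w : ℝ → MatH m} {w' : MatH m} {x : ℝ} (h : HasDerivAt w w' x) :
    HasDerivAt (fun y => jconj (w y)) (jconj w') x := by
  rw [hasDerivAt_matrix] at h ⊢
  rintro (i | i) j
  · exact ((h (Sum.inr i) j).star).fun_neg
  · exact (h (Sum.inl i) j).star

theorem map_star_eq_of_transpose {A : Mat m} (hA : Aᵀ = A) : A.map star = Aᴴ := by
  rw [Matrix.conjTranspose, hA]

theorem conjTranspose_map_star {A : Mat m} (hA : Aᵀ = A) : Aᴴ.map star = A := by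
  ext i j
  simpa using (congrFun (congrFun hA j) i).symm

/-- The reflection `z ↦ -k₀² / z*` of the uniformization variable. -/
def reflK (k₀ : ℝ) (z : ℂ) : ℂ := -((k₀ : ℂ) ^ 2) / conj z

theorem jconj_fromRows (u d : Mat m) :
    jconj (Matrix.fromRows u d) = Matrix.fromRows (-d.map star) (u.map star) := rfl

theorem map_star_smul (c : ℂ) (B : Mat m) : (c • B).map star = conj c • B.map star := by
  ext i j; simp

theorem map_star_add (B C : Mat m) : (B + C).map star = B.map star + C.map star := by
  ext i j; simp

theorem map_star_neg (B : Mat m) : (-B).map star = -B.map star := by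
  ext i j; simp

/-- The antilinear map exchanges the two blocks, and reflection followed by conjugation exchanges
the two diagonal coefficients `i k₀²/z` and `iz`. Symmetry of `q` turns its entrywise conjugate into
`q†`. -/
theorem jconj_symb {k₀ : ℝ} (hk : 0 < k₀) {q : Mat m} (hq : qᵀ = q) {z : ℂ} (hz : z ≠ 0)
    (B : MatH m) : jconj (symb k₀ q (reflK k₀ z) * B) = symb k₀ q z * jconj B := by
  have hk' : (k₀ : ℂ) ≠ 0 := by exact_mod_cast hk.ne'
  have hz' : conj z ≠ 0 := (map_ne_zero _).2 hz
  rw [symb_mul, symb_mul, jconj_fromRows, jconj_toRows₁, jconj_toRows₂]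
  simp only [map_star_add, map_star_neg, map_star_smul, map_star_mul, map_star_eq_of_transpose hq,
    conjTranspose_map_star hq]
  have e1 : conj (Complex.I * reflK k₀ z) = Complex.I * (k₀ : ℂ) ^ 2 / z := by
    simp only [reflK, map_mul, map_div₀, map_neg, map_pow, Complex.conj_I, Complex.conj_ofReal,
      Complex.conj_conj]
    ring
  have e2 : conj (Complex.I * (k₀ : ℂ) ^ 2 / reflK k₀ z) = Complex.I * z := by
    simp only [reflK, map_mul, map_div₀, map_neg, map_pow, Complex.conj_I, Complex.conj_ofReal,
      Complex.conj_conj]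
    field_simp
  rw [e1, e2]
  congr 1
  · rw [smul_neg]; abel
  · rw [Matrix.mul_neg, neg_neg]; abel

theorem jconj_sigma3_und (κ : ℂ) {q : Mat m} (hq : qᵀ = q) (B : MatH m) :
    jconj ((κ • sigma3 + und q) * B) = ((-conj κ) • sigma3 + und q) * jconj B := by
  have hB : jconj B = Matrix.fromRows (-(B.toRows₂).map star) ((B.toRows₁).map star) := rfl
  rw [hB]
  conv_lhs => rw [mul_fromRows_one B]
  simp only [sigma3, und, Matrix.fromBlocks_smul, Matrix.fromBlocks_add,
    Matrix.fromBlocks_mul_fromRows, jconj_fromRows]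
  simp only [smul_zero, zero_add, add_zero, map_star_add, map_star_neg, map_star_smul,
    map_star_mul, Matrix.smul_mul, Matrix.neg_mul, Matrix.one_mul, smul_neg, map_star_neg,
    map_star_eq_of_transpose hq, conjTranspose_map_star hq, Matrix.mul_neg, neg_smul, neg_neg,
    neg_add_rev]
  congr 1
  abel

theorem jconj_E₁ {A : Mat m} (hA : Aᵀ = A) (z : ℂ) : jconj (E₁ A (conj z)) = E₂ A z := by
  rw [E₁, E₂, jconj_fromRows, map_star_smul, conjTranspose_map_star hA]
  congr 1
  · simp [neg_div]
  · ext i j; simp [Matrix.one_apply, apply_ite]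

theorem jconj_E₁_mul {k₀ : ℝ} (hk : 0 < k₀) {A : Mat m} (hA : Aᵀ = A)
    (hAA : A * Aᴴ = ((k₀ : ℂ) ^ 2) • (1 : Mat m)) {z : ℂ} (hz : z ≠ 0) :
    jconj (E₁ A (reflK k₀ z)) * ((-(Complex.I / z)) • Aᴴ) = E₁ A z := by
  have hk' : (k₀ : ℂ) ≠ 0 := by exact_mod_cast hk.ne'
  have e : reflK k₀ z = conj (-((k₀ : ℂ) ^ 2) / z) := by simp [reflK]
  rw [e, jconj_E₁ hA, E₂, E₁, Matrix.fromRows_mul, Matrix.one_mul, Matrix.mul_smul,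
    Matrix.smul_mul, hAA, smul_smul, smul_smul]
  congr 1
  convert one_smul ℂ (1 : Mat m) using 2
  field_simp
  simp

/-- In particular reflection preserves `Im λ`, hence each of the regions where the eigenfunctions
are defined. -/
theorem lamK_reflK {k₀ : ℝ} (hk : 0 < k₀) {z : ℂ} (hz : z ≠ 0) :
    lamK k₀ (reflK k₀ z) = -conj (lamK k₀ z) := by
  have hk' : (k₀ : ℂ) ≠ 0 := by exact_mod_cast hk.ne'
  have hz' : conj z ≠ 0 := (map_ne_zero _).2 hz
  simp only [lamK, reflK, map_div₀, map_add, map_pow, Complex.conj_ofReal, Complex.conj_ofNat]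
  field_simp
  ring

theorem reflK_ne_zero {k₀ : ℝ} (hk : 0 < k₀) {z : ℂ} (hz : z ≠ 0) : reflK k₀ z ≠ 0 := by
  have hk' : (k₀ : ℂ) ≠ 0 := by exact_mod_cast hk.ne'
  exact div_ne_zero (neg_ne_zero.2 (pow_ne_zero 2 hk')) ((map_ne_zero _).2 hz)

theorem reflK_reflK {k₀ : ℝ} (hk : 0 < k₀) {z : ℂ} (hz : z ≠ 0) :
    reflK k₀ (reflK k₀ z) = z := by
  have hk' : (k₀ : ℂ) ≠ 0 := by exact_mod_cast hk.ne'
  have hz' : conj z ≠ 0 := (map_ne_zero _).2 hz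
  simp only [reflK, map_div₀, map_neg, map_pow, Complex.conj_ofReal, Complex.conj_conj]
  field_simp

theorem reflK_mem_Hclosed {k₀ : ℝ} (hk : 0 < k₀) {z : ℂ} (hz : z ∈ Hclosed k₀) :
    reflK k₀ z ∈ Hclosed k₀ := by
  refine ⟨reflK_ne_zero hk hz.1, ?_⟩
  rw [lamK_reflK hk hz.1]
  simpa using hz.2

/-- The symmetry of Jost solutions under `z ↦ -k₀² / z*`. -/
theorem Wing.jost_reflK {W : Wing m} (hW : W.Good) (hq : ∀ x, (W.q x)ᵀ = W.q x) (hA : W.Aᵀ = W.A)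
    {z : ℂ} (hz : z ∈ Hclosed W.k₀) (hl : lamK W.k₀ z ≠ 0) (x : ℝ) :
    W.jost z x = jconj (W.jost (reflK W.k₀ z) x) * ((-(Complex.I / z)) • W.Aᴴ) := by
  have hk := hW.k₀_pos
  have hr := reflK_mem_Hclosed hk hz
  refine (congrFun (Wing.jost_unique hW hz hl
    (w := fun x => jconj (W.jost (reflK W.k₀ z) x) * ((-(Complex.I / z)) • W.Aᴴ))
    (fun y => ?_) ?_) x).symm
  · have h := hasDerivAt_matrix_mul (hasDerivAt_jconj (Wing.hasDerivAt_jost hW hr y))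
      (hasDerivAt_const y ((-(Complex.I / z)) • W.Aᴴ))
    refine h.congr_deriv ?_
    rw [Matrix.mul_zero, add_zero, jconj_symb hk (hq y) hz.1, Matrix.mul_assoc]
  · have hc : Continuous fun B : MatH m => jconj B * ((-(Complex.I / z)) • W.Aᴴ) :=
      continuous_jconj.matrix_mul continuous_const
    have := (hc.tendsto _).comp (Wing.tendsto_jost hW hr)
    rwa [jconj_E₁_mul hk hA hW.mul hz.1] at this

end Conjugation

/-! ### Jost eigenfunctions in terms of wings -/

namespace Potential

variable {m : ℕ} {P : Potential m}

/-- The potential at time `t`, seen from `-∞`. -/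
def leftWing (P : Potential m) (t : ℝ) : Wing m := ⟨P.k₀, fun x => P.Q x t, P.Qm⟩

/-- The potential at time `t`, seen from `+∞`. -/
def rightWing (P : Potential m) (t : ℝ) : Wing m := ⟨P.k₀, fun x => -P.Q (-x) t, -P.Qp⟩

theorem norm_le_sum_entries (B : Mat m) : ‖B‖ ≤ ∑ i, ∑ j, ‖B i j‖ := by
  refine (matrix_norm_le_iff (by positivity)).2 fun i j => ?_
  refine le_trans ?_ (Finset.single_le_sum (f := fun i => ∑ j, ‖B i j‖)
    (fun i _ => by positivity) (Finset.mem_univ i))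
  exact Finset.single_le_sum (f := fun j => ‖B i j‖) (fun j _ => norm_nonneg _) (Finset.mem_univ j)

theorem wint_of_entries {f : ℝ → Mat m} (hf : Continuous f)
    (h : ∀ c : ℝ, ∀ i j, IntegrableOn (fun x : ℝ => (1 + |x|) * ‖f x i j‖) (Iio c)) : WInt f := by
  refine ⟨hf, fun c => ?_⟩
  rw [integrableOn_Iic_iff_integrableOn_Iio]
  have h1 : IntegrableOn (fun x : ℝ => ∑ i, ∑ j, (1 + |x|) * ‖f x i j‖) (Iio c) :=
    integrable_finsetSum _ fun i _ => integrable_finsetSum _ fun j _ => h c i j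
  refine h1.mono' ((continuous_const.add continuous_abs).mul hf.norm).aestronglyMeasurable
    (Eventually.of_forall fun x => ?_)
  rw [Real.norm_of_nonneg (by positivity)]
  simp_rw [← Finset.mul_sum]
  exact mul_le_mul_of_nonneg_left (norm_le_sum_entries _) (by positivity)

section

variable (hP : P.IsSolution)
include hP

theorem continuous_dxQ {t : ℝ} (ht : t ∈ P.T) : Continuous fun x => dx P.Q x t := by
  exact continuous_iff_continuousAt.2 fun x => ((hasDerivAt_Q hP ht).2.1 x).continuousAt

theorem continuous_Q {t : ℝ} (ht : t ∈ P.T) : Continuous fun x => P.Q x t := by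
  exact continuous_iff_continuousAt.2 fun x => ((hasDerivAt_Q hP ht).1 x).continuousAt

theorem leftWing_good {t : ℝ} (ht : t ∈ P.T) : (P.leftWing t).Good where
  k₀_pos := hP.k₀_pos
  mul := hP.Qm_mul
  mul' := hP.Qm_mul'
  wint := wint_of_entries ((continuous_Q hP ht).sub continuous_const)
    fun c i j => hP.integrable_left t ht c i j
  diff := ⟨fun x => dx P.Q x t, continuous_dxQ hP ht, (hasDerivAt_Q hP ht).1⟩

theorem rightWing_good {t : ℝ} (ht : t ∈ P.T) : (P.rightWing t).Good where
  k₀_pos := hP.k₀_pos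
  mul := by simpa [rightWing] using hP.Qp_mul
  mul' := by simpa [rightWing] using hP.Qp_mul'
  wint := by
    refine wint_of_entries ?_ fun c i j => ?_
    · exact (((continuous_Q hP ht).comp continuous_neg).neg).sub continuous_const
    · have h := hP.integrable_right t ht (-c) i j
      have hpre : (Neg.neg : ℝ → ℝ) ⁻¹' Ioi (-c) = Iio c := by ext; simp
      have h2 := ((Measure.measurePreserving_neg (volume : Measure ℝ)).integrableOn_comp_preimage
        (MeasurableEquiv.neg ℝ).measurableEmbedding).2 h
      rw [hpre] at h2
      refine h2.congr (Eventually.of_forall fun x => ?_)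
      simp only [Function.comp, rightWing, abs_neg, Matrix.sub_apply, Matrix.neg_apply]
      congr 1
      rw [← norm_neg]; congr 1; ring
  diff := by
    refine ⟨fun x => dx P.Q (-x) t, (continuous_dxQ hP ht).comp continuous_neg, fun x => ?_⟩
    have h := (((hasDerivAt_Q hP ht).1 (-x)).scomp x (hasDerivAt_neg x)).fun_neg
    refine h.congr_deriv ?_
    simp

theorem Qp_symm : P.Qpᵀ = P.Qp := by
  obtain ⟨t, ht⟩ := hP.isConnected_T.nonempty
  have h1 := (hP.tendsto_right.tendsto_at ht)
  have h2 : Tendsto (fun x => (P.Q x t)ᵀ) atTop (𝓝 P.Qpᵀ) :=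
    ((continuous_id.matrix_transpose).tendsto _).comp h1
  refine tendsto_nhds_unique h2 (h1.congr fun x => ?_)
  exact (hP.symm x t ht).symm

theorem Qm_symm : P.Qmᵀ = P.Qm := by
  obtain ⟨t, ht⟩ := hP.isConnected_T.nonempty
  have h1 := (hP.tendsto_left.tendsto_at ht)
  have h2 : Tendsto (fun x => (P.Q x t)ᵀ) atBot (𝓝 P.Qmᵀ) :=
    ((continuous_id.matrix_transpose).tendsto _).comp h1
  refine tendsto_nhds_unique h2 (h1.congr fun x => ?_)
  exact (hP.symm x t ht).symm

end

/-- `V̄` at time `t`, extended to the whole region `Im λ ≤ 0`. -/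
def vbar (P : Potential m) (t : ℝ) (z : ℂ) (x : ℝ) : MatH m := (P.rightWing t).jost (-z) (-x)

/-- `Ŵ` at time `t`, extended to the whole region `Im λ ≥ 0`. -/
def what (P : Potential m) (t : ℝ) (z : ℂ) (x : ℝ) : MatH m := (P.leftWing t).jost z x

/-- The region `Im λ ≤ 0`, `z ≠ 0`. -/
def Hlow (k₀ : ℝ) : Set ℂ := {z | -z ∈ Hclosed k₀}

theorem lamK_neg (k₀ : ℝ) (z : ℂ) : lamK k₀ (-z) = -lamK k₀ z := by
  simp only [lamK, div_neg]; ring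

theorem mem_Hlow {k₀ : ℝ} {z : ℂ} : z ∈ Hlow k₀ ↔ z ≠ 0 ∧ (lamK k₀ z).im ≤ 0 := by
  simp [Hlow, Hclosed, lamK_neg]

theorem lamK_conj (k₀ : ℝ) (z : ℂ) : lamK k₀ (conj z) = conj (lamK k₀ z) := by
  simp [lamK, Complex.conj_ofNat]

theorem conj_mem_Hlow {k₀ : ℝ} {z : ℂ} (hz : z ∈ Hclosed k₀) : conj z ∈ Hlow k₀ := by
  rw [mem_Hlow, lamK_conj]
  exact ⟨(map_ne_zero _).2 hz.1, by simpa using hz.2⟩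

theorem conj_mem_Hclosed {k₀ : ℝ} {z : ℂ} (hz : z ∈ Hlow k₀) : conj z ∈ Hclosed k₀ := by
  rw [mem_Hlow] at hz
  refine ⟨(map_ne_zero _).2 hz.1, ?_⟩
  rw [lamK_conj]
  simpa using hz.2

/-- Explains the signs in `rightWing` and `vbar`: the sign produced by `x ↦ -x` is absorbed by `z ↦
-z`, `q ↦ -q`, so solutions normalized at `+∞` reduce to those normalized at `-∞`. -/
theorem symb_neg (k₀ : ℝ) (q : Mat m) (z : ℂ) : symb k₀ (-q) (-z) = -symb k₀ q z := by
  simp only [symb, Matrix.fromBlocks_neg, div_neg, mul_neg, neg_smul, Matrix.conjTranspose_neg]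

theorem E₁_neg (A : Mat m) (z : ℂ) : E₁ (-A) (-z) = E₁ A z := by
  simp [E₁, div_neg]

section

variable (hP : P.IsSolution) {t : ℝ} (ht : t ∈ P.T)
include hP ht

theorem hasDerivAt_vbar {z : ℂ} (hz : z ∈ Hlow P.k₀) (x : ℝ) :
    HasDerivAt (P.vbar t z) (symb P.k₀ (P.Q x t) z * P.vbar t z x) x := by
  have h := (Wing.hasDerivAt_jost (rightWing_good hP ht) (z := -z) hz (-x)).scomp x
    (hasDerivAt_neg x)
  refine h.congr_deriv ?_
  simp only [rightWing, neg_neg, symb_neg]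
  simp [vbar, rightWing]

theorem hasDerivAt_what {z : ℂ} (hz : z ∈ Hclosed P.k₀) (x : ℝ) :
    HasDerivAt (P.what t z) (symb P.k₀ (P.Q x t) z * P.what t z x) x :=
  Wing.hasDerivAt_jost (leftWing_good hP ht) hz x

theorem tendsto_vbar {z : ℂ} (hz : z ∈ Hlow P.k₀) :
    Tendsto (P.vbar t z) atTop (𝓝 (E₁ P.Qp z)) := by
  have h := (Wing.tendsto_jost (rightWing_good hP ht) (z := -z) hz).comp tendsto_neg_atTop_atBot
  simp only [rightWing, E₁_neg] at h
  exact h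

theorem tendsto_what {z : ℂ} (hz : z ∈ Hclosed P.k₀) :
    Tendsto (P.what t z) atBot (𝓝 (E₁ P.Qm z)) :=
  Wing.tendsto_jost (leftWing_good hP ht) hz

theorem what_unique {z : ℂ} (hz : z ∈ Hclosed P.k₀) (hl : lamK P.k₀ z ≠ 0) {w : ℝ → MatH m}
    (hw : ∀ x, HasDerivAt w (symb P.k₀ (P.Q x t) z * w x) x)
    (hlim : Tendsto w atBot (𝓝 (E₁ P.Qm z))) : w = P.what t z :=
  Wing.jost_unique (leftWing_good hP ht) hz hl hw hlim

theorem vbar_unique {z : ℂ} (hz : z ∈ Hlow P.k₀) (hl : lamK P.k₀ z ≠ 0) {w : ℝ → MatH m}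
    (hw : ∀ x, HasDerivAt w (symb P.k₀ (P.Q x t) z * w x) x)
    (hlim : Tendsto w atTop (𝓝 (E₁ P.Qp z))) : w = P.vbar t z := by
  have h := Wing.jost_unique (rightWing_good hP ht) (z := -z) hz
    (by simpa [rightWing, lamK_neg] using hl) (w := fun x => w (-x)) (fun x => ?_) ?_
  · funext x
    rw [vbar, ← h]
    exact congrArg w (neg_neg x).symm
  · refine ((hw (-x)).scomp x (hasDerivAt_neg x)).congr_deriv ?_
    simp [rightWing, symb_neg]
  · have := hlim.comp tendsto_neg_atBot_atTop
    simp only [rightWing, E₁_neg]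
    exact this

end

/-! ### The Jost eigenfunctions -/

theorem hasDerivAt_theta (P : Potential m) (x t : ℝ) (z : ℂ) :
    HasDerivAt (fun y => P.theta y t z) (P.lam z) x := by
  unfold theta
  exact (((Complex.ofRealCLM.hasDerivAt (x := x)).add_const _).const_mul (P.lam z)).congr_deriv
    (by simp)

theorem hasDerivAt_exp_theta_smul {v : ℝ → MatH m} {A : Mat2 m} {x t : ℝ} {z : ℂ} (c : ℂ)
    (h : HasDerivAt v (A * v x) x) :
    HasDerivAt (fun y => Complex.exp (c * P.theta y t z) • v y)
      ((A + (c * P.lam z) • 1) * (Complex.exp (c * P.theta x t z) • v x)) x := by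
  refine ((((P.hasDerivAt_theta x t z).const_mul c).cexp).smul h).congr_deriv ?_
  rw [Matrix.add_mul, Matrix.mul_smul, Matrix.smul_mul, Matrix.one_mul, smul_smul]
  congr 2
  ring

theorem IsXJost.normalized {l : Filter ℝ} {E : MatH m} {z : ℂ} (hz : z ≠ 0) {t : ℝ}
    {v : ℝ → MatH m} (h : P.IsXJost l 1 E z t v) :
    (∀ x, HasDerivAt (fun y => Complex.exp (Complex.I * P.theta y t z) • v y)
      (symb P.k₀ (P.Q x t) z * (Complex.exp (Complex.I * P.theta x t z) • v x)) x) ∧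
    Tendsto (fun x => Complex.exp (Complex.I * P.theta x t z) • v x) l (𝓝 E) := by
  refine ⟨fun x => ?_, by simpa only [one_mul] using h.2⟩
  have := hasDerivAt_exp_theta_smul (P := P) (t := t) (z := z) Complex.I (h.1 x)
  rwa [laxM_eq, sigma3_und_add_lam P hz] at this

theorem isXJost_of_normalized {l : Filter ℝ} {E : MatH m} {z : ℂ} (hz : z ≠ 0) {t : ℝ}
    {w : ℝ → MatH m} (h : ∀ x, HasDerivAt w (symb P.k₀ (P.Q x t) z * w x) x)
    (hlim : Tendsto w l (𝓝 E)) :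
    P.IsXJost l 1 E z t fun x => Complex.exp (-(Complex.I * P.theta x t z)) • w x := by
  refine ⟨fun x => ?_, hlim.congr fun x => ?_⟩
  · have := hasDerivAt_exp_theta_smul (P := P) (t := t) (z := z) (-Complex.I) (h x)
    rw [← sigma3_und_add_lam P hz, add_assoc, ← add_smul, neg_mul, add_neg_cancel, zero_smul,
      add_zero, ← laxM_eq] at this
    simpa only [neg_mul] using this
  · rw [smul_smul, ← Complex.exp_add, one_mul, add_neg_cancel, Complex.exp_zero, one_smul]

theorem lam_conj (P : Potential m) (z : ℂ) : P.lam (conj z) = conj (P.lam z) := lamK_conj P.k₀ z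

theorem k_conj (P : Potential m) (z : ℂ) : P.k (conj z) = conj (P.k z) := by
  simp [k, Complex.conj_ofNat]

theorem theta_conj (P : Potential m) (x t : ℝ) (z : ℂ) :
    P.theta x t (conj z) = conj (P.theta x t z) := by
  simp only [theta, lam_conj, k_conj, map_mul, map_add, map_sub, map_pow, Complex.conj_ofReal,
    Complex.conj_ofNat]

theorem jconj_laxM {x t : ℝ} (hQ : (P.Q x t)ᵀ = P.Q x t) (z : ℂ) (B : MatH m) :
    jconj (P.laxM x t (conj z) * B) = P.laxM x t z * jconj B := by
  rw [laxM_eq, laxM_eq, jconj_sigma3_und _ hQ, k_conj]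
  congr 3
  simp

theorem IsXJost.jconj {l : Filter ℝ} {s : ℂ} {E : MatH m} {z : ℂ} {t : ℝ}
    (hQ : ∀ x, (P.Q x t)ᵀ = P.Q x t) {v : ℝ → MatH m} (h : P.IsXJost l s E (conj z) t v) :
    P.IsXJost l (-conj s) (jconj E) z t fun x => jconj (v x) := by
  refine ⟨fun x => ?_, ?_⟩
  · have := hasDerivAt_jconj (h.1 x)
    rwa [jconj_laxM (hQ x)] at this
  · have := (continuous_jconj.tendsto _).comp h.2
    refine this.congr fun x => ?_
    rw [Function.comp_apply, jconj_smul, ← Complex.exp_conj, theta_conj]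
    simp

theorem IsXJost.neg {l : Filter ℝ} {s : ℂ} {E : MatH m} {z : ℂ} {t : ℝ}
    {v : ℝ → MatH m} (h : P.IsXJost l s E z t v) :
    P.IsXJost l s (-E) z t fun x => -v x := by
  refine ⟨fun x => ?_, ?_⟩
  · have := (h.1 x).fun_neg
    rwa [← Matrix.mul_neg] at this
  · simpa only [smul_neg] using h.2.neg

theorem jost_condition_E₁ (P : Potential m) {A : Mat m}
    (hA : A * Aᴴ = ((P.k₀ : ℂ) ^ 2) • (1 : Mat m)) {z : ℂ} (hz : z ≠ 0) :
    (1 * Complex.I * P.lam z) • E₁ A z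
      + ((-(Complex.I * P.k z)) • sigma3 + und A) * E₁ A z = 0 := by
  rw [← symb_mul_E₁ hA hz, ← sigma3_und_add_lam P hz, one_mul]
  simp only [Matrix.add_mul, Matrix.smul_mul, Matrix.one_mul]
  abel

theorem jost_condition_E₂ (P : Potential m) {A : Mat m}
    (hA : A * Aᴴ = ((P.k₀ : ℂ) ^ 2) • (1 : Mat m)) (hAs : Aᵀ = A) {z : ℂ} (hz : z ≠ 0) :
    (-1 * Complex.I * P.lam z) • E₂ A z
      + ((-(Complex.I * P.k z)) • sigma3 + und A) * E₂ A z = 0 := by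
  have h1 := P.jost_condition_E₁ hA ((map_ne_zero conj).2 hz)
  have h2 := eq_neg_of_add_eq_zero_right h1
  have h3 := congrArg jconj h2
  rw [jconj_sigma3_und _ hAs, jconj_neg, jconj_smul, jconj_E₁ hAs] at h3
  have e1 : -conj (-(Complex.I * P.k (conj z))) = -(Complex.I * P.k z) := by
    rw [k_conj]; simp
  have e2 : conj (1 * Complex.I * P.lam (conj z)) = -1 * Complex.I * P.lam z := by
    rw [lam_conj]; simp
  rw [e1, e2] at h3
  rw [h3, add_neg_cancel]

section

variable (hP : P.IsSolution)
include hP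

theorem isXJost_left_unique {t : ℝ} (ht : t ∈ P.T) {z : ℂ} (hz : z ∈ Hclosed P.k₀)
    (hl : lamK P.k₀ z ≠ 0) {v : ℝ → MatH m} (h : P.IsXJost atBot 1 (E₁ P.Qm z) z t v) (x : ℝ) :
    Complex.exp (Complex.I * P.theta x t z) • v x = P.what t z x :=
  congrFun (what_unique hP ht hz hl (h.normalized hz.1).1 (h.normalized hz.1).2) x

theorem isXJost_right_unique {t : ℝ} (ht : t ∈ P.T) {z : ℂ} (hz : z ∈ Hlow P.k₀)
    (hl : lamK P.k₀ z ≠ 0) {v : ℝ → MatH m} (h : P.IsXJost atTop 1 (E₁ P.Qp z) z t v) (x : ℝ) :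
    Complex.exp (Complex.I * P.theta x t z) • v x = P.vbar t z x :=
  congrFun (vbar_unique hP ht hz hl (h.normalized (mem_Hlow.1 hz).1).1
    (h.normalized (mem_Hlow.1 hz).1).2) x

omit hP in
theorem eq_of_exp_smul {a b c : MatH m} {θ : ℂ} (ha : Complex.exp θ • a = c)
    (hb : Complex.exp θ • b = c) : a = b :=
  smul_right_injective _ (Complex.exp_ne_zero θ) (ha.trans hb.symm)

/-- As `phi` is a choice, a witness is needed: the Volterra solutions at the separate times, which
form a solution of the full Lax pair by uniqueness. Away from the branch points this uniqueness also
identifies the choice with the witness. -/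
theorem isJost_phi {z : ℂ} (hz : z ∈ Hclosed P.k₀) (hl : lamK P.k₀ z ≠ 0) :
    P.IsJost atBot 1 (E₁ P.Qm z) z (P.phi z) := by
  refine Classical.epsilon_spec (p := P.IsJost atBot 1 (E₁ P.Qm z) z)
    ⟨fun x t => Complex.exp (-(Complex.I * P.theta x t z)) • P.what t z x,
    isJost_of_isXJost hP hP.settles_left (P.jost_condition_E₁ hP.Qm_mul hz.1)
      (fun t ht v v' h h' => funext fun x => ?_) fun t ht => ?_⟩
  · exact eq_of_exp_smul (isXJost_left_unique hP ht hz hl h x)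
      (isXJost_left_unique hP ht hz hl h' x)
  · exact isXJost_of_normalized hz.1 (hasDerivAt_what hP ht hz) (tendsto_what hP ht hz)

theorem isJost_psiBar {z : ℂ} (hz : z ∈ Hlow P.k₀) (hl : lamK P.k₀ z ≠ 0) :
    P.IsJost atTop 1 (E₁ P.Qp z) z (P.psiBar z) := by
  have hz0 := (mem_Hlow.1 hz).1
  refine Classical.epsilon_spec (p := P.IsJost atTop 1 (E₁ P.Qp z) z)
    ⟨fun x t => Complex.exp (-(Complex.I * P.theta x t z)) • P.vbar t z x,
    isJost_of_isXJost hP hP.settles_right (P.jost_condition_E₁ hP.Qp_mul hz0)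
      (fun t ht v v' h h' => funext fun x => ?_) fun t ht => ?_⟩
  · exact eq_of_exp_smul (isXJost_right_unique hP ht hz hl h x)
      (isXJost_right_unique hP ht hz hl h' x)
  · exact isXJost_of_normalized hz0 (hasDerivAt_vbar hP ht hz) (tendsto_vbar hP ht hz)

theorem WHat_eq {z : ℂ} (hz : z ∈ Hclosed P.k₀) (hl : lamK P.k₀ z ≠ 0) (x : ℝ) {t : ℝ}
    (ht : t ∈ P.T) : P.WHat x t z = P.what t z x :=
  isXJost_left_unique hP ht hz hl ((isJost_phi hP hz hl).isXJost ht) x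

theorem VBar_eq {z : ℂ} (hz : z ∈ Hlow P.k₀) (hl : lamK P.k₀ z ≠ 0) (x : ℝ) {t : ℝ}
    (ht : t ∈ P.T) : P.VBar x t z = P.vbar t z x :=
  isXJost_right_unique hP ht hz hl ((isJost_psiBar hP hz hl).isXJost ht) x

theorem isXJost_jconj_E₁ {l : Filter ℝ} {A : Mat m} (hA : Aᵀ = A) {z : ℂ} {t : ℝ} (ht : t ∈ P.T)
    {v : ℝ → MatH m} (h : P.IsXJost l 1 (E₁ A (conj z)) (conj z) t v) :
    P.IsXJost l (-1) (E₂ A z) z t fun x => jconj (v x) := by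
  have := h.jconj fun x => hP.symm x t ht
  rwa [map_one, jconj_E₁ hA] at this

theorem isXJost_jconj_E₂ {l : Filter ℝ} {A : Mat m} (hA : Aᵀ = A) {z : ℂ} {t : ℝ} (ht : t ∈ P.T)
    {v : ℝ → MatH m} (h : P.IsXJost l (-1) (E₂ A z) z t v) :
    P.IsXJost l 1 (E₁ A (conj z)) (conj z) t fun x => -jconj (v x) := by
  have h1 : P.IsXJost l (-1) (E₂ A z) (conj (conj z)) t v := by rwa [Complex.conj_conj]
  have := (h1.jconj fun x => hP.symm x t ht).neg
  rwa [map_neg, map_one, neg_neg, ← jconj_E₁ hA, jconj_jconj, neg_neg] at this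

/-- The antilinear symmetry converts the problem for `ψ` at `z` into the one for `ψ̄` at `z*`, so no
separate Volterra theory is needed for the last `m` columns. -/
theorem isXJost_psi_unique {t : ℝ} (ht : t ∈ P.T) {z : ℂ} (hz : conj z ∈ Hlow P.k₀)
    (hl : lamK P.k₀ z ≠ 0) {v : ℝ → MatH m} (h : P.IsXJost atTop (-1) (E₂ P.Qp z) z t v) (x : ℝ) :
    v x = jconj (P.psiBar (conj z) x t) := by
  have hl' : lamK P.k₀ (conj z) ≠ 0 := by rw [lamK_conj]; exact (map_ne_zero _).2 hl
  have h1 := isXJost_right_unique hP ht hz hl' (isXJost_jconj_E₂ hP (Qp_symm hP) ht h) x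
  have h2 := isXJost_right_unique hP ht hz hl' ((isJost_psiBar hP hz hl').isXJost ht) x
  rw [← eq_of_exp_smul h1 h2, jconj_neg, jconj_jconj, neg_neg]

theorem isXJost_phiBar_unique {t : ℝ} (ht : t ∈ P.T) {z : ℂ} (hz : conj z ∈ Hclosed P.k₀)
    (hl : lamK P.k₀ z ≠ 0) {v : ℝ → MatH m} (h : P.IsXJost atBot (-1) (E₂ P.Qm z) z t v) (x : ℝ) :
    v x = jconj (P.phi (conj z) x t) := by
  have hl' : lamK P.k₀ (conj z) ≠ 0 := by rw [lamK_conj]; exact (map_ne_zero _).2 hl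
  have h1 := isXJost_left_unique hP ht hz hl' (isXJost_jconj_E₂ hP (Qm_symm hP) ht h) x
  have h2 := isXJost_left_unique hP ht hz hl' ((isJost_phi hP hz hl').isXJost ht) x
  rw [← eq_of_exp_smul h1 h2, jconj_neg, jconj_jconj, neg_neg]

theorem isJost_psi {z : ℂ} (hz : z ∈ Hclosed P.k₀) (hl : lamK P.k₀ z ≠ 0) :
    P.IsJost atTop (-1) (E₂ P.Qp z) z (P.psi z) := by
  have hl' : lamK P.k₀ (conj z) ≠ 0 := by rw [lamK_conj]; exact (map_ne_zero _).2 hl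
  have hz' := conj_mem_Hlow hz
  refine Classical.epsilon_spec (p := P.IsJost atTop (-1) (E₂ P.Qp z) z)
    ⟨fun x t => jconj (P.psiBar (conj z) x t),
    isJost_of_isXJost hP hP.settles_right (P.jost_condition_E₂ hP.Qp_mul (Qp_symm hP) hz.1)
      (fun t ht v v' h h' => funext fun x => ?_) fun t ht => ?_⟩
  · rw [isXJost_psi_unique hP ht hz' hl h, isXJost_psi_unique hP ht hz' hl h']
  · exact isXJost_jconj_E₁ hP (Qp_symm hP) ht ((isJost_psiBar hP hz' hl').isXJost ht)

theorem isJost_phiBar {z : ℂ} (hz : z ∈ Hlow P.k₀) (hl : lamK P.k₀ z ≠ 0) :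
    P.IsJost atBot (-1) (E₂ P.Qm z) z (P.phiBar z) := by
  have hl' : lamK P.k₀ (conj z) ≠ 0 := by rw [lamK_conj]; exact (map_ne_zero _).2 hl
  have hz' := conj_mem_Hclosed hz
  refine Classical.epsilon_spec (p := P.IsJost atBot (-1) (E₂ P.Qm z) z)
    ⟨fun x t => jconj (P.phi (conj z) x t),
    isJost_of_isXJost hP hP.settles_left
      (P.jost_condition_E₂ hP.Qm_mul (Qm_symm hP) (mem_Hlow.1 hz).1)
      (fun t ht v v' h h' => funext fun x => ?_) fun t ht => ?_⟩
  · rw [isXJost_phiBar_unique hP ht hz' hl h, isXJost_phiBar_unique hP ht hz' hl h']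
  · exact isXJost_jconj_E₁ hP (Qm_symm hP) ht ((isJost_phi hP hz' hl').isXJost ht)

theorem psi_eq {z : ℂ} (hz : z ∈ Hclosed P.k₀) (hl : lamK P.k₀ z ≠ 0) (x : ℝ) {t : ℝ}
    (ht : t ∈ P.T) : P.psi z x t = jconj (P.psiBar (conj z) x t) :=
  isXJost_psi_unique hP ht (conj_mem_Hlow hz) hl ((isJost_psi hP hz hl).isXJost ht) x

theorem VHat_eq {z : ℂ} (hz : z ∈ Hclosed P.k₀) (hl : lamK P.k₀ z ≠ 0) (x : ℝ) {t : ℝ}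
    (ht : t ∈ P.T) : P.VHat x t z = jconj (P.vbar t (conj z) x) := by
  have hl' : lamK P.k₀ (conj z) ≠ 0 := by rw [lamK_conj]; exact (map_ne_zero _).2 hl
  rw [← VBar_eq hP (conj_mem_Hlow hz) hl' x ht, VHat, VBar, psi_eq hP hz hl x ht, jconj_smul,
    ← Complex.exp_conj, theta_conj]
  simp

/-! ### Constancy of Wronskians -/

omit hP in
theorem und_conjTranspose (A : Mat m) : (und A : Mat2 m)ᴴ = -und A := by
  simp [und, Matrix.fromBlocks_conjTranspose, Matrix.fromBlocks_neg]

omit hP in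
theorem sigma3_conjTranspose : (sigma3 : Mat2 m)ᴴ = sigma3 := by
  simp [sigma3, Matrix.fromBlocks_conjTranspose]

omit hP in
-- This skewness, and its analogue for the time matrix, make products `f(z*)† g(z)` of solutions
-- constant.
theorem laxM_conjTranspose (P : Potential m) (x t : ℝ) (z : ℂ) :
    (P.laxM x t (conj z))ᴴ = -P.laxM x t z := by
  rw [laxM_eq, laxM_eq, Matrix.conjTranspose_add, Matrix.conjTranspose_smul, und_conjTranspose,
    sigma3_conjTranspose, k_conj, neg_add, ← neg_smul]
  congr 2
  simp

omit hP in
theorem laxN_conjTranspose (P : Potential m) (x t : ℝ) (z : ℂ) :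
    (P.laxN x t (conj z))ᴴ = -P.laxN x t z := by
  have e : star (Complex.I * P.k (conj z)) = -(Complex.I * P.k z) := by
    rw [k_conj]; simp
  have h1 := sigma3_mul_und (P.Q x t)
  have h2 := sigma3_mul_und (dx P.Q x t)
  rw [laxN_eq, laxN_eq]
  simp only [timeMat, Matrix.conjTranspose_add, Matrix.conjTranspose_sub,
    Matrix.conjTranspose_smul, Matrix.conjTranspose_mul, und_conjTranspose, sigma3_conjTranspose,
    star_mul', star_pow, e, star_neg, star_ofNat, Matrix.add_mul, Matrix.mul_neg,
    Matrix.neg_mul, h1, h2, mul_assoc, neg_neg]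
  module

omit hP in
/-- Products of solutions of the Lax pair at `z*` and `z` do not depend on `x` and `t`. -/
theorem conjTranspose_mul_eq (hP : P.IsSolution) {z : ℂ} {f g : ℝ → ℝ → MatH m}
    {l l' : Filter ℝ} {s s' : ℂ} {E E' : MatH m}
    (hf : P.IsJost l s E (conj z) f) (hg : P.IsJost l' s' E' z g) {x x' t t' : ℝ} (ht : t ∈ P.T)
    (ht' : t' ∈ P.T) : (f x t)ᴴ * g x t = (f x' t')ᴴ * g x' t' := by
  have hX : (f x t)ᴴ * g x t = (f x' t)ᴴ * g x' t := by
    refine is_const_of_deriv_eq_zero (f := fun y => (f y t)ᴴ * g y t) ?_ ?_ x x'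
    all_goals
      have hd : ∀ y, HasDerivAt (fun y => (f y t)ᴴ * g y t) 0 y := fun y => by
        refine (hasDerivAt_matrix_mul (hasDerivAt_conjTranspose (hasDerivAt_matrix.2
          ((hf t ht).1 y))) (hasDerivAt_matrix.2 ((hg t ht).1 y))).congr_deriv ?_
        rw [Matrix.conjTranspose_mul, laxM_conjTranspose, Matrix.mul_neg, Matrix.neg_mul,
          Matrix.mul_assoc, neg_add_cancel]
    · exact fun y => (hd y).differentiableAt
    · exact fun y => (hd y).deriv
  rw [hX]
  have hd : ∀ τ ∈ P.T, HasDerivAt (fun τ => (f x' τ)ᴴ * g x' τ) 0 τ := fun τ hτ => by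
    refine (hasDerivAt_matrix_mul (hasDerivAt_conjTranspose (hasDerivAt_matrix.2
      ((hf τ hτ).2.1 x'))) (hasDerivAt_matrix.2 ((hg τ hτ).2.1 x'))).congr_deriv ?_
    rw [Matrix.conjTranspose_mul, laxN_conjTranspose, Matrix.mul_neg, Matrix.neg_mul,
      Matrix.mul_assoc, neg_add_cancel]
  exact hP.isOpen_T.is_const_of_deriv_eq_zero hP.isConnected_T.isPreconnected
    (fun τ hτ => (hd τ hτ).differentiableAt.differentiableWithinAt) (fun τ hτ => (hd τ hτ).deriv)
    ht ht'

end

/-! ### Regions of the spectral plane -/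

theorem lamK_eq_zero_iff {k₀ : ℝ} {z : ℂ} (hz : z ≠ 0) :
    lamK k₀ z = 0 ↔ z = Complex.I * k₀ ∨ z = -(Complex.I * k₀) := by
  rw [lamK, div_eq_zero_iff, or_iff_left two_ne_zero]
  have h : z + (k₀ : ℂ) ^ 2 / z = (z - Complex.I * k₀) * (z + Complex.I * k₀) / z := by
    field_simp
    ring_nf
    rw [Complex.I_sq]; ring
  rw [h, div_eq_zero_iff, or_iff_left hz, mul_eq_zero, sub_eq_zero, add_eq_zero_iff_eq_neg]

theorem mem_Dplus_iff {z : ℂ} : z ∈ P.Dplus ↔ z ∈ Hopen P.k₀ := by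
  by_cases hz : z = 0
  · simp [hz, Dplus, Hopen]
  · have hn : 0 < 2 * ‖z‖ ^ 2 := by positivity
    simp only [Dplus, Hopen, mem_ofPred_eq, lamK_im P.k₀ hz, hz, ne_eq, not_false_eq_true,
      true_and, div_pos_iff_of_pos_right hn]

theorem mem_Sigma₀_iff (hk : 0 < P.k₀) {z : ℂ} :
    z ∈ P.Sigma₀ ↔ z ≠ 0 ∧ (lamK P.k₀ z).im = 0 ∧ lamK P.k₀ z ≠ 0 := by
  by_cases hz : z = 0
  · simp [hz, Sigma₀]
  · have hn : 2 * ‖z‖ ^ 2 ≠ 0 := by positivity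
    have h1 : (lamK P.k₀ z).im = 0 ↔ z.im = 0 ∨ ‖z‖ = P.k₀ := by
      rw [lamK_im P.k₀ hz, div_eq_zero_iff, or_iff_left hn, mul_eq_zero, sub_eq_zero,
        sq_eq_sq₀ (norm_nonneg z) hk.le, or_comm]
    rw [h1, ne_eq (lamK P.k₀ z), lamK_eq_zero_iff hz, not_or]
    exact and_left_comm

/-- Hence `γ` vanishes precisely at the branch points, to the order of `λ`. -/
theorem gam_mul (P : Potential m) {z : ℂ} (hz : z ≠ 0) : P.gam z * z = 2 * lamK P.k₀ z := by
  rw [gam, lamK]; field_simp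

theorem gam_ne_zero (P : Potential m) {z : ℂ} (hz : z ≠ 0) (hl : lamK P.k₀ z ≠ 0) :
    P.gam z ≠ 0 := by
  intro h
  have := P.gam_mul hz
  rw [h, zero_mul] at this
  exact hl (by simpa using this.symm)

theorem gam_conj (P : Potential m) (z : ℂ) : P.gam (conj z) = conj (P.gam z) := by
  simp [gam]

theorem mem_of_mem_Sigma₀ (hk : 0 < P.k₀) {z : ℂ} (hz : z ∈ P.Sigma₀) :
    z ∈ Hclosed P.k₀ ∧ z ∈ Hlow P.k₀ ∧ lamK P.k₀ z ≠ 0 := by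
  rw [mem_Sigma₀_iff hk] at hz
  exact ⟨⟨hz.1, hz.2.1.ge⟩, mem_Hlow.2 ⟨hz.1, hz.2.1.le⟩, hz.2.2⟩

theorem conj_mem_Sigma₀ (hk : 0 < P.k₀) {z : ℂ} (hz : z ∈ P.Sigma₀) : conj z ∈ P.Sigma₀ := by
  rw [mem_Sigma₀_iff hk] at hz ⊢
  rw [lamK_conj]
  exact ⟨(map_ne_zero _).2 hz.1, by simpa using hz.2.1, (map_ne_zero _).2 hz.2.2⟩

/-! ### The scattering matrix -/

theorem conjTranspose_mul_rows (B C : MatH m) :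
    Bᴴ * C = B.toRows₁ᴴ * C.toRows₁ + B.toRows₂ᴴ * C.toRows₂ := by
  conv_lhs => rw [mul_fromRows_one B, mul_fromRows_one C]
  rw [Matrix.conjTranspose_fromRows_eq_fromCols_conjTranspose, Matrix.fromCols_mul_fromRows]

theorem conjTranspose_map_star_comm (B : Mat m) : (B.map star)ᴴ = Bᴴ.map star := by
  ext i j; simp

theorem jconj_conjTranspose_mul_jconj (B C : MatH m) :
    (jconj B)ᴴ * jconj C = (Bᴴ * C).map star := by
  rw [conjTranspose_mul_rows, conjTranspose_mul_rows B C]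
  simp only [jconj_toRows₁, jconj_toRows₂, map_star_add, map_star_mul, Matrix.conjTranspose_neg,
    conjTranspose_map_star_comm, Matrix.neg_mul, Matrix.mul_neg, neg_neg]
  abel

theorem E₁_conjTranspose_mul_E₁ (P : Potential m) {A : Mat m}
    (hA : A * Aᴴ = ((P.k₀ : ℂ) ^ 2) • (1 : Mat m)) (z : ℂ) :
    (E₁ A (conj z))ᴴ * E₁ A z = P.gam z • (1 : Mat m) := by
  rw [conjTranspose_mul_rows]
  simp only [E₁, Matrix.toRows₁_fromRows, Matrix.toRows₂_fromRows, Matrix.conjTranspose_smul,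
    Matrix.conjTranspose_conjTranspose, Matrix.smul_mul, Matrix.mul_smul, hA, smul_smul,
    Matrix.conjTranspose_one, Matrix.one_mul]
  rw [gam, add_smul, one_smul]
  congr 2
  have hI : Complex.I ^ 2 = -1 := Complex.I_sq
  simp only [star_neg, star_div₀, RCLike.star_def, Complex.conj_I, Complex.conj_conj]
  linear_combination (-(P.k₀ : ℂ) ^ 2 / z ^ 2) * hI

theorem E₁_conjTranspose_mul_E₂ {A : Mat m} (z : ℂ) : (E₁ A (conj z))ᴴ * E₂ A z = 0 := by
  rw [conjTranspose_mul_rows]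
  simp only [E₁, E₂, Matrix.toRows₁_fromRows, Matrix.toRows₂_fromRows, Matrix.conjTranspose_smul,
    Matrix.conjTranspose_conjTranspose, Matrix.mul_one, Matrix.conjTranspose_one, Matrix.one_mul]
  rw [← add_smul]
  convert zero_smul ℂ A using 2
  simp only [star_neg, star_div₀, RCLike.star_def, Complex.conj_I, Complex.conj_conj]
  ring

theorem toCols_eq_of_fromCols_eq_mul {A₁ A₂ B₁ B₂ : MatH m} {S : Mat2 m}
    (h : Matrix.fromCols A₁ A₂ = Matrix.fromCols B₁ B₂ * S) :
    A₁ = B₁ * S.toBlocks₁₁ + B₂ * S.toBlocks₂₁ := by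
  rw [← Matrix.fromBlocks_toBlocks S, Matrix.fromCols_mul_fromBlocks] at h
  have := congrArg Matrix.toCols₁ h
  rw [Matrix.toCols₁_fromCols, Matrix.toCols₁_fromCols] at this
  simpa using this

section

variable (hP : P.IsSolution)
include hP

theorem psiBar_mul_phi_eq {z : ℂ} (hz : z ∈ Hclosed P.k₀) (hl : lamK P.k₀ z ≠ 0) (x : ℝ) {t : ℝ}
    (ht : t ∈ P.T) :
    (P.psiBar (conj z) x t)ᴴ * P.phi z x t = (P.vbar t (conj z) x)ᴴ * P.what t z x := by
  have hl' : lamK P.k₀ (conj z) ≠ 0 := by rw [lamK_conj]; exact (map_ne_zero _).2 hl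
  rw [← VBar_eq hP (conj_mem_Hlow hz) hl' x ht, ← WHat_eq hP hz hl x ht, VBar, WHat,
    Matrix.conjTranspose_smul, Matrix.smul_mul, Matrix.mul_smul, smul_smul, theta_conj,
    RCLike.star_def, ← Complex.exp_conj, ← Complex.exp_add]
  simp

/-- The product is constant and its exponential factors cancel, so it equals its limit at `+∞`,
computed from `E₁`. -/
theorem gram_psiBar_psiBar {z : ℂ} (hz : z ∈ P.Sigma₀) (x : ℝ) {t : ℝ} (ht : t ∈ P.T) :
    (P.psiBar (conj z) x t)ᴴ * P.psiBar z x t = P.gam z • (1 : Mat m) := by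
  have hk := hP.k₀_pos
  obtain ⟨h1, h2, h3⟩ := mem_of_mem_Sigma₀ hk hz
  obtain ⟨h1', h2', h3'⟩ := mem_of_mem_Sigma₀ hk (conj_mem_Sigma₀ hk hz)
  have hconst : ∀ y, (P.vbar t (conj z) y)ᴴ * P.vbar t z y
      = (P.psiBar (conj z) x t)ᴴ * P.psiBar z x t := by
    intro y
    rw [conjTranspose_mul_eq hP (isJost_psiBar hP h2' h3') (isJost_psiBar hP h2 h3) (x := x)
      (x' := y) ht ht, ← VBar_eq hP h2' h3' y ht, ← VBar_eq hP h2 h3 y ht, VBar, VBar,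
      Matrix.conjTranspose_smul, Matrix.smul_mul, Matrix.mul_smul, smul_smul, theta_conj,
      RCLike.star_def, ← Complex.exp_conj, ← Complex.exp_add]
    simp
  have hc : Continuous fun p : MatH m × MatH m => p.1ᴴ * p.2 := by fun_prop
  have hlim := (hc.tendsto _).comp ((tendsto_vbar hP ht h2').prodMk_nhds (tendsto_vbar hP ht h2))
  simp only [E₁_conjTranspose_mul_E₁ P hP.Qp_mul] at hlim
  refine tendsto_nhds_unique ?_ hlim
  refine tendsto_const_nhds.congr fun y => (hconst y).symm

/-- Here the exponentials do not cancel, but `λ` is real on the spectrum and their modulus does not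
depend on `x`. The norm of the constant product, times that nonzero modulus, tends to `‖E₁† E₂‖ =
0`. -/
theorem gram_psiBar_psi {z : ℂ} (hz : z ∈ P.Sigma₀) (x : ℝ) {t : ℝ} (ht : t ∈ P.T) :
    (P.psiBar (conj z) x t)ᴴ * P.psi z x t = 0 := by
  have hk := hP.k₀_pos
  obtain ⟨h1, h2, h3⟩ := mem_of_mem_Sigma₀ hk hz
  obtain ⟨h1', h2', h3'⟩ := mem_of_mem_Sigma₀ hk (conj_mem_Sigma₀ hk hz)
  set K := (P.psiBar (conj z) x t)ᴴ * P.psi z x t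
  have hJ := isJost_psiBar hP h2' h3'
  have hJ' := isJost_psi hP h1 h3
  have hc : Continuous fun p : MatH m × MatH m => p.1ᴴ * p.2 := by fun_prop
  have hlim := ((hc.tendsto _).comp ((hJ t ht).2.2.prodMk_nhds (hJ' t ht).2.2)).norm
  simp only [E₁_conjTranspose_mul_E₂, norm_zero] at hlim
  have hreal : ∀ y : ℝ, ‖Complex.exp (-(2 * Complex.I * P.theta y t z))‖
      = ‖Complex.exp (-(2 * Complex.I * P.theta 0 t z))‖ := by
    intro y
    rw [Complex.norm_exp, Complex.norm_exp]
    congr 1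
    have hi := ((mem_Sigma₀_iff hk).1 hz).2.1
    change (P.lam z).im = 0 at hi
    have e : P.theta y t z = P.theta 0 t z + (y : ℂ) * P.lam z := by
      simp only [theta]; push_cast; ring
    rw [e, mul_add, neg_add, Complex.add_re]
    have : (-(2 * Complex.I * ((y : ℂ) * P.lam z))).re = 0 := by
      simp [hi]
    rw [this, add_zero]
  have hval : ∀ y, ‖(Complex.exp (1 * Complex.I * P.theta y t (conj z)) •
      P.psiBar (conj z) y t)ᴴ * (Complex.exp (-1 * Complex.I * P.theta y t z) • P.psi z y t)‖
      = ‖Complex.exp (-(2 * Complex.I * P.theta 0 t z))‖ * ‖K‖ := by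
    intro y
    rw [← hreal y, ← norm_smul]
    congr 1
    simp only [K]
    rw [conjTranspose_mul_eq hP hJ hJ' (x := x) (x' := y) ht ht,
      Matrix.conjTranspose_smul, Matrix.smul_mul, Matrix.mul_smul, smul_smul, theta_conj,
      RCLike.star_def, ← Complex.exp_conj, ← Complex.exp_add]
    congr 2
    simp only [map_mul, map_one, Complex.conj_I, Complex.conj_conj]
    ring
  have h0 := tendsto_nhds_unique (tendsto_const_nhds.congr fun y => (hval y).symm) hlim
  rcases mul_eq_zero.1 h0 with h | h
  · exact absurd (norm_eq_zero.1 h) (Complex.exp_ne_zero _)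
  · exact norm_eq_zero.1 h

theorem gram_psi_psi {z : ℂ} (hz : z ∈ P.Sigma₀) (x : ℝ) {t : ℝ} (ht : t ∈ P.T) :
    (P.psi (conj z) x t)ᴴ * P.psi z x t = P.gam z • (1 : Mat m) := by
  have hk := hP.k₀_pos
  have hz' := conj_mem_Sigma₀ hk hz
  obtain ⟨h1, h2, h3⟩ := mem_of_mem_Sigma₀ hk hz
  obtain ⟨h1', h2', h3'⟩ := mem_of_mem_Sigma₀ hk hz'
  have h := gram_psiBar_psiBar hP hz' x ht
  rw [Complex.conj_conj] at h
  rw [psi_eq hP h1 h3 x ht, psi_eq hP h1' h3' x ht, Complex.conj_conj,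
    jconj_conjTranspose_mul_jconj, h, gam_conj, map_star_smul]
  rw [Complex.conj_conj]
  congr 1
  ext i j; simp [Matrix.one_apply, apply_ite]

theorem gram_psi_psiBar {z : ℂ} (hz : z ∈ P.Sigma₀) (x : ℝ) {t : ℝ} (ht : t ∈ P.T) :
    (P.psi (conj z) x t)ᴴ * P.psiBar z x t = 0 := by
  have h := gram_psiBar_psi hP (conj_mem_Sigma₀ hP.k₀_pos hz) x ht
  rw [Complex.conj_conj] at h
  have := congrArg Matrix.conjTranspose h
  rwa [Matrix.conjTranspose_mul, Matrix.conjTranspose_conjTranspose,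
    Matrix.conjTranspose_zero] at this

theorem gram_fundamental {z : ℂ} (hz : z ∈ P.Sigma₀) (x : ℝ) {t : ℝ} (ht : t ∈ P.T) :
    (Matrix.fromCols (P.psiBar (conj z) x t) (P.psi (conj z) x t))ᴴ
      * Matrix.fromCols (P.psiBar z x t) (P.psi z x t) = P.gam z • (1 : Mat2 m) := by
  rw [Matrix.conjTranspose_fromCols_eq_fromRows_conjTranspose, Matrix.fromRows_mul_fromCols,
    gram_psiBar_psiBar hP hz x ht, gram_psiBar_psi hP hz x ht, gram_psi_psi hP hz x ht,
    gram_psi_psiBar hP hz x ht, ← Matrix.fromBlocks_one, Matrix.fromBlocks_smul, smul_zero]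

/-- The fundamental matrix `Ψ` of `+∞` has inverse `γ⁻¹ Ψ(z*)†`, so the scattering matrix must be
`γ⁻¹ Ψ(z*)† Φ(z)`, which is constant as a block of products of solutions. -/
theorem scatS_spec {z : ℂ} (hz : z ∈ P.Sigma₀) (x : ℝ) {t : ℝ} (ht : t ∈ P.T) :
    Matrix.fromCols (P.phi z x t) (P.phiBar z x t)
      = Matrix.fromCols (P.psiBar z x t) (P.psi z x t) * P.scatS z := by
  have hk := hP.k₀_pos
  obtain ⟨h1, h2, h3⟩ := mem_of_mem_Sigma₀ hk hz
  obtain ⟨h1', h2', h3'⟩ := mem_of_mem_Sigma₀ hk (conj_mem_Sigma₀ hk hz)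
  have hg := P.gam_ne_zero h1.1 h3
  refine Classical.epsilon_spec (p := fun S : Mat2 m => ∀ x, ∀ t ∈ P.T,
    Matrix.fromCols (P.phi z x t) (P.phiBar z x t)
      = Matrix.fromCols (P.psiBar z x t) (P.psi z x t) * S)
    ⟨(P.gam z)⁻¹ • ((Matrix.fromCols (P.psiBar (conj z) x t) (P.psi (conj z) x t))ᴴ
      * Matrix.fromCols (P.phi z x t) (P.phiBar z x t)), fun x' t' ht' => ?_⟩ x t ht
  have hconst : (Matrix.fromCols (P.psiBar (conj z) x t) (P.psi (conj z) x t))ᴴ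
      * Matrix.fromCols (P.phi z x t) (P.phiBar z x t)
      = (Matrix.fromCols (P.psiBar (conj z) x' t') (P.psi (conj z) x' t'))ᴴ
      * Matrix.fromCols (P.phi z x' t') (P.phiBar z x' t') := by
    simp only [Matrix.conjTranspose_fromCols_eq_fromRows_conjTranspose,
      Matrix.fromRows_mul_fromCols]
    rw [conjTranspose_mul_eq hP (isJost_psiBar hP h2' h3') (isJost_phi hP h1 h3) ht ht',
      conjTranspose_mul_eq hP (isJost_psiBar hP h2' h3') (isJost_phiBar hP h2 h3) ht ht',
      conjTranspose_mul_eq hP (isJost_psi hP h1' h3') (isJost_phi hP h1 h3) ht ht',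
      conjTranspose_mul_eq hP (isJost_psi hP h1' h3') (isJost_phiBar hP h2 h3) ht ht']
  have hinv : ((P.gam z)⁻¹ • (Matrix.fromCols (P.psiBar (conj z) x' t')
      (P.psi (conj z) x' t'))ᴴ) * Matrix.fromCols (P.psiBar z x' t') (P.psi z x' t') = 1 := by
    rw [Matrix.smul_mul, gram_fundamental hP hz x' ht', smul_smul, inv_mul_cancel₀ hg, one_smul]
  rw [hconst, ← Matrix.smul_mul, ← Matrix.mul_assoc, mul_eq_one_comm.1 hinv, Matrix.one_mul]

theorem phi_eq_add {z : ℂ} (hz : z ∈ P.Sigma₀) (x : ℝ) {t : ℝ} (ht : t ∈ P.T) :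
    P.phi z x t = P.psiBar z x t * P.a z + P.psi z x t * P.b z := by
  have h := toCols_eq_of_fromCols_eq_mul (scatS_spec hP hz x ht)
  rwa [a, if_pos hz]

/-- The Wronskian formula for the block `a`, on the whole domain of the Jost eigenfunctions. -/
theorem gam_smul_a {z : ℂ} (hz : z ∈ Hclosed P.k₀) (hl : lamK P.k₀ z ≠ 0) (x : ℝ) {t : ℝ}
    (ht : t ∈ P.T) : P.gam z • P.a z = (P.vbar t (conj z) x)ᴴ * P.what t z x := by
  have hk := hP.k₀_pos
  rw [← psiBar_mul_phi_eq hP hz hl x ht]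
  by_cases hS : z ∈ P.Sigma₀
  · rw [phi_eq_add hP hS x ht, Matrix.mul_add, ← Matrix.mul_assoc, ← Matrix.mul_assoc,
      gram_psiBar_psiBar hP hS x ht, gram_psiBar_psi hP hS x ht, Matrix.zero_mul, add_zero,
      Matrix.smul_mul, Matrix.one_mul]
  · rw [a, if_neg hS]
    refine Classical.epsilon_spec (p := fun A : Mat m => ∀ x, ∀ t ∈ P.T,
      P.gam z • A = (P.psiBar (conj z) x t)ᴴ * P.phi z x t)
      ⟨(P.gam z)⁻¹ • ((P.psiBar (conj z) x t)ᴴ * P.phi z x t), fun x' t' ht' => ?_⟩ x t ht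
    have hl' : lamK P.k₀ (conj z) ≠ 0 := by rw [lamK_conj]; exact (map_ne_zero _).2 hl
    rw [smul_smul, mul_inv_cancel₀ (P.gam_ne_zero hz.1 hl), one_smul]
    exact conjTranspose_mul_eq hP (isJost_psiBar hP (conj_mem_Hlow hz) hl') (isJost_phi hP hz hl)
      ht ht'

/-- Since `b = ρ a = 0`, the jump of the Riemann–Hilbert problem disappears. This is the only
consequence of the vanishing of reflection that the gluing uses, besides invertibility of `a`. -/
theorem what_eq_vbar_mul_a (hrefl : P.Reflectionless) {z : ℂ} (hz : z ∈ P.Sigma₀) (x : ℝ) {t : ℝ}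
    (ht : t ∈ P.T) : P.what t z x = P.vbar t z x * P.a z := by
  obtain ⟨h1, h2, h3⟩ := mem_of_mem_Sigma₀ hP.k₀_pos hz
  obtain ⟨ha, -, hr, -⟩ := hrefl z hz
  have hb : P.b z = 0 := by
    have := congrArg (fun B => B * P.a z) hr
    simp only [rho, Matrix.zero_mul] at this
    rwa [Matrix.mul_assoc, Matrix.nonsing_inv_mul _ ha, Matrix.mul_one] at this
  have h := phi_eq_add hP hz x ht
  rw [hb, Matrix.mul_zero, add_zero] at h
  rw [← WHat_eq hP h1 h3 x ht, ← VBar_eq hP h2 h3 x ht, WHat, VBar, h, Matrix.smul_mul]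

end

end Potential

/-! ### Holomorphic matrix functions -/

section MatrixHolomorphic

variable {ι κ τ : Type*} [Fintype ι] [Fintype κ] [Fintype τ]

theorem differentiableAt_matrix {F : ℂ → Matrix ι κ ℂ} {z : ℂ} :
    DifferentiableAt ℂ F z ↔ ∀ i j, DifferentiableAt ℂ (fun w => F w i j) z := by
  refine (differentiableAt_pi (Φ := fun w i => F w i)).trans ?_
  exact forall_congr' fun i => differentiableAt_pi (Φ := fun w j => F w i j)

theorem differentiableAt_matrix_mul {F : ℂ → Matrix ι κ ℂ} {G : ℂ → Matrix κ τ ℂ} {z : ℂ}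
    (hF : DifferentiableAt ℂ F z) (hG : DifferentiableAt ℂ G z) :
    DifferentiableAt ℂ (fun w => F w * G w) z := by
  rw [differentiableAt_matrix] at hF hG ⊢
  intro i j
  simp only [Matrix.mul_apply]
  exact DifferentiableAt.fun_sum fun l _ => (hF i l).mul (hG l j)

theorem differentiableAt_conjTranspose_conj {F : ℂ → Matrix ι κ ℂ} {z : ℂ}
    (hF : DifferentiableAt ℂ F (conj z)) : DifferentiableAt ℂ (fun w => (F (conj w))ᴴ) z := by
  rw [differentiableAt_matrix] at hF ⊢
  intro i j
  have := (hF j i).conj_conj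
  rw [Complex.conj_conj] at this
  exact this

theorem differentiableAt_det [DecidableEq ι] {F : ℂ → Matrix ι ι ℂ} {z : ℂ}
    (hF : DifferentiableAt ℂ F z) : DifferentiableAt ℂ (fun w => (F w).det) z := by
  rw [differentiableAt_matrix] at hF
  simp only [Matrix.det_apply]
  exact DifferentiableAt.fun_sum fun σ _ =>
    (DifferentiableAt.fun_finsetProd fun i _ => hF _ _).const_smul _

theorem differentiableAt_matrix_inv [DecidableEq ι] {F : ℂ → Matrix ι ι ℂ} {z : ℂ}
    (hF : DifferentiableAt ℂ F z) (hz : (F z).det ≠ 0) :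
    DifferentiableAt ℂ (fun w => (F w)⁻¹) z := by
  have hadj : DifferentiableAt ℂ (fun w => (F w).adjugate) z := by
    rw [differentiableAt_matrix]
    intro i j
    simp only [Matrix.adjugate_apply]
    refine differentiableAt_det (differentiableAt_matrix.2 fun k l => ?_)
    rcases eq_or_ne k j with rfl | hkj
    · simp
    · simpa only [Matrix.updateRow_ne hkj] using differentiableAt_matrix.1 hF k l
  have h := ((differentiableAt_det hF).inv hz).smul hadj
  refine h.congr_of_eventuallyEq (Eventually.of_forall fun w => ?_)
  simp only [Matrix.inv_def, Ring.inverse_eq_inv']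
  rfl

theorem tendsto_matrix_inv [DecidableEq ι] {α : Type*} {l : Filter α} {F : α → Matrix ι ι ℂ}
    {A : Matrix ι ι ℂ} (hF : Tendsto F l (𝓝 A)) (hA : A.det ≠ 0) :
    Tendsto (fun w => (F w)⁻¹) l (𝓝 A⁻¹) := by
  refine (continuousAt_matrix_inv A ?_).tendsto.comp hF
  simpa only [Ring.inverse_eq_inv'] using continuousAt_inv₀ hA

end MatrixHolomorphic

theorem differentiableAt_jconj_conj {m : ℕ} {F : ℂ → MatH m} {z : ℂ}
    (hF : DifferentiableAt ℂ F (conj z)) : DifferentiableAt ℂ (fun w => jconj (F (conj w))) z := by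
  rw [differentiableAt_matrix] at hF ⊢
  have h : ∀ i j, DifferentiableAt ℂ (fun w => conj (F (conj w) i j)) z := fun i j => by
    have := (hF i j).conj_conj
    rw [Complex.conj_conj] at this
    exact this
  rintro (i | i) j
  · exact (h (Sum.inr i) j).neg
  · exact h (Sum.inl i) j

/-! ### Isotropy of Jost solutions -/

/-- The bilinear form `Bᵀ J C`. -/
def skew {m : ℕ} (B C : MatH m) : Mat m :=
  B.toRows₁ᵀ * C.toRows₂ - B.toRows₂ᵀ * C.toRows₁

theorem continuous_skew {m : ℕ} : Continuous fun p : MatH m × MatH m => skew p.1 p.2 := by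
  have h1 : Continuous fun B : MatH m => B.toRows₁ :=
    continuous_matrix fun i j => continuous_id.matrix_elem (Sum.inl i) j
  have h2 : Continuous fun B : MatH m => B.toRows₂ :=
    continuous_matrix fun i j => continuous_id.matrix_elem (Sum.inr i) j
  unfold skew
  exact (((h1.comp continuous_fst).matrix_transpose).matrix_mul (h2.comp continuous_snd)).sub
    (((h2.comp continuous_fst).matrix_transpose).matrix_mul (h1.comp continuous_snd))

theorem conjTranspose_transpose_of_symm {m : ℕ} {A : Mat m} (hA : Aᵀ = A) : (Aᴴ)ᵀ = Aᴴ := by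
  rw [← map_star_eq_of_transpose hA, ← Matrix.transpose_map, hA]

/-- For a symmetric potential the form satisfies `K' = 2iλ K`, so for `Im λ ≥ 0` its norm at `y ≤ 0`
is at least that at `0`. Its limit at `-∞` is the form on `E₁`, zero by symmetry of the boundary
value. -/
theorem Wing.jost_isotropic {m : ℕ} {W : Wing m} (hW : W.Good) (hq : ∀ x, (W.q x)ᵀ = W.q x)
    (hA : W.Aᵀ = W.A) {z : ℂ} (hz : z ∈ Hclosed W.k₀) (x : ℝ) :
    skew (W.jost z x) (W.jost z x) = 0 := by
  set K : ℝ → Mat m := fun x => skew (W.jost z x) (W.jost z x) with hK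
  set μ := lamK W.k₀ z with hμ
  have hd : ∀ y, HasDerivAt K ((2 * Complex.I * μ) • K y) y := by
    intro y
    have hw := hasDerivAt_toRows (Wing.hasDerivAt_jost hW hz y)
    rw [symb_mul, Matrix.toRows₁_fromRows, Matrix.toRows₂_fromRows] at hw
    have h1 := hasDerivAt_matrix_mul (hasDerivAt_transpose hw.1) hw.2
    have h2 := hasDerivAt_matrix_mul (hasDerivAt_transpose hw.2) hw.1
    refine (h1.fun_sub h2).congr_deriv ?_
    have hqh := conjTranspose_transpose_of_symm (hq y)
    have e : 2 * Complex.I * μ = Complex.I * (W.k₀ : ℂ) ^ 2 / z + Complex.I * z := by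
      rw [hμ, lamK]; ring
    simp only [hK, skew, e, Matrix.transpose_add, Matrix.transpose_smul, Matrix.transpose_mul,
      Matrix.transpose_neg, hq y, hqh, Matrix.add_mul, Matrix.mul_add, Matrix.smul_mul,
      Matrix.mul_smul, Matrix.neg_mul, Matrix.mul_neg, mul_assoc]
    module
  have hconst : ∀ y, K y = Complex.exp (2 * Complex.I * μ * y) • K 0 := by
    intro y
    have h1 : ∀ y : ℝ, HasDerivAt (fun y : ℝ => Complex.exp (-(2 * Complex.I * μ) * y) • K y) 0 y
        := by
      intro y
      have h2 : HasDerivAt (fun y : ℝ => -(2 * Complex.I * μ) * (y : ℂ))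
          (-(2 * Complex.I * μ) * 1) y := (Complex.ofRealCLM.hasDerivAt (x := y)).const_mul _
      refine (h2.cexp.smul (hd y)).congr_deriv ?_
      rw [smul_smul, ← add_smul]
      convert zero_smul ℂ (K y) using 2
      ring
    have h3 := is_const_of_deriv_eq_zero (fun y => (h1 y).differentiableAt)
      (fun y => (h1 y).deriv) y 0
    simp only [Complex.ofReal_zero, mul_zero, Complex.exp_zero, one_smul] at h3
    rw [← h3, smul_smul, ← Complex.exp_add]
    simp
  have hlim : Tendsto K atBot (𝓝 0) := by
    have h := (continuous_skew.tendsto _).comp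
      ((Wing.tendsto_jost hW hz).prodMk_nhds (Wing.tendsto_jost hW hz))
    have e : skew (E₁ W.A z) (E₁ W.A z) = 0 := by
      simp [skew, E₁, conjTranspose_transpose_of_symm hA]
    dsimp only at h
    rwa [e] at h
  have h0 : K 0 = 0 := by
    have hb : ∀ᶠ y in atBot, ‖K 0‖ ≤ ‖K y‖ := by
      filter_upwards [eventually_le_atBot 0] with y hy
      rw [hconst y, norm_smul]
      refine le_mul_of_one_le_left (norm_nonneg _) ?_
      rw [Complex.norm_exp, Real.one_le_exp_iff]
      have : (2 * Complex.I * μ * y).re = -(2 * μ.im * y) := by simp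
      rw [this]
      nlinarith [mul_nonneg hz.2 (neg_nonneg.2 hy)]
    have := ge_of_tendsto hlim.norm hb
    rw [norm_zero] at this
    exact norm_le_zero_iff.1 this
  have := hconst x
  rw [h0, smul_zero] at this
  exact this

theorem skew_jconj_self {m : ℕ} (B : MatH m) :
    skew (jconj B) (jconj B) = (skew B B).map star := by
  ext i j
  simp only [skew, jconj_toRows₁, jconj_toRows₂, Matrix.sub_apply, Matrix.mul_apply,
    Matrix.map_apply, Matrix.transpose_apply, Matrix.neg_apply, star_sub, star_sum, star_mul',
    neg_mul, mul_neg, Finset.sum_neg_distrib]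
  ring

theorem skew_jconj_right {m : ℕ} (B C : MatH m) : skew B (jconj C) = (Cᴴ * B)ᵀ := by
  rw [Potential.conjTranspose_mul_rows]
  simp only [skew, jconj_toRows₁, jconj_toRows₂, Matrix.transpose_add, Matrix.transpose_mul,
    Matrix.conjTranspose_transpose, Matrix.mul_neg, sub_neg_eq_add]

theorem skew_transpose {m : ℕ} (B C : MatH m) : (skew B C)ᵀ = -skew C B := by
  simp only [skew, Matrix.transpose_sub, Matrix.transpose_mul, Matrix.transpose_transpose, neg_sub]

theorem skew_mul_left {m : ℕ} (B C : MatH m) (A : Mat m) : skew (B * A) C = Aᵀ * skew B C := by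
  simp only [skew, (toRows_mul _ _).1, (toRows_mul _ _).2, Matrix.transpose_mul, Matrix.mul_sub,
    Matrix.mul_assoc]

theorem skew_mul_right {m : ℕ} (B C : MatH m) (A : Mat m) : skew B (C * A) = skew B C * A := by
  simp only [skew, (toRows_mul _ _).1, (toRows_mul _ _).2, Matrix.sub_mul, Matrix.mul_assoc]

theorem skew_sub_left {m : ℕ} (B B' C : MatH m) : skew (B - B') C = skew B C - skew B' C := by
  have h1 : (B - B').toRows₁ = B.toRows₁ - B'.toRows₁ := rfl
  have h2 : (B - B').toRows₂ = B.toRows₂ - B'.toRows₂ := rfl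
  simp only [skew, h1, h2, Matrix.transpose_sub, Matrix.sub_mul]
  abel

theorem skew_sub_right {m : ℕ} (B C C' : MatH m) : skew B (C - C') = skew B C - skew B C' := by
  have h1 : (C - C').toRows₁ = C.toRows₁ - C'.toRows₁ := rfl
  have h2 : (C - C').toRows₂ = C.toRows₂ - C'.toRows₂ := rfl
  simp only [skew, h1, h2, Matrix.mul_sub]
  abel

theorem skew_smul_left {m : ℕ} (c : ℂ) (B C : MatH m) : skew (c • B) C = c • skew B C := by
  have h1 : (c • B).toRows₁ = c • B.toRows₁ := rfl
  have h2 : (c • B).toRows₂ = c • B.toRows₂ := rfl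
  simp only [skew, h1, h2, Matrix.transpose_smul, Matrix.smul_mul, smul_sub]

theorem skew_smul_right {m : ℕ} (c : ℂ) (B C : MatH m) : skew B (c • C) = c • skew B C := by
  have h1 : (c • C).toRows₁ = c • C.toRows₁ := rfl
  have h2 : (c • C).toRows₂ = c • C.toRows₂ := rfl
  simp only [skew, h1, h2, Matrix.mul_smul, smul_sub]

namespace Potential

variable {m : ℕ} {P : Potential m}

/-! ### Eigenfunctions at fixed `(x, t)` as functions of the spectral parameter -/

theorem reflK_neg (k₀ : ℝ) (z : ℂ) : reflK k₀ (-z) = -reflK k₀ z := by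
  simp [reflK, div_neg, neg_div]

/-- `Im λ < 0`, `z ≠ 0`. -/
def HlowOpen (k₀ : ℝ) : Set ℂ := {z | -z ∈ Hopen k₀}

theorem isOpen_HlowOpen (k₀ : ℝ) : IsOpen (HlowOpen k₀) :=
  (isOpen_Hopen k₀).preimage continuous_neg

theorem mem_HlowOpen {k₀ : ℝ} {z : ℂ} : z ∈ HlowOpen k₀ ↔ z ≠ 0 ∧ (lamK k₀ z).im < 0 := by
  simp [HlowOpen, Hopen, lamK_neg]

theorem conj_mem_HlowOpen {k₀ : ℝ} {z : ℂ} (hz : z ∈ Hopen k₀) : conj z ∈ HlowOpen k₀ := by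
  rw [mem_HlowOpen, lamK_conj]
  exact ⟨(map_ne_zero _).2 hz.1, by simpa using hz.2⟩

section

variable (hP : P.IsSolution) {t : ℝ} (ht : t ∈ P.T)
include hP ht

theorem continuousOn_what (x : ℝ) : ContinuousOn (fun z => P.what t z x) (Hclosed P.k₀) :=
  Wing.continuousOn_jost (leftWing_good hP ht) x

theorem differentiableAt_what (x : ℝ) {z : ℂ} (hz : z ∈ Hopen P.k₀) :
    DifferentiableAt ℂ (fun z => P.what t z x) z :=
  (Wing.differentiableOn_jost (leftWing_good hP ht) x).differentiableAt
    ((isOpen_Hopen _).mem_nhds hz)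

theorem continuousOn_vbar (x : ℝ) : ContinuousOn (fun z => P.vbar t z x) (Hlow P.k₀) :=
  (Wing.continuousOn_jost (rightWing_good hP ht) (-x)).comp continuous_neg.continuousOn
    fun _ hz => hz

theorem differentiableAt_vbar (x : ℝ) {z : ℂ} (hz : z ∈ HlowOpen P.k₀) :
    DifferentiableAt ℂ (fun z => P.vbar t z x) z := by
  have h := (Wing.differentiableOn_jost (rightWing_good hP ht) (-x)).differentiableAt
    ((isOpen_Hopen _).mem_nhds (x := -z) hz)
  exact h.comp z differentiable_neg.differentiableAt

theorem what_injective {z : ℂ} (hz : z ∈ Hclosed P.k₀) (x : ℝ) {v : Mat m}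
    (h : P.what t z x * v = 0) : v = 0 :=
  Wing.jost_injective (leftWing_good hP ht) hz x h

theorem vbar_injective {z : ℂ} (hz : z ∈ Hlow P.k₀) (x : ℝ) {v : Mat m}
    (h : P.vbar t z x * v = 0) : v = 0 :=
  Wing.jost_injective (rightWing_good hP ht) (z := -z) hz (-x) h

theorem tendsto_what_cobounded (x : ℝ) : Tendsto (fun z => P.what t z x)
    (Bornology.cobounded ℂ ⊓ 𝓟 (Hclosed P.k₀)) (𝓝 (Matrix.fromRows 1 0)) :=
  Wing.tendsto_jost_cobounded (leftWing_good hP ht) x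

theorem tendsto_vbar_cobounded (x : ℝ) : Tendsto (fun z => P.vbar t z x)
    (Bornology.cobounded ℂ ⊓ 𝓟 (Hlow P.k₀)) (𝓝 (Matrix.fromRows 1 0)) := by
  refine (Wing.tendsto_jost_cobounded (rightWing_good hP ht) (-x)).comp (tendsto_inf.2 ⟨?_, ?_⟩)
  · exact (tendsto_neg_cobounded (E := ℂ)).mono_left inf_le_left
  · exact tendsto_principal.2 (eventually_inf_principal.2 (Eventually.of_forall fun z hz => hz))

theorem tendsto_mul_vbar_lower (x : ℝ) :
    Tendsto (fun y : ℝ => (y : ℂ) • (P.vbar t (-(Complex.I * y)) x).toRows₂) atTop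
      (𝓝 (P.Q x t)ᴴ) := by
  have h := Wing.tendsto_mul_lower (rightWing_good hP ht) (-x)
  simp only [rightWing, neg_neg, Matrix.conjTranspose_neg] at h
  simp only [vbar, neg_neg]
  exact h

theorem vbar_reflK {z : ℂ} (hz : z ∈ Hlow P.k₀) (hl : lamK P.k₀ z ≠ 0) (x : ℝ) :
    P.vbar t z x = jconj (P.vbar t (reflK P.k₀ z) x) * ((-(Complex.I / z)) • P.Qpᴴ) := by
  have h := Wing.jost_reflK (rightWing_good hP ht)
    (fun y => by simp [rightWing, hP.symm (-y) t ht])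
    (by simp [rightWing, Qp_symm hP]) (z := -z) hz (by simpa [rightWing, lamK_neg] using hl) (-x)
  rw [vbar, h]
  simp only [rightWing, Matrix.conjTranspose_neg, div_neg, neg_neg, reflK_neg, smul_neg, neg_smul]
  rfl

theorem what_reflK {z : ℂ} (hz : z ∈ Hclosed P.k₀) (hl : lamK P.k₀ z ≠ 0) (x : ℝ) :
    P.what t z x = jconj (P.what t (reflK P.k₀ z) x) * ((-(Complex.I / z)) • P.Qmᴴ) :=
  Wing.jost_reflK (leftWing_good hP ht) (fun y => hP.symm y t ht) (Qm_symm hP) hz hl x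

theorem skew_what {z : ℂ} (hz : z ∈ Hclosed P.k₀) (x : ℝ) :
    skew (P.what t z x) (P.what t z x) = 0 :=
  Wing.jost_isotropic (leftWing_good hP ht) (fun y => hP.symm y t ht) (Qm_symm hP) hz x

theorem skew_vbar {z : ℂ} (hz : z ∈ Hlow P.k₀) (x : ℝ) :
    skew (P.vbar t z x) (P.vbar t z x) = 0 :=
  Wing.jost_isotropic (rightWing_good hP ht) (fun y => by simp [rightWing, hP.symm (-y) t ht])
    (by simp [rightWing, Qp_symm hP]) (z := -z) hz (-x)

end

end Potential

/-! ### Full rank and invertibility -/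

section LinearAlgebra

variable {m : ℕ}

theorem exists_column {ι : Type*} [Fintype ι] {B : Matrix ι (Fin m) ℂ} {v : Fin m → ℂ}
    (hv : v ≠ 0) (h : B *ᵥ v = 0) : ∃ V : Mat m, V ≠ 0 ∧ B * V = 0 := by
  refine ⟨Matrix.of fun i _ => v i, fun h0 => hv (funext fun i => congrFun (congrFun h0 i) i), ?_⟩
  ext i j
  exact congrFun h i

theorem det_ne_zero_of_injective {A : Mat m} (h : ∀ V : Mat m, A * V = 0 → V = 0) :
    A.det ≠ 0 := by
  intro h0
  obtain ⟨v, hv, hAv⟩ := Matrix.exists_mulVec_eq_zero_iff.2 h0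
  obtain ⟨V, hV, hAV⟩ := exists_column hv hAv
  exact hV (h V hAV)

open scoped ComplexOrder in
theorem det_conjTranspose_mul_self_ne_zero {B : MatH m} (h : ∀ V : Mat m, B * V = 0 → V = 0) :
    (Bᴴ * B).det ≠ 0 := by
  intro h0
  obtain ⟨v, hv, hAv⟩ := Matrix.exists_mulVec_eq_zero_iff.2 h0
  rw [Matrix.conjTranspose_mul_self_mulVec_eq_zero] at hAv
  obtain ⟨V, hV, hAV⟩ := exists_column hv hAv
  exact hV (h V hAV)

theorem map_star_inv (A : Mat m) : (A.map star)⁻¹ = A⁻¹.map star := by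
  have h : ∀ B : Mat m, B.map star = (Bᴴ)ᵀ := fun B => by ext i j; simp
  rw [h, h, Matrix.conjTranspose_nonsing_inv, Matrix.transpose_nonsing_inv]

theorem det_map_star (A : Mat m) : (A.map star).det = conj A.det := by
  have h : A.map star = (Aᴴ)ᵀ := by ext i j; simp
  rw [h, Matrix.det_transpose, Matrix.det_conjTranspose]
  rfl

theorem det_ne_zero_of_mul_conjTranspose {A : Mat m} {c : ℂ} (hc : c ≠ 0)
    (h : A * Aᴴ = c • (1 : Mat m)) : A.det ≠ 0 := by
  intro h0
  have := congrArg Matrix.det h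
  rw [Matrix.det_mul, h0, zero_mul, Matrix.det_smul, Matrix.det_one, mul_one] at this
  exact pow_ne_zero _ hc this.symm

end LinearAlgebra

namespace Potential

variable {m : ℕ} {P : Potential m}

/-- `V̂` at time `t`, extended to the whole region `Im λ ≥ 0`. -/
def vhat (P : Potential m) (t : ℝ) (z : ℂ) (x : ℝ) : MatH m := jconj (P.vbar t (conj z) x)

/-- The Wronskian `γ a`. -/
def wr (P : Potential m) (t : ℝ) (z : ℂ) (x : ℝ) : Mat m :=
  (P.vbar t (conj z) x)ᴴ * P.what t z x

section

variable (hP : P.IsSolution) {t : ℝ} (ht : t ∈ P.T)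
include hP ht

theorem a_eq {z : ℂ} (hz : z ∈ Hclosed P.k₀) (hl : lamK P.k₀ z ≠ 0) (x : ℝ) :
    P.a z = (P.gam z)⁻¹ • P.wr t z x := by
  rw [wr, ← gam_smul_a hP hz hl x ht, smul_smul, inv_mul_cancel₀ (P.gam_ne_zero hz.1 hl), one_smul]

theorem differentiableAt_wr (x : ℝ) {z : ℂ} (hz : z ∈ Hopen P.k₀) :
    DifferentiableAt ℂ (fun z => P.wr t z x) z :=
  differentiableAt_matrix_mul (F := fun z => (P.vbar t (conj z) x)ᴴ)
    (differentiableAt_conjTranspose_conj (F := fun z => P.vbar t z x)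
      (differentiableAt_vbar hP ht x (conj_mem_HlowOpen hz))) (differentiableAt_what hP ht x hz)

theorem differentiableAt_vhat (x : ℝ) {z : ℂ} (hz : z ∈ Hopen P.k₀) :
    DifferentiableAt ℂ (fun z => P.vhat t z x) z :=
  differentiableAt_jconj_conj (F := fun z => P.vbar t z x) (differentiableAt_vbar hP ht x (conj_mem_HlowOpen hz))

theorem continuousOn_wr (x : ℝ) : ContinuousOn (fun z => P.wr t z x) (Hclosed P.k₀) := by
  have h : ContinuousOn (fun z => P.vbar t (conj z) x) (Hclosed P.k₀) :=
    (continuousOn_vbar hP ht x).comp (g := fun z => P.vbar t z x) (f := fun z => conj z)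
      Complex.continuous_conj.continuousOn fun z hz => conj_mem_Hlow hz
  have hc : Continuous fun p : MatH m × MatH m => p.1ᴴ * p.2 := by fun_prop
  exact hc.comp_continuousOn (f := fun z => (P.vbar t (conj z) x, P.what t z x))
    (h.prodMk (continuousOn_what hP ht x))

omit ht hP in
theorem lamK_ne_zero_of_mem {z : ℂ} (hz : z ∈ Hopen P.k₀) : lamK P.k₀ z ≠ 0 := by
  intro h
  have := hz.2
  rw [h] at this
  simp at this

omit ht hP in
theorem differentiableAt_gam {z : ℂ} (hz : z ≠ 0) : DifferentiableAt ℂ P.gam z := by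
  have h : z ^ 2 ≠ 0 := pow_ne_zero 2 hz
  unfold gam
  fun_prop (disch := assumption)

omit ht in
theorem differentiableAt_a {z : ℂ} (hz : z ∈ Hopen P.k₀) : DifferentiableAt ℂ P.a z := by
  obtain ⟨t, ht⟩ := hP.isConnected_T.nonempty
  have h := ((differentiableAt_gam (P := P) hz.1).inv
    (P.gam_ne_zero hz.1 (lamK_ne_zero_of_mem hz))).smul (differentiableAt_wr hP ht 0 hz)
  refine h.congr_of_eventuallyEq ?_
  filter_upwards [(isOpen_Hopen P.k₀).mem_nhds hz] with w hw
  exact a_eq hP ht (Hopen_subset _ hw) (lamK_ne_zero_of_mem hw) 0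

omit ht in
theorem continuousOn_a : ContinuousOn P.a (Hclosed P.k₀ ∩ {z | lamK P.k₀ z ≠ 0}) := by
  obtain ⟨t, ht⟩ := hP.isConnected_T.nonempty
  have h : ContinuousOn (fun z => (P.gam z)⁻¹ • P.wr t z 0)
      (Hclosed P.k₀ ∩ {z | lamK P.k₀ z ≠ 0}) := by
    refine ContinuousOn.smul (ContinuousOn.inv₀ (fun z hz => ?_)
      fun z hz => P.gam_ne_zero hz.1.1 hz.2) ((continuousOn_wr hP ht 0).mono inter_subset_left)
    exact (differentiableAt_gam hz.1.1).continuousAt.continuousWithinAt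
  exact h.congr fun z hz => a_eq hP ht hz.1 hz.2 0

omit ht in
-- Both factors of the Wronskian are transformed by the reflection symmetry; the outer matrices come
-- from the two boundary values, the scalar from `γ` and the factors `i/z`. Zeros of `det a` thus
-- come in reflected pairs.
theorem a_reflK {z : ℂ} (hz : z ∈ Hclosed P.k₀) (hl : lamK P.k₀ z ≠ 0) :
    P.a z = ((P.k₀ : ℂ) ^ 2)⁻¹ • (P.Qp * (P.a (reflK P.k₀ z)).map star * P.Qmᴴ) := by
  obtain ⟨t, ht⟩ := hP.isConnected_T.nonempty
  have hk := hP.k₀_pos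
  have hk' : (P.k₀ : ℂ) ≠ 0 := by exact_mod_cast hk.ne'
  have hz0 := hz.1
  have hcz : conj z ≠ 0 := (map_ne_zero _).2 hz0
  have hzr := reflK_mem_Hclosed hk hz
  have hlr : lamK P.k₀ (reflK P.k₀ z) ≠ 0 := by
    rw [lamK_reflK hk hz0, neg_ne_zero]; exact (map_ne_zero _).2 hl
  have hlc : lamK P.k₀ (conj z) ≠ 0 := by rw [lamK_conj]; exact (map_ne_zero _).2 hl
  have hg := P.gam_ne_zero hz0 hl
  have hrc : reflK P.k₀ (conj z) = conj (reflK P.k₀ z) := by simp [reflK]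
  have h1 := gam_smul_a hP hzr hlr 0 ht
  have h2 := gam_smul_a hP hz hl 0 ht
  rw [what_reflK hP ht hz hl, vbar_reflK hP ht (conj_mem_Hlow hz) hlc, hrc] at h2
  rw [Matrix.conjTranspose_mul, Matrix.mul_assoc, ← Matrix.mul_assoc (jconj _)ᴴ,
    jconj_conjTranspose_mul_jconj, ← h1, map_star_smul, Matrix.conjTranspose_smul,
    Matrix.conjTranspose_conjTranspose] at h2
  simp only [Matrix.smul_mul, Matrix.mul_smul, smul_smul, ← Matrix.mul_assoc] at h2
  have hgr : conj (P.gam (reflK P.k₀ z)) = z ^ 2 / (P.k₀ : ℂ) ^ 2 * P.gam z := by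
    simp only [gam, reflK, map_add, map_one, map_div₀, map_pow, map_neg, Complex.conj_ofReal,
      Complex.conj_conj]
    field_simp
    ring
  rw [hgr] at h2
  have h3 := congrArg (fun B => (P.gam z)⁻¹ • B) h2
  simp only [smul_smul, inv_mul_cancel₀ hg, one_smul] at h3
  rw [h3]
  congr 1
  simp only [star_neg, star_div₀, RCLike.star_def, Complex.conj_I, Complex.conj_conj]
  have hI : Complex.I ^ 2 = -1 := Complex.I_sq
  field_simp
  linear_combination (-1 : ℂ) * hI

omit ht in
theorem det_a_reflK {z : ℂ} (hz : z ∈ Hclosed P.k₀) (hl : lamK P.k₀ z ≠ 0) :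
    (P.a z).det = 0 ↔ (P.a (reflK P.k₀ z)).det = 0 := by
  have hk' : (P.k₀ : ℂ) ≠ 0 := by exact_mod_cast hP.k₀_pos.ne'
  have h1 := det_ne_zero_of_mul_conjTranspose (pow_ne_zero 2 hk') hP.Qp_mul
  have h2 : (P.Qmᴴ).det ≠ 0 := by
    rw [Matrix.det_conjTranspose]
    exact star_ne_zero.2 (det_ne_zero_of_mul_conjTranspose (pow_ne_zero 2 hk') hP.Qm_mul)
  rw [a_reflK hP hz hl, Matrix.det_smul, Matrix.det_mul, Matrix.det_mul, det_map_star]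
  simp [h1, hk', Matrix.det_conjTranspose] at h1 h2 ⊢
  tauto

/-- Dividing by `a` cancels `Q₋` and leaves the factor with `Q₊`, the same as for `V̄`; so the glued
function obeys a single reflection law. -/
theorem what_mul_inv_reflK {z : ℂ} (hz : z ∈ Hclosed P.k₀) (hl : lamK P.k₀ z ≠ 0) (x : ℝ) :
    P.what t z x * (P.a z)⁻¹
      = jconj (P.what t (reflK P.k₀ z) x * (P.a (reflK P.k₀ z))⁻¹)
        * ((-(Complex.I / z)) • P.Qpᴴ) := by
  have hk' : (P.k₀ : ℂ) ^ 2 ≠ 0 := pow_ne_zero 2 (by exact_mod_cast hP.k₀_pos.ne')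
  have hinv : ∀ {A : Mat m}, A * Aᴴ = ((P.k₀ : ℂ) ^ 2) • (1 : Mat m) →
      A⁻¹ = ((P.k₀ : ℂ) ^ 2)⁻¹ • Aᴴ := fun {A} hA =>
    Matrix.inv_eq_right_inv (by
      rw [Matrix.mul_smul, hA, smul_smul, inv_mul_cancel₀ hk', one_smul])
  have hQm : (P.Qmᴴ)⁻¹ = ((P.k₀ : ℂ) ^ 2)⁻¹ • P.Qm := by
    rw [hinv (A := P.Qmᴴ) (by rw [Matrix.conjTranspose_conjTranspose, hP.Qm_mul']),
      Matrix.conjTranspose_conjTranspose]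
  have hsm : ∀ B : Mat m, (((P.k₀ : ℂ) ^ 2)⁻¹ • B)⁻¹ = (P.k₀ : ℂ) ^ 2 • B⁻¹ := fun B => by
    by_cases hB : B.det = 0
    · rw [Matrix.nonsing_inv_apply_not_isUnit B (by simp [hB]),
        Matrix.nonsing_inv_apply_not_isUnit _ (by simp [hB]), smul_zero]
    · have := Matrix.inv_smul' B (Units.mk0 _ (inv_ne_zero hk')) (isUnit_iff_ne_zero.2 hB)
      simpa [Units.smul_def] using this
  rw [a_reflK hP hz hl, what_reflK hP ht hz hl, hsm, Matrix.mul_inv_rev, Matrix.mul_inv_rev, hQm,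
    hinv hP.Qp_mul, map_star_inv, jconj_mul]
  simp only [Matrix.smul_mul, Matrix.mul_smul, smul_smul, Matrix.mul_assoc]
  rw [← Matrix.mul_assoc P.Qmᴴ P.Qm, hP.Qm_mul', Matrix.smul_mul, Matrix.one_mul, Matrix.mul_smul,
    smul_smul]
  congr 1
  have hk'' : (P.k₀ : ℂ) ≠ 0 := by exact_mod_cast hP.k₀_pos.ne'
  field_simp

omit ht in
theorem tendsto_a_cobounded :
    Tendsto P.a (Bornology.cobounded ℂ ⊓ 𝓟 (Hclosed P.k₀)) (𝓝 1) := by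
  obtain ⟨t, ht⟩ := hP.isConnected_T.nonempty
  have hk := hP.k₀_pos
  have hn := tendsto_norm_cobounded_atTop (E := ℂ)
  have hconj : Tendsto (fun z : ℂ => conj z) (Bornology.cobounded ℂ ⊓ 𝓟 (Hclosed P.k₀))
      (Bornology.cobounded ℂ ⊓ 𝓟 (Hlow P.k₀)) := by
    refine tendsto_inf.2 ⟨?_, tendsto_principal.2
      (eventually_inf_principal.2 (Eventually.of_forall fun z hz => conj_mem_Hlow hz))⟩
    rw [← tendsto_norm_atTop_iff_cobounded]
    simpa using hn.mono_left inf_le_left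
  have hc : Continuous fun p : MatH m × MatH m => p.1ᴴ * p.2 := by fun_prop
  have h1 := (hc.tendsto _).comp (((tendsto_vbar_cobounded hP ht 0).comp hconj).prodMk_nhds
    (tendsto_what_cobounded hP ht 0))
  have h2 : Tendsto (fun z => (P.gam z)⁻¹) (Bornology.cobounded ℂ ⊓ 𝓟 (Hclosed P.k₀)) (𝓝 1) := by
    have h3 : Tendsto (fun z : ℂ => z⁻¹) (Bornology.cobounded ℂ) (𝓝 0) :=
      tendsto_inv₀_cobounded
    have h4 : Tendsto P.gam (Bornology.cobounded ℂ) (𝓝 1) := by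
      have := ((h3.pow 2).const_mul ((P.k₀ : ℂ) ^ 2)).const_add 1
      simp only [ne_eq, OfNat.ofNat_ne_zero, not_false_eq_true, zero_pow, mul_zero, add_zero] at this
      refine this.congr fun z => ?_
      rw [gam, inv_pow]; rfl
    simpa using (h4.inv₀ one_ne_zero).mono_left inf_le_left
  have h5 := h2.smul h1
  have e : (Matrix.fromRows 1 0 : MatH m)ᴴ * (Matrix.fromRows 1 0 : MatH m) = 1 := by
    rw [conjTranspose_mul_rows]; simp
  rw [one_smul] at h5
  dsimp only at h5
  rw [e] at h5
  refine h5.congr' ?_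
  rw [EventuallyEq, eventually_inf_principal]
  filter_upwards [hn.eventually_ge_atTop (2 * P.k₀)] with z hz hzH
  refine (a_eq hP ht hzH (fun h => ?_) 0).symm
  have h6 := norm_lamK_ge hk hz
  rw [h, norm_zero] at h6
  linarith

/-! ### Behaviour on the continuous spectrum -/

omit hP ht in
-- The Cayley parametrization `p (1 + is)/(1 - is)` runs along the circle `|z| = k₀`, where `Im λ =
-- 0`. Limits along the spectrum at `p` are therefore unique.
theorem circle_neBot (hk : 0 < P.k₀) {p : ℂ} (hp : ‖p‖ = P.k₀) :
    (𝓝[{z | (lamK P.k₀ z).im = 0} \ {p}] p).NeBot := by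
  have hp0 : p ≠ 0 := fun h => by rw [h, norm_zero] at hp; exact hk.ne hp
  have hden : ∀ s : ℝ, (1 - Complex.I * s : ℂ) ≠ 0 := fun s h => by
    have := congrArg Complex.re h
    simp at this
  have hnum : ∀ s : ℝ, ‖(1 + Complex.I * s : ℂ)‖ = ‖(1 - Complex.I * s : ℂ)‖ := fun s => by
    rw [← Complex.norm_conj]
    congr 1
    simp [sub_eq_add_neg]
  have ht : Tendsto (fun s : ℝ => p * ((1 + Complex.I * s) / (1 - Complex.I * s))) (𝓝[≠] (0 : ℝ))
      (𝓝[{z | (lamK P.k₀ z).im = 0} \ {p}] p) := by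
    refine tendsto_nhdsWithin_iff.2 ⟨?_, ?_⟩
    · have hc : ContinuousAt (fun s : ℝ => p * ((1 + Complex.I * s) / (1 - Complex.I * s)))
          0 := by
        refine continuousAt_const.mul (ContinuousAt.div (by fun_prop) (by fun_prop) (hden 0))
      have := hc.tendsto
      simp only [Complex.ofReal_zero, mul_zero, add_zero, sub_zero, div_one, mul_one] at this
      exact this.mono_left nhdsWithin_le_nhds
    · filter_upwards [self_mem_nhdsWithin] with s hs
      have hn : ‖p * ((1 + Complex.I * s) / (1 - Complex.I * s))‖ = P.k₀ := by
        rw [norm_mul, norm_div, hnum, div_self (norm_ne_zero_iff.2 (hden s)), mul_one, hp]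
      refine ⟨?_, fun h => ?_⟩
      · have hne : p * ((1 + Complex.I * s) / (1 - Complex.I * s)) ≠ 0 := fun h => by
          rw [h, norm_zero] at hn; exact hk.ne hn
        rw [mem_ofPred_eq, lamK_im P.k₀ hne, hn]
        simp
      · rw [mem_singleton_iff] at h
        have h1 := mul_right_eq_self₀.1 h
        rcases h1 with h1 | h1
        · rw [div_eq_one_iff_eq (hden s)] at h1
          have := congrArg Complex.im h1
          simp at this
          exact hs (by simp only [mem_singleton_iff]; linarith)
        · exact hp0 h1
  exact ht.neBot

omit ht in
-- At a branch point `γ` and the Wronskian both vanish. Along the spectrum, full rank of `V̄` gives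
-- `a = (V̄†V̄)⁻¹ V̄†Ŵ`, which does converge, to an invertible matrix because `Ŵ` has full rank too.
-- Inside, `a - A` is a quotient with denominator `λ` and continuous numerator, and the Lindelöf
-- lemma transfers the limit.
theorem exists_boundary_limit_branch (hrefl : P.Reflectionless) {t : ℝ} (ht : t ∈ P.T) (x : ℝ)
    {p : ℂ} (hp0 : p ≠ 0) (hp : lamK P.k₀ p = 0) :
    ∃ A : Mat m, A.det ≠ 0 ∧ Tendsto P.a (𝓝[Hopen P.k₀] p) (𝓝 A) ∧
      P.what t p x = P.vbar t p x * A := by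
  have hk := hP.k₀_pos
  have hpn : ‖p‖ = P.k₀ := by
    rcases (lamK_eq_zero_iff hp0).1 hp with h | h <;> simp [h, abs_of_pos hk]
  have hpc : p ∈ Hclosed P.k₀ := ⟨hp0, by rw [hp]; simp⟩
  have hpl : p ∈ Hlow P.k₀ := mem_Hlow.2 ⟨hp0, by rw [hp]; simp⟩
  set l := 𝓝[{z | (lamK P.k₀ z).im = 0} \ {p}] p with hl
  have : l.NeBot := circle_neBot hk hpn
  -- This disc avoids `0`, at distance `k₀`, and the other branch point, at distance `2k₀`.
  set δ := P.k₀ / 2 with hδ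
  have hδ0 : 0 < δ := by positivity
  have hball0 : ∀ z ∈ Metric.closedBall p δ, z ≠ 0 := by
    rintro z hz rfl
    rw [Metric.mem_closedBall, dist_zero_left, hpn] at hz
    linarith
  have hball : ∀ z ∈ Metric.closedBall p δ, lamK P.k₀ z = 0 ↔ z = p := by
    intro z hz
    refine ⟨fun h => ?_, fun h => h ▸ hp⟩
    have hd : ∀ c : ℂ, ‖c‖ = 1 → ¬ dist (c * (Complex.I * P.k₀)) (-(c * (Complex.I * P.k₀))) ≤ δ := by
      intro c hc h
      rw [dist_eq_norm, sub_neg_eq_add, ← two_mul, norm_mul, norm_mul, hc, norm_mul] at h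
      simp [abs_of_pos hk] at h
      linarith
    rw [Metric.mem_closedBall] at hz
    rcases (lamK_eq_zero_iff (hball0 z hz)).1 h with h1 | h1 <;>
      rcases (lamK_eq_zero_iff hp0).1 hp with h2 | h2
    · rw [h1, h2]
    · exact absurd (by simpa [h1, h2] using hz) (hd 1 (by simp))
    · exact absurd (by simpa [h1, h2] using hz) (hd (-1) (by simp))
    · rw [h1, h2]
  have hmem : ∀ᶠ z in l, z ∈ P.Sigma₀ ∧ z ∈ Metric.closedBall p δ := by
    have h1 : ∀ᶠ z in l, z ∈ Metric.closedBall p δ :=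
      nhdsWithin_le_nhds (Metric.closedBall_mem_nhds p hδ0)
    filter_upwards [h1, self_mem_nhdsWithin] with z hz hz'
    exact ⟨(mem_Sigma₀_iff hk).2 ⟨hball0 z hz, hz'.1, fun h => hz'.2 ((hball z hz).1 h)⟩, hz⟩
  have hlH : l ≤ 𝓝[Hclosed P.k₀] p := by
    refine le_inf inf_le_left (le_principal_iff.2 ?_)
    filter_upwards [hmem] with z hz using (mem_of_mem_Sigma₀ hk hz.1).1
  have hlL : l ≤ 𝓝[Hlow P.k₀] p := by
    refine le_inf inf_le_left (le_principal_iff.2 ?_)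
    filter_upwards [hmem] with z hz using (mem_of_mem_Sigma₀ hk hz.1).2.1
  have hF : Tendsto (fun z => P.what t z x) l (𝓝 (P.what t p x)) :=
    (continuousOn_what hP ht x p hpc).mono_left hlH
  have hG : Tendsto (fun z => P.vbar t z x) l (𝓝 (P.vbar t p x)) :=
    (continuousOn_vbar hP ht x p hpl).mono_left hlL
  have hc : Continuous fun p : MatH m × MatH m => p.1ᴴ * p.2 := by fun_prop
  have hGG := (hc.tendsto _).comp (hG.prodMk_nhds hG)
  have hGF := (hc.tendsto _).comp (hG.prodMk_nhds hF)
  have hdet := det_conjTranspose_mul_self_ne_zero (B := P.vbar t p x)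
    fun V hV => vbar_injective hP ht hpl x hV
  set A := ((P.vbar t p x)ᴴ * P.vbar t p x)⁻¹ * ((P.vbar t p x)ᴴ * P.what t p x) with hA
  have hcm : Continuous fun p : Mat m × Mat m => p.1 * p.2 := by fun_prop
  have ha : Tendsto P.a l (𝓝 A) := by
    have h1 := (hcm.tendsto _).comp ((tendsto_matrix_inv hGG hdet).prodMk_nhds hGF)
    refine h1.congr' ?_
    filter_upwards [hmem] with z hz
    obtain ⟨-, hzl, -⟩ := mem_of_mem_Sigma₀ hk hz.1
    have hdz := det_conjTranspose_mul_self_ne_zero (B := P.vbar t z x)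
      fun V hV => vbar_injective hP ht hzl x hV
    simp only [Function.comp_apply]
    rw [what_eq_vbar_mul_a hP hrefl hz.1 x ht, ← Matrix.mul_assoc (P.vbar t z x)ᴴ,
      Matrix.nonsing_inv_mul_cancel_left _ _ (isUnit_iff_ne_zero.2 hdz)]
  have hFA : P.what t p x = P.vbar t p x * A := by
    have hc2 : Continuous fun p : MatH m × Mat m => p.1 * p.2 := by fun_prop
    have h1 := (hc2.tendsto _).comp (hG.prodMk_nhds ha)
    refine tendsto_nhds_unique (hF.congr' ?_) h1
    filter_upwards [hmem] with z hz using what_eq_vbar_mul_a hP hrefl hz.1 x ht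
  refine ⟨A, det_ne_zero_of_injective fun V hV => ?_, ?_, hFA⟩
  · refine what_injective hP ht hpc x ?_
    rw [hFA, Matrix.mul_assoc, hV, Matrix.mul_zero]
  -- the Wronskian vanishes to first order at the branch point
  have hgam : ∀ z ∈ Metric.closedBall p δ, P.gam z = 2 * lamK P.k₀ z / z := fun z hz => by
    rw [eq_div_iff (hball0 z hz), P.gam_mul (hball0 z hz)]
  have hwra : ∀ z ∈ Metric.closedBall p δ, z ∈ Hclosed P.k₀ → z ≠ p →
      (z / 2) • P.wr t z x = lamK P.k₀ z • P.a z := by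
    intro z hz hzH hzp
    have hlz : lamK P.k₀ z ≠ 0 := fun h => hzp ((hball z hz).1 h)
    have hz0 := hball0 z hz
    rw [a_eq hP ht hzH hlz x, smul_smul, hgam z hz]
    congr 1
    field_simp
  have hlamc : ContinuousOn (lamK P.k₀) (Metric.closedBall p δ) :=
    (differentiableOn_lamK P.k₀).continuousOn.mono hball0
  have hsub : Metric.closedBall p δ ∩ {z | 0 ≤ (lamK P.k₀ z).im} ⊆ Hclosed P.k₀ :=
    fun z hz => ⟨hball0 z hz.1, hz.2⟩
  have hwrp : P.wr t p x = 0 := by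
    have h1 : Tendsto (fun z => (z / 2) • P.wr t z x) l (𝓝 ((p / 2) • P.wr t p x)) :=
      ((tendsto_id.mono_left (nhdsWithin_le_nhds)).div_const 2).smul
        ((continuousOn_wr hP ht x p hpc).mono_left hlH)
    have h2 : Tendsto (fun z => lamK P.k₀ z • P.a z) l (𝓝 (lamK P.k₀ p • A)) :=
      ((hlamc.continuousAt (Metric.closedBall_mem_nhds p hδ0)).tendsto.mono_left
        nhdsWithin_le_nhds).smul ha
    rw [hp, zero_smul] at h2
    have h3 := tendsto_nhds_unique (h1.congr' ?_) h2
    · exact (smul_eq_zero.1 h3).resolve_left (div_ne_zero hp0 two_ne_zero)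
    · filter_upwards [hmem, self_mem_nhdsWithin] with z hz hz'
      exact hwra z hz.2 (mem_of_mem_Sigma₀ hk hz.1).1 hz'.2
  have hquot : ∀ z ∈ Metric.closedBall p δ, z ∈ Hclosed P.k₀ → z ≠ p →
      (lamK P.k₀ z)⁻¹ • ((z / 2) • P.wr t z x - lamK P.k₀ z • A) = P.a z - A := by
    intro z hz hzH hzp
    have hlz : lamK P.k₀ z ≠ 0 := fun h => hzp ((hball z hz).1 h)
    rw [hwra z hz hzH hzp, ← smul_sub, smul_smul, inv_mul_cancel₀ hlz, one_smul]
  have hmain := tendsto_inv_smul_of_boundary (L := lamK P.k₀) (p := p)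
    (P := fun z => (z / 2) • P.wr t z x - lamK P.k₀ z • A) hδ0 hlamc
    ((differentiableOn_lamK P.k₀).mono fun z hz => hball0 z (Metric.ball_subset_closedBall hz))
    hball ?_ ?_ ?_ ?_
  · have hle : 𝓝[Hopen P.k₀] p ≤ 𝓝[{z | 0 ≤ (lamK P.k₀ z).im} \ {p}] p :=
      nhdsWithin_mono p fun z hz => ⟨hz.2.le, fun h => by
        rw [mem_singleton_iff] at h
        exact lamK_ne_zero_of_mem hz (h ▸ hp)⟩
    have h1 := (hmain.mono_left hle).add_const A
    rw [zero_add] at h1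
    refine h1.congr' ?_
    filter_upwards [self_mem_nhdsWithin,
      nhdsWithin_le_nhds (Metric.closedBall_mem_nhds p hδ0)] with z hz hzb
    rw [hquot z hzb (Hopen_subset _ hz) fun h => lamK_ne_zero_of_mem hz (h ▸ hp), sub_add_cancel]
  · refine ContinuousOn.sub (ContinuousOn.smul (f := fun z : ℂ => z / 2) (by fun_prop) ((continuousOn_wr hP ht x).mono hsub))
      ((hlamc.mono inter_subset_left).smul continuousOn_const)
  · intro z hz
    have hzb := Metric.ball_subset_closedBall hz.1
    have hzo : z ∈ Hopen P.k₀ := ⟨hball0 z hzb, hz.2⟩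
    refine DifferentiableAt.differentiableWithinAt (DifferentiableAt.sub
      (DifferentiableAt.fun_smul (c := fun z : ℂ => z / 2) (by fun_prop) (differentiableAt_wr hP ht x hzo))
      (DifferentiableAt.smul_const ?_ A))
    exact (differentiableOn_lamK P.k₀).differentiableAt (isOpen_ne.mem_nhds hzo.1)
  · simp only [hwrp, hp, smul_zero, zero_smul, sub_zero]
  · have h1 := ha.sub_const A
    rw [sub_self] at h1
    refine h1.congr' ?_
    filter_upwards [hmem, self_mem_nhdsWithin] with z hz hz'
    exact (hquot z hz.2 (mem_of_mem_Sigma₀ hk hz.1).1 hz'.2).symm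

omit ht in
/-- Boundary values of `a` on the closure of the continuous spectrum. -/
theorem exists_boundary_limit (hrefl : P.Reflectionless) {t : ℝ} (ht : t ∈ P.T) (x : ℝ)
    {p : ℂ} (hp0 : p ≠ 0) (hp : (lamK P.k₀ p).im = 0) :
    ∃ A : Mat m, A.det ≠ 0 ∧ Tendsto P.a (𝓝[Hopen P.k₀] p) (𝓝 A) ∧
      P.what t p x = P.vbar t p x * A := by
  by_cases hl : lamK P.k₀ p = 0
  · exact exists_boundary_limit_branch hP hrefl ht x hp0 hl
  · have hS := (mem_Sigma₀_iff hP.k₀_pos).2 ⟨hp0, hp, hl⟩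
    refine ⟨P.a p, (hrefl p hS).1.ne_zero, ?_, what_eq_vbar_mul_a hP hrefl hS x ht⟩
    exact (continuousOn_a hP p ⟨⟨hp0, hp.ge⟩, hl⟩).mono_left
      (nhdsWithin_mono p fun z hz => ⟨Hopen_subset _ hz, lamK_ne_zero_of_mem hz⟩)

end

end Potential

/-! ### The discrete spectrum -/

theorem reflK_eq_smul (k₀ : ℝ) (z : ℂ) :
    reflK k₀ z = ((-(k₀ ^ 2 / Complex.normSq z) : ℝ) : ℂ) * z := by
  by_cases hz : z = 0
  · simp [hz, reflK]
  have hc : conj z ≠ 0 := (map_ne_zero _).2 hz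
  have h : ((Complex.normSq z : ℝ) : ℂ) = z * conj z := (Complex.mul_conj z).symm
  rw [reflK]
  push_cast
  rw [h]
  field_simp

theorem reflK_im_neg {k₀ : ℝ} (hk : 0 < k₀) {z : ℂ} (hz : 0 < z.im) : (reflK k₀ z).im < 0 := by
  have hz0 : z ≠ 0 := fun h => by simp [h] at hz
  rw [reflK_eq_smul, Complex.im_ofReal_mul]
  have := div_pos (pow_pos hk 2) (Complex.normSq_pos.2 hz0)
  nlinarith

theorem reflK_im_pos {k₀ : ℝ} (hk : 0 < k₀) {z : ℂ} (hz : z.im < 0) : 0 < (reflK k₀ z).im := by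
  have hz0 : z ≠ 0 := fun h => by simp [h] at hz
  rw [reflK_eq_smul, Complex.im_ofReal_mul]
  have := div_pos (pow_pos hk 2) (Complex.normSq_pos.2 hz0)
  nlinarith

theorem reflK_mem_Hopen {k₀ : ℝ} (hk : 0 < k₀) {z : ℂ} (hz : z ∈ Hopen k₀) :
    reflK k₀ z ∈ Hopen k₀ :=
  ⟨reflK_ne_zero hk hz.1, by rw [lamK_reflK hk hz.1]; simpa using hz.2⟩

theorem continuousAt_reflK {k₀ : ℝ} {z : ℂ} (hz : z ≠ 0) : ContinuousAt (reflK k₀) z := by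
  unfold reflK
  exact continuousAt_const.div Complex.continuous_conj.continuousAt ((map_ne_zero _).2 hz)

namespace Potential

variable {m : ℕ} {P : Potential m}

section Spectrum

variable (hP : P.IsSolution) {N : ℕ} {z : Fin N → ℂ} (hz : P.IsDiscreteSpectrum z)
include hP hz

theorem mem_Hopen_of_spectrum (n : Fin N) :
    z n ∈ Hopen P.k₀ ∧ 0 < (z n).im ∧ (P.a (z n)).det = 0 := by
  obtain ⟨h1, h2, h3⟩ := (hz.mem_range_iff (z n)).1 ⟨n, rfl⟩
  exact ⟨mem_Dplus_iff.1 h1, h2, h3⟩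

theorem zeta_mem (j : Fin N ⊕ Fin N) : P.zeta z j ∈ Hopen P.k₀ := by
  rcases j with j | j
  · exact (mem_Hopen_of_spectrum hP hz j).1
  · exact reflK_mem_Hopen hP.k₀_pos (mem_Hopen_of_spectrum hP hz j).1

/-- The given zeros lie in the upper half-plane and their reflections in the lower one, so the two
families cannot meet. -/
theorem zeta_injective : Function.Injective (P.zeta z) := by
  have hk := hP.k₀_pos
  have him := fun n => (mem_Hopen_of_spectrum hP hz n).2.1
  have h0 := fun n => (mem_Hopen_of_spectrum hP hz n).1.1
  rintro (i | i) (j | j) h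
  · rw [hz.injective h]
  · have h1 : z i = reflK P.k₀ (z j) := h
    have h2 := reflK_im_neg hk (him j)
    rw [← h1] at h2
    exact absurd h2 (him i).not_gt
  · have h1 : reflK P.k₀ (z i) = z j := h
    have h2 := reflK_im_neg hk (him i)
    rw [h1] at h2
    exact absurd h2 (him j).not_gt
  · have h1 : reflK P.k₀ (z i) = reflK P.k₀ (z j) := h
    have h2 := congrArg (reflK P.k₀) h1
    rw [reflK_reflK hk (h0 i), reflK_reflK hk (h0 j)] at h2
    rw [hz.injective h2]

theorem det_a_eq_zero_iff {w : ℂ} (hw : w ∈ Hopen P.k₀) :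
    (P.a w).det = 0 ↔ w ∈ Set.range (P.zeta z) := by
  have hk := hP.k₀_pos
  have him : w.im ≠ 0 := fun h => by
    have := mem_Dplus_iff.2 hw
    simp [Dplus, h] at this
  have hr := reflK_mem_Hopen hk hw
  constructor
  · intro h
    rcases him.lt_or_gt with h1 | h1
    · have h2 := (det_a_reflK hP (Hopen_subset _ hw) (lamK_ne_zero_of_mem hw)).1 h
      obtain ⟨n, hn⟩ := (hz.mem_range_iff _).2 ⟨mem_Dplus_iff.2 hr, reflK_im_pos hk h1, h2⟩
      refine ⟨.inr n, ?_⟩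
      change reflK P.k₀ (z n) = w
      rw [hn, reflK_reflK hk hw.1]
    · obtain ⟨n, hn⟩ := (hz.mem_range_iff _).2 ⟨mem_Dplus_iff.2 hw, h1, h⟩
      exact ⟨.inl n, hn⟩
  · rintro ⟨n | n, rfl⟩
    · exact (mem_Hopen_of_spectrum hP hz n).2.2
    · have h1 := (mem_Hopen_of_spectrum hP hz n)
      exact (det_a_reflK hP (Hopen_subset _ h1.1) (lamK_ne_zero_of_mem h1.1)).1 h1.2.2

theorem eventually_det_a_ne_zero (n : Fin N) :
    ∀ᶠ w in 𝓝[≠] (z n), w ∈ Hopen P.k₀ ∧ (P.a w).det ≠ 0 := by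
  have h1 : ∀ᶠ w in 𝓝[≠] (z n), w ∈ Hopen P.k₀ :=
    nhdsWithin_le_nhds ((isOpen_Hopen _).mem_nhds (mem_Hopen_of_spectrum hP hz n).1)
  have h2 : ∀ᶠ w in 𝓝[≠] (z n), w ∉ Set.range (P.zeta z) \ {z n} :=
    nhdsWithin_le_nhds (((Set.finite_range _).sdiff).isClosed.isOpen_compl.mem_nhds
      (by simp))
  filter_upwards [h1, h2, self_mem_nhdsWithin] with w hw hw2 hw3
  exact ⟨hw, fun h => hw2 ⟨(det_a_eq_zero_iff hP hz hw).1 h, hw3⟩⟩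

end Spectrum

/-! ### The meromorphic eigenfunction -/

open Classical in
/-- The sectionally meromorphic function `V̄` on `Im λ ≤ 0`, `Ŵ a⁻¹` on `Im λ > 0`. -/
def merom (P : Potential m) (t x : ℝ) (z : ℂ) : MatH m :=
  if (lamK P.k₀ z).im ≤ 0 then P.vbar t z x else P.what t z x * (P.a z)⁻¹

theorem merom_of_nonpos (t x : ℝ) {z : ℂ} (h : (lamK P.k₀ z).im ≤ 0) :
    P.merom t x z = P.vbar t z x := if_pos h

theorem merom_of_pos (t x : ℝ) {z : ℂ} (h : 0 < (lamK P.k₀ z).im) :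
    P.merom t x z = P.what t z x * (P.a z)⁻¹ := if_neg h.not_ge

theorem continuous_mul_matH : Continuous fun p : MatH m × Mat m => p.1 * p.2 := by fun_prop

theorem hasDerivAt_lamK (k₀ : ℝ) {z : ℂ} (hz : z ≠ 0) :
    HasDerivAt (lamK k₀) ((1 - (k₀ : ℂ) ^ 2 / z ^ 2) / 2) z := by
  have h := ((hasDerivAt_id z).add ((hasDerivAt_inv hz).const_mul ((k₀ : ℂ) ^ 2))).div_const 2
  refine (h.congr_deriv ?_).congr_of_eventuallyEq ?_
  · field_simp; ring
  · filter_upwards with w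
    simp [lamK, div_eq_mul_inv]

theorem contDiffAt_lamK (k₀ : ℝ) {z : ℂ} (hz : z ≠ 0) : ContDiffAt ℂ 1 (lamK k₀) z := by
  unfold lamK
  fun_prop (disch := assumption)

section Merom

variable (hP : P.IsSolution) {t : ℝ} (ht : t ∈ P.T)
include hP ht

theorem differentiableAt_merom_low (x : ℝ) {p : ℂ} (hp : p ∈ HlowOpen P.k₀) :
    DifferentiableAt ℂ (P.merom t x) p := by
  refine (differentiableAt_vbar hP ht x hp).congr_of_eventuallyEq ?_
  filter_upwards [(isOpen_HlowOpen _).mem_nhds hp] with w hw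
  exact merom_of_nonpos t x (mem_HlowOpen.1 hw).2.le

theorem differentiableAt_merom_up (x : ℝ) {p : ℂ} (hp : p ∈ Hopen P.k₀) (hd : (P.a p).det ≠ 0) :
    DifferentiableAt ℂ (P.merom t x) p := by
  refine DifferentiableAt.congr_of_eventuallyEq (f := fun z => P.what t z x * (P.a z)⁻¹)
    (differentiableAt_matrix_mul (F := fun z => P.what t z x) (G := fun z => (P.a z)⁻¹)
    (differentiableAt_what hP ht x hp)
    (differentiableAt_matrix_inv (F := P.a) (differentiableAt_a hP hp) hd)) ?_
  filter_upwards [(isOpen_Hopen _).mem_nhds hp] with w hw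
  exact merom_of_pos t x hw.2

/-- From `Im λ > 0` the limit is `Ŵ A⁻¹` with `A` the boundary value of `a`, and `Ŵ = V̄ A` makes it
the value attained from the other side; branch points are included. -/
theorem continuousAt_merom (hrefl : P.Reflectionless) (x : ℝ) {p : ℂ} (hp0 : p ≠ 0)
    (hp : (lamK P.k₀ p).im = 0) : ContinuousAt (P.merom t x) p := by
  have hle : 𝓝 p ≤ 𝓝[Hlow P.k₀] p ⊔ 𝓝[Hopen P.k₀] p := by
    rw [← nhdsWithin_union]
    refine le_inf le_rfl (le_principal_iff.2 ?_)
    filter_upwards [isOpen_ne.mem_nhds hp0] with w hw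
    rcases le_or_gt (lamK P.k₀ w).im 0 with h | h
    · exact Or.inl (mem_Hlow.2 ⟨hw, h⟩)
    · exact Or.inr ⟨hw, h⟩
  refine Tendsto.mono_left (tendsto_sup.2 ⟨?_, ?_⟩) hle
  · rw [merom_of_nonpos t x hp.le]
    have h := (continuousOn_vbar hP ht x) p (mem_Hlow.2 ⟨hp0, hp.le⟩)
    refine Tendsto.congr' ?_ h
    filter_upwards [self_mem_nhdsWithin] with w hw
    exact (merom_of_nonpos t x (mem_Hlow.1 hw).2).symm
  · obtain ⟨A, hA, hlim, hwA⟩ := exists_boundary_limit hP hrefl ht x hp0 hp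
    have h1 : Tendsto (fun z => P.what t z x) (𝓝[Hopen P.k₀] p) (𝓝 (P.what t p x)) :=
      ((continuousOn_what hP ht x) p ⟨hp0, hp.ge⟩).mono_left (nhdsWithin_mono _ (Hopen_subset _))
    have h2 := (continuous_mul_matH.tendsto _).comp (h1.prodMk_nhds (tendsto_matrix_inv hlim hA))
    have e : P.what t p x * A⁻¹ = P.merom t x p := by
      rw [merom_of_nonpos t x hp.le, hwA, Matrix.mul_nonsing_inv_cancel_right _ _
        (isUnit_iff_ne_zero.2 hA)]
    dsimp only at h2
    rw [e] at h2
    refine h2.congr' ?_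
    filter_upwards [self_mem_nhdsWithin] with w hw
    exact (merom_of_pos t x hw.2).symm

/-- Holomorphy off the curve `Im λ = 0` and continuity on it suffice wherever `λ` is a local chart,
that is for `z² ≠ k₀²`. -/
theorem differentiableAt_merom (hrefl : P.Reflectionless) {N : ℕ} {z : Fin N → ℂ}
    (hz : P.IsDiscreteSpectrum z) (x : ℝ) {p : ℂ} (hp0 : p ≠ 0) (hp : p ∉ Set.range (P.zeta z)) :
    DifferentiableAt ℂ (P.merom t x) p := by
  have hoff : ∀ w : ℂ, w ≠ 0 → w ∉ Set.range (P.zeta z) → (lamK P.k₀ w).im ≠ 0 →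
      DifferentiableAt ℂ (P.merom t x) w := by
    intro w hw0 hw him
    rcases him.lt_or_gt with h | h
    · exact differentiableAt_merom_low hP ht x (mem_HlowOpen.2 ⟨hw0, h⟩)
    · exact differentiableAt_merom_up hP ht x ⟨hw0, h⟩
        fun hd => hw ((det_a_eq_zero_iff hP hz ⟨hw0, h⟩).1 hd)
  have hcont : ∀ w : ℂ, w ≠ 0 → w ∉ Set.range (P.zeta z) → ContinuousAt (P.merom t x) w := by
    intro w hw0 hw
    by_cases him : (lamK P.k₀ w).im = 0
    · exact continuousAt_merom hP ht hrefl x hw0 him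
    · exact (hoff w hw0 hw him).continuousAt
  have hopen : IsOpen {w : ℂ | w ≠ 0 ∧ w ∉ Set.range (P.zeta z)} :=
    isOpen_ne.inter (Set.finite_range _).isClosed.isOpen_compl
  have hchart : ∀ w : ℂ, w ≠ 0 → w ∉ Set.range (P.zeta z) → w ^ 2 ≠ (P.k₀ : ℂ) ^ 2 →
      DifferentiableAt ℂ (P.merom t x) w := by
    intro w hw0 hw hk
    refine differentiableAt_of_chart (contDiffAt_lamK P.k₀ hw0) (hasDerivAt_lamK P.k₀ hw0) ?_ ?_ ?_
    · have : w ^ 2 ≠ 0 := pow_ne_zero 2 hw0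
      refine div_ne_zero (fun h => hk ?_) two_ne_zero
      rw [sub_eq_zero, eq_comm, div_eq_one_iff_eq this] at h
      exact h.symm
    · filter_upwards [hopen.mem_nhds ⟨hw0, hw⟩] with w' hw' using hcont w' hw'.1 hw'.2
    · filter_upwards [hopen.mem_nhds ⟨hw0, hw⟩] with w' hw' using hoff w' hw'.1 hw'.2
  -- At `± k₀` the circle crosses the real axis and `λ' = 0`. These points are isolated, so
  -- continuity makes them removable; `-p` is deleted to leave a neighbourhood with one exceptional
  -- point.
  by_cases hk : p ^ 2 = (P.k₀ : ℂ) ^ 2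
  · have hfin : IsOpen ({w : ℂ | w ≠ 0 ∧ w ∉ Set.range (P.zeta z)} \ {-p}) :=
      hopen.sdiff isClosed_singleton
    have hmem : ({w : ℂ | w ≠ 0 ∧ w ∉ Set.range (P.zeta z)} \ {-p}) ∈ 𝓝 p :=
      hfin.mem_nhds ⟨⟨hp0, hp⟩, fun h => hp0 (self_eq_neg.1 h)⟩
    have h := (Complex.differentiableOn_compl_singleton_and_continuousAt_iff
      (f := P.merom t x) hmem).1 ⟨?_, hcont p hp0 hp⟩
    · exact h.differentiableAt hmem
    · intro w hw
      refine (hchart w hw.1.1.1 hw.1.1.2 fun h => ?_).differentiableWithinAt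
      rw [← hk, sq_eq_sq_iff_eq_or_eq_neg] at h
      exact h.elim hw.2 hw.1.2
  · exact hchart p hp0 hp hk

theorem merom_reflK (x : ℝ) {z : ℂ} (hz : z ≠ 0) (hl : lamK P.k₀ z ≠ 0) :
    P.merom t x z = jconj (P.merom t x (reflK P.k₀ z)) * ((-(Complex.I / z)) • P.Qpᴴ) := by
  have him : (lamK P.k₀ (reflK P.k₀ z)).im = (lamK P.k₀ z).im := by
    rw [lamK_reflK hP.k₀_pos hz]; simp
  rcases le_or_gt (lamK P.k₀ z).im 0 with h | h
  · rw [merom_of_nonpos t x h, merom_of_nonpos t x (him.le.trans h)]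
    exact vbar_reflK hP ht (mem_Hlow.2 ⟨hz, h⟩) hl x
  · rw [merom_of_pos t x h, merom_of_pos t x (h.trans_eq him.symm)]
    exact what_mul_inv_reflK hP ht ⟨hz, h.le⟩ hl x

theorem tendsto_merom_cobounded (x : ℝ) :
    Tendsto (P.merom t x) (Bornology.cobounded ℂ) (𝓝 (Matrix.fromRows 1 0)) := by
  have hle : Bornology.cobounded ℂ ≤ (Bornology.cobounded ℂ ⊓ 𝓟 (Hlow P.k₀)) ⊔
      (Bornology.cobounded ℂ ⊓ 𝓟 (Hopen P.k₀)) := by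
    rw [← inf_sup_left, sup_principal]
    refine le_inf le_rfl (le_principal_iff.2 ?_)
    filter_upwards [tendsto_norm_cobounded_atTop.eventually_gt_atTop 0] with w hw
    have hw0 := norm_pos_iff.1 hw
    rcases le_or_gt (lamK P.k₀ w).im 0 with h | h
    · exact Or.inl (mem_Hlow.2 ⟨hw0, h⟩)
    · exact Or.inr ⟨hw0, h⟩
  refine Tendsto.mono_left (tendsto_sup.2 ⟨?_, ?_⟩) hle
  · refine (tendsto_vbar_cobounded hP ht x).congr' ?_
    rw [EventuallyEq, eventually_inf_principal]
    exact Eventually.of_forall fun w hw => (merom_of_nonpos t x (mem_Hlow.1 hw).2).symm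
  · have hmono : Bornology.cobounded ℂ ⊓ 𝓟 (Hopen P.k₀)
        ≤ Bornology.cobounded ℂ ⊓ 𝓟 (Hclosed P.k₀) :=
      inf_le_inf_left _ (principal_mono.2 (Hopen_subset _))
    have h2 := (continuous_mul_matH.tendsto _).comp
      (((tendsto_what_cobounded hP ht x).mono_left hmono).prodMk_nhds
        (tendsto_matrix_inv ((tendsto_a_cobounded hP).mono_left hmono) (by simp)))
    dsimp only at h2
    rw [inv_one, Matrix.mul_one] at h2
    refine h2.congr' ?_
    rw [EventuallyEq, eventually_inf_principal]
    exact Eventually.of_forall fun w hw => (merom_of_pos t x hw.2).symm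

/-- Reflection sends `0` to infinity, where the limit is known; the factor `-(i/z) Q₊†` of the
reflection law becomes the residue. -/
theorem tendsto_smul_merom_zero (x : ℝ) :
    Tendsto (fun z => (z - 0) • P.merom t x z) (𝓝[≠] 0)
      (𝓝 (Matrix.fromRows 0 ((-Complex.I) • P.Qpᴴ))) := by
  have hk := hP.k₀_pos
  have hr : Tendsto (reflK P.k₀) (𝓝[≠] 0) (Bornology.cobounded ℂ) := by
    have h1 : Tendsto (fun z : ℂ => conj z) (𝓝[≠] 0) (𝓝[≠] 0) := by
      refine tendsto_nhdsWithin_iff.2 ⟨?_, ?_⟩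
      · have := (Complex.continuous_conj.tendsto 0).mono_left (nhdsWithin_le_nhds (s := {0}ᶜ))
        simpa using this
      · filter_upwards [self_mem_nhdsWithin] with w hw using (map_ne_zero _).2 hw
    have h2 := (tendsto_inv₀_nhdsNE_zero (α := ℂ)).comp h1
    rw [← tendsto_norm_atTop_iff_cobounded] at h2 ⊢
    refine (h2.const_mul_atTop (pow_pos hk 2)).congr fun w => ?_
    simp [reflK, div_eq_mul_inv]
  have h1 := (continuous_jconj.tendsto _).comp ((tendsto_merom_cobounded hP ht x).comp hr)
  have hc : Continuous fun B : MatH m => B * ((-Complex.I) • P.Qpᴴ) := by fun_prop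
  have h2 := (hc.tendsto _).comp h1
  have e : jconj (Matrix.fromRows 1 0 : MatH m) * ((-Complex.I) • P.Qpᴴ)
      = Matrix.fromRows 0 ((-Complex.I) • P.Qpᴴ) := by
    rw [jconj_fromRows, Matrix.fromRows_mul]
    have e1 : (1 : Mat m).map star = 1 := by
      rw [Matrix.map_one _ (star_zero _) (star_one _)]
    rw [e1]
    simp
  rw [e] at h2
  refine h2.congr' ?_
  have hl : ∀ᶠ w : ℂ in 𝓝[≠] 0, ‖w‖ < P.k₀ :=
    nhdsWithin_le_nhds (by simpa [Metric.ball, dist_zero_right] using Metric.ball_mem_nhds (0 : ℂ) hk)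
  filter_upwards [hl, self_mem_nhdsWithin] with w hw hw0
  have hw0' : w ≠ 0 := hw0
  have hlw : lamK P.k₀ w ≠ 0 := fun h => by
    rcases (lamK_eq_zero_iff hw0').1 h with h | h <;> rw [h] at hw <;>
      simp [abs_of_pos hk] at hw
  simp only [Function.comp_apply]
  rw [merom_reflK hP ht x hw0' hlw, sub_zero, ← Matrix.mul_smul, smul_smul]
  congr 2
  field_simp

end Merom

/-! ### Residues -/

theorem theta_reflK (hk : 0 < P.k₀) (x t : ℝ) {z : ℂ} (hz : z ≠ 0) :
    P.theta x t (reflK P.k₀ z) = -conj (P.theta x t z) := by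
  have hk' : (P.k₀ : ℂ) ≠ 0 := by exact_mod_cast hk.ne'
  have hc : conj z ≠ 0 := (map_ne_zero _).2 hz
  have h1 : P.lam (reflK P.k₀ z) = -conj (P.lam z) := lamK_reflK hk hz
  have h2 : P.k (reflK P.k₀ z) = conj (P.k z) := by
    simp only [k, reflK, map_sub, map_div₀, map_pow, Complex.conj_ofReal, map_ofNat]
    field_simp
    ring
  simp only [theta, h1, h2, map_mul, map_add, map_sub, map_pow, Complex.conj_ofReal, map_ofNat]
  ring

theorem exp_theta_conj (x t : ℝ) (z : ℂ) :
    conj (Complex.exp (2 * Complex.I * P.theta x t z))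
      = Complex.exp (-(2 * Complex.I * P.theta x t (conj z))) := by
  rw [← Complex.exp_conj, theta_conj]
  simp [Complex.conj_ofNat]

theorem exp_theta_reflK (hk : 0 < P.k₀) (x t : ℝ) {z : ℂ} (hz : z ≠ 0) :
    Complex.exp (2 * Complex.I * P.theta x t (reflK P.k₀ z))
      = conj (Complex.exp (2 * Complex.I * P.theta x t z)) := by
  rw [← Complex.exp_conj, theta_reflK hk x t hz]
  simp [Complex.conj_ofNat]

theorem skew_merom_vhat (hP : P.IsSolution) {t : ℝ} (ht : t ∈ P.T) (x : ℝ) {w : ℂ}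
    (hw : w ∈ Hopen P.k₀) (hd : (P.a w).det ≠ 0) :
    skew (P.merom t x w) (P.vhat t w x) = P.gam w • (1 : Mat m) := by
  rw [merom_of_pos t x hw.2, vhat, skew_jconj_right, ← Matrix.mul_assoc,
    ← gam_smul_a hP (Hopen_subset _ hw) (lamK_ne_zero_of_mem hw) x ht, Matrix.smul_mul,
    Matrix.mul_nonsing_inv _ (isUnit_iff_ne_zero.2 hd), Matrix.transpose_smul,
    Matrix.transpose_one]

theorem skew_merom_self (hP : P.IsSolution) {t : ℝ} (ht : t ∈ P.T) (x : ℝ) {w : ℂ}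
    (hw : w ∈ Hopen P.k₀) : skew (P.merom t x w) (P.merom t x w) = 0 := by
  rw [merom_of_pos t x hw.2, skew_mul_left, skew_mul_right,
    skew_what hP ht (Hopen_subset _ hw) x, Matrix.zero_mul, Matrix.mul_zero]

theorem skew_vhat_self (hP : P.IsSolution) {t : ℝ} (ht : t ∈ P.T) (x : ℝ) {w : ℂ}
    (hw : w ∈ Hclosed P.k₀) : skew (P.vhat t w x) (P.vhat t w x) = 0 := by
  rw [vhat, skew_jconj_self, skew_vbar hP ht (conj_mem_Hlow hw) x]
  ext i j; simp

theorem Qp_conjTranspose_symm (hP : P.IsSolution) : (P.Qpᴴ)ᵀ = P.Qpᴴ :=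
  conjTranspose_transpose_of_symm (Qp_symm hP)

theorem reflK_conj (k₀ : ℝ) (z : ℂ) : reflK k₀ (conj z) = conj (reflK k₀ z) := by simp [reflK]

section Residues

variable (hP : P.IsSolution) {t : ℝ} (ht : t ∈ P.T) {N : ℕ} {z : Fin N → ℂ}
  (hz : P.IsDiscreteSpectrum z)
include hP ht hz

theorem tendsto_residue {n : Fin N} {C : Mat m} (hC : P.IsNormingConstant (z n) C) (x : ℝ) :
    Tendsto (fun w => (w - z n) • P.merom t x w) (𝓝[≠] (z n))
      (𝓝 (Complex.exp (2 * Complex.I * P.theta x t (z n)) • (P.vhat t (z n) x * C))) := by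
  have hzn := (mem_Hopen_of_spectrum hP hz n).1
  have h := hC x t ht
  rw [VHat_eq hP (Hopen_subset _ hzn) (lamK_ne_zero_of_mem hzn) x ht] at h
  refine h.congr' ?_
  filter_upwards [nhdsWithin_le_nhds ((isOpen_Hopen _).mem_nhds hzn)] with w hw
  rw [merom_of_pos t x hw.2, WHat_eq hP (Hopen_subset _ hw) (lamK_ne_zero_of_mem hw) x ht]

/-- Subtracting from `merom` its polar part along `V̂` leaves a function `D` with a removable
singularity, so `(w - ζ) skew D D → 0`. By isotropy of both functions only the mixed terms survive,
and they are exactly `γ e^{2iθ} (Cᵀ - C)`. -/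
theorem norming_transpose {n : Fin N} {C : Mat m} (hC : P.IsNormingConstant (z n) C) :
    Cᵀ = C := by
  have hzn := (mem_Hopen_of_spectrum hP hz n).1
  have hev := eventually_det_a_ne_zero hP hz n
  set ζ := z n with hζ
  set e := Complex.exp (2 * Complex.I * P.theta 0 t ζ) with he
  have he0 : e ≠ 0 := Complex.exp_ne_zero _
  set D : ℂ → MatH m := fun w => P.merom t 0 w - (w - ζ)⁻¹ • (e • (P.vhat t w 0 * C)) with hD
  have hcV : Continuous fun B : MatH m => e • (B * C) := by fun_prop
  have hsm : Tendsto (fun w => (w - ζ) • D w) (𝓝[≠] ζ) (𝓝 0) := by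
    have h1 := (hcV.tendsto _).comp
      ((differentiableAt_vhat hP ht 0 hzn).continuousAt.tendsto.mono_left
        (nhdsWithin_le_nhds (s := {ζ}ᶜ)))
    have h2 := (tendsto_residue hP ht hz hC 0).sub h1
    rw [sub_self] at h2
    refine h2.congr' ?_
    filter_upwards [self_mem_nhdsWithin] with w hw
    simp only [hD, Function.comp_apply, smul_sub]
    rw [smul_smul, mul_inv_cancel₀ (sub_ne_zero.2 hw), one_smul]
  have hdiff : ∀ᶠ w in 𝓝[≠] ζ, DifferentiableAt ℂ D w := by
    filter_upwards [hev, self_mem_nhdsWithin] with w hw hne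
    have h1 := differentiableAt_matrix_mul (F := fun w => P.vhat t w 0) (G := fun _ => C)
      (differentiableAt_vhat hP ht 0 hw.1) (differentiableAt_const C)
    refine DifferentiableAt.sub (differentiableAt_merom_up hP ht 0 hw.1 hw.2)
      (DifferentiableAt.fun_smul (c := fun w : ℂ => (w - ζ)⁻¹) ?_ (h1.const_smul e))
    exact (differentiableAt_id.sub_const ζ).inv (sub_ne_zero.2 hne)
  have hlim := Complex.tendsto_limUnder_of_differentiable_on_punctured_nhds_of_isLittleO hdiff
    (isLittleO_sub_inv hsm)
  have hz0 : Tendsto (fun w : ℂ => w - ζ) (𝓝[≠] ζ) (𝓝 0) := by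
    have : Tendsto (fun w : ℂ => w - ζ) (𝓝 ζ) (𝓝 (ζ - ζ)) :=
      (continuous_id.sub continuous_const).tendsto ζ
    rw [sub_self] at this
    exact this.mono_left nhdsWithin_le_nhds
  have h3 := hz0.smul ((continuous_skew.tendsto _).comp (hlim.prodMk_nhds hlim))
  rw [zero_smul] at h3
  have h4 : Tendsto (fun w => P.gam w • (e • (Cᵀ - C))) (𝓝[≠] ζ)
      (𝓝 (P.gam ζ • (e • (Cᵀ - C)))) :=
    ((differentiableAt_gam hzn.1).continuousAt.tendsto.mono_left nhdsWithin_le_nhds).smul_const _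
  have h5 : P.gam ζ • (e • (Cᵀ - C)) = 0 := by
    refine tendsto_nhds_unique (h4.congr' ?_) h3
    filter_upwards [hev, self_mem_nhdsWithin] with w hw hne
    have hne' : w - ζ ≠ 0 := sub_ne_zero.2 hne
    have hwc := Hopen_subset _ hw.1
    have k1 := skew_merom_vhat hP ht 0 hw.1 hw.2
    have k2 := skew_transpose (P.merom t 0 w) (P.vhat t w 0)
    rw [k1, Matrix.transpose_smul, Matrix.transpose_one] at k2
    have k3 : skew (P.vhat t w 0) (P.merom t 0 w) = -(P.gam w • (1 : Mat m)) := by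
      rw [k2, neg_neg]
    simp only [hD, Function.comp_apply, skew_sub_left, skew_sub_right, skew_smul_left,
      skew_smul_right, skew_mul_left, skew_mul_right, k1, k3, skew_merom_self hP ht 0 hw.1,
      skew_vhat_self hP ht 0 hwc, Matrix.mul_zero, smul_zero, sub_zero,
      Matrix.smul_mul, Matrix.mul_smul, Matrix.mul_neg, Matrix.one_mul, Matrix.mul_one, smul_neg,
      smul_sub, zero_sub, smul_smul]
    have s : (w - ζ) * ((w - ζ)⁻¹ * e * P.gam w) = e * P.gam w := by
      rw [mul_assoc, mul_inv_cancel_left₀ hne']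
    rw [s, mul_comm e]
    abel
  have h6 := (smul_eq_zero.1 h5).resolve_left (P.gam_ne_zero hzn.1 (lamK_ne_zero_of_mem hzn))
  exact sub_eq_zero.1 ((smul_eq_zero.1 h6).resolve_left he0)

theorem norm2_transpose {C : Fin N → Mat m} (hC : ∀ n, P.IsNormingConstant (z n) (C n))
    (j : Fin N ⊕ Fin N) : (P.norm2 z C j)ᵀ = P.norm2 z C j := by
  rcases j with j | j
  · exact norming_transpose hP ht hz (hC j)
  · have h1 : ((C j)ᴴ)ᵀ = (C j)ᴴ :=
      conjTranspose_transpose_of_symm (norming_transpose hP ht hz (hC j))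
    simp only [norm2, Matrix.transpose_smul, Matrix.transpose_mul, Matrix.transpose_neg, h1,
      Qp_conjTranspose_symm hP, Matrix.mul_assoc]

/-- At a reflected point the residue is obtained by pulling back the one at `z_n` through the
reflection law; symmetry of `C_n` then yields the constants assigned to the second family. -/
theorem tendsto_residue_zeta {C : Fin N → Mat m} (hC : ∀ n, P.IsNormingConstant (z n) (C n))
    (x : ℝ) (j : Fin N ⊕ Fin N) :
    Tendsto (fun w => (w - P.zeta z j) • P.merom t x w) (𝓝[≠] (P.zeta z j))
      (𝓝 (Complex.exp (2 * Complex.I * P.theta x t (P.zeta z j))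
        • (P.vhat t (P.zeta z j) x * P.norm2 z C j))) := by
  rcases j with n | n
  · exact tendsto_residue hP ht hz (hC n) x
  have hk := hP.k₀_pos
  have hk' : (P.k₀ : ℂ) ≠ 0 := by exact_mod_cast hk.ne'
  have hzn := (mem_Hopen_of_spectrum hP hz n).1
  have hz0 := hzn.1
  have hcz : conj (z n) ≠ 0 := (map_ne_zero _).2 hz0
  change Tendsto (fun w => (w - reflK P.k₀ (z n)) • P.merom t x w) (𝓝[≠] (reflK P.k₀ (z n)))
    (𝓝 (Complex.exp (2 * Complex.I * P.theta x t (reflK P.k₀ (z n)))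
      • (P.vhat t (reflK P.k₀ (z n)) x * P.norm2 z C (.inr n))))
  have hζ := reflK_mem_Hopen hk hzn
  have hrr := reflK_reflK hk hz0
  set ζ' := reflK P.k₀ (z n) with hζ'
  have hr : Tendsto (reflK P.k₀) (𝓝[≠] ζ') (𝓝[≠] (z n)) := by
    refine tendsto_nhdsWithin_iff.2 ⟨?_, ?_⟩
    · have := (continuousAt_reflK (k₀ := P.k₀) hζ.1).tendsto
      rw [hrr] at this
      exact this.mono_left nhdsWithin_le_nhds
    · filter_upwards [self_mem_nhdsWithin, nhdsWithin_le_nhds (isOpen_ne.mem_nhds hζ.1)]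
        with w hw hw0 h
      refine hw ?_
      rw [mem_singleton_iff] at h ⊢
      rw [hζ', ← h, reflK_reflK hk hw0]
  have h1 := (continuous_jconj.tendsto _).comp ((tendsto_residue hP ht hz (hC n) x).comp hr)
  -- The scalar is dictated by `(w - ζ')(-i/w) = -(iζ'/k₀²) · conj (reflK w - z_n)`.
  have hw : Tendsto (fun w : ℂ => -(Complex.I * ζ' / (P.k₀ : ℂ) ^ 2)) (𝓝[≠] ζ')
      (𝓝 (-(Complex.I * ζ' / (P.k₀ : ℂ) ^ 2))) := tendsto_const_nhds
  have hcm : Continuous fun B : MatH m => B * P.Qpᴴ := by fun_prop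
  have h2 := hw.smul ((hcm.tendsto _).comp h1)
  have hlim : (-(Complex.I * ζ' / (P.k₀ : ℂ) ^ 2)) • (jconj (Complex.exp (2 * Complex.I
      * P.theta x t (z n)) • (P.vhat t (z n) x * C n)) * P.Qpᴴ)
      = Complex.exp (2 * Complex.I * P.theta x t ζ') • (P.vhat t ζ' x * P.norm2 z C (.inr n)) := by
    have hlc : lamK P.k₀ (conj (z n)) ≠ 0 := by
      rw [lamK_conj]; exact (map_ne_zero _).2 (lamK_ne_zero_of_mem hzn)
    have hv := vbar_reflK hP ht (conj_mem_Hlow (Hopen_subset _ hzn)) hlc x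
    rw [reflK_conj, ← hζ'] at hv
    have hv' : P.vbar t (conj (z n)) x
        = P.vhat t ζ' x * ((-(Complex.I / conj (z n))) • P.Qpᴴ) := hv
    rw [jconj_smul, jconj_mul, vhat, jconj_jconj, hv',
      map_star_eq_of_transpose (norming_transpose hP ht hz (hC n)), ← exp_theta_reflK hk x t hz0,
      ← hζ', norm2]
    simp only [Matrix.smul_mul, Matrix.mul_smul, Matrix.neg_mul, Matrix.mul_neg, smul_smul,
      smul_neg, neg_smul, Matrix.mul_assoc, neg_neg]
    rw [← neg_smul]
    congr 1
    rw [hζ', reflK]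
    have hI : Complex.I ^ 2 = -1 := Complex.I_sq
    field_simp
    linear_combination hI
  rw [hlim] at h2
  refine h2.congr' ?_
  filter_upwards [self_mem_nhdsWithin, nhdsWithin_le_nhds ((isOpen_Hopen _).mem_nhds hζ)]
    with w hw hwH
  have hw0 := hwH.1
  have hζ0 := hζ.1
  simp only [Function.comp_apply]
  rw [merom_reflK hP ht x hw0 (lamK_ne_zero_of_mem hwH), jconj_smul, Matrix.smul_mul,
    Matrix.mul_smul, smul_smul, smul_smul]
  congr 1
  rw [← hrr]
  simp only [reflK, map_sub, map_div₀, map_neg, map_pow, Complex.conj_ofReal, Complex.conj_conj]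
  field_simp
  ring

/-- Liouville's theorem for `merom`: the limit at infinity and the pole at `0` combine to `E₁`, and
the remaining principal parts are those of the discrete spectrum. -/
theorem vbar_eq_sum (hrefl : P.Reflectionless) {C : Fin N → Mat m}
    (hC : ∀ n, P.IsNormingConstant (z n) (C n)) (x : ℝ) {w : ℂ} (hw : w ∈ Hlow P.k₀) :
    P.vbar t w x = E₁ P.Qp w + ∑ j, (w - P.zeta z j)⁻¹ •
      (Complex.exp (2 * Complex.I * P.theta x t (P.zeta z j))
        • (P.vhat t (P.zeta z j) x * P.norm2 z C j)) := by
  classical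
  have hinj := zeta_injective hP hz
  have hmem := zeta_mem hP hz
  obtain ⟨hw0, hwl⟩ := mem_Hlow.1 hw
  -- The default value of the extension is the residue at `0`, which is not one of the `ζ_j`.
  set r : ℂ → MatH m := Function.extend (P.zeta z)
    (fun j => Complex.exp (2 * Complex.I * P.theta x t (P.zeta z j))
      • (P.vhat t (P.zeta z j) x * P.norm2 z C j))
    (fun _ => Matrix.fromRows 0 ((-Complex.I) • P.Qpᴴ)) with hr
  have hr0 : r 0 = Matrix.fromRows 0 ((-Complex.I) • P.Qpᴴ) := by
    rw [hr, Function.extend_apply']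
    rintro ⟨j, hj⟩
    exact (hmem j).1 hj
  have hrj : ∀ j, r (P.zeta z j) = Complex.exp (2 * Complex.I * P.theta x t (P.zeta z j))
      • (P.vhat t (P.zeta z j) x * P.norm2 z C j) := fun j => by
    rw [hr, hinj.extend_apply]
  have h0 : (0 : ℂ) ∉ Finset.univ.image (P.zeta z) := by
    simp only [Finset.mem_image, Finset.mem_univ, true_and, not_exists]
    exact fun j => (hmem j).1
  have key := eq_add_sum_of_simple_poles (insert 0 (Finset.univ.image (P.zeta z)))
    (f := P.merom t x) (r := r) (c := Matrix.fromRows 1 0) ?_ ?_ ?_ w ?_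
  · rw [merom_of_nonpos t x hwl] at key
    rw [key, Finset.sum_insert h0, hr0, Finset.sum_image fun i _ j _ h => hinj h, ← add_assoc]
    congr 1
    · rw [E₁_eq, sub_zero]
      congr 1
      ext i j
      rcases i with i | i
      · simp
      · simp [div_eq_mul_inv]
        ring
    · exact Finset.sum_congr rfl fun j _ => by rw [hrj]
  · intro p hp
    simp only [Finset.mem_insert, Finset.mem_image, Finset.mem_univ, true_and, not_or] at hp
    exact differentiableAt_merom hP ht hrefl hz x hp.1 hp.2
  · intro p hp
    rcases Finset.mem_insert.1 hp with rfl | hp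
    · rw [hr0]; exact tendsto_smul_merom_zero hP ht x
    · obtain ⟨j, -, rfl⟩ := Finset.mem_image.1 hp
      rw [hrj]; exact tendsto_residue_zeta hP ht hz hC x j
  · rw [← Metric.cobounded_eq_cocompact]
    exact tendsto_merom_cobounded hP ht x
  · simp only [Finset.mem_insert, Finset.mem_image, Finset.mem_univ, true_and, not_or, not_exists]
    refine ⟨hw0, fun j hj => ?_⟩
    have := (hmem j).2
    rw [hj] at this
    exact hwl.not_gt this

end Residues

end Potential

/-! ### The linear system of the inverse problem -/

section Cauchy

variable {m : ℕ} {ι : Type*} [Fintype ι]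

/-- Partial fractions: each simple pole of the product carries its coefficient times the value of
the other factor there. -/
theorem cauchy_mul_cauchy {p q : ι → ℂ} {s : ℂ} (hpq : ∀ j l, p j ≠ q l) (hp : ∀ j, s ≠ p j)
    (hq : ∀ l, s ≠ q l) (A D : ι → Mat m) :
    (∑ j, (s - p j)⁻¹ • A j) * (∑ l, (s - q l)⁻¹ • D l)
      = ∑ j, (s - p j)⁻¹ • (A j * ∑ l, (p j - q l)⁻¹ • D l)
        + ∑ l, (s - q l)⁻¹ • ((∑ j, (q l - p j)⁻¹ • A j) * D l) := by
  have e : ∑ l, (s - q l)⁻¹ • ((∑ j, (q l - p j)⁻¹ • A j) * D l)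
      = ∑ j, ∑ l, ((s - q l)⁻¹ * (q l - p j)⁻¹) • (A j * D l) := by
    rw [Finset.sum_comm]
    refine Finset.sum_congr rfl fun l _ => ?_
    rw [Finset.sum_mul, Finset.smul_sum]
    exact Finset.sum_congr rfl fun j _ => by rw [Matrix.smul_mul, smul_smul]
  rw [e, Finset.sum_mul, ← Finset.sum_add_distrib]
  refine Finset.sum_congr rfl fun j _ => ?_
  rw [Matrix.mul_sum, Matrix.mul_sum, Finset.smul_sum, ← Finset.sum_add_distrib]
  refine Finset.sum_congr rfl fun l _ => ?_
  rw [Matrix.smul_mul, Matrix.mul_smul, Matrix.mul_smul, smul_smul, smul_smul, ← add_smul]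
  congr 1
  have h1 := sub_ne_zero.2 (hp j)
  have h2 := sub_ne_zero.2 (hq l)
  have h3 := sub_ne_zero.2 (hpq j l)
  have h4 : q l - p j ≠ 0 := sub_ne_zero.2 (hpq j l).symm
  have h5 : q l - p j = -(p j - q l) := by ring
  rw [h5]
  field_simp
  ring

open scoped ComplexOrder in
theorem eq_zero_of_gram_add_gram {A B : Mat m} (h : A * Aᴴ + B * Bᴴ = 0) : A = 0 := by
  have h1 := Matrix.posSemidef_self_mul_conjTranspose A
  have h2 := Matrix.posSemidef_self_mul_conjTranspose B
  have h3 := congrArg Matrix.trace h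
  rw [Matrix.trace_add, Matrix.trace_zero,
    add_eq_zero_iff_of_nonneg h1.trace_nonneg h2.trace_nonneg] at h3
  exact Matrix.trace_mul_conjTranspose_self_eq_zero_iff.1 h3.1

/-- Identity theorem: the plane without finitely many points is connected and here contains the real
line. -/
theorem cauchy_eq_zero_of_real {ζ : ι → ℂ} (hζ : ∀ j, (ζ j).im ≠ 0) {A : ι → Mat m}
    (h : ∀ s : ℝ, ∑ j, ((s : ℂ) - ζ j)⁻¹ • A j = 0) {w : ℂ} (hw : w ∉ Set.range ζ) :
    ∑ j, (w - ζ j)⁻¹ • A j = 0 := by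
  have hopen : IsOpen (Set.range ζ)ᶜ := (Set.finite_range ζ).isClosed.isOpen_compl
  have hconn : IsPreconnected (Set.range ζ)ᶜ :=
    ((Set.finite_range ζ).countable.isConnected_compl_of_one_lt_rank
      (by rw [Complex.rank_real_complex]; exact Cardinal.one_lt_two)).isPreconnected
  have hreal : ∀ s : ℝ, (s : ℂ) ∉ Set.range ζ := by
    rintro s ⟨j, hj⟩
    exact hζ j (by rw [hj, Complex.ofReal_im])
  have hd : DifferentiableOn ℂ (fun w => ∑ j, (w - ζ j)⁻¹ • A j) (Set.range ζ)ᶜ := by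
    intro w hw
    refine (DifferentiableAt.fun_sum fun j _ => DifferentiableAt.smul_const ?_ (A j)).differentiableWithinAt
    refine (differentiableAt_id.sub_const (ζ j)).inv (sub_ne_zero.2 fun h => hw ⟨j, h.symm⟩)
  refine (hd.analyticOnNhd hopen).eqOn_zero_of_preconnected_of_frequently_eq_zero hconn
    (hreal 0) ?_ hw
  have ht : Tendsto (fun s : ℝ => (s : ℂ)) (𝓝[≠] 0) (𝓝[≠] ((0 : ℝ) : ℂ)) :=
    tendsto_nhdsWithin_iff.2 ⟨(Complex.continuous_ofReal.tendsto 0).mono_left nhdsWithin_le_nhds,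
      by filter_upwards [self_mem_nhdsWithin] with s hs using fun h => hs (by simpa using h)⟩
  exact ht.frequently (Eventually.of_forall h).frequently

/-- Uniqueness for the linear system of the reflectionless inverse problem. -/
theorem cauchy_system_eq_zero {ζ : ι → ℂ} (hζ : ∀ j l, ζ j ≠ conj (ζ l)) {R X : ι → Mat m}
    (hX : ∀ n, X n + ∑ l, X l * ∑ j, ((conj (ζ j) - ζ l)⁻¹ • R l)ᴴ
      * ((conj (ζ n) - ζ j)⁻¹ • R j) = 0) (n : ι) : X n = 0 := by
  -- Put `F(s) = ∑ (s - ζ_j)⁻¹ U_j R_j` and `G(s) = ∑ (s - ζ_l*)⁻¹ X_l R_l†`. The system splits into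
  -- `X_n = F(ζ_n*)` and `U_j = -G(ζ_j)`.
  set U : ι → Mat m := fun j => -∑ l, (ζ j - conj (ζ l))⁻¹ • (X l * (R l)ᴴ) with hU
  have hXU : ∀ n, X n = ∑ j, (conj (ζ n) - ζ j)⁻¹ • (U j * R j) := by
    intro n
    rw [eq_neg_of_add_eq_zero_left (hX n), ← Finset.sum_neg_distrib]
    simp only [hU, Matrix.mul_sum, Matrix.neg_mul, Matrix.sum_mul, smul_neg,
      Finset.smul_sum]
    rw [Finset.sum_neg_distrib, Finset.sum_neg_distrib, Finset.sum_comm]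
    congr 1
    refine Finset.sum_congr rfl fun j _ => Finset.sum_congr rfl fun l _ => ?_
    rw [Matrix.conjTranspose_smul, Matrix.smul_mul, Matrix.mul_smul, Matrix.mul_smul,
      Matrix.mul_smul, Matrix.smul_mul, ← Matrix.mul_assoc, smul_comm]
    simp
  have him : ∀ j, (ζ j).im ≠ 0 := fun j h => hζ j j (Complex.conj_eq_iff_im.2 h).symm
  have hs1 : ∀ (s : ℝ) j, (s : ℂ) ≠ ζ j := fun s j h => him j (by rw [← h, Complex.ofReal_im])
  have hs2 : ∀ (s : ℝ) j, (s : ℂ) ≠ conj (ζ j) := fun s j h => hs1 s j (by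
    rw [← Complex.conj_conj (ζ j), ← h, Complex.conj_ofReal])
  rw [hXU n]
  refine cauchy_eq_zero_of_real him (fun s => ?_) fun ⟨j, hj⟩ => hζ j n hj
  -- On the real line `F F† + G G† = 0`: expanded in partial fractions, the coefficients at `ζ_j`
  -- and `ζ_j*` are values of `F`, `G` and their adjoints, and they cancel. Positivity gives `F =
  -- 0`, hence `X = 0`.
  refine eq_zero_of_gram_add_gram (B := ∑ l, ((s : ℂ) - conj (ζ l))⁻¹ • (X l * (R l)ᴴ)) ?_
  have c1 : ∀ D : ι → Mat m, (∑ j, ((s : ℂ) - ζ j)⁻¹ • D j)ᴴ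
      = ∑ j, ((s : ℂ) - conj (ζ j))⁻¹ • (D j)ᴴ := fun D => by
    rw [Matrix.conjTranspose_sum]
    refine Finset.sum_congr rfl fun j _ => ?_
    rw [Matrix.conjTranspose_smul]
    simp
  have c2 : ∀ D : ι → Mat m, (∑ j, ((s : ℂ) - conj (ζ j))⁻¹ • D j)ᴴ
      = ∑ j, ((s : ℂ) - ζ j)⁻¹ • (D j)ᴴ := fun D => by
    rw [Matrix.conjTranspose_sum]
    refine Finset.sum_congr rfl fun j _ => ?_
    rw [Matrix.conjTranspose_smul]
    simp
  have d1 : ∀ j, ∑ l, (ζ j - conj (ζ l))⁻¹ • (U l * R l)ᴴ = (X j)ᴴ := fun j => by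
    rw [hXU j, Matrix.conjTranspose_sum]
    refine Finset.sum_congr rfl fun l _ => ?_
    rw [Matrix.conjTranspose_smul]
    simp
  have d2 : ∀ j, ∑ l, (conj (ζ j) - ζ l)⁻¹ • (X l * (R l)ᴴ)ᴴ = -(U j)ᴴ := fun j => by
    rw [hU, Matrix.conjTranspose_neg, neg_neg, Matrix.conjTranspose_sum]
    refine Finset.sum_congr rfl fun l _ => ?_
    rw [Matrix.conjTranspose_smul]
    simp
  have d3 : ∀ j, ∑ l, (ζ j - conj (ζ l))⁻¹ • (X l * (R l)ᴴ) = -U j := fun j => by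
    rw [hU, neg_neg]
  rw [c1, c2, cauchy_mul_cauchy hζ (hs1 s) (hs2 s),
    cauchy_mul_cauchy (fun j l => (hζ l j).symm) (hs2 s) (hs1 s)]
  simp only [d1, d2, d3, ← hXU]
  simp only [Matrix.conjTranspose_mul, Matrix.conjTranspose_conjTranspose,
    Matrix.mul_neg, Matrix.neg_mul, smul_neg, Finset.sum_neg_distrib, Matrix.mul_assoc]
  abel

end Cauchy

theorem map_star_sum {m : ℕ} {ι : Type*} (s : Finset ι) (F : ι → Mat m) :
    (∑ j ∈ s, F j).map star = ∑ j ∈ s, (F j).map star := by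
  ext a b
  simp [Matrix.sum_apply]

/-! ### Invertibility of the matrix `K`. -/

namespace Potential

variable {m : ℕ} {P : Potential m}

theorem conj_zeta_ne (hP : P.IsSolution) {N : ℕ} {z : Fin N → ℂ} (hz : P.IsDiscreteSpectrum z)
    (j l : Fin N ⊕ Fin N) : P.zeta z j ≠ conj (P.zeta z l) := fun h => by
  have h1 := (zeta_mem hP hz j).2
  have h2 := (zeta_mem hP hz l).2
  rw [h, lamK_conj, Complex.conj_im] at h1
  linarith

theorem cFun_eq {N : ℕ} (z : Fin N → ℂ) (C : Fin N → Mat m) (x t : ℝ) (j : Fin N ⊕ Fin N) (w : ℂ) :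
    P.cFun z C x t j w = (w - P.zeta z j)⁻¹ •
      (Complex.exp (2 * Complex.I * P.theta x t (P.zeta z j)) • P.norm2 z C j) := by
  rw [cFun, smul_smul, div_eq_mul_inv, mul_comm]

theorem isUnit_det_Kmat (hP : P.IsSolution) {N : ℕ} {z : Fin N → ℂ}
    (hz : P.IsDiscreteSpectrum z) (C : Fin N → Mat m) (x t : ℝ) :
    IsUnit (P.Kmat z C x t).det := by
  rw [isUnit_iff_ne_zero]
  intro h0
  obtain ⟨v, hv, hKv⟩ := Matrix.exists_mulVec_eq_zero_iff.2 h0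
  -- A kernel vector becomes a family of square matrices by repeating its `n`-th piece as every row
  -- of the `n`-th matrix.
  set X : Fin N ⊕ Fin N → Mat m := fun n => Matrix.of fun _ i => v (n, i) with hX
  have h1 : P.Kmat z C x t * col X = col 0 := by
    ext p c
    have := congrFun hKv p
    simpa [col, Matrix.mul_apply, Matrix.mulVec, dotProduct, hX] using this
  have h2 := (P.Kmat_mul_col_iff z C x t X 0).1 h1
  refine hv (funext fun p => ?_)
  have h3 := cauchy_system_eq_zero (conj_zeta_ne hP hz)
    (R := fun j => Complex.exp (2 * Complex.I * P.theta x t (P.zeta z j)) • P.norm2 z C j)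
    (X := X) (fun n => ?_) p.1
  · exact congrFun (congrFun h3 p.2) p.2
  · have := h2 n
    simp only [Omega, cFun_eq] at this
    exact this

/-! ### The linear system and the reconstruction formula. -/

section Reconstruction

variable (hP : P.IsSolution) {t : ℝ} (ht : t ∈ P.T) (hrefl : P.Reflectionless) {N : ℕ}
  {z : Fin N → ℂ} (hz : P.IsDiscreteSpectrum z) {C : Fin N → Mat m}
  (hC : ∀ n, P.IsNormingConstant (z n) (C n))
include hP ht hrefl hz hC

theorem vbar_rows (x : ℝ) {w : ℂ} (hw : w ∈ Hlow P.k₀) :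
    (P.vbar t w x).toRows₁ = 1 - ∑ j, (P.vbar t (conj (P.zeta z j)) x).toRows₂.map star
      * P.cFun z C x t j w ∧
    (P.vbar t w x).toRows₂ = (-(Complex.I / w)) • P.Qpᴴ
      + ∑ j, (P.vbar t (conj (P.zeta z j)) x).toRows₁.map star * P.cFun z C x t j w := by
  have h := vbar_eq_sum hP ht hz hrefl hC x hw
  have s1 : ∀ F : Fin N ⊕ Fin N → MatH m, (∑ j, F j).toRows₁ = ∑ j, (F j).toRows₁ := fun F => by
    ext a b
    simp [Matrix.toRows₁, Matrix.sum_apply]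
  have s2 : ∀ F : Fin N ⊕ Fin N → MatH m, (∑ j, F j).toRows₂ = ∑ j, (F j).toRows₂ := fun F => by
    ext a b
    simp [Matrix.toRows₂, Matrix.sum_apply]
  have a1 : ∀ A B : MatH m, (A + B).toRows₁ = A.toRows₁ + B.toRows₁ := fun _ _ => rfl
  have a2 : ∀ A B : MatH m, (A + B).toRows₂ = A.toRows₂ + B.toRows₂ := fun _ _ => rfl
  constructor
  · rw [h, a1, s1, sub_eq_add_neg, ← Finset.sum_neg_distrib]
    refine congrArg₂ _ rfl (Finset.sum_congr rfl fun j _ => ?_)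
    change (w - P.zeta z j)⁻¹ • (Complex.exp _ • ((P.vhat t (P.zeta z j) x).toRows₁ * _)) = _
    rw [vhat, jconj_toRows₁, cFun_eq, Matrix.mul_smul, Matrix.mul_smul, Matrix.neg_mul, smul_neg,
      smul_neg]
  · rw [h, a2, s2]
    refine congrArg₂ _ rfl (Finset.sum_congr rfl fun j _ => ?_)
    change (w - P.zeta z j)⁻¹ • (Complex.exp _ • ((P.vhat t (P.zeta z j) x).toRows₂ * _)) = _
    rw [vhat, jconj_toRows₂, cFun_eq, Matrix.mul_smul, Matrix.mul_smul]

/-- The upper row at `ζ_n*` involves the conjugated lower rows at the `ζ_j*`, which involve the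
upper rows again; substitution closes the system. Symmetry of the norming constants replaces the
conjugate of `c_l` by its adjoint, as `Ω` requires. -/
theorem linear_system (x : ℝ) (n : Fin N ⊕ Fin N) :
    (P.vbar t (conj (P.zeta z n)) x).toRows₁
      + ∑ l, (P.vbar t (conj (P.zeta z l)) x).toRows₁ * P.Omega z C x t n l
      = P.Yblock z C x t n := by
  have hmem := fun j => conj_mem_Hlow (Hopen_subset _ (zeta_mem hP hz j))
  have hlow : ∀ j, (P.vbar t (conj (P.zeta z j)) x).toRows₂.map star
      = (Complex.I / P.zeta z j) • P.Qp + ∑ l, (P.vbar t (conj (P.zeta z l)) x).toRows₁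
        * (P.cFun z C x t l (conj (P.zeta z j)))ᴴ := by
    intro j
    rw [(vbar_rows hP ht hrefl hz hC x (hmem j)).2, map_star_add, map_star_smul,
      conjTranspose_map_star (Qp_symm hP), map_star_sum]
    refine congrArg₂ _ ?_ (Finset.sum_congr rfl fun l _ => ?_)
    · congr 1
      simp [neg_div]
    · have e : (P.cFun z C x t l (conj (P.zeta z j)))ᵀ = P.cFun z C x t l (conj (P.zeta z j)) := by
        rw [cFun, Matrix.transpose_smul, norm2_transpose hP ht hz hC]
      rw [map_star_mul, map_star_eq_of_transpose e]
      congr 1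
      ext a b
      simp
  rw [(vbar_rows hP ht hrefl hz hC x (hmem n)).1, Yblock]
  simp only [hlow, Omega, Matrix.add_mul, Finset.sum_add_distrib, Matrix.sum_mul, Matrix.mul_sum,
    Matrix.smul_mul, Matrix.mul_smul, Finset.smul_sum, Matrix.mul_assoc, smul_smul]
  rw [Finset.sum_comm (f := fun j l => (P.vbar t (conj (P.zeta z l)) x).toRows₁ *
    ((P.cFun z C x t l (conj (P.zeta z j)))ᴴ * P.cFun z C x t j (conj (P.zeta z n))))]
  simp only [div_eq_mul_inv, one_mul]
  abel

/-- Along `z = -iy`, `y → ∞`, the lower block of `V̄` times `y` has limit `Q†` by the large `z`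
asymptotics and another expression by the pole expansion. Equating them and conjugating entrywise,
with `Q` and the norming constants symmetric, gives the formula. -/
theorem Q_eq_sum (x : ℝ) :
    P.Q x t = P.Qp + Complex.I • ∑ n,
      Complex.exp (-(2 * Complex.I * P.theta x t (conj (P.zeta z n)))) •
        ((P.vbar t (conj (P.zeta z n)) x).toRows₁ * (-(P.norm2 z C n)ᴴ)) := by
  have hy : ∀ ζ : ℂ, Tendsto (fun y : ℝ => (y : ℂ) * (-(Complex.I * y) - ζ)⁻¹) atTop
      (𝓝 Complex.I) := by
    intro ζ
    have h1 : Tendsto (fun y : ℝ => (-Complex.I - ζ * ((y⁻¹ : ℝ) : ℂ))⁻¹) atTop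
        (𝓝 (-Complex.I - ζ * ((0 : ℝ) : ℂ))⁻¹) :=
      (((Complex.continuous_ofReal.tendsto 0).comp tendsto_inv_atTop_zero).const_mul ζ
        |>.const_sub (-Complex.I)).inv₀ (by simp)
    have e : (-Complex.I - ζ * ((0 : ℝ) : ℂ))⁻¹ = Complex.I := by simp
    rw [e] at h1
    refine h1.congr' ?_
    filter_upwards [eventually_gt_atTop 0] with y hy0
    have hy' : (y : ℂ) ≠ 0 := by exact_mod_cast hy0.ne'
    have e2 : -(Complex.I * y) - ζ = y * (-Complex.I - ζ * ((y⁻¹ : ℝ) : ℂ)) := by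
      push_cast
      field_simp
    rw [e2, mul_inv, mul_inv_cancel_left₀ hy']
  set F : Fin N ⊕ Fin N → Mat m := fun j =>
    Complex.exp (2 * Complex.I * P.theta x t (P.zeta z j)) •
      ((P.vbar t (conj (P.zeta z j)) x).toRows₁.map star * P.norm2 z C j) with hF
  have h1 : Tendsto (fun y : ℝ => P.Qpᴴ + ∑ j, ((y : ℂ) * (-(Complex.I * y) - P.zeta z j)⁻¹) • F j)
      atTop (𝓝 (P.Qpᴴ + ∑ j, Complex.I • F j)) :=
    (tendsto_finsetSum _ fun j _ => (hy (P.zeta z j)).smul_const (F j)).const_add _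
  have h2 : (P.Q x t)ᴴ = P.Qpᴴ + ∑ j, Complex.I • F j := by
    refine tendsto_nhds_unique (tendsto_mul_vbar_lower hP ht x) (h1.congr' ?_)
    filter_upwards [eventually_gt_atTop 0, eventually_gt_atTop P.k₀] with y hy0 hyk
    have hy' : (y : ℂ) ≠ 0 := by exact_mod_cast hy0.ne'
    have hmem : -(Complex.I * (y : ℂ)) ∈ Hlow P.k₀ := by
      have hne : Complex.I * (y : ℂ) ≠ 0 := mul_ne_zero Complex.I_ne_zero hy'
      refine mem_Hlow.2 ⟨neg_ne_zero.2 hne, ?_⟩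
      rw [lamK_neg, Complex.neg_im, neg_nonpos]
      refine (mem_Dplus_iff.1 (?_ : Complex.I * (y : ℂ) ∈ P.Dplus)).2.le
      have hk := hP.k₀_pos
      simp only [Dplus, mem_ofPred_eq, norm_mul, Complex.norm_I, Complex.norm_real, one_mul,
        Complex.mul_im, Complex.I_re, Complex.I_im, Complex.ofReal_re, Complex.ofReal_im,
        Real.norm_eq_abs, sq_abs, zero_mul, zero_add]
      exact mul_pos (by nlinarith) hy0
    rw [(vbar_rows hP ht hrefl hz hC x hmem).2, smul_add, smul_smul, Finset.smul_sum]
    have e1 : (y : ℂ) * -(Complex.I / -(Complex.I * y)) = 1 := by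
      have := Complex.I_ne_zero
      field_simp
    rw [e1, one_smul]
    refine congrArg₂ _ rfl (Finset.sum_congr rfl fun j _ => ?_)
    simp only [hF, cFun_eq, Matrix.mul_smul, smul_smul, mul_assoc]
  have h3 := congrArg (fun B : Mat m => B.map star) h2
  simp only [map_star_add, map_star_sum, map_star_smul, conjTranspose_map_star (hP.symm x t ht),
    conjTranspose_map_star (Qp_symm hP), hF, map_star_mul,
    map_star_eq_of_transpose (norm2_transpose hP ht hz hC _), exp_theta_conj] at h3
  rw [h3, Finset.smul_sum]
  refine congrArg₂ _ rfl (Finset.sum_congr rfl fun j _ => ?_)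
  have e : ((P.vbar t (conj (P.zeta z j)) x).toRows₁.map star).map star
      = (P.vbar t (conj (P.zeta z j)) x).toRows₁ := by
    ext a b
    simp
  rw [e, Matrix.mul_neg, smul_neg, smul_neg, Complex.conj_I, neg_smul]

end Reconstruction

end Potential

/-! ### Norming constants -/

theorem jconj_mul_injective {m : ℕ} {B : MatH m} (hB : ∀ V : Mat m, B * V = 0 → V = 0)
    {V : Mat m} (h : jconj B * V = 0) : V = 0 := by
  have h1 := congrArg jconj h
  have h0 : jconj (0 : MatH m) = 0 := by
    simpa using jconj_smul (0 : ℂ) (0 : MatH m)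
  rw [jconj_mul, jconj_jconj, Matrix.neg_mul, h0, neg_eq_zero] at h1
  have h2 := congrArg (fun A : Mat m => A.map star) (hB _ h1)
  ext i j
  simpa using congrFun (congrFun h2 i) j

/-- If `B` has full rank and is isotropic, the orthogonal complement of its range is the range of
`jconj B`. -/
theorem exists_eq_jconj_mul {m : ℕ} {B Y : MatH m} (hB : ∀ V : Mat m, B * V = 0 → V = 0)
    (hBB : skew B B = 0) (hY : Bᴴ * Y = 0) : ∃ C : Mat m, Y = jconj B * C := by
  have hj := fun V => jconj_mul_injective hB (V := V)
  have hBV : Bᴴ * jconj B = 0 := by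
    have h1 := skew_jconj_right (jconj B) B
    rw [skew_jconj_self, hBB] at h1
    have h2 := congrArg Matrix.transpose h1
    rw [Matrix.transpose_transpose] at h2
    rw [← h2]
    ext i j; simp
  have hVB : (jconj B)ᴴ * B = 0 := by
    have := congrArg Matrix.conjTranspose hBV
    simpa [Matrix.conjTranspose_mul] using this
  have hd1 := det_conjTranspose_mul_self_ne_zero hB
  have hd2 := det_conjTranspose_mul_self_ne_zero hj
  set V := jconj B with hV
  refine ⟨(Vᴴ * V)⁻¹ * (Vᴴ * Y), ?_⟩
  rw [← sub_eq_zero]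
  set D := Y - V * ((Vᴴ * V)⁻¹ * (Vᴴ * Y)) with hD
  have hD1 : Bᴴ * D = 0 := by
    rw [hD, Matrix.mul_sub, hY, ← Matrix.mul_assoc, hBV, Matrix.zero_mul, sub_zero]
  have hD2 : Vᴴ * D = 0 := by
    rw [hD, Matrix.mul_sub, ← Matrix.mul_assoc Vᴴ V,
      Matrix.mul_nonsing_inv_cancel_left _ _ (isUnit_iff_ne_zero.2 hd2), sub_self]
  set G : Mat2 m := Matrix.fromCols B V with hG
  have hGD : Gᴴ * D = 0 := by
    rw [hG, Matrix.conjTranspose_fromCols_eq_fromRows_conjTranspose, Matrix.fromRows_mul, hD1, hD2,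
      Matrix.fromRows_zero]
  -- Together `B` and `jconj B` form a square matrix with invertible block diagonal Gram matrix, so
  -- a vector orthogonal to both vanishes.
  have hGG : Gᴴ * G = Matrix.fromBlocks (Bᴴ * B) 0 0 (Vᴴ * V) := by
    rw [hG, Matrix.conjTranspose_fromCols_eq_fromRows_conjTranspose, Matrix.fromRows_mul_fromCols,
      hBV, hVB]
  have hdet : (Gᴴ).det ≠ 0 := fun h => by
    have := congrArg Matrix.det hGG
    rw [Matrix.det_mul, h, zero_mul, Matrix.det_fromBlocks_zero₂₁] at this
    exact mul_ne_zero hd1 hd2 this.symm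
  rw [← Matrix.nonsing_inv_mul_cancel_left Gᴴ D (isUnit_iff_ne_zero.2 hdet), hGD, Matrix.mul_zero]

namespace Potential

variable {m : ℕ} {P : Potential m}

theorem vhat_injective (hP : P.IsSolution) {t : ℝ} (ht : t ∈ P.T) {z : ℂ}
    (hz : z ∈ Hclosed P.k₀) (x : ℝ) {V : Mat m} (h : P.vhat t z x * V = 0) : V = 0 :=
  jconj_mul_injective (fun _ hV => vbar_injective hP ht (conj_mem_Hlow hz) x hV) h

theorem continuous_laxM (hP : P.IsSolution) {t : ℝ} (ht : t ∈ P.T) (z : ℂ) :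
    Continuous fun x => P.laxM x t z := by
  simp_rw [laxM_eq]
  exact continuous_const.add (continuous_und.comp (continuous_Q hP ht))

theorem continuousOn_laxN (hP : P.IsSolution) (x : ℝ) (z : ℂ) :
    ContinuousOn (fun t => P.laxN x t z) P.T := by
  simp_rw [laxN_eq]
  have hp : ContinuousOn (fun t : ℝ => (x, t)) P.T := by fun_prop
  have hm : MapsTo (fun t : ℝ => (x, t)) P.T (univ ×ˢ P.T) := fun t ht => ⟨mem_univ _, ht⟩
  have h0 := (continuousOn_und_dx hP (n := 0) (by norm_num)).comp hp hm
  have h1 := (continuousOn_und_dx hP (n := 1) (by norm_num)).comp hp hm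
  have h2 := (continuousOn_und_dx hP (n := 2) (by norm_num)).comp hp hm
  exact (continuous_timeMat (m := m) (Complex.I * P.k z)).comp_continuousOn
    (f := fun t : ℝ => (und (P.Q x t), und (dx P.Q x t), und (dx (dx P.Q) x t)))
    (h0.prodMk (h1.prodMk h2))

/-- A relation between solutions of the Lax pair holds everywhere if it holds at one point. -/
theorem lax_relation (hP : P.IsSolution) {z : ℂ} {f g : ℝ → ℝ → MatH m} {l l' : Filter ℝ}
    {s s' : ℂ} {E E' : MatH m} (hf : P.IsJost l s E z f) (hg : P.IsJost l' s' E' z g) {A C : Mat m}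
    {x₀ t₀ : ℝ} (ht₀ : t₀ ∈ P.T) (h₀ : f x₀ t₀ * A = g x₀ t₀ * C) (x : ℝ) {t : ℝ} (ht : t ∈ P.T) :
    f x t * A = g x t * C := by
  have hx : ∀ y, f y t₀ * A - g y t₀ * C = 0 := by
    refine Wing.eq_zero_of_ode (continuous_laxM hP ht₀ z) (x₀ := x₀)
      (d := fun y => f y t₀ * A - g y t₀ * C) (fun y => ?_) (sub_eq_zero.2 h₀)
    refine ((hasDerivAt_matrix_mul (hasDerivAt_matrix.2 ((hf t₀ ht₀).1 y))
      (hasDerivAt_const y A)).sub (hasDerivAt_matrix_mul (hasDerivAt_matrix.2 ((hg t₀ ht₀).1 y))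
      (hasDerivAt_const y C))).congr_deriv ?_
    simp only [Matrix.mul_zero, add_zero, Matrix.mul_sub, Matrix.mul_assoc]
  rw [← sub_eq_zero]
  refine linear_ode_eq_zero (T := P.T) hP.isConnected_T.isPreconnected.ordConnected
    (M := fun t => (mulL (P.laxN x t z)).restrictScalars ℝ)
    (d := fun t => f x t * A - g x t * C) (x₀ := t₀)
    (continuous_mulL_real.comp_continuousOn (continuousOn_laxN hP x z)) (fun τ hτ => ?_) ht₀ (hx x)
    t ht
  refine ((hasDerivAt_matrix_mul (hasDerivAt_matrix.2 ((hf τ hτ).2.1 x))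
    (hasDerivAt_const τ A)).sub (hasDerivAt_matrix_mul (hasDerivAt_matrix.2 ((hg τ hτ).2.1 x))
    (hasDerivAt_const τ C))).congr_deriv ?_
  change _ = P.laxN x τ z * (f x τ * A - g x τ * C)
  simp only [Matrix.mul_zero, add_zero, Matrix.mul_sub, Matrix.mul_assoc]

/-- The residue is `Ŵ(ζ) R` with `R` the residue of `a⁻¹`. From `a R = 0` and the Wronskian formula
its columns are orthogonal to `V̄(ζ*)`, hence lie in the range of `V̂(ζ)`. This fixes `C` at one
point `(0, t₀)`; since both sides solve the Lax pair, the same `C` works everywhere. Uniqueness is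
the full rank of `V̂`. -/
theorem existsUnique_normingConstant (hP : P.IsSolution) {N : ℕ} {z : Fin N → ℂ}
    (hz : P.IsDiscreteSpectrum z) (n : Fin N) (hs : P.InvHasSimplePole (z n)) :
    ∃! C : Mat m, P.IsNormingConstant (z n) C := by
  obtain ⟨R, hR⟩ := hs
  obtain ⟨t₀, ht₀⟩ := hP.isConnected_T.nonempty
  have hzn := (mem_Hopen_of_spectrum hP hz n).1
  have hev := eventually_det_a_ne_zero hP hz n
  set ζ := z n with hζ
  have hzc := Hopen_subset _ hzn
  have hl := lamK_ne_zero_of_mem hzn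
  have hz0 : Tendsto (fun w : ℂ => w - ζ) (𝓝[≠] ζ) (𝓝 0) := by
    have : Tendsto (fun w : ℂ => w - ζ) (𝓝 ζ) (𝓝 (ζ - ζ)) :=
      (continuous_id.sub continuous_const).tendsto ζ
    rw [sub_self] at this
    exact this.mono_left nhdsWithin_le_nhds
  -- Limit of `a(w) · (w - ζ) a(w)⁻¹ = (w - ζ) I`.
  have haR : P.a ζ * R = 0 := by
    have hc : Continuous fun p : Mat m × Mat m => p.1 * p.2 := by fun_prop
    have h1 := (hc.tendsto _).comp
      (((differentiableAt_a hP hzn).continuousAt.tendsto.mono_left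
        (nhdsWithin_le_nhds (s := {ζ}ᶜ))).prodMk_nhds hR)
    have h2 := hz0.smul_const (1 : Mat m)
    rw [zero_smul] at h2
    refine tendsto_nhds_unique h1 (h2.congr' ?_)
    filter_upwards [hev] with w hw
    simp only [Function.comp_apply]
    rw [Matrix.mul_smul, Matrix.mul_nonsing_inv _ (isUnit_iff_ne_zero.2 hw.2)]
  have hY : (P.vbar t₀ (conj ζ) 0)ᴴ * (P.what t₀ ζ 0 * R) = 0 := by
    rw [← Matrix.mul_assoc, ← gam_smul_a hP hzc hl 0 ht₀, Matrix.smul_mul, haR, smul_zero]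
  obtain ⟨C₁, hC₁⟩ := exists_eq_jconj_mul
    (fun V hV => vbar_injective hP ht₀ (conj_mem_Hlow hzc) 0 hV)
    (skew_vbar hP ht₀ (conj_mem_Hlow hzc) 0) hY
  set C : Mat m := Complex.exp (-(2 * Complex.I * P.theta 0 t₀ ζ)) • C₁ with hC
  have h0 : P.phi ζ 0 t₀ * R = P.psi ζ 0 t₀ * C := by
    rw [← WHat_eq hP hzc hl 0 ht₀, ← VHat_eq hP hzc hl 0 ht₀, WHat, VHat, Matrix.smul_mul,
      Matrix.smul_mul] at hC₁
    have h1 := congrArg (fun B => Complex.exp (-(Complex.I * P.theta 0 t₀ ζ)) • B) hC₁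
    simp only [smul_smul, ← Complex.exp_add] at h1
    rw [neg_add_cancel, Complex.exp_zero, one_smul] at h1
    rw [h1, hC, Matrix.mul_smul]
    congr 2
    ring
  have hall := fun x t (ht : t ∈ P.T) => lax_relation hP (isJost_phi hP hzc hl)
    (isJost_psi hP hzc hl) ht₀ h0 x ht
  have hnorm : P.IsNormingConstant ζ C := by
    intro x t ht
    have h1 := (continuous_mul_matH.tendsto _).comp
      (((differentiableAt_what hP ht x hzn).continuousAt.tendsto.mono_left
        (nhdsWithin_le_nhds (s := {ζ}ᶜ))).prodMk_nhds hR)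
    have e : P.what t ζ x * R
        = Complex.exp (2 * Complex.I * P.theta x t ζ) • (P.VHat x t ζ * C) := by
      rw [← WHat_eq hP hzc hl x ht, WHat, VHat, Matrix.smul_mul, hall x t ht, Matrix.smul_mul,
        smul_smul, ← Complex.exp_add]
      congr 2
      ring
    dsimp only at h1
    rw [e] at h1
    refine h1.congr' ?_
    filter_upwards [nhdsWithin_le_nhds ((isOpen_Hopen _).mem_nhds hzn)] with w hw
    simp only [Function.comp_apply]
    rw [WHat_eq hP (Hopen_subset _ hw) (lamK_ne_zero_of_mem hw) x ht, Matrix.mul_smul]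
  refine ⟨C, hnorm, fun C' hC' => ?_⟩
  have h1 := tendsto_nhds_unique (hC' 0 t₀ ht₀) (hnorm 0 t₀ ht₀)
  have h2 := smul_right_injective _ (Complex.exp_ne_zero _) h1
  rw [VHat_eq hP hzc hl 0 ht₀, ← sub_eq_zero, ← Matrix.mul_sub] at h2
  exact sub_eq_zero.1 (vhat_injective hP ht₀ hzc 0 h2)

theorem VBar_conj_zeta (hP : P.IsSolution) {N : ℕ} {z : Fin N → ℂ} (hz : P.IsDiscreteSpectrum z)
    (x : ℝ) {t : ℝ} (ht : t ∈ P.T) (n : Fin N ⊕ Fin N) :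
    P.VBar x t (conj (P.zeta z n)) = P.vbar t (conj (P.zeta z n)) x := by
  have hmem := zeta_mem hP hz n
  refine VBar_eq hP (conj_mem_Hlow (Hopen_subset _ hmem)) ?_ x ht
  rw [lamK_conj]
  exact (map_ne_zero _).2 (lamK_ne_zero_of_mem hmem)

end Potential

end MMKdV

end

theorem proposition3p5 {m : ℕ} (P : MMKdV.Potential m) (hP : P.IsSolution)
    (hrefl : P.Reflectionless) {N : ℕ} (z : Fin N → ℂ) (hz : P.IsDiscreteSpectrum z)
    (hsimple : ∀ n, P.InvHasSimplePole (z n)) :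
    (∀ n, ∃! C : MMKdV.Mat m, P.IsNormingConstant (z n) C) ∧
    ∀ C : Fin N → MMKdV.Mat m, (∀ n, P.IsNormingConstant (z n) (C n)) →
      ∀ x : ℝ, ∀ t ∈ P.T,
        IsUnit (P.Kmat z C x t).det ∧
        ∃ X : Fin N ⊕ Fin N → MMKdV.Mat m,
          (∀ n, X n = (P.VBar x t (starRingEnd ℂ (P.zeta z n))).toRows₁) ∧
          P.Kmat z C x t * MMKdV.Potential.col X
            = MMKdV.Potential.col (P.Yblock z C x t) ∧
          P.Q x t = P.Qp + Complex.I • ∑ n,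
            Complex.exp (-(2 * Complex.I * P.theta x t (starRingEnd ℂ (P.zeta z n)))) •
              (X n * (-(P.norm2 z C n)ᴴ)) := by
  refine ⟨fun n => MMKdV.Potential.existsUnique_normingConstant hP hz n (hsimple n),
    fun C hC x t ht => ⟨MMKdV.Potential.isUnit_det_Kmat hP hz C x t,
      fun n => (P.VBar x t (starRingEnd ℂ (P.zeta z n))).toRows₁, fun _ => rfl, ?_, ?_⟩⟩
  all_goals
    simp only [MMKdV.Potential.VBar_conj_zeta hP hz x ht]
  · exact (P.Kmat_mul_col_iff z C x t _ _).2
      (MMKdV.Potential.linear_system hP ht hrefl hz hC x)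
  · exact MMKdV.Potential.Q_eq_sum hP ht hrefl hz hC x
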